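/- Let $m,n\in\mathbb{N}$ with $\alpha:=\log m/\log n$ well defined and irrational (so $m,n\ge 2$), let $\Lambda=\{0,\dots,m-1\}$, $\Lambda'=\{0,\dots,n-1\}$, and let $\Omega_+=(\Lambda\times\Lambda')^{\mathbb{N}}$ with the product topology and the shift $T$; write $\omega=(\omega^1,\omega^2)$ for its elements, and $T$ also for the shifts on $\Lambda^{\mathbb{N}}$ and $\Lambda'^{\mathbb{N}}$. Let $\mathbb{T}=\mathbb{R}/\mathbb{Z}$, identified as a set with $[0,1)$, let $\lambda$ be its Lebesgue probability measure, and let $l_k(t)=\lfloor t+\alpha k\rfloor$ for $t\in[0,1)$. Let $\mathcal{P}(\Omega_+)$ be the space of Borel probability measures on $\Omega_+$ with the weak topology, $$\Xi=\{(\omega,\nu)\in\Omega_+\times\mathcal{P}(\Omega_+):\ \omega\in\operatorname{supp}\nu\},\qquad X=\mathbb{T}\times\Xi .$$ For $t\in[0,1)$, $k\in\mathbb{N}$ and $\omega\in\Omega_+$ let $T_{t,k}(\omega)=(T^k\omega^1,T^{l_k(t)}\omega^2)$, and let $C_{t,k}(\omega)$ be the set of all $\omega'\in\Omega_+$ such that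 $\omega'^1$ agrees with $\omega^1$ in the first $k$ places and $\omega'^2$ agrees with $\omega^2$ in the first $l_k(t)$ places. For $(\omega,\nu)\in\Xi$ let $\nu_{t,k}^\omega\in\mathcal{P}(\Omega_+)$ be the magnified measure $$\nu_{t,k}^{\omega}(E)=\nu\big(T_{t,k}^{-1}(E)\,\big|\,C_{t,k}(\omega)\big)\qquad(E\subseteq\Omega_+\text{ Borel}).$$ The symbolic magnification operator $S:X\to X$ is $S(t,\omega,\nu)=(t+\alpha \bmod 1,\ T_{t,1}(\omega),\ \nu_{t,1}^{\omega})$. Let $Y\subseteq\Omega_+$ be a topologically transitive one-sided subshift of finite type, and let $\mu$ be an invariant Gibbs measure on $Y$ for a Hölder potential, that is, a $T$-invariant Borel probability measure with $\mu(Y)=1$ for which there are a Hölder function $\phi:Y\to\mathbb{R}$ and constants $P\in\mathbb{R}$, $K>0$ such that $$K^{-1}\le\frac{\mu(\{\omega'\in\Omega_+:\ \omega'_i=\omega_i\text{ for }1\le i\le k\})}{e^{-kP}\,e^{\sum_{j=0}^{k-1}\phi(T^j\omega)}}\le K\qquad\text{for all }\omega\in Y,\ k\ge 0 .$$ Then there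 is a Borel probability measure $\hat{Q}$ on $\Xi$ such that $Q=\lambda\times\hat{Q}$ is $S$-invariant and ergodic for $S$, and such that for every bounded continuous $f:X\to\mathbb{R}$, every integer $q\ge 1$ for which $T^q$ is topologically transitive on $Y$ (every $q\ge1$ if $Y$ is topologically mixing; $q=1$ always), and $\mu$-almost every $\omega\in\Omega_+$, one has $\omega\in\operatorname{supp}\mu$ and $$\frac{1}{N}\sum_{k=1}^{N}f\big(S^{qk}(0,\omega,\mu)\big)\longrightarrow\mathbb{E}_Q[f]\qquad(N\to\infty).$$ -/

import Mathlib

open MeasureTheory Filter Topology ProbabilityTheory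
open scoped BoundedContinuousFunction

noncomputable section

namespace SymbolicCP

/-! ### Subshifts of finite type and Gibbs measures -/

section Subshift

variable {A : Type*}

/-- The shift on one-sided sequences. -/
def shift (ω : ℕ → A) : ℕ → A := fun i => ω (i + 1)

/-- The cylinder of all sequences that agree with `ω` in the first `k` places. -/
def cylinder (k : ℕ) (ω : ℕ → A) : Set (ℕ → A) := {ω' | ∀ i < k, ω' i = ω i}

/-- `Y` is a (one-sided) subshift of finite type: for some `L`, it consists of all sequences whose
words of length `L` lie in a prescribed set `W` of allowed words. -/
def IsSFT (Y : Set (ℕ → A)) : Prop :=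
  ∃ (L : ℕ) (W : Set (Fin L → A)), Y = {ω | ∀ k : ℕ, (fun i : Fin L => ω (k + i)) ∈ W}

/-- The map `T` is topologically transitive on `Y`: for all nonempty relatively open subsets
`U ∩ Y` and `V ∩ Y` of `Y` some iterate of `T` carries a point of the first into the second. -/
def IsTransitiveOn {E : Type*} [TopologicalSpace E] (T : E → E) (Y : Set E) : Prop :=
  ∀ U V : Set E, IsOpen U → IsOpen V → (U ∩ Y).Nonempty → (V ∩ Y).Nonempty →
    ∃ j : ℕ, (U ∩ Y ∩ T^[j] ⁻¹' (V ∩ Y)).Nonempty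

/-- `φ` is Hölder on `Y`, i.e. Lipschitz for one of the metrics
`ρ ^ min {n | ω n ≠ ω' n}` with `0 < ρ < 1`. -/
def IsHolderPotentialOn (Y : Set (ℕ → A)) (φ : (ℕ → A) → ℝ) : Prop :=
  ∃ ρ K : ℝ, 0 < ρ ∧ ρ < 1 ∧ ∀ ω ∈ Y, ∀ ω' ∈ Y, ∀ n : ℕ,
    ω' ∈ cylinder n ω → |φ ω - φ ω'| ≤ K * ρ ^ n

/-- `μ` has the Gibbs property on `Y` for the potential `φ`, with some pressure `P`. -/
def HasGibbsProperty [MeasurableSpace A] (Y : Set (ℕ → A)) (φ : (ℕ → A) → ℝ)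
    (μ : Measure (ℕ → A)) : Prop :=
  ∃ P K : ℝ, 0 < K ∧ ∀ ω ∈ Y, ∀ k : ℕ,
    K⁻¹ ≤ μ.real (cylinder k ω) /
        (Real.exp (-(k * P)) * Real.exp (∑ j ∈ Finset.range k, φ (shift^[j] ω))) ∧
      μ.real (cylinder k ω) /
        (Real.exp (-(k * P)) * Real.exp (∑ j ∈ Finset.range k, φ (shift^[j] ω))) ≤ K

/-- The (probability) measure `μ` is shift-invariant, supported on `Y`, and has the Gibbs property for some Hölder potential. -/
structure IsInvariantGibbs [MeasurableSpace A] (Y : Set (ℕ → A)) (μ : Measure (ℕ → A)) :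
    Prop where
  invariant : MeasurePreserving shift μ μ
  supported : μ Yᶜ = 0
  gibbs : ∃ φ : (ℕ → A) → ℝ, IsHolderPotentialOn Y φ ∧ HasGibbsProperty Y φ μ

end Subshift

/-! ### The symbolic magnification operator -/

section Magnification

variable {m n : ℕ}

/-- The space of sequences `ω = (ω¹, ω²)` over the alphabet
`{0, …, m - 1} × {0, …, n - 1}`. -/
abbrev Seq (m n : ℕ) : Type := ℕ → Fin m × Fin n

/-- `(ω¹, ω²) ↦ (Tᵏ ω¹, Tˡ ω²)`. -/
def biShift (k l : ℕ) (ω : Seq m n) : Seq m n := fun i => ((ω (i + k)).1, (ω (i + l)).2)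

/-- The sequences that agree with `ω` in the first `k` places of the first coordinate and in the
first `l` places of the second coordinate. This is the atom containing `ω` of the finite
σ-algebra generated by these coordinates. -/
def biCylinder (k l : ℕ) (ω : Seq m n) : Set (Seq m n) :=
  {ω' | (∀ i < k, (ω' i).1 = (ω i).1) ∧ ∀ i < l, (ω' i).2 = (ω i).2}

lemma continuous_biShift (k l : ℕ) : Continuous (biShift k l : Seq m n → Seq m n) := by
  unfold biShift
  fun_prop

lemma isOpen_biCylinder (k l : ℕ) (ω : Seq m n) : IsOpen (biCylinder k l ω) := by
  have h : biCylinder k l ω =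
      (⋂ i ∈ Finset.range k, (fun ω' : Seq m n => (ω' i).1) ⁻¹' {(ω i).1}) ∩
        ⋂ i ∈ Finset.range l, (fun ω' : Seq m n => (ω' i).2) ⁻¹' {(ω i).2} := by
    ext ω'
    simp [biCylinder]
  rw [h]
  refine IsOpen.inter ?_ ?_
  · exact isOpen_biInter_finset fun i _ => (isOpen_discrete _).preimage (by fun_prop)
  · exact isOpen_biInter_finset fun i _ => (isOpen_discrete _).preimage (by fun_prop)

lemma mem_biCylinder_self (k l : ℕ) (ω : Seq m n) : ω ∈ biCylinder k l ω :=
  ⟨fun _ _ => rfl, fun _ _ => rfl⟩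

/-- The space `Ξ` of all pairs `(ω, ν)` of a sequence and a Borel probability measure on sequences
such that `ω` lies in the (topological) support of `ν`. -/
def Xi (m n : ℕ) : Type :=
  {p : Seq m n × ProbabilityMeasure (Seq m n) // p.1 ∈ (p.2 : Measure (Seq m n)).support}

/-- The topology of `Ξ`: product topology on sequences, weak topology on measures. -/
instance : TopologicalSpace (Xi m n) :=
  inferInstanceAs (TopologicalSpace
    {p : Seq m n × ProbabilityMeasure (Seq m n) // p.1 ∈ (p.2 : Measure (Seq m n)).support})

instance : MeasurableSpace (Xi m n) := borel _

instance : BorelSpace (Xi m n) := ⟨rfl⟩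

lemma measure_biCylinder_inter_ne_zero (k l : ℕ) (p : Xi m n) {U : Set (Seq m n)}
    (hU : IsOpen U) (h : biShift k l p.1.1 ∈ U) :
    (p.1.2 : Measure (Seq m n)) (biCylinder k l p.1.1 ∩ biShift k l ⁻¹' U) ≠ 0 := by
  refine ((Measure.mem_support_iff_forall _).1 p.2 _ (IsOpen.mem_nhds ?_ ?_)).ne'
  · exact (isOpen_biCylinder k l _).inter (hU.preimage (continuous_biShift k l))
  · exact ⟨mem_biCylinder_self k l _, h⟩

lemma measure_biCylinder_ne_zero (k l : ℕ) (p : Xi m n) :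
    (p.1.2 : Measure (Seq m n)) (biCylinder k l p.1.1) ≠ 0 := by
  simpa using measure_biCylinder_inter_ne_zero k l p isOpen_univ (Set.mem_univ _)

/-- The magnified measure: condition `ν` on the first `k` places of the first coordinate and the
first `l` places of the second coordinate of `ω`, and shift these places away. Thus
`C ↦ ν (biShift k l ⁻¹' C | biCylinder k l ω)`; as `ω` is in the support of `ν`, the conditioning
event has positive measure. -/
def magnifiedMeasure (k l : ℕ) (p : Xi m n) : ProbabilityMeasure (Seq m n) :=
  ⟨((p.1.2 : Measure (Seq m n))[|biCylinder k l p.1.1]).map (biShift k l), by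
    have := cond_isProbabilityMeasure (measure_biCylinder_ne_zero k l p)
    exact Measure.isProbabilityMeasure_map (continuous_biShift k l).measurable.aemeasurable⟩

lemma biShift_mem_support (k l : ℕ) (p : Xi m n) :
    biShift k l p.1.1 ∈ (magnifiedMeasure k l p : Measure (Seq m n)).support := by
  refine (Measure.mem_support_iff_forall _).2 fun U hU => ?_
  obtain ⟨V, hVU, hV, hmem⟩ := mem_nhds_iff.1 hU
  refine lt_of_lt_of_le (pos_iff_ne_zero.2 ?_) (measure_mono hVU)
  change ((p.1.2 : Measure (Seq m n))[|biCylinder k l p.1.1]).map (biShift k l) V ≠ 0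
  rw [Measure.map_apply (continuous_biShift k l).measurable hV.measurableSet,
    cond_apply (isOpen_biCylinder k l _).measurableSet]
  exact mul_ne_zero (ENNReal.inv_ne_zero.2 (measure_ne_top _ _))
    (measure_biCylinder_inter_ne_zero k l p hV hmem)

/-- The map `(ω, ν) ↦ ((Tᵏ ω¹, Tˡ ω²), magnified measure)` of `Ξ` into itself. -/
def magnify (k l : ℕ) (p : Xi m n) : Xi m n :=
  ⟨(biShift k l p.1.1, magnifiedMeasure k l p), biShift_mem_support k l p⟩

/-- The angle `α = log m / log n`. -/
def angle (m n : ℕ) : ℝ := Real.log m / Real.log n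

/-- `l_k(t) = ⌊t + α k⌋`, where the point `t` of the circle is represented in `[0, 1)`. -/
def ell (m n k : ℕ) (t : UnitAddCircle) : ℕ :=
  ⌊(AddCircle.equivIco (1 : ℝ) 0 t : ℝ) + angle m n * k⌋₊

/-- The symbolic magnification operator on `X = 𝕋 × Ξ`: it rotates `t` by `α`, and magnifies
`(ω, ν)` by one place in the first and by `l₁(t)` places in the second coordinate. -/
def magnificationOperator (x : UnitAddCircle × Xi m n) : UnitAddCircle × Xi m n :=
  (x.1 + (angle m n : UnitAddCircle), magnify 1 (ell m n 1 x.1) x.2)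

end Magnification

end SymbolicCP

end

noncomputable section
namespace SymbolicCP

/-! ### Cylinders and the shift -/

section Cylinder

variable {A : Type*}

/-! Let `θ = q * α`. Conditioning in stages shows that after `q * k` steps the point `(0, ω, μ)` has
become the circle point `k * θ`, the two coordinates of `ω` read from the times `q * k` and `⌊k *
θ⌋₊` on, and the conditional law of these two futures given the letters already read. As `α` is
irrational, the two reading times drift apart linearly. The claim is that the picture at step `k`
looks, on average over `k`, as if the two coordinates came from two independent sequences with law
`μ`.

The Gibbs property is used through the quasi-Bernoulli inequalities: the measure of a word is
comparable to the product of the measures of its two parts (`HasGibbsProperty.quasiBernoulliOn`).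
Three facts are drawn from them.

Memory loss. The chi-square dependence between a window and the letters around it is bounded by `K ^
2`, and it increases whenever letters are revealed that the surroundings predict better than the
window does. A bounded increasing quantity has little room for such gains, so a window of length `r`
predicts the next letters up to an error of order `1 / √r` in mean square (`memory_loss_single`,
`memory_loss_double`). Hence the conditional law of the two futures is close to a product of two
laws, each determined by a finite window around its own reading time
(`UpperQuasiBernoulli.exists_isLocallyProduct`).

Decoupling. Functions of two windows moving at different speeds satisfy an exponential estimate,
because the law of separated windows is dominated by the product law with one factor `K` per cut.
Thus nonnegative functions with small mean under `μ × μ` have small averages along almost every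
single `ω` (`UpperQuasiBernoulli.ae_eventually_sum_le`).

Averages under `μ × μ`. The relevant system is the skew product `(t, x, y) ↦ (t + θ, T^q x, T^⌊t +
θ⌋ y)`. Tail events of `μ` are invariant under `T^p` for some `p`, so correlations are
asymptotically `p`-periodic. Ergodicity of `T^q` and of `T` makes the periodic weights sum to zero
for functions of mean zero, and Weyl equidistribution on a circle of length `p` then kills the
second moment of the averages (`IsQuasiBernoulli.uniformlyAverages_zero`).

Together these give, for almost every `ω`, convergence of the averages of every continuous function
on a compact space that contains `X`. The limit law arises as the limit of the laws of the local
models of order `r`; it is carried by `Ξ` because the measure of a local model is a conditional law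
of its sequence. Invariance holds since the operator is continuous off two values of `t`. Ergodicity
holds because, along a generic orbit, the averages over blocks of a fixed large length are close to
the mean from most starting points. -/

lemma shift_iterate_apply (j : ℕ) (ω : ℕ → A) (i : ℕ) : shift^[j] ω i = ω (i + j) := by
  induction j generalizing ω with
  | zero => rfl
  | succ j ih => rw [Function.iterate_succ_apply, ih, shift, Nat.add_assoc]

lemma mem_cylinder_self (k : ℕ) (ω : ℕ → A) : ω ∈ cylinder k ω := fun _ _ => rfl

lemma cylinder_eq_of_mem {k : ℕ} {ω ω' : ℕ → A} (h : ω' ∈ cylinder k ω) :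
    cylinder k ω' = cylinder k ω := by
  ext x
  exact ⟨fun hx i hi => (hx i hi).trans (h i hi), fun hx i hi => (hx i hi).trans (h i hi).symm⟩

lemma cylinder_anti {k l : ℕ} (h : k ≤ l) (ω : ℕ → A) : cylinder l ω ⊆ cylinder k ω :=
  fun _ hx i hi => hx i (hi.trans_le h)

/-- The first `k` letters. -/
def prefixWord (k : ℕ) (ω : ℕ → A) : Fin k → A := fun i => ω i

lemma prefixWord_eq_iff {k : ℕ} {ω ω' : ℕ → A} :
    prefixWord k ω' = prefixWord k ω ↔ ω' ∈ cylinder k ω :=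
  ⟨fun h i hi => congrFun h ⟨i, hi⟩, fun h => funext fun i => h i i.2⟩

lemma preimage_prefixWord (k : ℕ) (ω : ℕ → A) :
    prefixWord k ⁻¹' {prefixWord k ω} = cylinder k ω := by
  ext x
  exact prefixWord_eq_iff

variable [TopologicalSpace A]

lemma continuous_shift : Continuous (shift : (ℕ → A) → ℕ → A) := by
  unfold shift
  fun_prop

lemma continuous_shift_iterate (j : ℕ) : Continuous (shift^[j] : (ℕ → A) → ℕ → A) :=
  continuous_shift.iterate j

lemma continuous_prefixWord (k : ℕ) : Continuous (prefixWord k : (ℕ → A) → Fin k → A) := by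
  unfold prefixWord
  fun_prop

lemma isOpen_cylinder [DiscreteTopology A] (k : ℕ) (ω : ℕ → A) : IsOpen (cylinder k ω) := by
  rw [← preimage_prefixWord]
  exact (isOpen_discrete _).preimage (continuous_prefixWord k)

lemma exists_cylinder_subset {U : Set (ℕ → A)} (hU : IsOpen U) {ω : ℕ → A} (h : ω ∈ U) :
    ∃ k, cylinder k ω ⊆ U := by
  obtain ⟨I, u, hu, hI⟩ := isOpen_pi_iff.1 hU ω h
  refine ⟨I.sup id + 1, fun x hx => hI fun i hi => ?_⟩
  rw [hx i (Nat.lt_succ_of_le (Finset.le_sup (f := id) hi))]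
  exact (hu i hi).2

end Cylinder

/-! ### Comparison of measures through cylinders -/

section CylinderMeasure

variable {m n : ℕ}

lemma measurableSet_cylinder (k : ℕ) (ω : Seq m n) : MeasurableSet (cylinder k ω) :=
  (isOpen_cylinder k ω).measurableSet

lemma measurable_shift_iterate (j : ℕ) : Measurable (shift^[j] : Seq m n → Seq m n) :=
  (continuous_shift_iterate j).measurable

lemma measurable_prefixWord (k : ℕ) : Measurable (prefixWord k : Seq m n → _) :=
  (continuous_prefixWord k).measurable

/-- Such a set is a finite disjoint union of cylinders of length `k`, one for each prefix that
occurs, so the inequalities add up. -/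
lemma measure_le_of_dependsOn {ν₁ ν₂ : Measure (Seq m n)} {k : ℕ}
    (h : ∀ ω, ν₁ (cylinder k ω) ≤ ν₂ (cylinder k ω)) {E : Set (Seq m n)}
    (hE : ∀ ω ∈ E, cylinder k ω ⊆ E) : ν₁ E ≤ ν₂ E := by
  classical
  set s : Finset (Fin k → Fin m × Fin n) := (Set.toFinite (prefixWord k '' E)).toFinset with hs
  have hEs : E = prefixWord k ⁻¹' (s : Set (Fin k → Fin m × Fin n)) := by
    ext x
    simp only [hs, Set.Finite.coe_toFinset, Set.mem_preimage, Set.mem_image]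
    exact ⟨fun hx => ⟨x, hx, rfl⟩, fun ⟨y, hy, hyx⟩ => hE y hy (prefixWord_eq_iff.1 hyx.symm)⟩
  rw [hEs, ← sum_measure_preimage_singleton s fun y _ =>
      measurable_prefixWord k (measurableSet_singleton y),
    ← sum_measure_preimage_singleton s fun y _ =>
      measurable_prefixWord k (measurableSet_singleton y)]
  refine Finset.sum_le_sum fun y hy => ?_
  obtain ⟨x, -, rfl⟩ : y ∈ prefixWord k '' E := by simpa [hs] using hy
  rw [preimage_prefixWord]
  exact h x

/-- An open set is the increasing union of the sets `V k` of points whose cylinder of length `k₀ +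
k` stays inside; outer regularity of the finite measure `ν₂` then reaches all sets. In this way
inequalities between masses of words become inequalities between measures. -/
lemma measure_le_of_cylinder_le {ν₁ ν₂ : Measure (Seq m n)} [IsFiniteMeasure ν₂] (k₀ : ℕ)
    (h : ∀ k, k₀ ≤ k → ∀ ω, ν₁ (cylinder k ω) ≤ ν₂ (cylinder k ω)) : ν₁ ≤ ν₂ := by
  have hopen : ∀ U : Set (Seq m n), IsOpen U → ν₁ U ≤ ν₂ U := by
    intro U hU
    set V : ℕ → Set (Seq m n) := fun k => {ω | cylinder (k₀ + k) ω ⊆ U} with hV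
    have hmono : Monotone V := fun a b hab ω hω =>
      (cylinder_anti (Nat.add_le_add_left hab k₀) ω).trans hω
    have hUV : U = ⋃ k, V k := by
      ext x
      simp only [Set.mem_iUnion]
      refine ⟨fun hx => ?_, fun ⟨k, hk⟩ => hk (mem_cylinder_self _ x)⟩
      obtain ⟨k, hk⟩ := exists_cylinder_subset hU hx
      exact ⟨k, (cylinder_anti (Nat.le_add_left k k₀) x).trans hk⟩
    rw [hUV, hmono.measure_iUnion]
    refine iSup_le fun k => ?_
    refine (measure_le_of_dependsOn (h (k₀ + k) (Nat.le_add_right _ _)) ?_).trans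
      (measure_mono (Set.subset_iUnion V k))
    intro ω hω x hx
    change cylinder _ _ ⊆ U
    rw [cylinder_eq_of_mem hx]
    exact hω
  refine Measure.le_iff.2 fun B _ => ?_
  rw [B.measure_eq_iInf_isOpen ν₂]
  exact le_iInf₂ fun U hBU => le_iInf fun hU => (measure_mono hBU).trans (hopen U hU)

end CylinderMeasure

/-! ### Consequences of the Gibbs property -/

section Gibbs

variable {m n : ℕ}

/-- The past and the future are dominated by the product of their laws. -/
def UpperQuasiBernoulli (K : ENNReal) (μ : Measure (Seq m n)) : Prop :=
  ∀ (a : ℕ) (ω : Seq m n) (B : Set (Seq m n)), MeasurableSet B →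
    μ (cylinder a ω ∩ shift^[a] ⁻¹' B) ≤ K * μ (cylinder a ω) * μ B

variable {A : Type*}

lemma IsSFT.shift_mem {Y : Set (ℕ → A)} (hY : IsSFT Y) {ω : ℕ → A} (h : ω ∈ Y) (j : ℕ) :
    shift^[j] ω ∈ Y := by
  obtain ⟨L, W, rfl⟩ := hY
  intro k
  have := h (k + j)
  simpa only [shift_iterate_apply, Nat.add_right_comm k _ j] using this

/-- Concatenation of the first `k` letters of `ω` with `η`. -/
def concat (k : ℕ) (ω η : ℕ → A) : ℕ → A := fun i => if i < k then ω i else η (i - k)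

lemma concat_mem_cylinder (k : ℕ) (ω η : ℕ → A) : concat k ω η ∈ cylinder k ω :=
  fun i hi => by simp [concat, hi]

lemma shift_iterate_concat (k : ℕ) (ω η : ℕ → A) : shift^[k] (concat k ω η) = η := by
  ext i
  simp [shift_iterate_apply, concat]

lemma concat_mem_cylinder_add {k L : ℕ} {ω η : ℕ → A} (h : shift^[k] ω ∈ cylinder L η) :
    concat k ω η ∈ cylinder (k + L) ω := by
  intro i hi
  by_cases hik : i < k
  · simp [concat, hik]
  · have := h (i - k) (by omega)
    rw [shift_iterate_apply, Nat.sub_add_cancel (by omega)] at this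
    simp [concat, hik, this]

/-- `L` is a memory length of `Y`. -/
def HasMemory (L : ℕ) (Y : Set (ℕ → A)) : Prop :=
  ∀ ω ∈ Y, ∀ η ∈ Y, ∀ k, shift^[k] ω ∈ cylinder L η → concat k ω η ∈ Y

/-- A window of length `L` that starts before the junction sees only letters of `ω`, because the
overlap makes the concatenation agree with `ω` up to time `k + L`; a window that starts later sees
only letters of `η`. -/
lemma IsSFT.exists_hasMemory {Y : Set (ℕ → A)} (hY : IsSFT Y) : ∃ L, HasMemory L Y := by
  obtain ⟨L, W, rfl⟩ := hY
  refine ⟨L, fun ω hω η hη k h s => ?_⟩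
  rcases le_or_gt k s with hs | hs
  · have := hη (s - k)
    convert this using 2 with i
    simp only [concat]
    rw [if_neg (by omega)]
    congr 1
    omega
  · have := hω s
    convert this using 2 with i
    exact concat_mem_cylinder_add h (s + i) (by omega)

/-- `Y` has a point from the `L`-cylinder of `ω` that gets into that of `ω'` after `j` steps. -/
def Reach (L : ℕ) (Y : Set (ℕ → A)) (j : ℕ) (ω ω' : ℕ → A) : Prop :=
  ∃ ζ ∈ Y, ζ ∈ cylinder L ω ∧ shift^[j] ζ ∈ cylinder L ω'

lemma Reach.trans {L : ℕ} {Y : Set (ℕ → A)} (hL : HasMemory L Y) {i j : ℕ} {x y z : ℕ → A}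
    (h₁ : Reach L Y i x y) (h₂ : Reach L Y j y z) : Reach L Y (i + j) x z := by
  obtain ⟨ζ, hζ, h1, h2⟩ := h₁
  obtain ⟨η, hη, h3, h4⟩ := h₂
  have h5 : shift^[i] ζ ∈ cylinder L η := by rw [cylinder_eq_of_mem h3]; exact h2
  refine ⟨concat i ζ η, hL _ hζ _ hη _ h5, ?_, ?_⟩
  · rw [← cylinder_eq_of_mem h1]
    exact cylinder_anti (Nat.le_add_left L i) _ (concat_mem_cylinder_add h5)
  · rw [add_comm, Function.iterate_add_apply, shift_iterate_concat]
    exact h4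

lemma Reach.self_mul {L : ℕ} {Y : Set (ℕ → A)} (hL : HasMemory L Y) {j : ℕ} {x : ℕ → A}
    (hx : x ∈ Y) (h : Reach L Y j x x) (a : ℕ) : Reach L Y (j * a) x x := by
  induction a with
  | zero => exact ⟨x, hx, mem_cylinder_self _ _, mem_cylinder_self _ _⟩
  | succ a ih => exact ih.trans hL h

/-- Transitivity may act at time `0`. Starting from the image of `ω` instead of `ω` forces a
positive return time. -/
lemma exists_return {Y : Set (ℕ → A)} [TopologicalSpace A] [DiscreteTopology A] (hY : IsSFT Y)
    (htr : IsTransitiveOn shift Y) {L : ℕ} (hL : HasMemory L Y) {ω : ℕ → A} (hω : ω ∈ Y) :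
    ∃ j, 1 ≤ j ∧ Reach L Y j ω ω := by
  have h1 : Reach L Y 1 ω (shift^[1] ω) :=
    ⟨ω, hω, mem_cylinder_self _ _, mem_cylinder_self _ _⟩
  obtain ⟨j, x, hx, hx'⟩ := htr _ _ (isOpen_cylinder L (shift^[1] ω)) (isOpen_cylinder L ω)
    ⟨_, mem_cylinder_self _ _, hY.shift_mem hω 1⟩ ⟨_, mem_cylinder_self _ _, hω⟩
  exact ⟨1 + j, by omega, h1.trans hL ⟨x, hx.2, hx.1, hx'.1⟩⟩

/-- The return time depends only on the word of length `L`, and loops can be repeated, so the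
product over the finitely many words serves all of them. The factor `L + 1` makes it at least `L`.
-/
lemma exists_common_return {Y : Set (ℕ → A)} [Finite A] [TopologicalSpace A] [DiscreteTopology A]
    (hY : IsSFT Y) (htr : IsTransitiveOn shift Y) {L : ℕ} (hL : HasMemory L Y) :
    ∃ p, 1 ≤ p ∧ L ≤ p ∧ ∀ ω ∈ Y, Reach L Y p ω ω := by
  classical
  have := Fintype.ofFinite (Fin L → A)
  have key : ∀ w : Fin L → A, ∃ j, 1 ≤ j ∧ ∀ ω ∈ Y, prefixWord L ω = w → Reach L Y j ω ω := by
    intro w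
    by_cases hw : ∃ ω ∈ Y, prefixWord L ω = w
    · obtain ⟨ω, hω, rfl⟩ := hw
      obtain ⟨j, hj, hr⟩ := exists_return hY htr hL hω
      refine ⟨j, hj, fun ω' _ h' => ?_⟩
      have := cylinder_eq_of_mem (prefixWord_eq_iff.1 h')
      simpa only [Reach, this] using hr
    · push Not at hw
      exact ⟨1, le_rfl, fun ω hω h => absurd h (hw ω hω)⟩
  choose j hj hr using key
  have hpos : 1 ≤ ∏ w, j w := Finset.one_le_prod' fun w _ => hj w
  refine ⟨(∏ w, j w) * (L + 1), ?_, ?_, fun ω hω => ?_⟩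
  · exact Nat.mul_pos hpos (Nat.succ_pos L)
  · nlinarith
  · obtain ⟨a, ha⟩ := Finset.dvd_prod_of_mem j (Finset.mem_univ (prefixWord L ω))
    rw [ha, mul_assoc]
    exact (hr _ ω hω rfl).self_mul hL hω _

/-- A function of cylinders that is positive on the `k`-cylinders that meet `Y` is bounded below. -/
lemma exists_le_of_cylinder {Y : Set (Seq m n)} {g : Set (Seq m n) → ENNReal} {k : ℕ}
    (hpos : ∀ ω ∈ Y, g (cylinder k ω) ≠ 0) :
    ∃ c : ENNReal, c ≠ 0 ∧ c ≤ 1 ∧ ∀ ω ∈ Y, c ≤ g (cylinder k ω) := by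
  classical
  have key : ∀ w : Fin k → Fin m × Fin n, ∃ c : ENNReal, c ≠ 0 ∧ c ≤ 1 ∧
      ∀ ω ∈ Y, prefixWord k ω = w → c ≤ g (cylinder k ω) := by
    intro w
    by_cases hw : ∃ ω ∈ Y, prefixWord k ω = w
    · obtain ⟨ω, hω, rfl⟩ := hw
      refine ⟨min (g (cylinder k ω)) 1, ?_, min_le_right _ _, fun ω' _ h => ?_⟩
      · simp [min_eq_iff, hpos ω hω]
      · rw [cylinder_eq_of_mem (prefixWord_eq_iff.1 h)]
        exact min_le_left _ _
    · push Not at hw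
      exact ⟨1, one_ne_zero, le_rfl, fun ω hω h => absurd h (hw ω hω)⟩
  choose c hc hc1 hcm using key
  refine ⟨∏ w, c w, Finset.prod_ne_zero_iff.2 fun w _ => hc w,
    Finset.prod_le_one' fun w _ => hc1 w, fun ω hω => ?_⟩
  refine le_trans ?_ (hcm _ ω hω rfl)
  rw [← Finset.mul_prod_erase _ _ (Finset.mem_univ (prefixWord k ω))]
  exact mul_le_of_le_one_right' (Finset.prod_le_one' fun w _ => hc1 w)

end Gibbs
end SymbolicCP
end

noncomputable section
namespace SymbolicCP

/-! ### Quasi-Bernoulli bounds and common futures -/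

section GibbsBounds

variable {m n : ℕ}

lemma cylinder_inter_preimage {A : Type*} {a b : ℕ} {ω η ζ : ℕ → A} (h₁ : ζ ∈ cylinder a ω)
    (h₂ : shift^[a] ζ ∈ cylinder b η) :
    cylinder a ω ∩ shift^[a] ⁻¹' cylinder b η = cylinder (a + b) ζ := by
  rw [← cylinder_eq_of_mem h₁, ← cylinder_eq_of_mem h₂]
  ext x
  simp only [cylinder, Set.mem_inter_iff, Set.mem_ofPred_eq, Set.mem_preimage, shift_iterate_apply]
  refine ⟨fun ⟨h, h'⟩ i hi => ?_, fun h => ⟨fun i hi => h i (by omega), fun i hi => h _ (by omega)⟩⟩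
  rcases lt_or_ge i a with hia | hia
  · exact h i hia
  · simpa [Nat.sub_add_cancel hia] using h' (i - a) (by omega)

/-- The two-sided quasi-Bernoulli property on the points of `Y`. -/
def QuasiBernoulliOn (Y : Set (Seq m n)) (K : ENNReal) (μ : Measure (Seq m n)) : Prop :=
  ∀ ω ∈ Y, ∀ k j : ℕ,
    μ (cylinder (k + j) ω) ≤ K * μ (cylinder k ω) * μ (cylinder j (shift^[k] ω)) ∧
    μ (cylinder k ω) * μ (cylinder j (shift^[k] ω)) ≤ K * μ (cylinder (k + j) ω)

/-- The Gibbs weight `g` is exactly multiplicative along orbits, since Birkhoff sums are additive,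
and each of the three cylinder masses is within a factor `K` of its weight. Hence the constant `K ^
3`. -/
lemma HasGibbsProperty.quasiBernoulliOn {Y : Set (Seq m n)} (hY : IsSFT Y)
    {φ : Seq m n → ℝ} {μ : Measure (Seq m n)} [IsProbabilityMeasure μ]
    (h : HasGibbsProperty Y φ μ) :
    (∀ ω ∈ Y, ∀ k, μ (cylinder k ω) ≠ 0) ∧ ∃ K : ENNReal, K ≠ ⊤ ∧ QuasiBernoulliOn Y K μ := by
  obtain ⟨P, K, hK, hG⟩ := h
  set g : ℕ → Seq m n → ℝ := fun k ω =>
    Real.exp (-(k * P)) * Real.exp (∑ j ∈ Finset.range k, φ (shift^[j] ω)) with hg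
  have hgpos : ∀ k ω, 0 < g k ω := fun k ω => by positivity
  have hgadd : ∀ k j ω, g (k + j) ω = g k ω * g j (shift^[k] ω) := by
    intro k j ω
    simp only [hg, Finset.sum_range_add, ← Real.exp_add]
    congr 1
    have : ∀ x, φ (shift^[x] (shift^[k] ω)) = φ (shift^[k + x] ω) := fun x => by
      rw [← Function.iterate_add_apply, add_comm]
    simp only [this]
    push_cast
    ring
  have hup : ∀ ω ∈ Y, ∀ k, μ.real (cylinder k ω) ≤ K * g k ω := fun ω hω k =>
    (div_le_iff₀ (hgpos k ω)).1 (hG ω hω k).2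
  have hlo : ∀ ω ∈ Y, ∀ k, g k ω ≤ K * μ.real (cylinder k ω) := by
    intro ω hω k
    have := (le_div_iff₀ (hgpos k ω)).1 (hG ω hω k).1
    rwa [inv_mul_le_iff₀ hK] at this
  refine ⟨fun ω hω k h0 => ?_, ENNReal.ofReal (K ^ 3), ENNReal.ofReal_ne_top,
    fun ω hω k j => ?_⟩
  · have := hlo ω hω k
    rw [Measure.real, h0] at this
    simp only [ENNReal.toReal_zero, mul_zero] at this
    exact absurd this (not_le.2 (hgpos k ω))
  · have h1 := hup ω hω k
    have h2 := hup _ (hY.shift_mem hω k) j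
    have h3 := hup ω hω (k + j)
    have h4 := hlo ω hω k
    have h5 := hlo _ (hY.shift_mem hω k) j
    have h6 := hlo ω hω (k + j)
    have e : ∀ E : Set (Seq m n), μ E = ENNReal.ofReal (μ.real E) := fun E => by
      rw [ofReal_measureReal]
    rw [hgadd] at h3 h6
    have p1 := hgpos k ω
    have p2 := hgpos j (shift^[k] ω)
    rw [e (cylinder (k + j) ω), e (cylinder k ω), e (cylinder j _),
      ← ENNReal.ofReal_mul (by positivity), ← ENNReal.ofReal_mul (by positivity),
      ← ENNReal.ofReal_mul (by positivity), ← ENNReal.ofReal_mul (by positivity)]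
    constructor <;> apply ENNReal.ofReal_le_ofReal
    · calc _ ≤ K * (g k ω * g j (shift^[k] ω)) := h3
        _ ≤ K * ((K * μ.real (cylinder k ω)) * (K * μ.real (cylinder j (shift^[k] ω)))) := by
          gcongr
        _ = _ := by ring
    · calc _ ≤ (K * g k ω) * (K * g j (shift^[k] ω)) := by gcongr
        _ = K ^ 2 * (g k ω * g j (shift^[k] ω)) := by ring
        _ ≤ K ^ 2 * (K * μ.real (cylinder (k + j) ω)) := by gcongr
        _ = _ := by ring

lemma exists_mem_of_measure_ne_zero {Y : Set (Seq m n)} {μ : Measure (Seq m n)}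
    (hμY : μ Yᶜ = 0) {E : Set (Seq m n)} (h : μ E ≠ 0) : ∃ ω ∈ Y, ω ∈ E := by
  by_contra! hc
  exact h (measure_mono_null (fun x hx hxY => hc x hxY hx) hμY)

/-- The bound for cylinders of the future passes to Borel sets. A cylinder of positive mass meets
`Y`, so bounds at points of `Y` are enough. -/
lemma QuasiBernoulliOn.upper {Y : Set (Seq m n)} {K : ENNReal} {μ : Measure (Seq m n)}
    [IsProbabilityMeasure μ] (h : QuasiBernoulliOn Y K μ) (hK : K ≠ ⊤) (hμY : μ Yᶜ = 0) :
    UpperQuasiBernoulli K μ := by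
  intro a ω B hB
  have hc : K * μ (cylinder a ω) ≠ ⊤ := ENNReal.mul_ne_top hK (measure_ne_top _ _)
  -- With the constant in `NNReal`, the measure `c • μ` is finite by instance, as the comparison
  -- through cylinders requires.
  obtain ⟨c, hcc⟩ := WithTop.ne_top_iff_exists.1 hc
  change (c : ENNReal) = _ at hcc
  rw [← hcc]
  have hle : (μ.restrict (cylinder a ω)).map shift^[a] ≤ c • μ := by
    refine measure_le_of_cylinder_le 0 fun k _ η => ?_
    rw [Measure.map_apply (measurable_shift_iterate a) (measurableSet_cylinder _ _),
      Measure.restrict_apply (measurable_shift_iterate a (measurableSet_cylinder _ _)),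
      Set.inter_comm, Measure.smul_apply]
    change _ ≤ (c : ENNReal) * _
    by_cases h0 : μ (cylinder a ω ∩ shift^[a] ⁻¹' cylinder k η) = 0
    · simp [h0]
    obtain ⟨ζ, hζ, h1, h2⟩ := exists_mem_of_measure_ne_zero hμY h0
    rw [cylinder_inter_preimage h1 h2, hcc, ← cylinder_eq_of_mem h1, ← cylinder_eq_of_mem h2]
    exact (h ζ hζ a k).1
  have := hle B
  rw [Measure.map_apply (measurable_shift_iterate a) hB,
    Measure.restrict_apply (measurable_shift_iterate a hB), Set.inter_comm] at this
  exact this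

/-- After a cylinder of length `k`, the future has a part equivalent to `μ` on an `L`-cylinder. -/
lemma QuasiBernoulliOn.lower {Y : Set (Seq m n)} {K : ENNReal} {μ : Measure (Seq m n)}
    [IsProbabilityMeasure μ] (h : QuasiBernoulliOn Y K μ) (hμY : μ Yᶜ = 0)
    (hK : K ≠ ⊤) {L : ℕ} (hL : HasMemory L Y) {ω : Seq m n} (hω : ω ∈ Y) (k : ℕ)
    {B : Set (Seq m n)} (hB : MeasurableSet B) (hBs : B ⊆ cylinder L (shift^[k] ω)) :
    μ (cylinder k ω) * μ B ≤ K * μ (cylinder (k + L) ω ∩ shift^[k] ⁻¹' B) := by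
  have hle : μ (cylinder k ω) • μ.restrict (cylinder L (shift^[k] ω)) ≤
      K • (μ.restrict (cylinder (k + L) ω)).map shift^[k] := by
    have : IsFiniteMeasure (K • (μ.restrict (cylinder (k + L) ω)).map shift^[k]) :=
      Measure.smul_finite _ hK
    refine measure_le_of_cylinder_le L fun b hb η => ?_
    rw [Measure.smul_apply, Measure.smul_apply,
      Measure.map_apply (measurable_shift_iterate k) (measurableSet_cylinder _ _),
      Measure.restrict_apply (measurable_shift_iterate k (measurableSet_cylinder _ _)),
      Measure.restrict_apply (measurableSet_cylinder _ _), smul_eq_mul, smul_eq_mul]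
    by_cases h0 : μ (cylinder b η ∩ cylinder L (shift^[k] ω)) = 0
    · simp [h0]
    -- Splicing the first `k` letters of `ω` to `ζ` gives a point of `Y`, at which the lower bound
    -- may be used. Since `b ≥ L`, its cylinder of length `k + b` lies in the cylinder of length `k
    -- + L` of `ω`.
    obtain ⟨ζ, hζ, h1, h2⟩ := exists_mem_of_measure_ne_zero hμY h0
    have h3 : shift^[k] ω ∈ cylinder L ζ := by
      rw [cylinder_eq_of_mem h2]
      exact mem_cylinder_self _ _
    have h4 := h _ (hL ω hω ζ hζ k h3) k b
    rw [shift_iterate_concat] at h4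
    have h5 := concat_mem_cylinder k ω ζ
    have h6 := concat_mem_cylinder_add h3
    rw [← cylinder_eq_of_mem h1]
    rw [cylinder_eq_of_mem h5] at h4
    refine le_trans ?_ (h4.2.trans ?_)
    · gcongr
      exact Set.inter_subset_left
    · gcongr
      intro x hx
      constructor
      · intro i hi
        have := hx (i + k) (by omega)
        rw [shift_iterate_apply]
        rw [this]
        have h7 := shift_iterate_concat k ω ζ
        rw [← shift_iterate_apply k (concat k ω ζ) i, h7]
      · rw [← cylinder_eq_of_mem h6]
        exact cylinder_anti (by omega) _ hx
  have := hle B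
  rw [Measure.smul_apply, Measure.smul_apply, Measure.map_apply (measurable_shift_iterate k) hB,
    Measure.restrict_apply (measurable_shift_iterate k hB), Measure.restrict_apply hB,
    Set.inter_eq_self_of_subset_left hBs, Set.inter_comm] at this
  exact this

/-- After a cylinder of length `i + L`, the laws of the future at the times `i` and `i + p` have a
common part. -/
def HasCommonFuture (L p : ℕ) (c : ENNReal) (μ : Measure (Seq m n)) : Prop :=
  ∀ i ω, μ (cylinder (i + L) ω) ≠ 0 → ∃ D, MeasurableSet D ∧ c ≤ μ D ∧
    ∀ B ⊆ D, MeasurableSet B →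
      c * μ (cylinder (i + L) ω) * μ B ≤ μ (cylinder (i + L) ω ∩ shift^[i] ⁻¹' B) ∧
      c * μ (cylinder (i + L) ω) * μ B ≤ μ (cylinder (i + L) ω ∩ shift^[i + p] ⁻¹' B)

lemma le_of_le_mul_of_le_inv {K c a b : ENNReal} (hK0 : K ≠ 0) (hK : K ≠ ⊤) (hc : c ≤ K⁻¹)
    (h : a ≤ K * b) : c * a ≤ b :=
  calc c * a ≤ K⁻¹ * (K * b) := by gcongr
    _ = b := by rw [← mul_assoc, ENNReal.inv_mul_cancel hK0 hK, one_mul]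

/-- `D` is the cylinder of the word of length `L` read at time `i`. At that time the future
dominates a multiple of `μ` on `D`; a loop of length `p` brings the same word back, so the same is
true at time `i + p`. Prescribing the loop costs the mass of a cylinder of length `p - L`. -/
lemma QuasiBernoulliOn.hasCommonFuture {Y : Set (Seq m n)} (hY : IsSFT Y) {K : ENNReal}
    {μ : Measure (Seq m n)} [IsProbabilityMeasure μ] (h : QuasiBernoulliOn Y K μ)
    (hpos : ∀ ω ∈ Y, ∀ k, μ (cylinder k ω) ≠ 0)
    (hμY : μ Yᶜ = 0) (hK0 : K ≠ 0) (hK : K ≠ ⊤) {L p : ℕ} (hL : HasMemory L Y) (hLp : L ≤ p)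
    (hp : ∀ ω ∈ Y, Reach L Y p ω ω) :
    ∃ c, c ≠ 0 ∧ HasCommonFuture L p c μ := by
  obtain ⟨c₁, hc₁, hc₁1, hD⟩ := exists_le_of_cylinder fun ω hω => hpos ω hω L
  obtain ⟨c₂, hc₂, hc₂1, hD₂⟩ := exists_le_of_cylinder fun ω hω => hpos ω hω (p - L)
  -- `c₁` bounds `μ D` from below, `K⁻¹` is the loss at time `i`, and `c₂ * (K * K)⁻¹` is the loss
  -- at time `i + p`, where the loop and the splice cost a factor `K` each.
  set c := min c₁ (min K⁻¹ (c₂ * (K * K)⁻¹)) with hc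
  have hcK : c ≤ K⁻¹ := (min_le_right _ _).trans (min_le_left _ _)
  have hcKK : c ≤ c₂ * (K * K)⁻¹ := (min_le_right _ _).trans (min_le_right _ _)
  refine ⟨c, ?_, fun i ω h0 => ?_⟩
  · have h1 : (K : ENNReal)⁻¹ ≠ 0 := ENNReal.inv_ne_zero.2 hK
    have h2 : c₂ * (K * K)⁻¹ ≠ 0 :=
      mul_ne_zero hc₂ (ENNReal.inv_ne_zero.2 (ENNReal.mul_ne_top hK hK))
    simp only [hc, ne_eq, min_eq_iff]
    tauto
  obtain ⟨ω', hω', hmem⟩ := exists_mem_of_measure_ne_zero hμY h0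
  rw [← cylinder_eq_of_mem hmem]
  refine ⟨cylinder L (shift^[i] ω'), measurableSet_cylinder _ _,
    (min_le_left _ _).trans (hD _ (hY.shift_mem hω' i)), fun B hB hBm => ⟨?_, ?_⟩⟩
  · rw [mul_assoc]
    refine le_of_le_mul_of_le_inv hK0 hK hcK (le_trans ?_ (h.lower hμY hK hL hω' i hBm hB))
    gcongr
    exact cylinder_anti (Nat.le_add_right _ _) _
  · obtain ⟨ζ, hζ, h1, h2⟩ := hp _ (hY.shift_mem hω' i)
    have h3 : shift^[i] ω' ∈ cylinder L ζ := by
      rw [cylinder_eq_of_mem h1]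
      exact mem_cylinder_self _ _
    have hz := hL ω' hω' ζ hζ i h3
    have hz1 := concat_mem_cylinder_add h3
    have hz2 : shift^[i + p] (concat i ω' ζ) = shift^[p] ζ := by
      rw [add_comm, Function.iterate_add_apply, shift_iterate_concat]
    have h4 := h.lower hμY hK hL hz (i + p) hBm (by rwa [hz2, cylinder_eq_of_mem h2])
    have h5 := (h _ hz (i + L) (p - L)).2
    rw [cylinder_eq_of_mem hz1, show i + L + (p - L) = i + p by omega] at h5
    have h6 := hD₂ _ (hY.shift_mem hz (i + L))
    have h7 : cylinder (i + p + L) (concat i ω' ζ) ⊆ cylinder (i + L) ω' := by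
      rw [← cylinder_eq_of_mem hz1]
      exact cylinder_anti (by omega) _
    have h8 : μ (cylinder (i + L) ω') * c₂ * μ B ≤
        K * K * μ (cylinder (i + L) ω' ∩ shift^[i + p] ⁻¹' B) :=
      calc _ ≤ μ (cylinder (i + L) ω') * μ (cylinder (p - L) (shift^[i + L] (concat i ω' ζ))) *
            μ B := by gcongr
        _ ≤ K * μ (cylinder (i + p) (concat i ω' ζ)) * μ B := by gcongr
        _ = K * (μ (cylinder (i + p) (concat i ω' ζ)) * μ B) := by rw [mul_assoc]
        _ ≤ K * (K * μ (cylinder (i + L) ω' ∩ shift^[i + p] ⁻¹' B)) := by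
          exact mul_le_mul_right (h4.trans (by gcongr)) _
        _ = _ := by rw [mul_assoc]
    refine le_trans ?_ (le_of_le_mul_of_le_inv (mul_ne_zero hK0 hK0) (ENNReal.mul_ne_top hK hK)
      le_rfl h8)
    calc c * μ (cylinder (i + L) ω') * μ B
        ≤ (c₂ * (K * K)⁻¹) * μ (cylinder (i + L) ω') * μ B := by gcongr
      _ = _ := by ring

end GibbsBounds

/-! ### Density points -/

/-- This is the Lebesgue density theorem for refining finite partitions into open cells. A compact
`F ⊆ E` of positive measure has a neighbourhood `O` that is hardly larger, and by compactness the
cells of one level `k` that meet `F` lie in `O`. If each of them had a proportion `ε` outside `E`,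
the set `O \ F` would be too large. -/
lemma exists_cell_density {X : Type*} [TopologicalSpace X] [MeasurableSpace X] [BorelSpace X] [T2Space X]
    (P : Measure X) [IsFiniteMeasure P] [P.Regular] (C : ℕ → X → Set X)
    (hopen : ∀ k x, IsOpen (C k x)) (hself : ∀ k x, x ∈ C k x)
    (heq : ∀ k x y, y ∈ C k x → C k y = C k x) (hanti : ∀ k l x, k ≤ l → C l x ⊆ C k x)
    (hfin : ∀ k, (Set.range (C k)).Finite)
    (hbasis : ∀ U, IsOpen U → ∀ x ∈ U, ∃ k, C k x ⊆ U) {E : Set X} (hE : MeasurableSet E)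
    (hPE : P E ≠ 0) {ε : ENNReal} (hε : ε ≠ 0) :
    ∃ k x, P (C k x) ≠ 0 ∧ P (C k x \ E) ≤ ε * P (C k x) := by
  wlog hεt : ε ≠ ⊤ generalizing ε
  · obtain ⟨k, x, h1, h2⟩ := this one_ne_zero ENNReal.one_ne_top
    refine ⟨k, x, h1, h2.trans ?_⟩
    gcongr
    rw [not_not.1 hεt]
    exact le_top
  obtain ⟨F, hFE, hF, hF0⟩ := hE.exists_lt_isCompact (pos_iff_ne_zero.2 hPE)
  have hδ : ε / 2 * P F ≠ 0 := mul_ne_zero (by simp [hε]) hF0.ne'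
  obtain ⟨O, hFO, hO, hOle⟩ := F.exists_isOpen_le_add P hδ
  choose! κ hκ using hbasis O hO
  obtain ⟨t, htF, ht⟩ := hF.elim_nhds_subcover (fun x => C (κ x) x)
    fun x _ => (hopen _ _).mem_nhds (hself _ _)
  set k := t.sup κ with hk
  have hCO : ∀ y ∈ F, C k y ⊆ O := by
    intro y hy
    obtain ⟨x, hx, hyx⟩ := Set.mem_iUnion₂.1 (ht hy)
    refine (hanti _ _ y (Finset.le_sup (f := κ) hx)).trans ?_
    rw [heq _ _ _ hyx]
    exact hκ x (hFO (htF x hx))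
  by_contra! hcon
  set S : Set (Set X) := C k '' F with hS
  have hSfin : S.Finite := (hfin k).subset (Set.image_subset_range _ _)
  have hdisj : S.PairwiseDisjoint id := by
    rintro _ ⟨x, -, rfl⟩ _ ⟨y, -, rfl⟩ hne
    refine Set.disjoint_left.2 fun z hz hz' => hne ?_
    rw [← heq k x z hz, ← heq k y z hz']
  have hFV : F ⊆ ⋃₀ S := fun y hy => ⟨C k y, ⟨y, hy, rfl⟩, hself k y⟩
  have hVO : ⋃₀ S ⊆ O := Set.sUnion_subset (by rintro _ ⟨y, hy, rfl⟩; exact hCO y hy)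
  have hSm : ∀ s ∈ S, MeasurableSet s := by
    rintro _ ⟨y, -, rfl⟩
    exact (hopen _ _).measurableSet
  have key : ε * P (⋃₀ S) ≤ P (⋃₀ S \ E) := by
    rw [Set.sUnion_eq_biUnion]
    rw [measure_biUnion (f := fun s => s) hSfin.countable hdisj hSm]
    have e : (⋃ s ∈ S, s) \ E = ⋃ s ∈ S, s \ E := by
      ext; simp; grind
    rw [e, measure_biUnion (f := fun s => s \ E) hSfin.countable
      (hdisj.mono fun s => Set.sdiff_subset) fun s hs => (hSm s hs).diff hE, ← ENNReal.tsum_mul_left]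
    refine ENNReal.tsum_le_tsum ?_
    rintro ⟨_, ⟨y, -, rfl⟩⟩
    by_cases h0 : P (C k y) = 0
    · simp [h0]
    · exact (hcon k y h0).le
  have h1 : P (⋃₀ S \ E) ≤ ε / 2 * P F := by
    calc P (⋃₀ S \ E) ≤ P (O \ F) := measure_mono (Set.sdiff_subset_sdiff hVO hFE)
      _ = P O - P F := measure_sdiff hFO hF.measurableSet.nullMeasurableSet (measure_ne_top _ _)
      _ ≤ _ := tsub_le_iff_left.2 hOle
  have h2 : ε * P F ≤ ε / 2 * P F := (by gcongr : ε * P F ≤ ε * P (⋃₀ S)).trans (key.trans h1)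
  have h3 : ε / 2 < ε := ENNReal.half_lt_self hε hεt
  exact absurd h2 (not_le.2 (ENNReal.mul_lt_mul_left hF0.ne' (measure_ne_top _ _) h3))

/-! ### Ergodicity of the powers of the shift -/

section Ergodic

variable {m n : ℕ}

lemma finite_range_cylinder (k : ℕ) : (Set.range (cylinder k : Seq m n → _)).Finite := by
  have : Set.range (cylinder k : Seq m n → _) ⊆
      Set.range fun w : Fin k → Fin m × Fin n => prefixWord k ⁻¹' {w} := by
    rintro _ ⟨ω, rfl⟩
    exact ⟨prefixWord k ω, preimage_prefixWord k ω⟩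
  exact (Set.finite_range _).subset this

lemma shift_iterate_preimage_mul {A : Set (Seq m n)} {q : ℕ} (hA : shift^[q] ⁻¹' A = A) (k : ℕ) :
    shift^[q * k] ⁻¹' A = A := by
  induction k with
  | zero => rfl
  | succ k ih =>
    rw [Nat.mul_succ, Function.iterate_add, Set.preimage_comp, ih, hA]

/-- If the complement of `A` kept mass at least `δ` in every `L`-cylinder of `Y`, then by
`QuasiBernoulliOn.lower` and the invariance of `A` it would keep a fixed proportion of every
cylinder of length `q * k + L`. The density lemma applied to `A` excludes this. -/
lemma QuasiBernoulliOn.exists_cylinder_diff {Y : Set (Seq m n)} {K : ENNReal}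
    {μ : Measure (Seq m n)} [IsProbabilityMeasure μ] (hQ : QuasiBernoulliOn Y K μ)
    (hμY : μ Yᶜ = 0) (hK : K ≠ ⊤) {L : ℕ} (hL : HasMemory L Y) (hY : IsSFT Y) {q : ℕ} (hq : 1 ≤ q)
    {A : Set (Seq m n)} (hA : MeasurableSet A) (hinv : shift^[q] ⁻¹' A = A) (hA0 : μ A ≠ 0) :
    ∃ η ∈ Y, μ (cylinder L η \ A) = 0 := by
  by_contra! hcon
  obtain ⟨δ, hδ, hδ1, hδle⟩ := exists_le_of_cylinder (g := fun E => μ (E \ A)) hcon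
  have hδt : δ ≠ ⊤ := ne_top_of_le_ne_top ENNReal.one_ne_top hδ1
  -- `K + 1` replaces `K` because it is certainly nonzero and so cancels against its inverse.
  have hK1 : K + 1 ≠ ⊤ := ENNReal.add_ne_top.2 ⟨hK, ENNReal.one_ne_top⟩
  obtain ⟨k, ω, h0, hle⟩ := exists_cell_density μ (fun k => cylinder (q * k + L))
    (fun k x => isOpen_cylinder _ x) (fun k x => mem_cylinder_self _ x)
    (fun k x y h => cylinder_eq_of_mem h)
    (fun k l x h => cylinder_anti (Nat.add_le_add_right (Nat.mul_le_mul_left q h) L) x)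
    (fun k => finite_range_cylinder _)
    (fun U hU x hx => by
      obtain ⟨k, hk⟩ := exists_cylinder_subset hU hx
      exact ⟨k, (cylinder_anti (by nlinarith) x).trans hk⟩) hA hA0
    (ε := (K + 1)⁻¹ * (δ / 2)) (mul_ne_zero (ENNReal.inv_ne_zero.2 hK1) (by simp [hδ]))
  obtain ⟨ω', hω', hmem⟩ := exists_mem_of_measure_ne_zero hμY h0
  simp only [← cylinder_eq_of_mem hmem] at h0 hle
  have h1 := hQ.lower hμY hK hL hω' (q * k) ((measurableSet_cylinder _ _).diff hA)
    (Set.sdiff_subset (s := cylinder L (shift^[q * k] ω')) (t := A))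
  have h2 : cylinder (q * k + L) ω' ∩
      shift^[q * k] ⁻¹' (cylinder L (shift^[q * k] ω') \ A) ⊆ cylinder (q * k + L) ω' \ A := by
    rintro x ⟨hx, hx', hxA⟩
    refine ⟨hx, fun h => hxA ?_⟩
    rwa [← shift_iterate_preimage_mul hinv k] at h
  have h3 : μ (cylinder (q * k + L) ω') * δ ≤ μ (cylinder (q * k + L) ω') * (δ / 2) :=
    calc _ ≤ μ (cylinder (q * k) ω') * μ (cylinder L (shift^[q * k] ω') \ A) := by
          gcongr
          · exact cylinder_anti (Nat.le_add_right _ _) _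
          · exact hδle _ (hY.shift_mem hω' _)
      _ ≤ K * μ (cylinder (q * k + L) ω' \ A) := h1.trans (by gcongr)
      _ ≤ (K + 1) * ((K + 1)⁻¹ * (δ / 2) * μ (cylinder (q * k + L) ω')) := by
          gcongr
          exact le_self_add
      _ = _ := by
          rw [← mul_assoc, ← mul_assoc, ENNReal.mul_inv_cancel (by simp) hK1, one_mul, mul_comm]
  exact absurd h3 (not_le.2 (ENNReal.mul_lt_mul_right h0 (measure_ne_top _ _)
    (ENNReal.half_lt_self hδ hδt)))

/-- If neither `A` nor its complement were null, each would fill a cylinder of `Y` up to a null set.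
Transitivity of `shift^[q]` gives a point of `Y` that passes from one cylinder to the other, hence a
whole cylinder of positive mass that does so, against the invariance of `A`. -/
lemma QuasiBernoulliOn.ergodic {Y : Set (Seq m n)} {K : ENNReal}
    {μ : Measure (Seq m n)} [IsProbabilityMeasure μ] (hQ : QuasiBernoulliOn Y K μ)
    (hinv : MeasurePreserving shift μ μ) (hpos : ∀ ω ∈ Y, ∀ k, μ (cylinder k ω) ≠ 0)
    (hμY : μ Yᶜ = 0) (hK : K ≠ ⊤) (hY : IsSFT Y) {q : ℕ} (hq : 1 ≤ q)
    (htr : IsTransitiveOn shift^[q] Y) : Ergodic shift^[q] μ := by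
  obtain ⟨L, hL⟩ := hY.exists_hasMemory
  refine ⟨hinv.iterate q, ⟨fun A hA hAinv => eventuallyConst_set'.2 ?_⟩⟩
  by_contra! hcon
  have hA0 : μ A ≠ 0 := fun h => hcon.1 (ae_eq_empty.2 h)
  have hA1 : μ Aᶜ ≠ 0 := fun h => hcon.2 (ae_eq_univ.2 h)
  obtain ⟨η, hη, hη0⟩ := hQ.exists_cylinder_diff hμY hK hL hY hq hA hAinv hA0
  obtain ⟨ξ, hξ, hξ0⟩ := hQ.exists_cylinder_diff hμY hK hL hY hq hA.compl
    (by rw [Set.preimage_compl, hAinv]) hA1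
  obtain ⟨j, x, hx, hx'⟩ := htr _ _ (isOpen_cylinder L ξ) (isOpen_cylinder L η)
    ⟨ξ, mem_cylinder_self _ _, hξ⟩ ⟨η, mem_cylinder_self _ _, hη⟩
  rw [← Function.iterate_mul] at hx'
  have hO : IsOpen (cylinder L ξ ∩ shift^[q * j] ⁻¹' cylinder L η) :=
    (isOpen_cylinder _ _).inter ((isOpen_cylinder _ _).preimage (continuous_shift_iterate _))
  obtain ⟨k, hk⟩ := exists_cylinder_subset hO ⟨hx.1, hx'.1⟩
  refine hpos x hx.2 k (measure_mono_null (hk.trans ?_) (measure_union_null hξ0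
    ((hinv.iterate (q * j)).preimage_null hη0)))
  rintro y ⟨h1, h2⟩
  by_cases hy : y ∈ A
  · exact Or.inl ⟨h1, fun h => h hy⟩
  · refine Or.inr ⟨h2, fun h => hy ?_⟩
    rwa [← shift_iterate_preimage_mul hAinv j]

/-- The properties of an invariant Gibbs measure that are used below. -/
structure IsQuasiBernoulli (K : ENNReal) (p : ℕ) (μ : Measure (Seq m n)) : Prop where
  invariant : MeasurePreserving shift μ μ
  upper : UpperQuasiBernoulli K μ
  ne_top : K ≠ ⊤
  one_le : 1 ≤ p
  common : ∃ L c, c ≠ 0 ∧ HasCommonFuture L p c μ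

lemma IsInvariantGibbs.isQuasiBernoulli {Y : Set (Seq m n)} (hY : IsSFT Y)
    (htr : IsTransitiveOn shift Y) {μ : Measure (Seq m n)} [IsProbabilityMeasure μ]
    (h : IsInvariantGibbs Y μ) :
    (∃ K p, IsQuasiBernoulli K p μ) ∧
      ∀ q, 1 ≤ q → IsTransitiveOn shift^[q] Y → Ergodic shift^[q] μ := by
  obtain ⟨φ, -, hG⟩ := h.gibbs
  obtain ⟨hpos, K, hK, hQ⟩ := hG.quasiBernoulliOn hY
  obtain ⟨L, hL⟩ := hY.exists_hasMemory
  obtain ⟨p, hp, hLp, hr⟩ := exists_common_return hY htr hL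
  have hK0 : K ≠ 0 := by
    rintro rfl
    obtain ⟨ω, hω, -⟩ := exists_mem_of_measure_ne_zero h.supported
      (E := Set.univ) (by simp)
    have := (hQ ω hω 0 0).1
    simp [hpos ω hω] at this
  exact ⟨⟨K, p, h.invariant, hQ.upper hK h.supported, hK, hp, L,
    hQ.hasCommonFuture hY hpos h.supported hK0 hK hL hLp hr⟩,
    fun q hq hq' => hQ.ergodic h.invariant hpos h.supported hK hY hq hq'⟩

end Ergodic
end SymbolicCP
end

noncomputable section
namespace SymbolicCP

/-! ### Finitely many coordinates -/

section Cell

variable {m n : ℕ}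

/-- The letter at one place of one of the two coordinates. -/
def coord (j : Bool × ℕ) (ω : Seq m n) : Fin m ⊕ Fin n :=
  if j.1 then Sum.inl (ω j.2).1 else Sum.inr (ω j.2).2

/-- The sequences that agree with `ω` on a finite set of coordinates. -/
def cell (S : Finset (Bool × ℕ)) (ω : Seq m n) : Set (Seq m n) :=
  {ω' | ∀ j ∈ S, coord j ω' = coord j ω}

/-- The restriction to a finite set of coordinates. -/
def restr (S : Finset (Bool × ℕ)) (ω : Seq m n) : S → Fin m ⊕ Fin n := fun j => coord j ω

lemma restr_eq_iff {S : Finset (Bool × ℕ)} {ω ω' : Seq m n} :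
    restr S ω' = restr S ω ↔ ω' ∈ cell S ω :=
  ⟨fun h j hj => congrFun h ⟨j, hj⟩, fun h => funext fun j => h j j.2⟩

lemma preimage_restr (S : Finset (Bool × ℕ)) (ω : Seq m n) :
    restr S ⁻¹' {restr S ω} = cell S ω := by
  ext x
  exact restr_eq_iff

lemma continuous_coord (j : Bool × ℕ) : Continuous (coord j : Seq m n → _) := by
  unfold coord
  split_ifs <;> fun_prop

lemma continuous_restr (S : Finset (Bool × ℕ)) : Continuous (restr S : Seq m n → _) :=
  continuous_pi fun _ => continuous_coord _

lemma isClopen_preimage_restr (S : Finset (Bool × ℕ)) (E : Set (S → Fin m ⊕ Fin n)) :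
    IsClopen (restr S ⁻¹' E) := (isClopen_discrete E).preimage (continuous_restr S)

lemma isClopen_cell (S : Finset (Bool × ℕ)) (ω : Seq m n) : IsClopen (cell S ω) := by
  rw [← preimage_restr]
  exact isClopen_preimage_restr S _

lemma measurableSet_cell (S : Finset (Bool × ℕ)) (ω : Seq m n) : MeasurableSet (cell S ω) :=
  (isClopen_cell S ω).isOpen.measurableSet

lemma mem_cell_self (S : Finset (Bool × ℕ)) (ω : Seq m n) : ω ∈ cell S ω := fun _ _ => rfl

lemma cell_eq_of_mem {S : Finset (Bool × ℕ)} {ω ω' : Seq m n} (h : ω' ∈ cell S ω) :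
    cell S ω' = cell S ω := by
  rw [← preimage_restr, ← preimage_restr, restr_eq_iff.2 h]

lemma cell_anti {S S' : Finset (Bool × ℕ)} (h : S ⊆ S') (ω : Seq m n) : cell S' ω ⊆ cell S ω :=
  fun _ hx j hj => hx j (h hj)

lemma cell_union (S S' : Finset (Bool × ℕ)) (ω : Seq m n) :
    cell (S ∪ S') ω = cell S ω ∩ cell S' ω := by
  ext x
  simp only [cell, Set.mem_ofPred_eq, Finset.mem_union, Set.mem_inter_iff]
  grind

/-- `f` depends only on the coordinates in `S`. -/
def ConstOnCells {β : Type*} (S : Finset (Bool × ℕ)) (f : Seq m n → β) : Prop :=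
  ∀ ω, ∀ ω' ∈ cell S ω, f ω' = f ω

lemma ConstOnCells.mono {β : Type*} {S S' : Finset (Bool × ℕ)} (h : S ⊆ S') {f : Seq m n → β}
    (hf : ConstOnCells S f) : ConstOnCells S' f := fun ω ω' hω => hf ω ω' (cell_anti h ω hω)

lemma ConstOnCells.comp₂ {β γ δ : Type*} {S : Finset (Bool × ℕ)} {f : Seq m n → β}
    {g : Seq m n → γ} (hf : ConstOnCells S f) (hg : ConstOnCells S g) (h : β → γ → δ) :
    ConstOnCells S fun ω => h (f ω) (g ω) := fun ω ω' hω => by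
  simp only [hf ω ω' hω, hg ω ω' hω]

lemma ConstOnCells.continuous {β : Type*} [TopologicalSpace β] {S : Finset (Bool × ℕ)}
    {f : Seq m n → β} (hf : ConstOnCells S f) : Continuous f :=
  continuous_iff_continuousAt.2 fun ω => by
    have : f =ᶠ[𝓝 ω] fun _ => f ω :=
      Filter.mem_of_superset ((isClopen_cell S ω).isOpen.mem_nhds (mem_cell_self S ω)) (hf ω)
    exact continuousAt_const.congr this.symm

lemma constOnCells_indicator_cell (S : Finset (Bool × ℕ)) (η : Seq m n) :
    ConstOnCells S ((cell S η).indicator (1 : Seq m n → ℝ)) := by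
  intro ω ω' h
  by_cases hω : ω ∈ cell S η
  · have : ω' ∈ cell S η := by rwa [← cell_eq_of_mem hω]
    simp [hω, this]
  · have : ω' ∉ cell S η := fun h' => hω (by
      rw [← cell_eq_of_mem h', cell_eq_of_mem h]; exact mem_cell_self _ _)
    simp [hω, this]

/-- The integral as a sum over the values of a map to a finite type. -/
lemma integral_eq_sum_fiber {Ω β : Type*} [MeasurableSpace Ω] [Fintype β] {μ : Measure Ω}
    {f : Ω → β} (hf : ∀ b, MeasurableSet (f ⁻¹' {b})) {h : Ω → ℝ} (hh : Integrable h μ) :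
    ∫ ω, h ω ∂μ = ∑ b, ∫ ω in f ⁻¹' {b}, h ω ∂μ := by
  rw [← integral_biUnion_finset _ (fun b _ => hf b) _ fun b _ => hh.integrableOn]
  · have : (⋃ b ∈ Finset.univ, f ⁻¹' {b}) = Set.univ := by ext; simp
    rw [this, setIntegral_univ]
  · exact Set.pairwiseDisjoint_fiber f _

variable {μ : Measure (Seq m n)} [IsProbabilityMeasure μ]

/-- The average over the cells: the conditional expectation given the coordinates in `S`. -/
def avg (μ : Measure (Seq m n)) (S : Finset (Bool × ℕ)) (f : Seq m n → ℝ) (ω : Seq m n) : ℝ :=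
  (∫ x in cell S ω, f x ∂μ) / μ.real (cell S ω)

omit [IsProbabilityMeasure μ] in
lemma constOnCells_avg (S : Finset (Bool × ℕ)) (f : Seq m n → ℝ) :
    ConstOnCells S (avg μ S f) := fun ω ω' h => by rw [avg, avg, cell_eq_of_mem h]

lemma ConstOnCells.bounded {S : Finset (Bool × ℕ)} {f : Seq m n → ℝ} (hf : ConstOnCells S f) :
    ∃ C, ∀ ω, |f ω| ≤ C := by
  classical
  have : (Set.range f).Finite := by
    have h2 : Set.range f ⊆ Set.range fun w : S → Fin m ⊕ Fin n =>
        if h : ∃ ω, restr S ω = w then f h.choose else 0 := by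
      rintro _ ⟨ω, rfl⟩
      refine ⟨restr S ω, ?_⟩
      have h : ∃ ω', restr S ω' = restr S ω := ⟨ω, rfl⟩
      dsimp only
      rw [dif_pos h]
      exact hf _ _ (restr_eq_iff.1 h.choose_spec)
    exact (Set.finite_range _).subset h2
  obtain ⟨C, hC⟩ := (this.image (fun x => |x|)).bddAbove
  exact ⟨C, fun ω => hC ⟨_, ⟨ω, rfl⟩, rfl⟩⟩

lemma ConstOnCells.integrable {S : Finset (Bool × ℕ)} {f : Seq m n → ℝ} (hf : ConstOnCells S f) :
    Integrable f μ := by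
  obtain ⟨C, hC⟩ := hf.bounded
  exact Integrable.of_bound hf.continuous.aestronglyMeasurable C (ae_of_all _ hC)

lemma setIntegral_cell_of_measure_eq_zero {E : Set (Seq m n)} (h : μ.real E = 0)
    (f : Seq m n → ℝ) : ∫ x in E, f x ∂μ = 0 := by
  rw [measureReal_eq_zero_iff] at h
  rw [Measure.restrict_eq_zero.2 h, integral_zero_measure]

/-- `avg` has the defining property of the conditional expectation. -/
lemma integral_avg_mul {S : Finset (Bool × ℕ)} {f g : Seq m n → ℝ} (hf : Integrable f μ)
    (hg : ConstOnCells S g) : ∫ ω, avg μ S f ω * g ω ∂μ = ∫ ω, f ω * g ω ∂μ := by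
  have hm : ∀ b, MeasurableSet (restr S ⁻¹' {b} : Set (Seq m n)) := fun b =>
    (isClopen_preimage_restr S _).isOpen.measurableSet
  have hi : Integrable (fun ω => f ω * g ω) μ := by
    obtain ⟨C, hC⟩ := hg.bounded
    exact hf.mul_bdd hg.continuous.aestronglyMeasurable (ae_of_all _ hC)
  rw [integral_eq_sum_fiber hm hi, integral_eq_sum_fiber hm
    ((constOnCells_avg S f).comp₂ hg (· * ·)).integrable]
  refine Finset.sum_congr rfl fun b _ => ?_
  by_cases hb : ∃ ω, restr S ω = b
  · obtain ⟨ω, rfl⟩ := hb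
    rw [preimage_restr, setIntegral_congr_fun (f := fun x => avg μ S f x * g x) (g := fun _ => avg μ S f ω * g ω)
        (measurableSet_cell S ω) fun x hx => by
          simp only [constOnCells_avg S f ω x hx, hg ω x hx],
      setIntegral_congr_fun (f := fun x => f x * g x) (g := fun x => f x * g ω)
        (measurableSet_cell S ω) fun x hx => by
          simp only [hg ω x hx], setIntegral_const, integral_mul_const, smul_eq_mul, ← mul_assoc]
    congr 1
    by_cases h0 : μ.real (cell S ω) = 0
    · rw [h0, zero_mul, setIntegral_cell_of_measure_eq_zero h0]
    · rw [avg, mul_div_cancel₀ _ h0]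
  · have : (restr S ⁻¹' {b} : Set (Seq m n)) = ∅ := by
      ext x
      simp only [Set.mem_preimage, Set.mem_singleton_iff, Set.mem_empty_iff_false, iff_false]
      exact fun h => hb ⟨x, h⟩
    simp [this]

/-- The mean square distance of two conditional expectations. -/
def sqDist (μ : Measure (Seq m n)) (S S' : Finset (Bool × ℕ)) (f : Seq m n → ℝ) : ℝ :=
  ∫ ω, (avg μ S' f ω - avg μ S f ω) ^ 2 ∂μ

/-- Pythagoras: `avg μ S f` is the orthogonal projection of `avg μ S' f`, so the mean square
distance is a difference of energies. Every monotonicity in the windows used later comes from this.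
-/
lemma sqDist_eq {S S' : Finset (Bool × ℕ)} (h : S ⊆ S') {f : Seq m n → ℝ} (hf : Integrable f μ) :
    sqDist μ S S' f = ∫ ω, avg μ S' f ω ^ 2 ∂μ - ∫ ω, avg μ S f ω ^ 2 ∂μ := by
  have hS := constOnCells_avg (μ := μ) S f
  have hS' := constOnCells_avg (μ := μ) S' f
  have h1 : ∫ ω, avg μ S' f ω * avg μ S f ω ∂μ = ∫ ω, avg μ S f ω ^ 2 ∂μ := by
    rw [integral_avg_mul hf (hS.mono h), ← integral_avg_mul hf hS]
    simp only [sq]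
  have i1 : Integrable (fun ω => avg μ S' f ω ^ 2) μ :=
    (hS'.comp₂ hS' (fun x _ => x ^ 2)).integrable
  have i2 : Integrable (fun ω => avg μ S f ω ^ 2) μ :=
    (hS.comp₂ hS (fun x _ => x ^ 2)).integrable
  have i3 : Integrable (fun ω => 2 * (avg μ S' f ω * avg μ S f ω)) μ :=
    (hS'.comp₂ (hS.mono h) (fun x y => 2 * (x * y))).integrable
  calc sqDist μ S S' f
      = ∫ ω, (avg μ S' f ω ^ 2 - 2 * (avg μ S' f ω * avg μ S f ω) + avg μ S f ω ^ 2) ∂μ := by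
        unfold sqDist
        congr 1 with ω
        ring
    _ = _ := by
        rw [integral_add (f := fun ω => avg μ S' f ω ^ 2 - 2 * (avg μ S' f ω * avg μ S f ω))
            (i1.sub i3) i2, integral_sub i1 i3, integral_const_mul, h1]
        ring

omit [IsProbabilityMeasure μ] in
lemma sqDist_nonneg (S S' : Finset (Bool × ℕ)) (f : Seq m n → ℝ) : 0 ≤ sqDist μ S S' f :=
  integral_nonneg fun _ => sq_nonneg _

lemma sqDist_mono {S₁ S₂ S₃ S₄ : Finset (Bool × ℕ)} (h₁ : S₁ ⊆ S₂) (h₂ : S₂ ⊆ S₃) (h₃ : S₃ ⊆ S₄)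
    {f : Seq m n → ℝ} (hf : Integrable f μ) : sqDist μ S₂ S₃ f ≤ sqDist μ S₁ S₄ f := by
  have a1 := sqDist_nonneg (μ := μ) S₁ S₂ f
  have a2 := sqDist_nonneg (μ := μ) S₃ S₄ f
  rw [sqDist_eq h₁ hf] at a1
  rw [sqDist_eq h₃ hf] at a2
  rw [sqDist_eq h₂ hf, sqDist_eq ((h₁.trans h₂).trans h₃) hf]
  linarith

lemma integral_avg_sq_le (S : Finset (Bool × ℕ)) {f : Seq m n → ℝ} (hf : Integrable f μ)
    (hf2 : Integrable (fun ω => f ω ^ 2) μ) : ∫ ω, avg μ S f ω ^ 2 ∂μ ≤ ∫ ω, f ω ^ 2 ∂μ := by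
  have hS := constOnCells_avg (μ := μ) S f
  have h1 : ∫ ω, f ω * avg μ S f ω ∂μ = ∫ ω, avg μ S f ω ^ 2 ∂μ := by
    rw [← integral_avg_mul hf hS]
    simp only [sq]
  have i2 : Integrable (fun ω => avg μ S f ω ^ 2) μ :=
    (hS.comp₂ hS (fun x _ => x ^ 2)).integrable
  have i3 : Integrable (fun ω => 2 * (f ω * avg μ S f ω)) μ := by
    obtain ⟨C, hC⟩ := hS.bounded
    exact (hf.mul_bdd hS.continuous.aestronglyMeasurable (ae_of_all _ hC)).const_mul 2
  have h2 : 0 ≤ ∫ ω, (f ω ^ 2 - 2 * (f ω * avg μ S f ω) + avg μ S f ω ^ 2) ∂μ := by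
    refine integral_nonneg fun ω => ?_
    have : f ω ^ 2 - 2 * (f ω * avg μ S f ω) + avg μ S f ω ^ 2 = (f ω - avg μ S f ω) ^ 2 := by ring
    simp only [this]
    exact sq_nonneg _
  rw [integral_add (f := fun ω => f ω ^ 2 - 2 * (f ω * avg μ S f ω)) (hf2.sub i3) i2, integral_sub hf2 i3, integral_const_mul, h1] at h2
  linarith

/-- The conditional probability of `V` given the coordinates in `S`. -/
def condP (μ : Measure (Seq m n)) (S : Finset (Bool × ℕ)) (V : Set (Seq m n)) : Seq m n → ℝ :=
  avg μ S (V.indicator 1)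

omit [IsProbabilityMeasure μ] in
lemma condP_apply (S : Finset (Bool × ℕ)) {V : Set (Seq m n)} (hV : MeasurableSet V)
    (ω : Seq m n) : condP μ S V ω = μ.real (V ∩ cell S ω) / μ.real (cell S ω) := by
  rw [condP, avg, integral_indicator_one hV, measureReal_restrict_apply hV]

omit [IsProbabilityMeasure μ] in
lemma condP_nonneg (S : Finset (Bool × ℕ)) {V : Set (Seq m n)} (hV : MeasurableSet V)
    (ω : Seq m n) : 0 ≤ condP μ S V ω := by
  rw [condP_apply S hV]
  positivity

lemma condP_le_one (S : Finset (Bool × ℕ)) {V : Set (Seq m n)} (hV : MeasurableSet V)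
    (ω : Seq m n) : condP μ S V ω ≤ 1 := by
  rw [condP_apply S hV]
  exact div_le_one_of_le₀ (measureReal_mono Set.inter_subset_right) measureReal_nonneg

lemma integrable_indicator {V : Set (Seq m n)} (hV : MeasurableSet V) :
    Integrable (V.indicator (1 : Seq m n → ℝ)) μ :=
  (integrable_const (1 : ℝ)).indicator hV

/-- Approximate conditional independence: `V` is nearly determined by `S₂` alone, and `U` by
`S₁` alone. -/
lemma integral_condP_inter_sub_sq_le {G G' S₁ S₂ : Finset (Bool × ℕ)} (hG : G ⊆ G')
    (h₂ : S₂ ⊆ G) {U V : Set (Seq m n)} (hU : MeasurableSet U) (hV : MeasurableSet V)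
    (hUG : ConstOnCells G' (U.indicator (1 : Seq m n → ℝ))) :
    ∫ ω, (condP μ G (U ∩ V) ω - condP μ S₁ U ω * condP μ S₂ V ω) ^ 2 ∂μ ≤
      2 * sqDist μ S₂ G' (V.indicator 1) + 2 * sqDist μ S₁ G (U.indicator 1) := by
  set u : Seq m n → ℝ := U.indicator 1 with hu
  set v : Seq m n → ℝ := V.indicator 1 with hv
  set h := condP μ S₂ V with hh
  set w := avg μ G' v with hw
  have hhc : ConstOnCells G h := (constOnCells_avg S₂ _).mono h₂
  have hwc : ConstOnCells G' w := constOnCells_avg G' v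
  have hui : Integrable u μ := integrable_indicator hU
  have hvi : Integrable v μ := integrable_indicator hV
  set g : Seq m n → ℝ := fun ω => u ω * (w ω - h ω) with hg
  have hgc : ConstOnCells G' g := hUG.comp₂ (hwc.comp₂ (hhc.mono hG) (· - ·)) (· * ·)
  -- Since `u` is determined by `G'` and `h` by `G`, the conditional expectation of `u * (w - h)`
  -- given `G` is the error made in replacing the conditional probability of `U ∩ V` by the product
  -- of that of `U` with `h`. Averaging contracts the mean square, which leaves the distance from
  -- `h` to `w`.
  have key : ∀ ω, avg μ G g ω = condP μ G (U ∩ V) ω - condP μ G U ω * h ω := by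
    intro ω
    simp only [condP, avg]
    rw [div_mul_eq_mul_div, ← sub_div]
    congr 1
    have e1 : ∫ x in cell G ω, (U ∩ V).indicator (1 : Seq m n → ℝ) x ∂μ =
        ∫ x in cell G ω, u x * w x ∂μ := by
      have hc : ConstOnCells G' fun x => u x * (cell G ω).indicator (1 : Seq m n → ℝ) x :=
        hUG.comp₂ ((constOnCells_indicator_cell G ω).mono hG) (· * ·)
      have := integral_avg_mul hvi hc
      rw [← integral_indicator (measurableSet_cell G ω), ← integral_indicator (measurableSet_cell G ω)]
      refine Eq.trans ?_ (this.symm.trans ?_) <;> congr 1 with x <;>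
        by_cases hx : x ∈ cell G ω <;> by_cases hxU : x ∈ U <;> by_cases hxV : x ∈ V <;>
        simp [hx, hxU, hxV, hu, hv, hw]
    have e2 : (∫ x in cell G ω, u x ∂μ) * h ω = ∫ x in cell G ω, u x * h x ∂μ := by
      rw [← integral_mul_const]
      refine setIntegral_congr_fun (measurableSet_cell G ω) fun x hx => ?_
      simp only [hhc ω x hx]
    rw [e1, e2, ← integral_sub (hUG.comp₂ hwc (· * ·)).integrable.integrableOn
      (hUG.comp₂ (hhc.mono hG) (· * ·)).integrable.integrableOn]
    simp only [hg, mul_sub]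
  have hu01 : ∀ ω, u ω ^ 2 ≤ 1 := by
    intro ω
    by_cases hω : ω ∈ U <;> simp [hu, hω]
  have b1 : ∫ ω, (condP μ G (U ∩ V) ω - condP μ G U ω * h ω) ^ 2 ∂μ ≤ sqDist μ S₂ G' v := by
    simp only [← key]
    refine (integral_avg_sq_le G hgc.integrable
      (hgc.comp₂ hgc fun x _ => x ^ 2).integrable).trans ?_
    refine integral_mono (hgc.comp₂ hgc fun x _ => x ^ 2).integrable
      (hwc.comp₂ (hhc.mono hG) fun x y => (x - y) ^ 2).integrable fun ω => ?_
    change (u ω * (w ω - h ω)) ^ 2 ≤ (w ω - h ω) ^ 2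
    rw [mul_pow]
    exact mul_le_of_le_one_left (sq_nonneg _) (hu01 ω)
  have c1 : ConstOnCells G (condP μ G (U ∩ V)) := constOnCells_avg _ _
  have c2 : ConstOnCells G (condP μ G U) := constOnCells_avg _ _
  have c3 : ConstOnCells (G ∪ S₁) (condP μ S₁ U) :=
    (constOnCells_avg _ _).mono Finset.subset_union_right
  have hGS : G ⊆ G ∪ S₁ := Finset.subset_union_left
  have i1 : Integrable (fun ω => (condP μ G (U ∩ V) ω - condP μ G U ω * h ω) ^ 2) μ :=
    (c1.comp₂ (c2.comp₂ hhc (· * ·)) fun x y => (x - y) ^ 2).integrable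
  have i2 : Integrable (fun ω => (condP μ G U ω - condP μ S₁ U ω) ^ 2) μ :=
    ((c2.mono hGS).comp₂ c3 fun x y => (x - y) ^ 2).integrable
  calc ∫ ω, (condP μ G (U ∩ V) ω - condP μ S₁ U ω * h ω) ^ 2 ∂μ
      ≤ ∫ ω, (2 * (condP μ G (U ∩ V) ω - condP μ G U ω * h ω) ^ 2 +
          2 * (condP μ G U ω - condP μ S₁ U ω) ^ 2) ∂μ := by
        refine integral_mono (((c1.mono hGS).comp₂ (c3.comp₂ (hhc.mono hGS) (· * ·))
          fun x y => (x - y) ^ 2).integrable) ((i1.const_mul 2).add (i2.const_mul 2)) fun ω => ?_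
        have h0 := condP_nonneg (μ := μ) S₂ hV ω
        have h1 := condP_le_one (μ := μ) S₂ hV ω
        have : (h ω) ^ 2 ≤ 1 := pow_le_one₀ h0 h1
        set a := condP μ G (U ∩ V) ω - condP μ G U ω * h ω
        set b := condP μ G U ω - condP μ S₁ U ω
        have e : condP μ G (U ∩ V) ω - condP μ S₁ U ω * h ω = a + h ω * b := by ring
        simp only [e]
        nlinarith [sq_nonneg (a - h ω * b), mul_le_mul_of_nonneg_right this (sq_nonneg b)]
    _ = 2 * ∫ ω, (condP μ G (U ∩ V) ω - condP μ G U ω * h ω) ^ 2 ∂μ +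
          2 * ∫ ω, (condP μ G U ω - condP μ S₁ U ω) ^ 2 ∂μ := by
        rw [integral_add (i1.const_mul 2) (i2.const_mul 2), integral_const_mul, integral_const_mul]
    _ ≤ _ := by
        gcongr
        exact le_rfl

end Cell
end SymbolicCP
end

noncomputable section
namespace SymbolicCP

/-! ### The chi-square bound -/

section ChiSquare

/-- Cauchy-Schwarz with the weights `ρ i * c i v`, of total mass at most one, bounds the square of
an `ℓ¹` distance by a chi-square sum. Expanding the squares (`h3`) identifies that sum with the
increment on the right, which can then be telescoped. -/
lemma sq_sum_abs_sub_le {ι υ : Type*} [Fintype ι] [Fintype υ] {a c : ι → υ → ℝ} {ρ : ι → ℝ}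
    (hc : ∀ i v, 0 ≤ c i v) (hρ : ∀ i, 0 ≤ ρ i)
    (hac : ∀ i v, ρ i * c i v = 0 → a i v = 0) (hsum : ∑ i, ∑ v, ρ i * c i v ≤ 1) (v₀ : υ) :
    (∑ i, |a i v₀ - (∑ v, a i v) * c i v₀ / ∑ v, c i v|) ^ 2 ≤
      (∑ i, ∑ v, a i v ^ 2 / (ρ i * c i v)) - ∑ i, (∑ v, a i v) ^ 2 / (ρ i * ∑ v, c i v) := by
  set r : ι → υ → ℝ := fun i v => |a i v - (∑ v, a i v) * c i v / ∑ v, c i v| with hr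
  have hr0 : ∀ i v, ρ i * c i v = 0 → r i v = 0 := by
    intro i v h
    rcases mul_eq_zero.1 h with h' | h'
    · have : ∑ v, a i v = 0 := Finset.sum_eq_zero fun v _ => hac i v (by rw [h', zero_mul])
      simp [hr, hac i v h, this]
    · simp [hr, hac i v h, h']
  have h1 : ∑ i, r i v₀ ≤ ∑ i, ∑ v, r i v := Finset.sum_le_sum fun i _ =>
    Finset.single_le_sum (f := r i) (fun v _ => abs_nonneg _) (Finset.mem_univ v₀)
  have h2 : (∑ p : ι × υ, r p.1 p.2) ^ 2 ≤
      (∑ p : ι × υ, ρ p.1 * c p.1 p.2) * ∑ p : ι × υ, r p.1 p.2 ^ 2 / (ρ p.1 * c p.1 p.2) := by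
    refine Finset.sum_sq_le_sum_mul_sum_of_sq_le_mul _
      (fun p _ => mul_nonneg (hρ _) (hc _ _))
      (fun p _ => div_nonneg (sq_nonneg _) (mul_nonneg (hρ _) (hc _ _))) fun p _ => ?_
    by_cases h : ρ p.1 * c p.1 p.2 = 0
    · simp [h, hr0 _ _ h]
    · exact (mul_div_cancel₀ _ h).ge
  have h3 : ∀ i, ∑ v, r i v ^ 2 / (ρ i * c i v) =
      (∑ v, a i v ^ 2 / (ρ i * c i v)) - (∑ v, a i v) ^ 2 / (ρ i * ∑ v, c i v) := by
    intro i
    set b := ∑ v, a i v with hb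
    set d := ∑ v, c i v with hd
    by_cases h0 : ρ i * d = 0
    · have hz : ∀ v, ρ i * c i v = 0 := by
        intro v
        rcases mul_eq_zero.1 h0 with h | h
        · rw [h, zero_mul]
        · rw [(Finset.sum_eq_zero_iff_of_nonneg fun v _ => hc i v).1 h v (Finset.mem_univ v),
            mul_zero]
      simp [h0, hz]
    · have hρ0 : ρ i ≠ 0 := left_ne_zero_of_mul h0
      have hd0 : d ≠ 0 := right_ne_zero_of_mul h0
      have e : ∀ v, r i v ^ 2 / (ρ i * c i v) =
          a i v ^ 2 / (ρ i * c i v) - 2 * b / (ρ i * d) * a i v + b ^ 2 / (ρ i * d ^ 2) * c i v := by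
        intro v
        simp only [hr, sq_abs, ← hb, ← hd]
        by_cases hcv : c i v = 0
        · simp [hcv, hac i v (by rw [hcv, mul_zero])]
        · field_simp
          ring
      rw [Finset.sum_congr rfl fun v _ => e v, Finset.sum_add_distrib, Finset.sum_sub_distrib,
        ← Finset.mul_sum, ← Finset.mul_sum, ← hb, ← hd]
      field_simp
      ring
  have h4 : 0 ≤ ∑ i, ∑ v, r i v ^ 2 / (ρ i * c i v) := Finset.sum_nonneg fun i _ =>
    Finset.sum_nonneg fun v _ => div_nonneg (sq_nonneg _) (mul_nonneg (hρ _) (hc _ _))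
  rw [← Finset.sum_sub_distrib, ← Finset.sum_congr rfl fun i _ => h3 i]
  rw [Fintype.sum_prod_type, Fintype.sum_prod_type, Fintype.sum_prod_type] at h2
  calc (∑ i, r i v₀) ^ 2 ≤ (∑ i, ∑ v, r i v) ^ 2 := by
        have : 0 ≤ ∑ i, r i v₀ := Finset.sum_nonneg fun i _ => abs_nonneg _
        gcongr
    _ ≤ _ := h2
    _ ≤ 1 * ∑ i, ∑ v, r i v ^ 2 / (ρ i * c i v) := by gcongr
    _ = _ := one_mul _

lemma integral_comp_fiber {Ω β : Type*} [MeasurableSpace Ω] [Fintype β] {μ : Measure Ω}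
    [IsFiniteMeasure μ] {f : Ω → β} (hf : ∀ b, MeasurableSet (f ⁻¹' {b})) (H : β → ℝ) :
    ∫ ω, H (f ω) ∂μ = ∑ b, μ.real (f ⁻¹' {b}) * H b := by
  classical
  have hm : Measurable fun ω => H (f ω) := by
    intro E _
    have : (fun ω => H (f ω)) ⁻¹' E = ⋃ b ∈ {b | H b ∈ E}, f ⁻¹' {b} := by ext; simp
    rw [this]
    exact MeasurableSet.biUnion (Set.toFinite _).countable fun b _ => hf b
  have hi : Integrable (fun ω => H (f ω)) μ := by
    refine Integrable.of_bound hm.aestronglyMeasurable (∑ b, ‖H b‖) (ae_of_all _ fun ω => ?_)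
    exact Finset.single_le_sum (f := fun b => ‖H b‖) (fun _ _ => norm_nonneg _)
      (Finset.mem_univ (f ω))
  rw [integral_eq_sum_fiber hf hi]
  refine Finset.sum_congr rfl fun b _ => ?_
  rw [setIntegral_congr_fun (g := fun _ => H b) (hf b) fun x hx => by
    simp only [Set.mem_preimage, Set.mem_singleton_iff] at hx
    simp only [hx], setIntegral_const, smul_eq_mul]

lemma sum_measureReal_inter_fiber {Ω β : Type*} [MeasurableSpace Ω] [Fintype β] {μ : Measure Ω}
    [IsFiniteMeasure μ] {f : Ω → β} (hf : ∀ b, MeasurableSet (f ⁻¹' {b})) {E : Set Ω}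
    (hE : MeasurableSet E) : ∑ b, μ.real (E ∩ f ⁻¹' {b}) = μ.real E := by
  have := integral_eq_sum_fiber hf ((integrable_const (1 : ℝ)).indicator hE (μ := μ))
  rw [integral_indicator_const _ hE] at this
  simp only [smul_eq_mul, mul_one] at this
  rw [this]
  refine Finset.sum_congr rfl fun b _ => ?_
  rw [integral_indicator_const _ hE, measureReal_restrict_apply hE, smul_eq_mul, mul_one]

variable {m n : ℕ} {μ : Measure (Seq m n)} [IsProbabilityMeasure μ]

/-- One plus the chi-square dependence between the coordinates in `S` and those in `X₁`, `X₂`. -/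
def chi (μ : Measure (Seq m n)) (X₁ X₂ S : Finset (Bool × ℕ)) : ℝ :=
  ∫ ω, μ.real (cell X₁ ω ∩ cell X₂ ω ∩ cell S ω) /
    (μ.real (cell X₁ ω) * μ.real (cell X₂ ω) * μ.real (cell S ω)) ∂μ

lemma measurableSet_restr (S : Finset (Bool × ℕ)) (b : S → Fin m ⊕ Fin n) :
    MeasurableSet (restr S ⁻¹' {b} : Set (Seq m n)) :=
  (isClopen_preimage_restr S _).isOpen.measurableSet

/-- Adding `T` to `S` raises the chi-square dependence on `X₁` and `X₂` by at least the square of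
what these say about `T` beyond `S`. The mean square distance is first bounded by the mean distance,
since conditional probabilities lie in `[0, 1]`. -/
lemma sqDist_sq_le_chi_sub (X₁ X₂ S T : Finset (Bool × ℕ)) (η : Seq m n) :
    sqDist μ S (S ∪ X₁ ∪ X₂) ((cell T η).indicator 1) ^ 2 ≤
      chi μ X₁ X₂ (S ∪ T) - chi μ X₁ X₂ S := by
  set x : Seq m n → (X₁ → Fin m ⊕ Fin n) × (X₂ → Fin m ⊕ Fin n) := fun ω => (restr X₁ ω, restr X₂ ω) with hx
  have fx : ∀ p, x ⁻¹' {p} = restr X₁ ⁻¹' {p.1} ∩ restr X₂ ⁻¹' {p.2} := by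
    rintro ⟨p, q⟩
    ext ω
    simp [hx]
  set y : Seq m n → ((X₁ → Fin m ⊕ Fin n) × (X₂ → Fin m ⊕ Fin n)) × (S → Fin m ⊕ Fin n) := fun ω => (x ω, restr S ω) with hy
  have fy : ∀ p, y ⁻¹' {p} = x ⁻¹' {p.1} ∩ restr S ⁻¹' {p.2} := by
    rintro ⟨p, q⟩
    ext ω
    simp [hy]
  have mx : ∀ p, MeasurableSet (x ⁻¹' {p}) := fun p => by
    rw [fx]
    exact (measurableSet_restr _ _).inter (measurableSet_restr _ _)
  have my : ∀ p, MeasurableSet (y ⁻¹' {p}) := fun p => by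
    rw [fy]
    exact (mx _).inter (measurableSet_restr _ _)
  set z : Seq m n → (((X₁ → Fin m ⊕ Fin n) × (X₂ → Fin m ⊕ Fin n)) × (S → Fin m ⊕ Fin n)) × (T → Fin m ⊕ Fin n) := fun ω => (y ω, restr T ω) with hz
  have fz : ∀ p, z ⁻¹' {p} = y ⁻¹' {p.1} ∩ restr T ⁻¹' {p.2} := by
    rintro ⟨p, q⟩
    ext ω
    simp [hz]
  have mz : ∀ p, MeasurableSet (z ⁻¹' {p}) := fun p => by
    rw [fz]
    exact (my _).inter (measurableSet_restr _ _)
  set a : ((X₁ → Fin m ⊕ Fin n) × (X₂ → Fin m ⊕ Fin n)) × (S → Fin m ⊕ Fin n) → (T → Fin m ⊕ Fin n) → ℝ := fun p v => μ.real (y ⁻¹' {p} ∩ restr T ⁻¹' {v}) with ha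
  set c : ((X₁ → Fin m ⊕ Fin n) × (X₂ → Fin m ⊕ Fin n)) × (S → Fin m ⊕ Fin n) → (T → Fin m ⊕ Fin n) → ℝ := fun p v =>
    μ.real (restr S ⁻¹' {p.2} ∩ restr T ⁻¹' {v}) with hc
  set ρ : ((X₁ → Fin m ⊕ Fin n) × (X₂ → Fin m ⊕ Fin n)) × (S → Fin m ⊕ Fin n) → ℝ := fun p =>
    μ.real (restr X₁ ⁻¹' {p.1.1}) * μ.real (restr X₂ ⁻¹' {p.1.2}) with hρ
  have sa : ∀ p, ∑ v, a p v = μ.real (y ⁻¹' {p}) := fun p =>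
    sum_measureReal_inter_fiber (measurableSet_restr T) (my p)
  have sc : ∀ p, ∑ v, c p v = μ.real (restr S ⁻¹' {p.2}) := fun p =>
    sum_measureReal_inter_fiber (measurableSet_restr T) (measurableSet_restr _ _)
  have one : ∀ S : Finset (Bool × ℕ), ∑ w, μ.real (restr S ⁻¹' {w}) = 1 := fun S => by
    simpa using sum_measureReal_inter_fiber (μ := μ) (measurableSet_restr S) MeasurableSet.univ
  -- `a` is the joint mass of all values, `c` that of the values on `S` and `T`, and `ρ` the product
  -- of the masses of the values on `X₁` and on `X₂`. The two side goals are absolute continuity and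
  -- the total mass of the weights.
  have key := sq_sum_abs_sub_le (a := a) (c := c) (ρ := ρ) (fun _ _ => measureReal_nonneg)
    (fun _ => mul_nonneg measureReal_nonneg measureReal_nonneg) ?_ ?_ (restr T η)
  · have e0 : ∀ ω, cell X₁ ω ∩ cell X₂ ω ∩ cell S ω = y ⁻¹' {y ω} := fun ω => by
      rw [fy, fx, ← preimage_restr, ← preimage_restr, ← preimage_restr]
    have e1 : chi μ X₁ X₂ S = ∑ p, (∑ v, a p v) ^ 2 / (ρ p * ∑ v, c p v) := by
      simp only [chi, e0]
      rw [← Finset.sum_congr rfl fun p _ => show μ.real (y ⁻¹' {p}) *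
        (μ.real (y ⁻¹' {p}) / (ρ p * μ.real (restr S ⁻¹' {p.2}))) = _ by rw [sa, sc]; ring,
        ← integral_comp_fiber my
          fun p => μ.real (y ⁻¹' {p}) / (ρ p * μ.real (restr S ⁻¹' {p.2}))]
      simp only [hρ, hy, hx, preimage_restr]
    have e2 : chi μ X₁ X₂ (S ∪ T) = ∑ p, ∑ v, a p v ^ 2 / (ρ p * c p v) := by
      simp only [chi, cell_union, ← Set.inter_assoc, e0]
      rw [← Fintype.sum_prod_type' fun p v => a p v ^ 2 / (ρ p * c p v),
        ← Finset.sum_congr rfl fun p _ => show μ.real (z ⁻¹' {p}) *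
          (a p.1 p.2 / (ρ p.1 * c p.1 p.2)) = _ by rw [fz]; simp only [ha]; ring,
        ← integral_comp_fiber mz fun p => a p.1 p.2 / (ρ p.1 * c p.1 p.2)]
      simp only [hρ, ha, hc, hz, hy, hx, preimage_restr]
    have e3 : sqDist μ S (S ∪ X₁ ∪ X₂) ((cell T η).indicator 1) ≤
        ∑ p, |a p (restr T η) - (∑ v, a p v) * c p (restr T η) / ∑ v, c p v| := by
      have hV := measurableSet_cell T η
      have e4 : ∀ ω, cell (S ∪ X₁ ∪ X₂) ω = y ⁻¹' {y ω} := fun ω => by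
        rw [← e0, cell_union, cell_union, Set.inter_assoc, Set.inter_comm]
      have e5 : sqDist μ S (S ∪ X₁ ∪ X₂) ((cell T η).indicator 1) =
          ∑ p, μ.real (y ⁻¹' {p}) * (a p (restr T η) / μ.real (y ⁻¹' {p}) -
            c p (restr T η) / μ.real (restr S ⁻¹' {p.2})) ^ 2 := by
        rw [← integral_comp_fiber my fun p => (a p (restr T η) / μ.real (y ⁻¹' {p}) -
            c p (restr T η) / μ.real (restr S ⁻¹' {p.2})) ^ 2]
        change ∫ ω, (condP μ (S ∪ X₁ ∪ X₂) (cell T η) ω - condP μ S (cell T η) ω) ^ 2 ∂μ = _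
        simp only [condP_apply _ hV, e4, ha, hc, hy, preimage_restr, Set.inter_comm]
      rw [e5]
      refine Finset.sum_le_sum fun p _ => ?_
      rw [sa, sc]
      set α := μ.real (y ⁻¹' {p})
      set d := μ.real (restr S ⁻¹' {p.2} : Set (Seq m n))
      have hα : 0 ≤ α := measureReal_nonneg
      by_cases h0 : α = 0
      · rw [h0, zero_mul]; exact abs_nonneg _
      have u1 : a p (restr T η) / α ≤ 1 :=
        div_le_one_of_le₀ (measureReal_mono Set.inter_subset_left) hα
      have u2 : 0 ≤ a p (restr T η) / α := div_nonneg measureReal_nonneg hα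
      have u3 : c p (restr T η) / d ≤ 1 :=
        div_le_one_of_le₀ (measureReal_mono Set.inter_subset_left) measureReal_nonneg
      have u4 : 0 ≤ c p (restr T η) / d := div_nonneg measureReal_nonneg measureReal_nonneg
      have u5 : a p (restr T η) - α * c p (restr T η) / d =
          α * (a p (restr T η) / α - c p (restr T η) / d) := by
        rw [mul_sub, mul_div_cancel₀ _ h0, mul_div_assoc]
      rw [u5, abs_mul, abs_of_nonneg hα]
      gcongr
      have u6 : |a p (restr T η) / α - c p (restr T η) / d| ≤ 1 := abs_le.2 ⟨by linarith, by linarith⟩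
      rw [← sq_abs, sq]
      exact mul_le_of_le_one_left (abs_nonneg _) u6
    rw [e1, e2]
    refine le_trans ?_ key
    have := sqDist_nonneg (μ := μ) S (S ∪ X₁ ∪ X₂) ((cell T η).indicator 1)
    gcongr
  · intro p v h
    by_contra h0
    have hle : ∀ E, y ⁻¹' {p} ∩ restr T ⁻¹' {v} ⊆ E → μ.real E ≠ 0 := fun E hE h' =>
      h0 (le_antisymm ((measureReal_mono hE).trans h'.le) measureReal_nonneg)
    have hsub : y ⁻¹' {p} ∩ restr T ⁻¹' {v} ⊆ (restr X₁ ⁻¹' {p.1.1} ∩ restr X₂ ⁻¹' {p.1.2}) ∩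
        restr S ⁻¹' {p.2} ∩ restr T ⁻¹' {v} := by rw [fy, fx]
    refine mul_ne_zero (mul_ne_zero (hle _ (hsub.trans ?_)) (hle _ (hsub.trans ?_)))
      (hle _ (hsub.trans ?_)) h
    · exact fun ω hω => hω.1.1.1
    · exact fun ω hω => hω.1.1.2
    · exact fun ω hω => ⟨hω.1.2, hω.2⟩
  · rw [Fintype.sum_prod_type, Finset.sum_congr rfl fun p _ => Finset.sum_congr rfl fun q _ => by
      rw [← Finset.mul_sum, sc]]
    simp only [hρ, ← Finset.mul_sum, one, mul_one, Fintype.sum_prod_type, le_refl]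

end ChiSquare
end SymbolicCP
end

noncomputable section
namespace SymbolicCP

/-! ### Memory loss of conditional probabilities -/

section MemoryLoss

variable {m n : ℕ} {μ : Measure (Seq m n)}

/-- `B` reads only letters from time `s` on, so it is the preimage under `shift^[s]` of a Borel set.
The hypothesis then dominates `μ.restrict B` by a multiple of `μ` on cylinders of length `s`, of
which `A` is a union. -/
lemma UpperQuasiBernoulli.inter_le {K : ENNReal} [IsFiniteMeasure μ]
    (h : UpperQuasiBernoulli K μ)
    (hinv : MeasurePreserving shift μ μ) {s : ℕ} {A B : Set (Seq m n)}
    (hA : ∀ ω ∈ A, cylinder s ω ⊆ A) (hB : MeasurableSet B)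
    (hBs : ∀ ω ω' : Seq m n, (∀ i, s ≤ i → ω i = ω' i) → ω ∈ B → ω' ∈ B) :
    μ (A ∩ B) ≤ K * μ A * μ B := by
  rcases A.eq_empty_or_nonempty with rfl | ⟨ω₀, -⟩
  · simp
  have hcont : Continuous (concat s ω₀) := by
    refine continuous_pi fun i => ?_
    unfold concat
    split_ifs <;> fun_prop
  set B' : Set (Seq m n) := concat s ω₀ ⁻¹' B with hB'
  have hB'm : MeasurableSet B' := hcont.measurable hB
  have hBB' : B = shift^[s] ⁻¹' B' := by
    ext ω
    have e : ∀ i, s ≤ i → ω i = concat s ω₀ (shift^[s] ω) i := fun i hi => by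
      simp [concat, not_lt.2 hi, shift_iterate_apply, Nat.sub_add_cancel hi]
    exact ⟨hBs _ _ e, hBs _ _ fun i hi => (e i hi).symm⟩
  have hle : μ.restrict B A ≤ (K * μ B) • μ A := by
    change _ ≤ ((K * μ B) • μ) A
    refine measure_le_of_dependsOn (k := s) (fun ω => ?_) hA
    rw [Measure.restrict_apply (measurableSet_cylinder _ _), Measure.smul_apply, smul_eq_mul]
    calc _ = μ (cylinder s ω ∩ shift^[s] ⁻¹' B') := by rw [← hBB']
      _ ≤ K * μ (cylinder s ω) * μ B' := h s ω B' hB'm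
      _ = K * μ B * μ (cylinder s ω) := by
        rw [hBB', (hinv.iterate s).measure_preimage hB'm.nullMeasurableSet]
        ring
  have : μ (A ∩ B) ≤ μ.restrict B A := by
    rw [Measure.restrict_apply' hB]
  refine this.trans (hle.trans (le_of_eq ?_))
  rw [smul_eq_mul]
  ring

/-- The coordinates in `S` belong to times in `[i, j)`. -/
def TimesIn (S : Finset (Bool × ℕ)) (i j : ℕ) : Prop := ∀ t ∈ S, i ≤ t.2 ∧ t.2 < j

lemma coord_congr {ω ω' : Seq m n} {j : Bool × ℕ} (h : ω j.2 = ω' j.2) : coord j ω = coord j ω' := by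
  simp only [coord, h]

lemma TimesIn.cylinder_subset {S : Finset (Bool × ℕ)} {i j : ℕ} (h : TimesIn S i j)
    (η : Seq m n) {ω : Seq m n} (hω : ω ∈ cell S η) : cylinder j ω ⊆ cell S η :=
  fun x hx t ht => by rw [← hω t ht]; exact coord_congr (hx t.2 (h t ht).2)

lemma chi_nonneg (X₁ X₂ S : Finset (Bool × ℕ)) : 0 ≤ chi μ X₁ X₂ S :=
  integral_nonneg fun _ => by positivity

/-- `X₁`, `S`, `X₂` occupy consecutive ranges of times. Cutting twice shows that their joint law has
density at most `K ^ 2` with respect to the product of the three laws. -/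
lemma chi_le [IsProbabilityMeasure μ] {K : ENNReal} (h : UpperQuasiBernoulli K μ) (hK : K ≠ ⊤)
    (hinv : MeasurePreserving shift μ μ) {X₁ X₂ S : Finset (Bool × ℕ)} {s s' s'' : ℕ}
    (h₁ : TimesIn X₁ 0 s) (h₂ : TimesIn X₂ s' s'') (hS : TimesIn S s s') (hss : s ≤ s') :
    chi μ X₁ X₂ S ≤ K.toReal ^ 2 := by
  have hb : ∀ ω : Seq m n, μ.real (cell X₁ ω ∩ cell X₂ ω ∩ cell S ω) ≤
      K.toReal ^ 2 * (μ.real (cell X₁ ω) * μ.real (cell X₂ ω) * μ.real (cell S ω)) := by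
    intro ω
    have a1 : μ (cell X₁ ω ∩ cell S ω) ≤ K * μ (cell X₁ ω) * μ (cell S ω) := by
      refine h.inter_le (s := s) hinv (fun η hη => h₁.cylinder_subset ω hη)
        (measurableSet_cell _ _) fun η η' hηη hη t ht => ?_
      rw [← hη t ht]
      exact (coord_congr (hηη t.2 (hS t ht).1)).symm
    have a2 : μ ((cell X₁ ω ∩ cell S ω) ∩ cell X₂ ω) ≤
        K * μ (cell X₁ ω ∩ cell S ω) * μ (cell X₂ ω) := by
      refine h.inter_le (s := s') hinv (fun η hη x hx => ⟨?_, ?_⟩)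
        (measurableSet_cell _ _) fun η η' hηη hη t ht => ?_
      · exact h₁.cylinder_subset ω hη.1 (cylinder_anti hss η hx)
      · exact hS.cylinder_subset ω hη.2 hx
      · rw [← hη t ht]
        exact (coord_congr (hηη t.2 (h₂ t ht).1)).symm
    have a3 : μ (cell X₁ ω ∩ cell X₂ ω ∩ cell S ω) ≤
        K ^ 2 * (μ (cell X₁ ω) * μ (cell X₂ ω) * μ (cell S ω)) := by
      rw [Set.inter_right_comm]
      calc _ ≤ _ := a2
        _ ≤ K * (K * μ (cell X₁ ω) * μ (cell S ω)) * μ (cell X₂ ω) := by gcongr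
        _ = _ := by ring
    have := ENNReal.toReal_mono (by finiteness) a3
    simpa only [Measure.real, ENNReal.toReal_mul, ENNReal.toReal_pow] using this
  calc chi μ X₁ X₂ S ≤ ∫ _, K.toReal ^ 2 ∂μ := by
        refine integral_mono_of_nonneg (ae_of_all _ fun ω => by positivity) (integrable_const _)
          (ae_of_all _ fun ω => ?_)
        exact div_le_of_le_mul₀ (by positivity) (by positivity) (hb ω)
    _ = _ := by simp

/-- With step `a` the sum telescopes to `a` terms at the end minus `a` terms at the start. -/
lemma sum_shift_sub_le {f : ℕ → ℝ} {B : ℝ} (h0 : ∀ i, 0 ≤ f i) (N a : ℕ)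
    (hB : ∀ i < N + a, f i ≤ B) : ∑ c ∈ Finset.range N, (f (c + a) - f c) ≤ a * B := by
  have h1 : ∑ c ∈ Finset.range (N + a), f c =
      ∑ c ∈ Finset.range N, f c + ∑ c ∈ Finset.range a, f (N + c) := Finset.sum_range_add _ _ _
  have h2 : ∑ c ∈ Finset.range (a + N), f c =
      ∑ c ∈ Finset.range a, f c + ∑ c ∈ Finset.range N, f (a + c) := Finset.sum_range_add _ _ _
  rw [add_comm a N] at h2
  simp only [add_comm a] at h2
  have h3 : 0 ≤ ∑ c ∈ Finset.range a, f c := Finset.sum_nonneg fun i _ => h0 i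
  have h4 : ∑ c ∈ Finset.range a, f (N + c) ≤ ∑ _c ∈ Finset.range a, B :=
    Finset.sum_le_sum fun i hi => hB _ (by have := Finset.mem_range.1 hi; omega)
  rw [Finset.sum_const, Finset.card_range, nsmul_eq_mul] at h4
  rw [Finset.sum_sub_distrib]
  linarith

/-- Translation of a set of coordinates. -/
def shiftSet (c : ℕ) (S : Finset (Bool × ℕ)) : Finset (Bool × ℕ) :=
  S.image fun j => (j.1, j.2 + c)

lemma preimage_cell (c : ℕ) (S : Finset (Bool × ℕ)) (ω : Seq m n) :
    shift^[c] ⁻¹' cell S (shift^[c] ω) = cell (shiftSet c S) ω := by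
  ext x
  simp only [cell, shiftSet, Set.mem_preimage, Set.mem_ofPred_eq, Finset.mem_image,
    forall_exists_index, and_imp, forall_apply_eq_imp_iff₂, coord, shift_iterate_apply]

lemma condP_shift (hinv : MeasurePreserving shift μ μ) (c : ℕ) (S : Finset (Bool × ℕ))
    {V : Set (Seq m n)} (hV : MeasurableSet V) (ω : Seq m n) :
    condP μ (shiftSet c S) (shift^[c] ⁻¹' V) ω = condP μ S V (shift^[c] ω) := by
  rw [condP_apply _ (measurable_shift_iterate c hV), condP_apply _ hV, ← preimage_cell,
    ← Set.preimage_inter, Measure.real, Measure.real,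
    (hinv.iterate c).measure_preimage (hV.inter (measurableSet_cell _ _)).nullMeasurableSet,
    (hinv.iterate c).measure_preimage (measurableSet_cell _ _).nullMeasurableSet]
  rfl

lemma integral_comp_measurePreserving {X Y : Type*} [MeasurableSpace X] [MeasurableSpace Y]
    {μ : Measure X} {ν : Measure Y} {g : X → Y} (hg : MeasurePreserving g μ ν) {f : Y → ℝ}
    (hf : AEStronglyMeasurable f ν) : ∫ x, f (g x) ∂μ = ∫ y, f y ∂ν := by
  rw [← hg.map_eq, integral_map hg.measurable.aemeasurable (by rwa [hg.map_eq])]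

lemma sqDist_shift [IsProbabilityMeasure μ] (hinv : MeasurePreserving shift μ μ) (c : ℕ)
    (S S' : Finset (Bool × ℕ)) {V : Set (Seq m n)} (hV : MeasurableSet V) :
    sqDist μ (shiftSet c S) (shiftSet c S') ((shift^[c] ⁻¹' V).indicator 1) =
      sqDist μ S S' (V.indicator 1) := by
  have h : ∀ S, ∀ ω, avg μ (shiftSet c S) ((shift^[c] ⁻¹' V).indicator 1) ω =
      condP μ S V (shift^[c] ω) := fun S ω => condP_shift hinv c S hV ω
  simp only [sqDist, h]
  exact integral_comp_measurePreserving (hinv.iterate c)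
    (f := fun ω => (condP μ S' V ω - condP μ S V ω) ^ 2)
    (((constOnCells_avg S' _).mono Finset.subset_union_right).comp₂
      ((constOnCells_avg S _).mono Finset.subset_union_left)
      fun x y => (x - y) ^ 2).continuous.aestronglyMeasurable

lemma exists_preimage_cell_eq (c : ℕ) (S : Finset (Bool × ℕ)) (η : Seq m n) :
    ∃ η', shift^[c] ⁻¹' cell S η = cell (shiftSet c S) η' := by
  refine ⟨concat c η η, ?_⟩
  rw [← preimage_cell, shift_iterate_concat]

/-- The coordinates of one kind with times in `[i, j)`. -/
def box (b : Bool) (i j : ℕ) : Finset (Bool × ℕ) := {b} ×ˢ Finset.Ico i j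

lemma mem_box {b : Bool} {i j : ℕ} {t : Bool × ℕ} : t ∈ box b i j ↔ t.1 = b ∧ i ≤ t.2 ∧ t.2 < j := by
  rw [box, Finset.mem_product, Finset.mem_singleton, Finset.mem_Ico]

lemma shiftSet_box (c : ℕ) (b : Bool) (i j : ℕ) : shiftSet c (box b i j) = box b (i + c) (j + c) := by
  ext ⟨b', t⟩
  simp only [shiftSet, Finset.mem_image, mem_box, Prod.mk.injEq, Prod.exists]
  constructor
  · rintro ⟨x, y, ⟨rfl, h1, h2⟩, rfl, rfl⟩
    exact ⟨rfl, by omega, by omega⟩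
  · rintro ⟨rfl, h1, h2⟩
    exact ⟨b', t - c, ⟨rfl, by omega, by omega⟩, rfl, by omega⟩

lemma shiftSet_union (c : ℕ) (S S' : Finset (Bool × ℕ)) :
    shiftSet c (S ∪ S') = shiftSet c S ∪ shiftSet c S' := Finset.image_union _ _

/-- Along the chain `chi μ X₁ X₂ (W c)` stays in `[0, K ^ 2]` and gains at least `D ^ 2` between `c`
and `c + a`. The gains have room for `a * K ^ 2` altogether, however long the chain. -/
lemma sq_mul_le_of_chain [IsProbabilityMeasure μ] {K : ENNReal} (h : UpperQuasiBernoulli K μ)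
    (hK : K ≠ ⊤) (hinv : MeasurePreserving shift μ μ) {X₁ X₂ : Finset (Bool × ℕ)} {s s' s'' : ℕ}
    (h₁ : TimesIn X₁ 0 s) (h₂ : TimesIn X₂ s' s'') (hss : s ≤ s') {N a : ℕ}
    {W T : ℕ → Finset (Bool × ℕ)} (hW : ∀ c < N + a, TimesIn (W c) s s')
    (hT : ∀ c < N, W c ∪ T c = W (c + a)) {η : ℕ → Seq m n} {D : ℝ} (hD0 : 0 ≤ D)
    (hD : ∀ c < N, D ≤ sqDist μ (W c) (W c ∪ X₁ ∪ X₂) ((cell (T c) (η c)).indicator 1)) :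
    N * D ^ 2 ≤ a * K.toReal ^ 2 := by
  calc (N : ℝ) * D ^ 2 = ∑ _c ∈ Finset.range N, D ^ 2 := by simp
    _ ≤ ∑ c ∈ Finset.range N, (chi μ X₁ X₂ (W (c + a)) - chi μ X₁ X₂ (W c)) := by
        refine Finset.sum_le_sum fun c hc => ?_
        have hc := Finset.mem_range.1 hc
        rw [← hT c hc]
        refine le_trans ?_ (sqDist_sq_le_chi_sub X₁ X₂ (W c) (T c) (η c))
        have := hD c hc
        gcongr
    _ ≤ a * K.toReal ^ 2 := by
        refine sum_shift_sub_le (f := fun c => chi μ X₁ X₂ (W c)) (fun i => chi_nonneg _ _ _)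
          N a fun i hi => ?_
        exact chi_le h hK hinv h₁ h₂ (hW i hi) hss

variable [IsProbabilityMeasure μ] {K : ENNReal}

/-- The coordinates of the kind `b` before `k` and of the other kind before `l`. -/
def biBox (b : Bool) (k l : ℕ) : Finset (Bool × ℕ) := box b 0 k ∪ box (!b) 0 l

/-- The chain reveals the letters of kind `b` after time `k`, with the whole past before `k` as
`X₁`. By stationarity its step at `c` compares, at time `k`, the window of length `c ≤ r` with a
past containing `biBox b k l`, because `l ≤ k - r`. That distance dominates the one in question. -/
lemma memory_loss_single (h : UpperQuasiBernoulli K μ)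
    (hK : K ≠ ⊤) (hinv : MeasurePreserving shift μ μ) (b : Bool) {a k l r : ℕ} (hlk : l + r ≤ k)
    (η : Seq m n) :
    (r - a : ℕ) * sqDist μ (box b (k - r) k) (biBox b k l)
      ((shift^[k] ⁻¹' cell (box b 0 a) η).indicator 1) ^ 2 ≤ a * K.toReal ^ 2 := by
  rcases le_or_gt r a with hra | hra
  · rw [Nat.sub_eq_zero_of_le hra, Nat.cast_zero, zero_mul]
    positivity
  have hU : MeasurableSet (cell (box b 0 a) η) := measurableSet_cell _ _
  have hη : ∀ c, ∃ η', shift^[k + c] ⁻¹' cell (box b 0 a) η = cell (box b (k + c) (k + c + a)) η' := by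
    intro c
    have := exists_preimage_cell_eq (k + c) (box b 0 a) η
    rwa [shiftSet_box, zero_add, add_comm a] at this
  choose η' hη' using hη
  refine sq_mul_le_of_chain h hK hinv (X₁ := box b 0 k ∪ box (!b) 0 k) (X₂ := ∅) (s := k)
    (s' := k + r) (s'' := 0) ?_ (by simp [TimesIn]) (Nat.le_add_right _ _)
    (W := fun c => box b k (k + c)) (T := fun c => box b (k + c) (k + c + a)) (η := η')
    ?_ ?_ (sqDist_nonneg _ _ _) fun c hc => ?_
  · intro t ht
    simp only [Finset.mem_union, mem_box] at ht
    omega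
  · intro c hc t ht
    simp only [mem_box] at ht
    omega
  · intro c hc
    ext t
    simp only [Finset.mem_union, mem_box]
    grind
  · rw [← hη', Finset.union_empty, Function.iterate_add, Set.preimage_comp]
    have hV : MeasurableSet (shift^[k] ⁻¹' cell (box b 0 a) η) := measurable_shift_iterate k hU
    have hV' := measurable_shift_iterate c hV
    calc _ ≤ sqDist μ (box b (k - c) k)
          (box b (k - c) k ∪ (box b 0 (k - c) ∪ box (!b) 0 (k - c))) _ := by
            refine sqDist_mono ?_ ?_ ?_ (integrable_indicator hV) <;> intro t ht <;>
              simp only [biBox, Finset.mem_union, mem_box] at ht ⊢ <;> grind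
      _ = _ := (sqDist_shift (μ := μ) hinv c _ _ hV).symm
      _ ≤ _ := by
            simp only [shiftSet_union, shiftSet_box, show k - c + c = k by omega]
            refine sqDist_mono (Finset.Subset.refl _) Finset.subset_union_left ?_
              (integrable_indicator hV')
            intro t ht
            simp only [Finset.mem_union, mem_box] at ht ⊢
            grind

/-- Letters of the second kind after time `l` are predicted while those of kind `b` are known beyond
`l`. The window is therefore two-sided in kind `b`, and besides the remote past there is a future
`X₂`, extended to `k + r` to leave room for translations. The chain reveals letters of the second
kind inside `[l, l + r)`, where kind `b` is known throughout. -/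
lemma memory_loss_double (h : UpperQuasiBernoulli K μ)
    (hK : K ≠ ⊤) (hinv : MeasurePreserving shift μ μ) (b : Bool) {a k l r : ℕ} (hlk : l + r ≤ k)
    (hrl : r ≤ l) (η : Seq m n) :
    (r - a : ℕ) * sqDist μ (box b (l - r) (l + r) ∪ box (!b) (l - r) l) (biBox b k l)
      ((shift^[l] ⁻¹' cell (box (!b) 0 a) η).indicator 1) ^ 2 ≤ a * K.toReal ^ 2 := by
  rcases le_or_gt r a with hra | hra
  · rw [Nat.sub_eq_zero_of_le hra, Nat.cast_zero, zero_mul]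
    positivity
  have hU : MeasurableSet (cell (box (!b) 0 a) η) := measurableSet_cell _ _
  have hη : ∀ c, ∃ η',
      shift^[l + c] ⁻¹' cell (box (!b) 0 a) η = cell (box (!b) (l + c) (l + c + a)) η' := by
    intro c
    have := exists_preimage_cell_eq (l + c) (box (!b) 0 a) η
    rwa [shiftSet_box, zero_add, add_comm a] at this
  choose η' hη' using hη
  refine sq_mul_le_of_chain h hK hinv (X₁ := box b 0 l ∪ box (!b) 0 l)
    (X₂ := box b (l + r) (k + r) ∪ box (!b) (l + r) (k + r)) (s := l)
    (s' := l + r) (s'' := k + r) ?_ ?_ (Nat.le_add_right _ _)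
    (W := fun c => box b l (l + r) ∪ box (!b) l (l + c))
    (T := fun c => box (!b) (l + c) (l + c + a)) (η := η')
    ?_ ?_ (sqDist_nonneg _ _ _) fun c hc => ?_
  · intro t ht
    simp only [Finset.mem_union, mem_box] at ht
    omega
  · intro t ht
    simp only [Finset.mem_union, mem_box] at ht
    omega
  · intro c hc t ht
    simp only [Finset.mem_union, mem_box] at ht
    omega
  · intro c hc
    ext t
    simp only [Finset.mem_union, mem_box]
    grind
  · rw [← hη', Function.iterate_add, Set.preimage_comp]
    have hV : MeasurableSet (shift^[l] ⁻¹' cell (box (!b) 0 a) η) := measurable_shift_iterate l hU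
    have hV' := measurable_shift_iterate c hV
    calc _ ≤ sqDist μ (box b (l - c) (l - c + r) ∪ box (!b) (l - c) l)
          ((box b (l - c) (l - c + r) ∪ box (!b) (l - c) l) ∪ ((box b 0 (l - c) ∪
            box (!b) 0 (l - c)) ∪ (box b (l - c + r) k ∪ box (!b) (l - c + r) k))) _ := by
            refine sqDist_mono ?_ ?_ ?_ (integrable_indicator hV) <;> intro t ht <;>
              simp only [biBox, Finset.mem_union, mem_box] at ht ⊢ <;> grind
      _ = _ := (sqDist_shift (μ := μ) hinv c _ _ hV).symm
      _ ≤ _ := by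
            simp only [shiftSet_union, shiftSet_box, show l - c + c = l by omega,
              show l - c + r + c = l + r by omega]
            refine sqDist_mono (Finset.Subset.refl _) Finset.subset_union_left ?_
              (integrable_indicator hV')
            intro t ht
            simp only [Finset.mem_union, mem_box] at ht ⊢
            grind

/-- The coordinates that determine the limit law of the coordinate `b` that is read further. -/
def farBox (b : Bool) (k r : ℕ) : Finset (Bool × ℕ) := box b (k - r) k

/-- The coordinates that determine the limit law of the other coordinate. -/
def nearBox (b : Bool) (l r : ℕ) : Finset (Bool × ℕ) :=
  box b (l - r) (l + r) ∪ box (!b) (l - r) l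

lemma le_div_sqrt_of_mul_sq_le {D B : ℝ} {N : ℝ} (hN : 0 < N) (hB : 0 ≤ B) (h : N * D ^ 2 ≤ B) :
    D ≤ √B / √N := by
  rw [← Real.sqrt_div hB]
  exact Real.le_sqrt_of_sq_le ((le_div_iff₀' hN).2 h)

/-- Up to an error that is small for large `r`, given the coordinates in `biBox b k l` the letters
after the time `k` of the kind `b` and those after the time `l` of the other kind are independent,
and their laws depend only on windows of size `r`. -/
lemma exists_integral_condP_biBox_le (h : UpperQuasiBernoulli K μ)
    (hK : K ≠ ⊤) (hinv : MeasurePreserving shift μ μ) (a : ℕ) :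
    ∃ C : ℝ, 0 ≤ C ∧ ∀ (b : Bool) (k l r : ℕ), l + r ≤ k → r ≤ l → 1 ≤ r → ∀ η η' : Seq m n,
      ∫ ω, (condP μ (biBox b k l) (shift^[k] ⁻¹' cell (box b 0 a) η ∩
          shift^[l] ⁻¹' cell (box (!b) 0 a) η') ω -
        condP μ (farBox b k r) (shift^[k] ⁻¹' cell (box b 0 a) η) ω *
        condP μ (nearBox b l r) (shift^[l] ⁻¹' cell (box (!b) 0 a) η') ω) ^ 2 ∂μ ≤ C / √r := by
  set B : ℝ := a * K.toReal ^ 2 with hB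
  have hB0 : 0 ≤ B := by positivity
  refine ⟨4 * √(2 * B) + √(2 * a), by positivity, fun b k l r hlk hrl hr η η' => ?_⟩
  have hU : MeasurableSet (shift^[k] ⁻¹' cell (box b 0 a) η) :=
    measurable_shift_iterate k (measurableSet_cell _ _)
  have hV : MeasurableSet (shift^[l] ⁻¹' cell (box (!b) 0 a) η') :=
    measurable_shift_iterate l (measurableSet_cell _ _)
  have hr0 : (0 : ℝ) < √r := Real.sqrt_pos.2 (by exact_mod_cast hr)
  -- For `r < 2 * a` the integrand is at most `1`, which the summand `√(2 * a)` of the constant pays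
  -- for. Otherwise `r - a ≥ r / 2`.
  rcases lt_or_ge r (2 * a) with hra | hra
  · have h1 : (1 : ℝ) ≤ √(2 * a) / √r := by
      rw [one_le_div hr0]
      exact Real.sqrt_le_sqrt (by exact_mod_cast hra.le)
    refine le_trans ?_ (h1.trans ?_)
    · refine (integral_mono_of_nonneg (ae_of_all _ fun ω => sq_nonneg _)
        (integrable_const (1 : ℝ)) (ae_of_all _ fun ω => ?_)).trans (by simp)
      have a1 := condP_nonneg (μ := μ) (biBox b k l) (hU.inter hV) ω
      have a2 := condP_le_one (μ := μ) (biBox b k l) (hU.inter hV) ω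
      have a3 := condP_nonneg (μ := μ) (farBox b k r) hU ω
      have a4 := condP_le_one (μ := μ) (farBox b k r) hU ω
      have a5 := condP_nonneg (μ := μ) (nearBox b l r) hV ω
      have a6 := condP_le_one (μ := μ) (nearBox b l r) hV ω
      have a7 := mul_nonneg a3 a5
      have a8 := mul_le_one₀ a4 a5 a6
      rw [← sq_abs]
      exact pow_le_one₀ (abs_nonneg _) (abs_le.2 ⟨by linarith, by linarith⟩)
    · gcongr
      have := Real.sqrt_nonneg (2 * B)
      linarith
  · have hN : (0 : ℝ) < (r - a : ℕ) := by
      have : 0 < r - a := by omega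
      exact_mod_cast this
    have hN2 : (r : ℝ) / 2 ≤ (r - a : ℕ) := by
      rw [Nat.cast_sub (by omega)]
      have : (2 * a : ℝ) ≤ r := by exact_mod_cast hra
      linarith
    have hsq : √B / √(r - a : ℕ) ≤ √(2 * B) / √r := by
      rw [← Real.sqrt_div hB0, ← Real.sqrt_div (by positivity)]
      apply Real.sqrt_le_sqrt
      have : (0 : ℝ) < r := by exact_mod_cast hr
      calc B / (r - a : ℕ) ≤ B / (r / 2) := by gcongr
        _ = 2 * B / r := by field_simp
    have d1 := (le_div_sqrt_of_mul_sq_le hN hB0 (memory_loss_single h hK hinv b hlk (a := a) η)).trans hsq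
    -- The near letters are predicted from a set that must also determine the far word, hence `k +
    -- a` in place of `k`.
    have d2 := (le_div_sqrt_of_mul_sq_le hN hB0 (memory_loss_double h hK hinv b (k := k + a)
      (show l + r ≤ k + a by omega) hrl (a := a) η')).trans hsq
    have hUG : ConstOnCells (biBox b (k + a) l)
        ((shift^[k] ⁻¹' cell (box b 0 a) η).indicator (1 : Seq m n → ℝ)) := by
      obtain ⟨η'', h'⟩ := exists_preimage_cell_eq k (box b 0 a) η
      rw [h']
      refine (constOnCells_indicator_cell _ _).mono ?_
      rw [shiftSet_box]
      intro t ht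
      simp only [biBox, Finset.mem_union, mem_box] at ht ⊢
      grind
    have := integral_condP_inter_sub_sq_le (μ := μ) (G := biBox b k l) (G' := biBox b (k + a) l)
      (S₁ := farBox b k r) (S₂ := nearBox b l r) ?_ ?_ hU hV hUG
    · refine this.trans ?_
      have e : 2 * (√(2 * B) / √r) + 2 * (√(2 * B) / √r) ≤
          (4 * √(2 * B) + √(2 * a)) / √r := by
        have := Real.sqrt_nonneg (2 * a)
        rw [add_div]
        have := div_nonneg this hr0.le
        linarith [mul_div_assoc 4 (√(2 * B)) √r]
      refine le_trans ?_ e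
      gcongr
      · exact d2
      · exact d1
    · intro t ht
      simp only [biBox, Finset.mem_union, mem_box] at ht ⊢
      grind
    · intro t ht
      simp only [biBox, nearBox, Finset.mem_union, mem_box] at ht ⊢
      grind

end MemoryLoss
end SymbolicCP
end

noncomputable section
namespace SymbolicCP

/-! ### Decoupling and exponential estimates -/

section LargeDeviations

variable {m n : ℕ} {μ : Measure (Seq m n)} {K : ENNReal}

lemma continuous_concat {A : Type*} [TopologicalSpace A] (s : ℕ) (ω : ℕ → A) :
    Continuous (concat s ω) := by
  refine continuous_pi fun i => ?_
  unfold concat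
  split_ifs
  · exact continuous_const
  · exact continuous_apply _

lemma lintegral_eq_sum_fiber {Ω β : Type*} [MeasurableSpace Ω] [Fintype β] {μ : Measure Ω}
    {f : Ω → β} (hf : ∀ b, MeasurableSet (f ⁻¹' {b})) (h : Ω → ENNReal) :
    ∫⁻ ω, h ω ∂μ = ∑ b, ∫⁻ ω in f ⁻¹' {b}, h ω ∂μ := by
  rw [← lintegral_biUnion_finset _ (fun b _ => hf b)]
  · have : (⋃ b ∈ Finset.univ, f ⁻¹' {b}) = Set.univ := by ext; simp
    rw [this, setLIntegral_univ]
  · exact Set.pairwiseDisjoint_fiber f _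

lemma UpperQuasiBernoulli.setLIntegral_cylinder_le (h : UpperQuasiBernoulli K μ)
    (hinv : MeasurePreserving shift μ μ) {s : ℕ} (η : Seq m n) {g : Seq m n → ENNReal}
    (hg : Measurable g) (hgs : ∀ x x' : Seq m n, (∀ t, s ≤ t → x t = x' t) → g x = g x') :
    ∫⁻ ω in cylinder s η, g ω ∂μ ≤ K * (μ (cylinder s η) * ∫⁻ ω, g ω ∂μ) := by
  set g' : Seq m n → ENNReal := fun x => g (concat s η x) with hg'
  have hm : Measurable g' := hg.comp (continuous_concat s η).measurable
  have hgg : ∀ x, g x = g' (shift^[s] x) := fun x => hgs _ _ fun t ht => by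
    simp [concat, not_lt.2 ht, shift_iterate_apply, Nat.sub_add_cancel ht]
  have hle : (μ.restrict (cylinder s η)).map shift^[s] ≤ (K * μ (cylinder s η)) • μ := by
    refine Measure.le_iff.2 fun B hB => ?_
    rw [Measure.map_apply (measurable_shift_iterate s) hB, Measure.restrict_apply
      (measurable_shift_iterate s hB), Set.inter_comm]
    simpa using h s η B hB
  have h1 : ∫⁻ ω, g ω ∂μ = ∫⁻ ω, g' ω ∂μ := by
    simp only [hgg]
    exact (hinv.iterate s).lintegral_comp hm
  rw [h1]
  simp only [hgg]
  rw [← lintegral_map hm (measurable_shift_iterate s)]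
  refine (lintegral_mono' hle le_rfl).trans ?_
  rw [lintegral_smul_measure, smul_eq_mul, mul_assoc]

/-- Decoupling of a function on the diagonal: the dependence on the two variables is through
disjoint times. -/
lemma UpperQuasiBernoulli.lintegral_diag_le (h : UpperQuasiBernoulli K μ)
    (hinv : MeasurePreserving shift μ μ) {s : ℕ} {F : Seq m n → Seq m n → ENNReal}
    (hF : ∀ y, Measurable fun x => F x y)
    (hx : ∀ x x' y : Seq m n, (∀ t, s ≤ t → x t = x' t) → F x y = F x' y)
    (hy : ∀ x y, ∀ y' ∈ cylinder s y, F x y' = F x y) :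
    ∫⁻ ω, F ω ω ∂μ ≤ K * ∫⁻ y, ∫⁻ x, F x y ∂μ ∂μ := by
  have hm : ∀ b, MeasurableSet (prefixWord s ⁻¹' {b} : Set (Seq m n)) := fun b =>
    measurable_prefixWord s (measurableSet_singleton b)
  rw [lintegral_eq_sum_fiber hm, lintegral_eq_sum_fiber hm, Finset.mul_sum]
  refine Finset.sum_le_sum fun b _ => ?_
  by_cases hb : ∃ η : Seq m n, prefixWord s η = b
  · obtain ⟨η, rfl⟩ := hb
    rw [preimage_prefixWord]
    have h1 : ∫⁻ ω in cylinder s η, F ω ω ∂μ = ∫⁻ ω in cylinder s η, F ω η ∂μ :=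
      setLIntegral_congr_fun (measurableSet_cylinder s η) fun ω hω => hy ω η ω hω
    have h2 : ∫⁻ y in cylinder s η, ∫⁻ x, F x y ∂μ ∂μ =
        ∫⁻ _y in cylinder s η, ∫⁻ x, F x η ∂μ ∂μ :=
      setLIntegral_congr_fun (measurableSet_cylinder s η) fun y hω => by
        simp only [fun x => hy x η y hω]
    rw [h1, h2, setLIntegral_const, mul_comm (∫⁻ x, F x η ∂μ)]
    exact h.setLIntegral_cylinder_le hinv η (hF η) fun x x' => hx x x' η
  · have : (prefixWord s ⁻¹' {b} : Set (Seq m n)) = ∅ := by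
      ext x
      simpa using fun hx => hb ⟨x, hx⟩
    simp [this]

/-- In both variables `f` reads the past and `g` the future. The decoupling on the diagonal is
applied in `y` and then in `x`, at the cost of one factor `K` each time. -/
lemma UpperQuasiBernoulli.lintegral_lintegral_mul_le [SFinite μ] (h : UpperQuasiBernoulli K μ)
    (hinv : MeasurePreserving shift μ μ) {s s' : ℕ} {f g : Seq m n → Seq m n → ENNReal}
    (hf : Measurable (Function.uncurry f)) (hg : Measurable (Function.uncurry g))
    (hf1 : ∀ x y, ∀ x' ∈ cylinder s x, f x' y = f x y)
    (hf2 : ∀ x y, ∀ y' ∈ cylinder s' y, f x y' = f x y)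
    (hg1 : ∀ x x' y : Seq m n, (∀ t, s ≤ t → x t = x' t) → g x y = g x' y)
    (hg2 : ∀ x y y' : Seq m n, (∀ t, s' ≤ t → y t = y' t) → g x y = g x y') :
    ∫⁻ x, ∫⁻ y, f x y * g x y ∂μ ∂μ ≤
      K ^ 2 * ((∫⁻ x, ∫⁻ y, f x y ∂μ ∂μ) * ∫⁻ x, ∫⁻ y, g x y ∂μ ∂μ) := by
  have hgy : ∀ x, Measurable (g x) := fun x => hg.of_uncurry_left
  have hfy : ∀ x, Measurable (f x) := fun x => hf.of_uncurry_left
  set fb : Seq m n → ENNReal := fun x => ∫⁻ y, f x y ∂μ with hfb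
  set gb : Seq m n → ENNReal := fun x => ∫⁻ y, g x y ∂μ with hgb
  have mfb : Measurable fb := hf.lintegral_prod_right
  have mgb : Measurable gb := hg.lintegral_prod_right
  have h1 : ∀ x, ∫⁻ y, f x y * g x y ∂μ ≤ K * (fb x * gb x) := fun x => by
    refine (h.lintegral_diag_le hinv (s := s') (F := fun y' y => f x y * g x y')
      (fun y => (hgy x).const_mul _) (fun y y' z hyy => by rw [hg2 x y y' hyy])
      (fun y' y z hz => by rw [hf2 x y z hz])).trans_eq ?_
    simp_rw [lintegral_const_mul _ (hgy x)]
    rw [lintegral_mul_const _ (hfy x)]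
  have h2 : ∫⁻ x, fb x * gb x ∂μ ≤ K * ((∫⁻ x, fb x ∂μ) * ∫⁻ x, gb x ∂μ) := by
    refine (h.lintegral_diag_le hinv (s := s) (F := fun x' x => fb x * gb x')
      (fun y => mgb.const_mul _) (fun y y' z hyy => ?_) (fun y' y z hz => ?_)).trans_eq ?_
    · simp only [hgb, fun w => hg1 y y' w hyy]
    · simp only [hfb, fun w => hf1 y w z hz]
    simp_rw [lintegral_const_mul _ mgb]
    rw [lintegral_mul_const _ mfb]
  calc ∫⁻ x, ∫⁻ y, f x y * g x y ∂μ ∂μ ≤ ∫⁻ x, K * (fb x * gb x) ∂μ := lintegral_mono h1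
    _ = K * ∫⁻ x, fb x * gb x ∂μ := lintegral_const_mul _ (mfb.mul mgb)
    _ ≤ K * (K * ((∫⁻ x, fb x ∂μ) * ∫⁻ x, gb x ∂μ)) := by gcongr
    _ = _ := by rw [sq, mul_assoc]

/-- `f` depends on its first variable only through the times in `[i, j)` and on the second only
through those in `[i', j')`. -/
structure DependsOnWindows {β : Type*} (i j i' j' : ℕ) (f : Seq m n → Seq m n → β) : Prop where
  left : ∀ x x' y : Seq m n, (∀ t, i ≤ t → t < j → x t = x' t) → f x y = f x' y
  right : ∀ x y y' : Seq m n, (∀ t, i' ≤ t → t < j' → y t = y' t) → f x y = f x y'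

/-- The last factor is peeled off by induction. Expanding `1 + 2 * e` before decoupling lets `K ^ 2`
multiply only the small term; decoupling the product directly would cost a power of `K` growing with
`N`. -/
lemma UpperQuasiBernoulli.lintegral_lintegral_prod_le [IsProbabilityMeasure μ]
    (h : UpperQuasiBernoulli K μ)
    (hinv : MeasurePreserving shift μ μ) {ε : ENNReal} {e : ℕ → Seq m n → Seq m n → ENNReal}
    {N : ℕ} {u u' v v' : ℕ → ℕ} (hm : ∀ j, Measurable (Function.uncurry (e j)))
    (hu : ∀ i j, i < j → j < N → u' i ≤ u j) (hv : ∀ i j, i < j → j < N → v' i ≤ v j)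
    (he : ∀ j < N, DependsOnWindows (u j) (u' j) (v j) (v' j) (e j))
    (hε : ∀ j < N, ∫⁻ x, ∫⁻ y, e j x y ∂μ ∂μ ≤ ε) :
    ∫⁻ x, ∫⁻ y, ∏ j ∈ Finset.range N, (1 + 2 * e j x y) ∂μ ∂μ ≤ (1 + 2 * K ^ 2 * ε) ^ N := by
  induction N with
  | zero => simp
  | succ N ih =>
    have ih' := ih (fun i j hij hj => hu i j hij (by omega)) (fun i j hij hj => hv i j hij (by omega))
      (fun j hj => he j (by omega)) (fun j hj => hε j (by omega))
    set f : Seq m n → Seq m n → ENNReal := fun x y => ∏ j ∈ Finset.range N, (1 + 2 * e j x y) with hf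
    have mf : Measurable (Function.uncurry f) :=
      Finset.measurable_fun_prod _ fun j _ => ((hm j).const_mul 2).const_add 1
    have mf' : ∀ x, Measurable (f x) := fun x => mf.of_uncurry_left
    have key := h.lintegral_lintegral_mul_le hinv (s := u N) (s' := v N) mf (hm N)
      (fun x y x' hx => Finset.prod_congr rfl fun j hj => by
        have hj := Finset.mem_range.1 hj
        rw [(he j (by omega)).left x' x y fun t _ ht => hx t (ht.trans_le (hu j N hj (by omega)))])
      (fun x y y' hy => Finset.prod_congr rfl fun j hj => by
        have hj := Finset.mem_range.1 hj
        rw [(he j (by omega)).right x y' y fun t _ ht => hy t (ht.trans_le (hv j N hj (by omega)))])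
      (fun x x' y hx => (he N (by omega)).left x x' y fun t ht _ => hx t ht)
      (fun x y y' hy => (he N (by omega)).right x y y' fun t ht _ => hy t ht)
    calc ∫⁻ x, ∫⁻ y, ∏ j ∈ Finset.range (N + 1), (1 + 2 * e j x y) ∂μ ∂μ
        = ∫⁻ x, ∫⁻ y, (f x y + 2 * (f x y * e N x y)) ∂μ ∂μ := by
          refine lintegral_congr fun x => lintegral_congr fun y => ?_
          rw [Finset.prod_range_succ]
          ring
      _ = ∫⁻ x, ∫⁻ y, f x y ∂μ ∂μ + 2 * ∫⁻ x, ∫⁻ y, f x y * e N x y ∂μ ∂μ := by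
          have m2 : Measurable (Function.uncurry fun x y => f x y * e N x y) := mf.mul (hm N)
          have m3 : ∀ x, ∫⁻ y, (f x y + 2 * (f x y * e N x y)) ∂μ =
              ∫⁻ y, f x y ∂μ + 2 * ∫⁻ y, f x y * e N x y ∂μ := fun x => by
            rw [lintegral_add_left (mf' x), lintegral_const_mul 2
              (show Measurable fun y => f x y * e N x y from m2.of_uncurry_left)]
          simp_rw [m3]
          rw [lintegral_add_left mf.lintegral_prod_right, lintegral_const_mul _
            m2.lintegral_prod_right]
      _ ≤ (∫⁻ x, ∫⁻ y, f x y ∂μ ∂μ) + 2 * (K ^ 2 * ((∫⁻ x, ∫⁻ y, f x y ∂μ ∂μ) * ε)) := by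
          refine add_le_add_right (mul_le_mul_right (key.trans ?_) _) _
          exact mul_le_mul_right (mul_le_mul_right (hε N (by omega)) _) _
      _ = (∫⁻ x, ∫⁻ y, f x y ∂μ ∂μ) * (1 + 2 * K ^ 2 * ε) := by ring
      _ ≤ (1 + 2 * K ^ 2 * ε) ^ (N + 1) := by
          rw [pow_succ _ N]
          exact mul_le_mul_left ih' _

lemma exp_le_one_add_two_mul {t : ℝ} (h0 : 0 ≤ t) (h1 : t ≤ 1) : Real.exp t ≤ 1 + 2 * t := by
  have := Real.abs_exp_sub_one_le (x := t) (by rwa [abs_of_nonneg h0])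
  rw [abs_of_nonneg h0] at this
  linarith [le_abs_self (Real.exp t - 1)]

/-- A large deviation estimate for sums of functions with separated windows. -/
lemma UpperQuasiBernoulli.measure_le_sum_le [IsProbabilityMeasure μ]
    (h : UpperQuasiBernoulli K μ) (hK : K ≠ ⊤)
    (hinv : MeasurePreserving shift μ μ) {ε : ℝ} (hε0 : 0 ≤ ε) {e : ℕ → Seq m n → Seq m n → ℝ}
    {N s : ℕ} {u u' v v' : ℕ → ℕ} (hm : ∀ j, Measurable (Function.uncurry (e j)))
    (h0 : ∀ j x y, 0 ≤ e j x y) (h1 : ∀ j x y, e j x y ≤ 1)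
    (hu : ∀ i j, i < j → j < N → u' i ≤ u j) (hv : ∀ i j, i < j → j < N → v' i ≤ v j)
    (hus : ∀ j < N, s ≤ u j) (hvs : ∀ j < N, v' j ≤ s)
    (he : ∀ j < N, DependsOnWindows (u j) (u' j) (v j) (v' j) (e j))
    (hε : ∀ j < N, ∫⁻ x, ∫⁻ y, ENNReal.ofReal (e j x y) ∂μ ∂μ ≤ ENNReal.ofReal ε) :
    μ {ω | 4 * K.toReal ^ 2 * ε * N ≤ ∑ j ∈ Finset.range N, e j ω ω} ≤
      K * ENNReal.ofReal (Real.exp (-(2 * K.toReal ^ 2 * ε * N))) := by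
  set κ := K.toReal with hκ
  -- Exponential Chebyshev: for `0 ≤ e ≤ 1` the product of the `1 + 2 * e` dominates the exponential
  -- of the sum. Its mean over independent `x` and `y` is controlled by the preceding lemma. The
  -- diagonal costs only one more `K`, since all windows in `x` come after time `s` and all windows
  -- in `y` before it.
  set g : Seq m n → Seq m n → ENNReal := fun x y =>
    ∏ j ∈ Finset.range N, (1 + 2 * ENNReal.ofReal (e j x y)) with hg
  have mg : Measurable (Function.uncurry g) :=
    Finset.measurable_fun_prod _ fun j _ => ((hm j).ennreal_ofReal.const_mul 2).const_add 1
  have he' : ∀ j < N, DependsOnWindows (u j) (u' j) (v j) (v' j)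
      fun x y => ENNReal.ofReal (e j x y) := fun j hj =>
    ⟨fun x x' y hx => by rw [(he j hj).left x x' y hx],
      fun x y y' hy => by rw [(he j hj).right x y y' hy]⟩
  have b1 : ∫⁻ x, ∫⁻ y, g x y ∂μ ∂μ ≤ ENNReal.ofReal (Real.exp (2 * κ ^ 2 * ε * N)) := by
    refine (h.lintegral_lintegral_prod_le hinv (e := fun j x y => ENNReal.ofReal (e j x y))
      (fun j => (hm j).ennreal_ofReal) hu hv he' hε).trans ?_
    rw [← ENNReal.ofReal_toReal hK, ← hκ]
    have : (1 + 2 * ENNReal.ofReal κ ^ 2 * ENNReal.ofReal ε : ENNReal) =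
        ENNReal.ofReal (1 + 2 * κ ^ 2 * ε) := by
      rw [ENNReal.ofReal_add zero_le_one (by positivity), ENNReal.ofReal_mul (by positivity),
        ENNReal.ofReal_mul (by positivity), ENNReal.ofReal_pow (by positivity)]
      simp
    rw [this, ← ENNReal.ofReal_pow (by positivity)]
    refine ENNReal.ofReal_le_ofReal ?_
    rw [mul_comm _ (N : ℝ), Real.exp_nat_mul]
    exact pow_le_pow_left₀ (by positivity) (by linarith [Real.add_one_le_exp (2 * κ ^ 2 * ε)]) _
  have b2 : ∫⁻ ω, g ω ω ∂μ ≤ K * ENNReal.ofReal (Real.exp (2 * κ ^ 2 * ε * N)) := by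
    refine (h.lintegral_diag_le hinv (s := s) (fun y => mg.of_uncurry_right)
      (fun x x' y hx => Finset.prod_congr rfl fun j hj => ?_)
      (fun x y y' hy => Finset.prod_congr rfl fun j hj => ?_)).trans ?_
    · have hj := Finset.mem_range.1 hj
      rw [(he j hj).left x x' y fun t ht _ => hx t ((hus j hj).trans ht)]
    · have hj := Finset.mem_range.1 hj
      rw [(he j hj).right x y' y fun t _ ht => hy t (ht.trans_le (hvs j hj))]
    · gcongr
      rwa [lintegral_lintegral_swap mg.aemeasurable] at b1
  have b3 : {ω | 4 * κ ^ 2 * ε * N ≤ ∑ j ∈ Finset.range N, e j ω ω} ⊆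
      {ω | ENNReal.ofReal (Real.exp (4 * κ ^ 2 * ε * N)) ≤ g ω ω} := by
    intro ω hω
    rw [Set.mem_ofPred_eq] at hω ⊢
    have : g ω ω = ENNReal.ofReal (∏ j ∈ Finset.range N, (1 + 2 * e j ω ω)) := by
      rw [ENNReal.ofReal_prod_of_nonneg fun j _ => by linarith [h0 j ω ω]]
      refine Finset.prod_congr rfl fun j _ => ?_
      rw [ENNReal.ofReal_add zero_le_one (by linarith [h0 j ω ω]), ENNReal.ofReal_mul (by norm_num)]
      simp
    rw [this]
    refine ENNReal.ofReal_le_ofReal ((Real.exp_le_exp.2 hω).trans ?_)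
    rw [Real.exp_sum]
    exact Finset.prod_le_prod (fun j _ => (Real.exp_pos _).le)
      fun j _ => exp_le_one_add_two_mul (h0 j ω ω) (h1 j ω ω)
  have mgd : Measurable fun ω => g ω ω := mg.comp (measurable_id.prodMk measurable_id)
  refine (measure_mono b3).trans ?_
  refine (meas_ge_le_lintegral_div mgd.aemeasurable (by simp [Real.exp_pos]) (by simp)).trans ?_
  refine (ENNReal.div_le_div_right b2 _).trans_eq ?_
  rw [mul_div_assoc, ← ENNReal.ofReal_div_of_pos (Real.exp_pos _), ← Real.exp_sub]
  congr 3
  ring_nf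

end LargeDeviations

end SymbolicCP
end

noncomputable section
namespace SymbolicCP

/-! ### From exponential estimates to almost sure averages -/

section AlmostSure

variable {m n : ℕ} {μ : Measure (Seq m n)} {K : ENNReal}

lemma DependsOnWindows.mono {β : Type*} {i j i' j' a b a' b' : ℕ} {f : Seq m n → Seq m n → β}
    (h : DependsOnWindows i j i' j' f) (h1 : a ≤ i) (h2 : j ≤ b) (h3 : a' ≤ i') (h4 : j' ≤ b') :
    DependsOnWindows a b a' b' f :=
  ⟨fun x x' y hx => h.left x x' y fun t ht ht' => hx t (h1.trans ht) (ht'.trans_le h2),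
    fun x y y' hy => h.right x y y' fun t ht ht' => hy t (h3.trans ht) (ht'.trans_le h4)⟩

lemma sum_range_mul_eq (f : ℕ → ℝ) (n M : ℕ) :
    ∑ k ∈ Finset.range (n * M), f k = ∑ i ∈ Finset.range M, ∑ j ∈ Finset.range n, f (j * M + i) := by
  rw [Finset.sum_comm]
  induction n with
  | zero => simp
  | succ n ih => rw [Nat.succ_mul, Finset.sum_range_add, ih, Finset.sum_range_succ]

/-- Strong induction that removes the last block `[N - b N, N)`; below `N₀` each term is bounded by
one. -/
lemma sum_le_of_block_le {f : ℕ → ℝ} {c : ℝ} (hc : 0 ≤ c) (h1 : ∀ k, f k ≤ 1) {N₀ : ℕ} {b : ℕ → ℕ}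
    (hb : ∀ N, N₀ ≤ N → 1 ≤ b N ∧ b N ≤ N)
    (h : ∀ N, N₀ ≤ N → ∑ k ∈ Finset.range (b N), f (N - b N + k) ≤ c * b N) (N : ℕ) :
    ∑ k ∈ Finset.range N, f k ≤ N₀ + c * N := by
  induction N using Nat.strong_induction_on with
  | _ N ih =>
    rcases lt_or_ge N N₀ with hN | hN
    · have : ∑ k ∈ Finset.range N, f k ≤ ∑ k ∈ Finset.range N, (1 : ℝ) :=
        Finset.sum_le_sum fun k _ => h1 k
      have h2 : (N : ℝ) ≤ N₀ := by exact_mod_cast hN.le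
      simp only [Finset.sum_const, Finset.card_range, nsmul_eq_mul, mul_one] at this
      have : 0 ≤ c * N := by positivity
      linarith
    · obtain ⟨hb1, hb2⟩ := hb N hN
      have h2 := ih (N - b N) (by omega)
      have h3 := Finset.sum_range_add f (N - b N) (b N)
      rw [Nat.sub_add_cancel hb2] at h3
      rw [Nat.cast_sub hb2] at h2
      linarith [h N hN]

/-- By `exp x ≥ x ^ 5 / 5!` the term is at most a constant times `(Nat.sqrt N + 1) ^ (-4)`, hence a
constant times `(N + 1) ^ (-2)`. -/
lemma summable_of_le_mul_exp {d : ℝ} (hd : 0 < d) :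
    Summable fun N : ℕ => (Nat.sqrt N + 1 : ℝ) * Real.exp (-(d * Nat.sqrt N)) := by
  set C : ℝ := 120 / d ^ 5 * Real.exp d with hC
  have hC0 : 0 ≤ C := by positivity
  have hs : Summable fun N : ℕ => C * (1 / ((N + 1 : ℕ) : ℝ) ^ 2) :=
    ((summable_nat_add_iff 1).2 (Real.summable_one_div_nat_pow.2 one_lt_two)).mul_left C
  refine hs.of_nonneg_of_le (fun N => by positivity) fun N => ?_
  set s : ℝ := (Nat.sqrt N : ℝ) with hs
  have hs0 : 0 ≤ s := by positivity
  have h1 : ((N + 1 : ℕ) : ℝ) ≤ (s + 1) ^ 2 := by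
    have := Nat.lt_succ_sqrt N
    have : N + 1 ≤ (Nat.sqrt N + 1) * (Nat.sqrt N + 1) := this
    rw [sq, hs]
    exact_mod_cast this
  have h2 : (d * (s + 1)) ^ 5 / 120 ≤ Real.exp (d * (s + 1)) := by
    have := Real.pow_div_factorial_le_exp (d * (s + 1)) (by positivity) 5
    norm_num [Nat.factorial] at this ⊢
    exact this
  have h3 : (s + 1) ^ 5 * Real.exp (-(d * s)) ≤ C := by
    have : Real.exp (d * (s + 1)) = Real.exp d * Real.exp (d * s) := by
      rw [← Real.exp_add]; ring_nf
    rw [this, mul_pow] at h2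
    rw [Real.exp_neg, ← div_eq_mul_inv, div_le_iff₀ (Real.exp_pos _), hC]
    rw [div_le_iff₀ (by norm_num)] at h2
    have hd5 : 0 < d ^ 5 := by positivity
    rw [div_mul_eq_mul_div, div_mul_eq_mul_div, le_div_iff₀ hd5]
    linarith
  rw [mul_one_div, le_div_iff₀ (by positivity)]
  calc (s + 1) * Real.exp (-(d * s)) * ((N + 1 : ℕ) : ℝ) ^ 2
      ≤ (s + 1) * Real.exp (-(d * s)) * ((s + 1) ^ 2) ^ 2 := by gcongr
    _ = (s + 1) ^ 5 * Real.exp (-(d * s)) := by ring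
    _ ≤ C := h3

lemma floor_add_le {β : ℝ} (hβ : 0 ≤ β) {k k' c : ℕ} (h : β * k + c ≤ β * k') :
    ⌊β * k⌋₊ + c ≤ ⌊β * k'⌋₊ := by
  rw [← Nat.floor_add_natCast (by positivity)]
  exact Nat.floor_le_floor h

/-- Functions of windows of slowly growing size along two different speeds: if their means with
respect to the product measure are small, so are almost surely their averages. -/
theorem UpperQuasiBernoulli.ae_eventually_sum_le [IsProbabilityMeasure μ]
    (h : UpperQuasiBernoulli K μ) (hK : K ≠ ⊤) (hK1 : 1 ≤ K)
    (hinv : MeasurePreserving shift μ μ) {β γ : ℝ} (hγ : 0 < γ) (hβ : γ < β) {ε : ℝ} (hε0 : 0 < ε)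
    {e : ℕ → Seq m n → Seq m n → ℝ} (hm : ∀ j, Measurable (Function.uncurry (e j)))
    (h0 : ∀ j x y, 0 ≤ e j x y) (h1 : ∀ j x y, e j x y ≤ 1) {C : ℕ}
    (he : ∀ k : ℕ, DependsOnWindows (⌊β * k⌋₊ - (Nat.sqrt k + C)) (⌊β * k⌋₊ + (Nat.sqrt k + C))
      (⌊γ * k⌋₊ - (Nat.sqrt k + C)) (⌊γ * k⌋₊ + (Nat.sqrt k + C)) (e k))
    (hε : ∀ᶠ k in atTop, ∫⁻ x, ∫⁻ y, ENNReal.ofReal (e k x y) ∂μ ∂μ ≤ ENNReal.ofReal ε) :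
    ∀ᵐ ω ∂μ, ∀ᶠ N : ℕ in atTop,
      ∑ k ∈ Finset.range N, e k ω ω ≤ 5 * K.toReal ^ 2 * ε * N := by
  set κ := K.toReal with hκ
  have hκ1 : 1 ≤ κ := by
    rw [hκ, ← ENNReal.toReal_one]
    exact ENNReal.toReal_mono hK hK1
  have hβ0 : 0 < β := hγ.trans hβ
  obtain ⟨k₀, hk₀⟩ := eventually_atTop.1 hε
  -- `A` makes a step of `M N` indices move even the slower window by at least its diameter. `E`
  -- makes the block of `L N * M N` indices before `N` so short that all its fast windows lie beyond
  -- all its slow ones.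
  obtain ⟨A, hA⟩ := exists_nat_ge ((2 * C + 2) / γ)
  rw [div_le_iff₀ hγ] at hA
  have hA0 : 0 < A := by
    rcases Nat.eq_zero_or_pos A with rfl | h
    · have : (0 : ℝ) < 2 * C + 2 := by positivity
      simp at hA; linarith
    · exact h
  obtain ⟨E, hE⟩ := exists_nat_ge (max (4 * A : ℝ) (4 * A * β / (β - γ)))
  have hE1 : (4 * A : ℝ) ≤ E := (le_max_left _ _).trans hE
  have hE2 : (4 * A * β / (β - γ) : ℝ) ≤ E := (le_max_right _ _).trans hE
  rw [div_le_iff₀ (by linarith)] at hE2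
  have hE0 : 0 < E := by
    have : (0 : ℝ) < E := lt_of_lt_of_le (by positivity) hE1
    exact_mod_cast this
  -- The block is split into `M N` residue classes of `L N` indices, so that the windows within one
  -- class do not overlap.
  set M : ℕ → ℕ := fun N => A * (Nat.sqrt N + 1) with hM
  set L : ℕ → ℕ := fun N => Nat.sqrt N / E with hL
  set ρ : ℕ → ℕ := fun N => (C + 1) * (Nat.sqrt N + 1) with hρ
  obtain ⟨N₁, hN₁⟩ := exists_nat_ge (8 * (C + 1) / (β - γ))
  rw [div_le_iff₀ (by linarith)] at hN₁
  set N₀ : ℕ := (E + 1) ^ 2 + 2 * k₀ + (N₁ + 1) ^ 2 with hN₀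
  have hsq : ∀ N, N₀ ≤ N → E + 1 ≤ Nat.sqrt N ∧ N₁ + 1 ≤ Nat.sqrt N := fun N hN =>
    ⟨Nat.le_sqrt'.2 (by omega), Nat.le_sqrt'.2 (by omega)⟩
  -- the length of a block
  have hLM : ∀ N, N₀ ≤ N → (E * (L N * M N) : ℝ) ≤ 2 * A * N := fun N hN => by
    have a1 : E * L N ≤ Nat.sqrt N := Nat.mul_div_le _ _
    have a2 : Nat.sqrt N + 1 ≤ 2 * Nat.sqrt N := by have := (hsq N hN).1; omega
    have a3 : Nat.sqrt N * Nat.sqrt N ≤ N := Nat.sqrt_le N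
    have : E * (L N * M N) ≤ 2 * A * N :=
      calc E * (L N * M N) = E * L N * (A * (Nat.sqrt N + 1)) := by rw [hM]; ring
        _ ≤ Nat.sqrt N * (A * (2 * Nat.sqrt N)) := by gcongr
        _ = 2 * A * (Nat.sqrt N * Nat.sqrt N) := by ring
        _ ≤ 2 * A * N := by gcongr
    exact_mod_cast this
  have hhalf : ∀ N, N₀ ≤ N → (2 * (L N * M N) : ℝ) ≤ N := fun N hN => by
    have a1 := hLM N hN
    have a2 : (4 * A * (L N * M N) : ℝ) ≤ E * (L N * M N) := by gcongr
    have hA' : (0 : ℝ) < 2 * A := by positivity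
    refine le_of_mul_le_mul_left ?_ hA'
    linarith
  have hhalf' : ∀ N, N₀ ≤ N → 2 * (L N * M N) ≤ N := fun N hN => by exact_mod_cast hhalf N hN
  have hfar : ∀ N, N₀ ≤ N → 2 * β * (L N * M N : ℝ) ≤ (β - γ) * N := fun N hN => by
    have a1 := hLM N hN
    have a2 : (4 * A * β * (L N * M N) : ℝ) ≤ E * (β - γ) * (L N * M N) := by gcongr
    have hA' : (0 : ℝ) < 2 * A := by positivity
    refine le_of_mul_le_mul_left ?_ hA'
    have : (E * (L N * M N) : ℝ) * (β - γ) ≤ 2 * A * N * (β - γ) :=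
      mul_le_mul_of_nonneg_right a1 (by linarith)
    linarith
  have hρN : ∀ N, N₀ ≤ N → 4 * (ρ N : ℝ) ≤ (β - γ) * N := fun N hN => by
    have a1 : (Nat.sqrt N : ℝ) * Nat.sqrt N ≤ N := by exact_mod_cast Nat.sqrt_le N
    have a2 : (N₁ : ℝ) ≤ Nat.sqrt N := by exact_mod_cast (Nat.le_succ _).trans (hsq N hN).2
    have a3 : (1 : ℝ) ≤ Nat.sqrt N := by
      have := (hsq N hN).1
      exact_mod_cast (by omega : 1 ≤ Nat.sqrt N)
    have a4 : 8 * (C + 1 : ℝ) ≤ Nat.sqrt N * (β - γ) :=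
      hN₁.trans (mul_le_mul_of_nonneg_right a2 (by linarith))
    calc 4 * (ρ N : ℝ) = 4 * (C + 1) * (Nat.sqrt N + 1) := by simp only [hρ]; push_cast; ring
      _ ≤ 8 * (C + 1) * Nat.sqrt N := by
          have : 4 * (C + 1 : ℝ) * (Nat.sqrt N + 1) ≤ 4 * (C + 1) * (2 * Nat.sqrt N) := by
            gcongr; linarith
          linarith
      _ ≤ Nat.sqrt N * (β - γ) * Nat.sqrt N := by gcongr
      _ = (β - γ) * (Nat.sqrt N * Nat.sqrt N) := by ring
      _ ≤ (β - γ) * N := mul_le_mul_of_nonneg_left a1 (by linarith)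
  -- the exceptional events
  set idx : ℕ → ℕ → ℕ → ℕ := fun N i j => N - L N * M N + (j * M N + i) with hidx
  have hprob : ∀ N, N₀ ≤ N → ∀ i < M N,
      μ {ω | 4 * κ ^ 2 * ε * L N ≤ ∑ j ∈ Finset.range (L N), e (idx N i j) ω ω} ≤
        K * ENNReal.ofReal (Real.exp (-(2 * κ ^ 2 * ε * L N))) := by
    intro N hN i hi
    have hlt : ∀ j < L N, idx N i j < N := fun j hj => by
      have : (j + 1) * M N ≤ L N * M N := Nat.mul_le_mul_right _ hj
      have := hhalf' N hN
      simp only [hidx]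
      rw [Nat.succ_mul] at *
      omega
    have hge : ∀ j, N - L N * M N ≤ idx N i j := fun j => Nat.le_add_right _ _
    have hwin : ∀ j < L N, Nat.sqrt (idx N i j) + C ≤ ρ N := fun j hj => by
      have : Nat.sqrt (idx N i j) ≤ Nat.sqrt N := Nat.sqrt_le_sqrt (hlt j hj).le
      simp only [hρ]
      nlinarith
    have hsep : ∀ j j', j < j' → (2 * ρ N : ℝ) ≤ γ * ((idx N i j' : ℝ) - idx N i j) :=
        fun j j' hjj => by
      have a1 : idx N i j + M N ≤ idx N i j' := by
        have : (j + 1) * M N ≤ j' * M N := Nat.mul_le_mul_right _ hjj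
        rw [Nat.succ_mul] at this
        simp only [hidx]
        omega
      have a2 : (M N : ℝ) ≤ (idx N i j' : ℝ) - idx N i j := by
        rw [le_sub_iff_add_le']
        exact_mod_cast a1
      calc (2 * ρ N : ℝ) = (2 * C + 2) * (Nat.sqrt N + 1) := by
            simp only [hρ]; push_cast; ring
        _ ≤ A * γ * (Nat.sqrt N + 1) := by gcongr
        _ = γ * M N := by simp only [hM]; push_cast; ring
        _ ≤ _ := by gcongr
    have hsep' : ∀ j j', j < j' → (2 * ρ N : ℝ) ≤ β * ((idx N i j' : ℝ) - idx N i j) :=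
        fun j j' hjj => by
      have a1 := hsep j j' hjj
      have a3 : (0 : ℝ) ≤ (idx N i j' : ℝ) - idx N i j := by
        by_contra hcon
        push Not at hcon
        have : γ * ((idx N i j' : ℝ) - idx N i j) < 0 := mul_neg_of_pos_of_neg hγ hcon
        have : (0 : ℝ) ≤ 2 * ρ N := by positivity
        linarith
      exact a1.trans (mul_le_mul_of_nonneg_right hβ.le a3)
    -- The cut `s` lies after every slow window of the block and before every fast one.
    refine h.measure_le_sum_le hK hinv hε0.le (e := fun j => e (idx N i j))
      (s := ⌊γ * N⌋₊ + ρ N)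
      (u := fun j => ⌊β * idx N i j⌋₊ - ρ N) (u' := fun j => ⌊β * idx N i j⌋₊ + ρ N)
      (v := fun j => ⌊γ * idx N i j⌋₊ - ρ N) (v' := fun j => ⌊γ * idx N i j⌋₊ + ρ N)
      (fun j => hm _) (fun j => h0 _) (fun j => h1 _) ?_ ?_ ?_ ?_ ?_ ?_
    · intro j j' hjj _
      have := floor_add_le hβ0.le (k := idx N i j) (k' := idx N i j') (c := 2 * ρ N) (by
        push_cast
        linarith [hsep' j j' hjj])
      omega
    · intro j j' hjj _
      have := floor_add_le hγ.le (k := idx N i j) (k' := idx N i j') (c := 2 * ρ N) (by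
        push_cast
        linarith [hsep j j' hjj])
      omega
    · intro j _
      have b1 : (N : ℝ) - L N * M N ≤ idx N i j := by
        have := hge j
        have h2 : N ≤ idx N i j + L N * M N := by omega
        rw [sub_le_iff_le_add]
        exact_mod_cast h2
      have b2 : γ * N + (2 * ρ N : ℕ) ≤ β * idx N i j := by
        have := mul_le_mul_of_nonneg_left b1 hβ0.le
        push_cast
        linarith [hfar N hN, hρN N hN]
      have b3 : ⌊γ * N⌋₊ + 2 * ρ N ≤ ⌊β * idx N i j⌋₊ := by
        rw [← Nat.floor_add_natCast (by positivity)]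
        exact Nat.floor_le_floor b2
      omega
    · intro j hj
      have : ⌊γ * idx N i j⌋₊ ≤ ⌊γ * N⌋₊ := Nat.floor_le_floor (by
        have : (idx N i j : ℝ) ≤ N := by exact_mod_cast (hlt j hj).le
        gcongr)
      omega
    · intro j hj
      have := hwin j hj
      exact (he _).mono (by omega) (by omega) (by omega) (by omega)
    · intro j hj
      refine hk₀ _ (le_trans ?_ (hge j))
      have := hhalf' N hN
      omega
  set bad : ℕ → Set (Seq m n) := fun N => if N₀ ≤ N then ⋃ i ∈ Finset.range (M N),
    {ω | 4 * κ ^ 2 * ε * L N ≤ ∑ j ∈ Finset.range (L N), e (idx N i j) ω ω} else ∅ with hbad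
  set d : ℝ := 2 * κ ^ 2 * ε with hd
  have hd0 : 0 < d := by positivity
  have hbadle : ∀ N, μ (bad N) ≤ ENNReal.ofReal (κ * A * Real.exp d *
      ((Nat.sqrt N + 1 : ℝ) * Real.exp (-(d / E * Nat.sqrt N)))) := by
    intro N
    by_cases hN : N₀ ≤ N
    swap
    · simp [hbad, hN]
    simp only [hbad, hN, if_true]
    refine (measure_biUnion_finset_le _ _).trans ((Finset.sum_le_sum fun i hi =>
      hprob N hN i (Finset.mem_range.1 hi)).trans ?_)
    rw [Finset.sum_const, Finset.card_range, nsmul_eq_mul, ← ENNReal.ofReal_toReal hK, ← hκ,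
      ← ENNReal.ofReal_natCast, ← ENNReal.ofReal_mul (by positivity),
      ← ENNReal.ofReal_mul (by positivity)]
    refine ENNReal.ofReal_le_ofReal ?_
    have c1 : (Nat.sqrt N : ℝ) ≤ E * (L N + 1) := by
      have := Nat.lt_mul_div_succ (Nat.sqrt N) hE0
      exact_mod_cast this.le
    have c2 : Real.exp (-(d * L N)) ≤ Real.exp d * Real.exp (-(d / E * Nat.sqrt N)) := by
      rw [← Real.exp_add]
      refine Real.exp_le_exp.2 ?_
      have : d / E * Nat.sqrt N ≤ d / E * (E * (L N + 1)) := by gcongr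
      have hE' : (E : ℝ) ≠ 0 := by positivity
      have h3 : d / E * (E * (L N + 1)) = d * L N + d := by field_simp
      linarith
    calc (M N : ℝ) * (κ * Real.exp (-(d * L N)))
        ≤ M N * (κ * (Real.exp d * Real.exp (-(d / E * Nat.sqrt N)))) := by gcongr
      _ = _ := by simp only [hM]; push_cast; ring
  -- For each class the failure probability is exponentially small in `√N`, against about `√N`
  -- classes, so Borel-Cantelli applies.
  have hsum : ∑' N, μ (bad N) ≠ ⊤ := by
    have := ((summable_of_le_mul_exp (d := d / E) (by positivity)).mul_left
      (κ * A * Real.exp d)).tsum_ofReal_ne_top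
    exact ne_top_of_le_ne_top this (ENNReal.tsum_le_tsum hbadle)
  filter_upwards [ae_eventually_notMem hsum] with ω hω
  obtain ⟨N₂, hN₂⟩ := eventually_atTop.1 hω
  have hblock := sum_le_of_block_le (f := fun k => e k ω ω) (c := 4 * κ ^ 2 * ε) (by positivity)
    (fun k => h1 k ω ω) (N₀ := max N₀ N₂) (b := fun N => L N * M N)
    (fun N hN => by
      have hN' : N₀ ≤ N := (le_max_left _ _).trans hN
      have : 1 ≤ L N := (Nat.one_le_div_iff hE0).2 (by have := (hsq N hN').1; omega)
      have h2 : 1 ≤ M N := Nat.mul_pos hA0 (Nat.succ_pos _)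
      exact ⟨Nat.mul_pos this h2, by have := hhalf' N hN'; omega⟩)
    (fun N hN => by
      have hN' : N₀ ≤ N := (le_max_left _ _).trans hN
      have hnot := hN₂ N ((le_max_right _ _).trans hN)
      simp only [hbad, hN', if_true, Set.mem_iUnion, not_exists, Set.mem_ofPred_eq, not_le,
        Finset.mem_range] at hnot
      rw [sum_range_mul_eq]
      calc _ ≤ ∑ i ∈ Finset.range (M N), 4 * κ ^ 2 * ε * L N :=
            Finset.sum_le_sum fun i hi => (hnot i (Finset.mem_range.1 hi)).le
        _ = _ := by
            rw [Finset.sum_const, Finset.card_range, nsmul_eq_mul]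
            push_cast
            ring)
  -- The constant `5` in place of `4` absorbs the initial indices that no good block covers.
  have hκε : 0 < κ ^ 2 * ε := by positivity
  obtain ⟨N₃, hN₃⟩ := exists_nat_ge ((max N₀ N₂ : ℕ) / (κ ^ 2 * ε))
  rw [div_le_iff₀ hκε] at hN₃
  filter_upwards [eventually_ge_atTop N₃] with N hN
  refine (hblock N).trans ?_
  have : (N₃ : ℝ) * (κ ^ 2 * ε) ≤ N * (κ ^ 2 * ε) := by gcongr
  linarith

end AlmostSure

end SymbolicCP
end

noncomputable section
namespace SymbolicCP

/-! ### The estimate for either order of the two speeds -/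

section Symmetric

variable {m n : ℕ} {μ : Measure (Seq m n)} {K : ENNReal}

lemma UpperQuasiBernoulli.one_le [IsProbabilityMeasure μ] (h : UpperQuasiBernoulli K μ) :
    1 ≤ K := by
  have : Nonempty (Seq m n) := by
    by_contra hne
    rw [not_nonempty_iff] at hne
    have : μ Set.univ = 0 := by rw [Set.univ_eq_empty_iff.2 hne, measure_empty]
    simp at this
  obtain ⟨ω⟩ := this
  have h0 : cylinder 0 ω = Set.univ := by ext; simp [cylinder]
  simpa [h0] using h 0 ω Set.univ MeasurableSet.univ

lemma lintegral_lintegral_ofReal_le [IsProbabilityMeasure μ] {e : Seq m n → Seq m n → ℝ}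
    (hm : Measurable (Function.uncurry e)) (h0 : ∀ x y, 0 ≤ e x y) (h1 : ∀ x y, e x y ≤ 1) {ε : ℝ}
    (h : ∫ x, ∫ y, e x y ∂μ ∂μ ≤ ε) :
    ∫⁻ x, ∫⁻ y, ENNReal.ofReal (e x y) ∂μ ∂μ ≤ ENNReal.ofReal ε := by
  have hi : Integrable (Function.uncurry e) (μ.prod μ) :=
    Integrable.of_bound hm.aestronglyMeasurable 1 (ae_of_all _ fun z => by
      rw [Function.uncurry, Real.norm_of_nonneg (h0 _ _)]
      exact h1 _ _)
  refine le_trans (le_of_eq ?_) (ENNReal.ofReal_le_ofReal h)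
  rw [integral_integral hi]
  change _ = ENNReal.ofReal (∫ z, Function.uncurry e z ∂μ.prod μ)
  rw [ofReal_integral_eq_lintegral_ofReal hi (ae_of_all _ fun z => h0 _ _),
    lintegral_prod _ (by fun_prop)]
  rfl

/-- The symmetric form of `UpperQuasiBernoulli.ae_eventually_sum_le`. -/
theorem UpperQuasiBernoulli.ae_eventually_sum_le_of_ne [IsProbabilityMeasure μ]
    (h : UpperQuasiBernoulli K μ) (hK : K ≠ ⊤)
    (hinv : MeasurePreserving shift μ μ) {β γ : ℝ} (hβ : 0 < β) (hγ : 0 < γ) (hne : β ≠ γ)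
    {ε : ℝ} (hε0 : 0 < ε)
    {e : ℕ → Seq m n → Seq m n → ℝ} (hm : ∀ j, Measurable (Function.uncurry (e j)))
    (h0 : ∀ j x y, 0 ≤ e j x y) (h1 : ∀ j x y, e j x y ≤ 1) {C : ℕ}
    (he : ∀ k : ℕ, DependsOnWindows (⌊β * k⌋₊ - (Nat.sqrt k + C)) (⌊β * k⌋₊ + (Nat.sqrt k + C))
      (⌊γ * k⌋₊ - (Nat.sqrt k + C)) (⌊γ * k⌋₊ + (Nat.sqrt k + C)) (e k))
    (hε : ∀ᶠ k in atTop, ∫ x, ∫ y, e k x y ∂μ ∂μ ≤ ε) :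
    ∀ᵐ ω ∂μ, ∀ᶠ N : ℕ in atTop,
      ∑ k ∈ Finset.range N, e k ω ω ≤ 5 * K.toReal ^ 2 * ε * N := by
  have hε' : ∀ᶠ k in atTop, ∫⁻ x, ∫⁻ y, ENNReal.ofReal (e k x y) ∂μ ∂μ ≤ ENNReal.ofReal ε :=
    hε.mono fun k hk => lintegral_lintegral_ofReal_le (hm k) (h0 k) (h1 k) hk
  rcases lt_or_gt_of_ne hne with hlt | hlt
  · refine h.ae_eventually_sum_le hK h.one_le hinv hβ hlt hε0 (e := fun k x y => e k y x)
      (fun j => (hm j).comp measurable_swap) (fun j x y => h0 j y x) (fun j x y => h1 j y x)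
      (fun k => ⟨fun x x' y hx => (he k).right y x x' hx, fun x y y' hy => (he k).left y y' x hy⟩)
      (hε'.mono fun k hk => ?_)
    rwa [lintegral_lintegral_swap]
    exact ((hm k).ennreal_ofReal.comp measurable_swap).aemeasurable
  · exact h.ae_eventually_sum_le hK h.one_le hinv hγ hlt hε0 hm h0 h1 he hε'

end Symmetric

/-! ### Periodicity of the tail σ-algebra -/

section Tail

variable {m n : ℕ} {μ : Measure (Seq m n)} {K : ENNReal} {p : ℕ}

/-- Sets in the tail σ-algebra are `p`-periodic. -/
lemma IsQuasiBernoulli.preimage_ae_eq_of_tail [IsProbabilityMeasure μ] (h : IsQuasiBernoulli K p μ)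
    {E : Set (Seq m n)} (hE : MeasurableSet E)
    (htail : ∀ i, ∃ B, MeasurableSet B ∧ E =ᵐ[μ] shift^[i] ⁻¹' B) :
    shift^[p] ⁻¹' E =ᵐ[μ] E := by
  obtain ⟨L, c, hc, hfut⟩ := h.common
  have hTp := h.invariant.iterate p
  suffices hG : μ (E \ shift^[p] ⁻¹' E) = 0 by
    have hle : E ≤ᵐ[μ] shift^[p] ⁻¹' E := ae_le_set.2 hG
    exact (ae_eq_of_ae_subset_of_measure_ge hle (hTp.measure_preimage hE.nullMeasurableSet).le
      hE.nullMeasurableSet (measure_ne_top _ _)).symm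
  -- If positive, the set `E \ shift^[p] ⁻¹' E` nearly fills some cylinder. For most `x` there,
  -- `shift^[i] x ∈ B` and `shift^[i + p] x ∉ B`. The laws of both futures dominate a multiple of
  -- `μ` on `D`, so the first makes `D \ B` small and the second makes `D ∩ B` small.
  by_contra hG
  wlog hcf : c ≠ ⊤ generalizing c
  · refine this 1 one_ne_zero (fun i ω h0 => ?_) ENNReal.one_ne_top
    obtain ⟨D, hD, hcD, hB⟩ := hfut i ω h0
    rw [not_not.1 hcf] at hcD
    exact absurd (top_le_iff.1 hcD) (measure_ne_top _ _)
  -- The two errors add up to `c ^ 2 / 2`, against `c * μ D ≥ c ^ 2`.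
  set ε : ENNReal := c ^ 2 / 4 with hε
  have hε0 : ε ≠ 0 := by simp [hε, hc]
  obtain ⟨i, ω, hω0, hω⟩ := exists_cell_density μ (fun k => cylinder (k + L))
    (fun k x => isOpen_cylinder _ x) (fun k x => mem_cylinder_self _ x)
    (fun k x y => cylinder_eq_of_mem) (fun k l x hkl => cylinder_anti (by omega) x)
    (fun k => finite_range_cylinder _) (fun U hU x hx => by
      obtain ⟨k, hk⟩ := exists_cylinder_subset hU hx
      exact ⟨k, (cylinder_anti (by omega) x).trans hk⟩)
    (hE.diff (measurable_shift_iterate p hE)) hG hε0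
  obtain ⟨D, hD, hcD, hfutB⟩ := hfut i ω hω0
  obtain ⟨B, hB, hEB⟩ := htail i
  set Cy := cylinder (i + L) ω with hCy
  have hCf : μ Cy ≠ ⊤ := measure_ne_top _ _
  have e1 : μ (Cy ∩ shift^[i] ⁻¹' (D \ B)) ≤ ε * μ Cy := by
    refine le_trans (measure_mono_ae ?_) hω
    filter_upwards [hEB] with x hx hxC
    refine ⟨hxC.1, fun hxE => hxC.2.2 ?_⟩
    exact (iff_of_eq hx).1 hxE.1
  have e2 : μ (Cy ∩ shift^[i + p] ⁻¹' (D ∩ B)) ≤ ε * μ Cy := by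
    refine le_trans (measure_mono_ae ?_) hω
    filter_upwards [hTp.quasiMeasurePreserving.ae hEB] with x hx hxC
    refine ⟨hxC.1, fun hxE => hxE.2 ?_⟩
    refine (iff_of_eq hx).2 ?_
    have : shift^[i + p] x ∈ B := hxC.2.2
    rwa [Function.iterate_add_apply] at this
  have f1 := ((hfutB (D \ B) Set.sdiff_subset (hD.diff hB)).1).trans e1
  have f2 := ((hfutB (D ∩ B) Set.inter_subset_left (hD.inter hB)).2).trans e2
  have g1 : c * μ D * μ Cy ≤ (c ^ 2 / 2) * μ Cy := by
    rw [← measure_inter_add_sdiff D hB]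
    calc c * (μ (D ∩ B) + μ (D \ B)) * μ Cy
        = c * μ Cy * μ (D ∩ B) + c * μ Cy * μ (D \ B) := by ring
      _ ≤ ε * μ Cy + ε * μ Cy := add_le_add f2 f1
      _ = (c ^ 2 / 2) * μ Cy := by
        rw [← add_mul, hε, ENNReal.div_add_div_same, ← two_mul, mul_comm 2,
          show (4 : ENNReal) = 2 * 2 by norm_num, ENNReal.mul_div_mul_right _ _ (by simp) (by simp)]
  have g2 : c ^ 2 ≤ c ^ 2 / 2 := by
    refine (ENNReal.mul_le_mul_iff_left hω0 hCf).1 (le_trans ?_ g1)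
    rw [sq]
    gcongr
  exact absurd g2 (not_le.2 (ENNReal.half_lt_self (by simp [hc]) (by simp [hcf])))

/-- The statement for sets is applied to the rational sublevel sets, which determine the function.
-/
lemma IsQuasiBernoulli.comp_ae_eq_of_tail [IsProbabilityMeasure μ] (h : IsQuasiBernoulli K p μ)
    {f : Seq m n → ℝ} (hf : Measurable f)
    (htail : ∀ i, ∃ g, Measurable g ∧ f =ᵐ[μ] g ∘ shift^[i]) : f ∘ shift^[p] =ᵐ[μ] f := by
  have key : ∀ c : ℚ, ∀ᵐ x ∂μ, f (shift^[p] x) < c ↔ f x < c := fun c => by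
    have := h.preimage_ae_eq_of_tail (E := f ⁻¹' Set.Iio (c : ℝ)) (hf measurableSet_Iio) fun i => by
      obtain ⟨g, hg, hfg⟩ := htail i
      refine ⟨g ⁻¹' Set.Iio (c : ℝ), hg measurableSet_Iio, ?_⟩
      filter_upwards [hfg] with x hx
      exact congrArg (· < (c : ℝ)) hx
    filter_upwards [this] with x hx
    exact iff_of_eq hx
  filter_upwards [ae_all_iff.2 key] with x hx
  by_contra hne
  rcases lt_or_gt_of_ne hne with hlt | hlt
  · obtain ⟨c, h1, h2⟩ := exists_rat_btwn hlt
    exact absurd ((hx c).1 h1) (not_lt.2 h2.le)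
  · obtain ⟨c, h1, h2⟩ := exists_rat_btwn hlt
    exact absurd ((hx c).2 h1) (not_lt.2 h2.le)

end Tail

/-! ### Isometries with periodic tail -/

section Hilbert

open scoped InnerProductSpace

variable {E : Type*} [NormedAddCommGroup E] [InnerProductSpace ℝ E] [CompleteSpace E]
  (U : E →ₗᵢ[ℝ] E)

omit [CompleteSpace E] in
lemma isometry_mul_apply (U V : E →ₗᵢ[ℝ] E) (x : E) : (U * V) x = U (V x) := rfl

/-- The correlations of an isometry with periodic tail are asymptotically periodic. -/
lemma exists_periodic_tendsto_inner {p : ℕ}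
    (hp : ∀ φ, (∀ n, ∃ ψ, φ = (U ^ n) ψ) → (U ^ p) φ = φ) (f : E) :
    ∃ φ, (U ^ p) φ = φ ∧ ∀ g, Tendsto (fun n => ⟪f, (U ^ n) g⟫_ℝ - ⟪φ, (U ^ n) g⟫_ℝ) atTop (𝓝 0) := by
  -- The closed ranges `V n` decrease, and `φ` is the projection of `f` to their intersection. The
  -- remainder `ξ` is the limit of the projections of `f` to the spaces `W n`, which are orthogonal
  -- to `(U ^ n) g`.
  set V : ℕ → Submodule ℝ E := fun n => LinearMap.range (U ^ n).toLinearMap with hV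
  have hcl : ∀ n, IsClosed (V n : Set E) := fun n => by
    have := (U ^ n).isometry.isClosedEmbedding.isClosed_range
    convert! this
  have hVO : ∀ n, (V n)ᗮᗮ = V n := fun n => by
    rw [Submodule.orthogonal_orthogonal_eq_closure, IsClosed.submodule_topologicalClosure_eq (hcl n)]
  have hanti : ∀ a b, a ≤ b → V b ≤ V a := by
    rintro a b hab x ⟨y, rfl⟩
    refine ⟨(U ^ (b - a)) y, ?_⟩
    change (U ^ a) ((U ^ (b - a)) y) = (U ^ b) y
    rw [← isometry_mul_apply, ← pow_add, Nat.add_sub_cancel' hab]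
  set W : ℕ → Submodule ℝ E := fun n => (V n)ᗮ with hW
  have hmono : Monotone W := fun a b hab => Submodule.orthogonal_le (hanti a b hab)
  set Q := (⨆ i, W i).topologicalClosure with hQ
  have hlim := Submodule.starProjection_tendsto_closure_iSup W hmono f
  set ξ := Q.starProjection f with hξ
  have hφ : ∀ n, f - ξ ∈ V n := fun n => by
    rw [← hVO n]
    refine Submodule.orthogonal_le ?_ (Q.sub_starProjection_mem_orthogonal f)
    exact (le_iSup W n).trans (Submodule.le_topologicalClosure _)
  refine ⟨f - ξ, hp _ fun n => ?_, fun g => ?_⟩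
  · obtain ⟨ψ, hψ⟩ := hφ n
    exact ⟨ψ, hψ.symm⟩
  · have e1 : ∀ n, ⟪f, (U ^ n) g⟫_ℝ - ⟪f - ξ, (U ^ n) g⟫_ℝ =
        ⟪ξ - (W n).starProjection f, (U ^ n) g⟫_ℝ := fun n => by
      have : ⟪(W n).starProjection f, (U ^ n) g⟫_ℝ = 0 := by
        rw [real_inner_comm]
        exact Submodule.inner_right_of_mem_orthogonal (K := V n) ⟨g, rfl⟩
          ((W n).starProjection_apply_mem f)
      rw [inner_sub_left, inner_sub_left, this]
      ring
    simp only [e1]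
    have h2 : Tendsto (fun n => ‖ξ - (W n).starProjection f‖ * ‖g‖) atTop (𝓝 0) := by
      have := ((tendsto_const_nhds (x := ξ)).sub hlim).norm.mul_const ‖g‖
      simpa [hξ] using this
    refine squeeze_zero_norm (fun n => ?_) h2
    refine (norm_inner_le_norm _ _).trans_eq ?_
    rw [(U ^ n).norm_map]

omit [CompleteSpace E] in
lemma inner_pow_add_of_periodic {p : ℕ} {φ : E} (hφ : (U ^ p) φ = φ) (g : E) (n : ℕ) :
    ⟪φ, (U ^ (n + p)) g⟫_ℝ = ⟪φ, (U ^ n) g⟫_ℝ := by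
  conv_lhs => rw [← hφ]
  rw [add_comm, pow_add, isometry_mul_apply, LinearIsometry.inner_map_map]

omit [CompleteSpace E] in
lemma pow_mul_of_periodic {p : ℕ} {φ : E} (hφ : (U ^ p) φ = φ) (a : ℕ) : (U ^ (a * p)) φ = φ := by
  induction a with
  | zero => simp
  | succ a ih => rw [Nat.succ_mul, pow_add, isometry_mul_apply, hφ, ih]

omit [CompleteSpace E] in
-- The orbit sum `H` is fixed by `U ^ q`, because `φ` is fixed by `U ^ (q * p)`. Since `U` need not
-- be invertible, each term is pushed forward to `(U ^ (q * p)) g`, where the sum becomes the inner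
-- product of `H` and `g`.
lemma sum_inner_eq_zero_of_periodic {p q : ℕ} {φ g : E} (hφ : (U ^ p) φ = φ)
    (hq : ∀ H, (U ^ q) H = H → ⟪H, g⟫_ℝ = 0) :
    ∑ c ∈ Finset.range p, ⟪φ, (U ^ (q * c)) g⟫_ℝ = 0 := by
  set H := ∑ c ∈ Finset.range p, (U ^ (q * c)) φ with hH
  have h1 : (U ^ q) H = H := by
    rw [hH, map_sum]
    have : ∀ c, (U ^ q) ((U ^ (q * c)) φ) = (U ^ (q * (c + 1))) φ := fun c => by
      rw [← isometry_mul_apply, ← pow_add]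
      congr 2
      ring
    simp only [this]
    have h2 := Finset.sum_range_succ (fun c => (U ^ (q * c)) φ) p
    rw [Finset.sum_range_succ', pow_mul_of_periodic U hφ q] at h2
    simpa using h2
  have h3 : (U ^ q) (∑ c ∈ Finset.range p, (U ^ (q * (p - 1 - c))) φ) = (U ^ q) H := by
    rw [hH, Finset.sum_range_reflect (fun c => (U ^ (q * c)) φ)]
  have h4 : ∀ c ∈ Finset.range p, ⟪φ, (U ^ (q * c)) g⟫_ℝ =
      ⟪(U ^ q) ((U ^ (q * (p - 1 - c))) φ), (U ^ (q * p)) g⟫_ℝ := fun c hc => by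
    have hc := Finset.mem_range.1 hc
    have e : q * p = (q + q * (p - 1 - c)) + q * c := by
      have : p = 1 + (p - 1 - c) + c := by omega
      conv_lhs => rw [this]
      ring
    rw [e, pow_add U _ (q * c), isometry_mul_apply, ← isometry_mul_apply, ← pow_add,
      LinearIsometry.inner_map_map]
  have h5 : (U ^ (q * p)) H = H := by
    rw [hH, map_sum]
    refine Finset.sum_congr rfl fun c _ => ?_
    rw [← isometry_mul_apply, ← pow_add, add_comm, pow_add, isometry_mul_apply,
      pow_mul_of_periodic U hφ]
  rw [Finset.sum_congr rfl h4, ← sum_inner, ← map_sum, h3, h1, ← h5, LinearIsometry.inner_map_map]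
  exact hq H h1

end Hilbert

/-! ### Asymptotically periodic correlations -/

section Correlation

open scoped InnerProductSpace

variable {m n : ℕ} {μ : Measure (Seq m n)} {K : ENNReal} {p : ℕ}

lemma pow_compMeasurePreservingₗᵢ (hinv : MeasurePreserving shift μ μ) (j : ℕ) (φ : Lp ℝ 2 μ) :
    ((Lp.compMeasurePreservingₗᵢ ℝ shift hinv) ^ j) φ =
      Lp.compMeasurePreserving shift^[j] (hinv.iterate j) φ := by
  rw [← Lp.compMeasurePreserving_iterate]
  induction j with
  | zero => rfl
  | succ j ih =>
    rw [pow_succ', isometry_mul_apply, ih, Function.iterate_succ_apply']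
    rfl

/-- Correlations are asymptotically periodic. -/
theorem IsQuasiBernoulli.exists_periodic_correlation [IsProbabilityMeasure μ]
    (h : IsQuasiBernoulli K p μ) {f g : Seq m n → ℝ} (hf : MemLp f 2 μ) (hg : MemLp g 2 μ) :
    ∃ a : ℕ → ℝ, (∀ j, a (j + p) = a j) ∧
      Tendsto (fun j => ∫ x, f x * g (shift^[j] x) ∂μ - a j) atTop (𝓝 0) ∧
      ∀ q, Ergodic shift^[q] μ → ∫ x, g x ∂μ = 0 → ∑ c ∈ Finset.range p, a (q * c) = 0 := by
  set U := Lp.compMeasurePreservingₗᵢ (E := ℝ) (p := 2) ℝ shift h.invariant with hU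
  have hUc : ∀ j (φ : Lp ℝ 2 μ), (U ^ j) φ =ᵐ[μ] φ ∘ shift^[j] := fun j φ => by
    rw [hU, pow_compMeasurePreservingₗᵢ]
    exact Lp.coeFn_compMeasurePreserving _ _
  -- A vector in the range of every power of the Koopman isometry is a function measurable with
  -- respect to the tail, hence periodic.
  obtain ⟨φ, hφ, hlim⟩ := exists_periodic_tendsto_inner U (p := p) (fun φ hφ => by
    refine Lp.ext ((hUc p φ).trans ?_)
    have hm := (Lp.stronglyMeasurable φ).measurable
    refine h.comp_ae_eq_of_tail hm fun i => ?_
    obtain ⟨ψ, hψ⟩ := hφ i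
    refine ⟨ψ, (Lp.stronglyMeasurable ψ).measurable, ?_⟩
    rw [hψ]
    exact hUc i ψ) (hf.toLp f)
  refine ⟨fun j => ⟪φ, (U ^ j) (hg.toLp g)⟫_ℝ, fun j => inner_pow_add_of_periodic U hφ _ j, ?_,
    fun q hq hg0 => sum_inner_eq_zero_of_periodic U hφ fun H hH => ?_⟩
  · refine (hlim (hg.toLp g)).congr fun j => ?_
    congr 1
    rw [L2.inner_def]
    refine integral_congr_ae ?_
    filter_upwards [hf.coeFn_toLp, hUc j (hg.toLp g),
      (h.invariant.iterate j).quasiMeasurePreserving.ae hg.coeFn_toLp] with x h1 h2 h3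
    rw [h1, h2, Function.comp_apply, h3, real_inner_eq_re_inner]
    simp [mul_comm]
  -- A vector fixed by the `q`-th power is constant by ergodicity, and `g` is orthogonal to the
  -- constants.
  · have h1 : H ∘ shift^[q] =ᵐ[μ] H := by
      have := hUc q H
      rw [hH] at this
      exact this.symm
    obtain ⟨c, hc⟩ := hq.ae_eq_const_of_ae_eq_comp_ae (Lp.aestronglyMeasurable H) h1
    rw [L2.inner_def]
    calc ∫ x, ⟪H x, (hg.toLp g) x⟫_ℝ ∂μ = ∫ x, c * g x ∂μ := by
          refine integral_congr_ae ?_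
          filter_upwards [hc, hg.coeFn_toLp] with x h2 h3
          rw [h2, h3]
          simp [mul_comm]
      _ = 0 := by rw [integral_const_mul, hg0, mul_zero]

end Correlation

end SymbolicCP
end

noncomputable section
namespace SymbolicCP

/-! ### Uniform equidistribution of irrational rotations -/

section Weyl

/-- The orbit averages of `ψ` converge uniformly to its integral. -/
def UniformlyEquidistributed {G F : Type*} [AddCommGroup G] [MeasurableSpace G]
    [NormedAddCommGroup F] [NormedSpace ℝ F] (ν : Measure G) (θ : G) (ψ : G → F) : Prop :=
  ∀ ε > 0, ∃ J₀ : ℕ, ∀ J ≥ J₀, ∀ s,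
    ‖∑ j ∈ Finset.range J, ψ (s + j • θ) - (J : ℝ) • ∫ x, ψ x ∂ν‖ ≤ ε * J

variable {T : ℝ} [hT : Fact (0 < T)]

/-- For `k ≠ 0` the sum is geometric with ratio `z ≠ 1`, hence bounded by `2 / ‖z - 1‖` whatever the
starting point. -/
lemma uniformlyEquidistributed_fourier {θ : AddCircle T} (hθ : ∀ k : ℤ, k ≠ 0 → k • θ ≠ 0)
    (k : ℤ) : UniformlyEquidistributed AddCircle.haarAddCircle θ (fourier k : C(AddCircle T, ℂ)) := by
  intro ε hε
  by_cases hk : k = 0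
  · subst hk
    refine ⟨0, fun J _ s => ?_⟩
    simp only [fourier_zero, Finset.sum_const, Finset.card_range, nsmul_eq_mul, mul_one,
      integral_const, probReal_univ, one_smul]
    simp
    positivity
  set z : ℂ := fourier k θ with hz
  have hz1 : z ≠ 1 := by
    intro h1
    refine hθ k hk ?_
    rw [hz, fourier_apply, ← Circle.coe_one, Circle.coe_inj, ← AddCircle.toCircle_zero] at h1
    exact AddCircle.injective_toCircle hT.out.ne' h1
  have hmul : ∀ x : AddCircle T, fourier k (x + θ) = z * fourier k x := fun x => by
    simp only [hz, fourier_apply, smul_add, AddCircle.toCircle_add]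
    push_cast
    ring
  have hint : ∫ x, fourier k x ∂(AddCircle.haarAddCircle (T := T)) = 0 := by
    have h1 := integral_add_right_eq_self (μ := AddCircle.haarAddCircle (T := T))
      (fun x => (fourier k x : ℂ)) θ
    simp only [hmul] at h1
    rw [integral_const_mul] at h1
    have h2 : (z - 1) * ∫ x, fourier k x ∂(AddCircle.haarAddCircle (T := T)) = 0 := by
      rw [sub_mul, h1, one_mul, sub_self]
    exact (mul_eq_zero.1 h2).resolve_left (sub_ne_zero.2 hz1)
  have hj : ∀ (j : ℕ) (s : AddCircle T), fourier k (s + j • θ) = z ^ j * fourier k s := by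
    intro j s
    induction j with
    | zero => simp
    | succ j ih => rw [succ_nsmul, ← add_assoc, hmul, ih, pow_succ']; ring
  have hznorm : ‖z‖ = 1 := by rw [hz, fourier_apply]; exact Circle.norm_coe _
  have hz0 : 0 < ‖z - 1‖ := norm_pos_iff.2 (sub_ne_zero.2 hz1)
  obtain ⟨J₀, hJ₀⟩ := exists_nat_ge (2 / ‖z - 1‖ / ε)
  rw [div_le_iff₀ hε] at hJ₀
  refine ⟨J₀, fun J hJ s => ?_⟩
  rw [hint, smul_zero, sub_zero]
  simp only [hj]
  rw [← Finset.sum_mul, geom_sum_eq hz1, norm_mul, norm_div]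
  have h3 : ‖(fourier k s : ℂ)‖ = 1 := by rw [fourier_apply]; exact Circle.norm_coe _
  rw [h3, mul_one]
  have h4 : ‖z ^ J - 1‖ ≤ 2 := by
    refine (norm_sub_le _ _).trans ?_
    rw [norm_pow, hznorm, one_pow, norm_one]
    norm_num
  calc ‖z ^ J - 1‖ / ‖z - 1‖ ≤ 2 / ‖z - 1‖ := by gcongr
    _ ≤ J₀ * ε := hJ₀
    _ ≤ ε * J := by rw [mul_comm]; gcongr

lemma integrable_continuousMap {F : Type*} [NormedAddCommGroup F] (ψ : C(AddCircle T, F)) :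
    Integrable ψ (AddCircle.haarAddCircle (T := T)) := by
  have : CompactSpace (AddCircle T) := inferInstance
  exact ψ.continuous.integrable_of_hasCompactSupport
    (HasCompactSupport.of_compactSpace _)

/-- Weyl's equidistribution theorem. -/
theorem uniformlyEquidistributed_complex {θ : AddCircle T} (hθ : ∀ k : ℤ, k ≠ 0 → k • θ ≠ 0)
    (ψ : C(AddCircle T, ℂ)) : UniformlyEquidistributed AddCircle.haarAddCircle θ ψ := by
  have hspan : ∀ φ ∈ Submodule.span ℂ (Set.range (@fourier T)),
      UniformlyEquidistributed AddCircle.haarAddCircle θ φ := by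
    intro φ hφ
    induction hφ using Submodule.span_induction with
    | mem φ h =>
      obtain ⟨k, rfl⟩ := h
      exact uniformlyEquidistributed_fourier hθ k
    | zero =>
      intro ε hε
      exact ⟨0, fun J _ s => by simp; positivity⟩
    | add f g _ _ hf hg =>
      intro ε hε
      obtain ⟨J₁, h₁⟩ := hf (ε / 2) (by positivity)
      obtain ⟨J₂, h₂⟩ := hg (ε / 2) (by positivity)
      refine ⟨max J₁ J₂, fun J hJ s => ?_⟩
      have a₁ := h₁ J ((le_max_left _ _).trans hJ) s
      have a₂ := h₂ J ((le_max_right _ _).trans hJ) s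
      simp only [ContinuousMap.add_apply]
      rw [Finset.sum_add_distrib, integral_add (integrable_continuousMap f)
        (integrable_continuousMap g), smul_add, add_sub_add_comm]
      refine (norm_add_le _ _).trans ?_
      linarith
    | smul c f _ hf =>
      intro ε hε
      obtain ⟨J₁, h₁⟩ := hf (ε / (‖c‖ + 1)) (by positivity)
      refine ⟨J₁, fun J hJ s => ?_⟩
      have a₁ := h₁ J hJ s
      simp only [ContinuousMap.smul_apply]
      rw [← Finset.smul_sum, integral_smul, smul_comm, ← smul_sub, norm_smul]
      calc ‖c‖ * _ ≤ (‖c‖ + 1) * (ε / (‖c‖ + 1) * J) := by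
            gcongr
            linarith
        _ = ε * J := by field_simp
  intro ε hε
  have hd : ψ ∈ (Submodule.span ℂ (Set.range (@fourier T))).topologicalClosure := by
    rw [span_fourier_closure_eq_top]; trivial
  obtain ⟨φ, hφ, hdist⟩ := Metric.mem_closure_iff.1 hd (ε / 3) (by positivity)
  obtain ⟨J₁, h₁⟩ := hspan φ hφ (ε / 3) (by positivity)
  refine ⟨J₁, fun J hJ s => ?_⟩
  have a₁ := h₁ J hJ s
  have hpt : ∀ x, ‖ψ x - φ x‖ ≤ ε / 3 := fun x => by
    rw [← dist_eq_norm]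
    exact (ContinuousMap.dist_apply_le_dist x).trans hdist.le
  have a₂ : ‖∑ j ∈ Finset.range J, (ψ (s + j • θ) - φ (s + j • θ))‖ ≤ J * (ε / 3) := by
    refine (norm_sum_le_of_le _ fun j _ => hpt _).trans_eq ?_
    simp
  have a₃ : ‖(J : ℝ) • ∫ x, (ψ x - φ x) ∂AddCircle.haarAddCircle‖ ≤ J * (ε / 3) := by
    rw [norm_smul, Real.norm_natCast]
    gcongr
    refine (norm_integral_le_of_norm_le_const (ae_of_all _ hpt)).trans_eq ?_
    simp
  rw [Finset.sum_sub_distrib] at a₂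
  rw [integral_sub (integrable_continuousMap ψ) (integrable_continuousMap φ), smul_sub] at a₃
  calc _ = ‖(∑ j ∈ Finset.range J, ψ (s + j • θ) - ∑ j ∈ Finset.range J, φ (s + j • θ)) -
        ((J : ℝ) • ∫ x, ψ x ∂AddCircle.haarAddCircle - (J : ℝ) • ∫ x, φ x ∂AddCircle.haarAddCircle)
        + (∑ j ∈ Finset.range J, φ (s + j • θ) - (J : ℝ) • ∫ x, φ x ∂AddCircle.haarAddCircle)‖ := by
        congr 1; abel
    _ ≤ _ := norm_add_le_of_le (norm_sub_le_of_le a₂ a₃) a₁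
    _ = ε * J := by ring

theorem uniformlyEquidistributed_real {θ : AddCircle T} (hθ : ∀ k : ℤ, k ≠ 0 → k • θ ≠ 0)
    (ψ : C(AddCircle T, ℝ)) : UniformlyEquidistributed AddCircle.haarAddCircle θ ψ := by
  intro ε hε
  obtain ⟨J₀, h⟩ := uniformlyEquidistributed_complex hθ
    (⟨fun x => (ψ x : ℂ), Complex.continuous_ofReal.comp ψ.continuous⟩ : C(AddCircle T, ℂ)) ε hε
  refine ⟨J₀, fun J hJ s => ?_⟩
  have := h J hJ s
  simp only [ContinuousMap.coe_mk] at this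
  rw [integral_complex_ofReal, ← Complex.ofReal_sum, Complex.real_smul, ← Complex.ofReal_mul,
    ← Complex.ofReal_sub, Complex.norm_real] at this
  exact this

lemma zsmul_coe_ne_zero {θ : ℝ} (hθ : Irrational (θ / T)) (k : ℤ) (hk : k ≠ 0) :
    k • (θ : AddCircle T) ≠ 0 := by
  intro h
  rw [← AddCircle.coe_zsmul, AddCircle.coe_eq_zero_iff] at h
  obtain ⟨j, hj⟩ := h
  rw [zsmul_eq_mul, zsmul_eq_mul] at hj
  refine hθ ⟨j / k, ?_⟩
  have hk' : (k : ℝ) ≠ 0 := by exact_mod_cast hk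
  have hT' := hT.out.ne'
  push_cast
  field_simp
  linarith

end Weyl

/-! ### Irrational rotations with periodic weights -/

section PeriodicWeights

scoped instance : Fact ((0 : ℝ) < 1) := ⟨one_pos⟩

lemma haarAddCircle_eq_volume :
    AddCircle.haarAddCircle (T := 1) = (volume : Measure UnitAddCircle) := by
  have := AddCircle.volume_eq_smul_haarAddCircle (T := 1)
  rw [ENNReal.ofReal_one, one_smul] at this
  exact this.symm

lemma coe_natCast_eq_zero (k : ℕ) : ((k : ℝ) : UnitAddCircle) = 0 :=
  (AddCircle.coe_eq_zero_iff 1).2 ⟨k, by simp⟩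

/-- Continuous functions that are `1` at the origin and have small integral. -/
lemma exists_bump_integral_le {ε : ℝ} (hε : 0 < ε) :
    ∃ w : C(UnitAddCircle, ℝ), w 0 = 1 ∧ (∀ x, 0 ≤ w x) ∧ (∀ x, w x ≤ 1) ∧
      ∫ x, w x ∂(AddCircle.haarAddCircle (T := 1)) ≤ ε := by
  set w : ℕ → C(UnitAddCircle, ℝ) := fun N => ⟨fun x => max 0 (1 - N * ‖x‖), by fun_prop⟩ with hw
  have hlim : Tendsto (fun N => ∫ x, w N x ∂(AddCircle.haarAddCircle (T := 1))) atTop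
      (𝓝 (∫ _x : UnitAddCircle, 0 ∂(AddCircle.haarAddCircle (T := 1)))) := by
    refine tendsto_integral_of_dominated_convergence (fun _ => 1)
      (fun N => (w N).continuous.aestronglyMeasurable) (integrable_const _)
      (fun N => ae_of_all _ fun x => ?_) ?_
    · change ‖max 0 (1 - (N : ℝ) * ‖x‖)‖ ≤ 1
      rw [Real.norm_of_nonneg (le_max_left _ _)]
      exact max_le zero_le_one (by have : (0:ℝ) ≤ N * ‖x‖ := by positivity
                                   linarith)
    · have h0 : ∀ᵐ x ∂(AddCircle.haarAddCircle (T := 1)), x ≠ (0 : UnitAddCircle) := by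
        rw [haarAddCircle_eq_volume, ae_iff]
        have := AddCircle.volume_closedBall (T := 1) (x := 0) 0
        simpa using this
      filter_upwards [h0] with x hx
      have hx' : 0 < ‖x‖ := norm_pos_iff.2 hx
      obtain ⟨N₀, hN₀⟩ := exists_nat_ge (1 / ‖x‖)
      rw [div_le_iff₀ hx'] at hN₀
      refine tendsto_const_nhds.congr' ?_
      filter_upwards [eventually_ge_atTop N₀] with N hN
      have : (N₀ : ℝ) * ‖x‖ ≤ N * ‖x‖ := by gcongr
      exact (max_eq_left (by linarith)).symm
  rw [integral_zero] at hlim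
  obtain ⟨N, hN⟩ := (hlim.eventually_le_const hε).exists
  refine ⟨w N, by simp [hw], fun x => le_max_left _ _, fun x => max_le zero_le_one ?_, hN⟩
  have : (0:ℝ) ≤ N * ‖x‖ := by positivity
  linarith

/-- A function of the circle times a function of the integer part. -/
lemma continuous_mul_floor {v : UnitAddCircle → ℝ} (hv : Continuous v) (hv0 : v 0 = 0)
    {b : ℤ → ℝ} {B : ℝ} (hb : ∀ k, |b k| ≤ B) :
    Continuous fun x : ℝ => v (x : UnitAddCircle) * b ⌊x⌋ := by
  refine continuous_iff_continuousAt.2 fun x => ?_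
  have hv' : Continuous fun x : ℝ => v (x : UnitAddCircle) :=
    hv.comp (AddCircle.continuous_mk' 1)
  by_cases hx : (x : UnitAddCircle) = 0
  · have h0 : v (x : UnitAddCircle) * b ⌊x⌋ = 0 := by rw [hx, hv0, zero_mul]
    rw [ContinuousAt, h0]
    have h1 : Tendsto (fun y : ℝ => |v (y : UnitAddCircle)| * B) (𝓝 x) (𝓝 0) := by
      have : Tendsto (fun y : ℝ => |v (y : UnitAddCircle)| * B) (𝓝 x)
          (𝓝 (|v (x : UnitAddCircle)| * B)) := (hv'.continuousAt (x := x)).abs.mul_const B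
      rwa [hx, hv0, abs_zero, zero_mul] at this
    refine squeeze_zero_norm (fun y => ?_) h1
    rw [norm_mul, Real.norm_eq_abs, Real.norm_eq_abs]
    exact mul_le_mul_of_nonneg_left (hb _) (abs_nonneg _)
  · have hlt : (⌊x⌋ : ℝ) < x := by
      refine lt_of_le_of_ne (Int.floor_le x) fun h => hx ?_
      rw [← h, AddCircle.coe_eq_zero_iff]
      exact ⟨⌊x⌋, by simp⟩
    have hloc : ∀ᶠ y in 𝓝 x, ⌊y⌋ = ⌊x⌋ := by
      filter_upwards [Ioo_mem_nhds hlt (Int.lt_floor_add_one x)] with y hy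
      exact Int.floor_eq_iff.2 ⟨hy.1.le, hy.2⟩
    have : ContinuousAt (fun y : ℝ => v (y : UnitAddCircle) * b ⌊x⌋) x :=
      hv'.continuousAt.mul continuousAt_const
    exact this.congr (hloc.mono fun y hy => by simp only [hy])

lemma exists_bound_of_periodic {a : ℕ → ℝ} {p : ℕ} (hp : 1 ≤ p) (ha : ∀ j, a (j + p) = a j) :
    ∃ B, 0 ≤ B ∧ ∀ j, |a j| ≤ B := by
  refine ⟨∑ c ∈ Finset.range p, |a c|, by positivity, fun j => ?_⟩
  have hper : Function.Periodic a p := ha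
  rw [← hper.map_mod_nat j]
  exact Finset.single_le_sum (f := fun c => |a c|) (fun _ _ => abs_nonneg _)
    (Finset.mem_range.2 (Nat.mod_lt _ hp))

lemma sum_range_periodic_shift {a : ℕ → ℝ} {p : ℕ} (ha : ∀ j, a (j + p) = a j) (i : ℕ) :
    ∑ c ∈ Finset.range p, a (i + c) = ∑ c ∈ Finset.range p, a c := by
  induction i with
  | zero => simp
  | succ i ih =>
    rw [← ih]
    have h1 := Finset.sum_range_succ (fun c => a (i + c)) p
    rw [Finset.sum_range_succ', ha, add_zero] at h1
    have h2 : ∀ c, a (i + 1 + c) = a (i + (c + 1)) := fun c => by congr 1; ring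
    simp only [h2]
    linarith

/-- Equidistribution of an irrational rotation together with periodic weights. -/
theorem exists_sum_periodic_weights_le {p : ℕ} (hp : 1 ≤ p) {a b : ℕ → ℝ}
    (ha : ∀ j, a (j + p) = a j) (hb : ∀ j, b (j + p) = b j)
    (hab : ∑ c ∈ Finset.range p, a c = 0 ∨ ∑ c ∈ Finset.range p, b c = 0)
    {θ : ℝ} (hθ : Irrational θ) (hθ0 : 0 ≤ θ) (u : C(UnitAddCircle, ℝ)) {ε : ℝ} (hε : 0 < ε) :
    ∃ M₀ : ℕ, ∀ M ≥ M₀, ∀ s : ℝ, 0 ≤ s →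
      |∑ k ∈ Finset.range M, u ((s + k * θ : ℝ) : UnitAddCircle) * a k * b ⌊s + k * θ⌋₊| ≤
        ε * M := by
  obtain ⟨A, hA0, hA⟩ := exists_bound_of_periodic hp ha
  obtain ⟨B, hB0, hB⟩ := exists_bound_of_periodic hp hb
  have hp0 : (0 : ℝ) < p := by exact_mod_cast hp
  set D : ℝ := (‖u‖ + 1) * (A + 1) * (B + 1) with hD
  have hD0 : 0 < D := by positivity
  have huD : ∀ x k l, |u x * a k * b l| ≤ D := fun x k l => by
    rw [abs_mul, abs_mul, hD]
    have h1 : |u x| ≤ ‖u‖ + 1 := (u.norm_coe_le_norm x).trans (by linarith)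
    have h2 : |a k| ≤ A + 1 := (hA k).trans (by linarith)
    have h3 : |b l| ≤ B + 1 := (hB l).trans (by linarith)
    gcongr
  -- Multiplication by `1 - w` removes the jumps of the weight `b ⌊x⌋` at the integers, and the part
  -- thrown away has small mean.
  obtain ⟨w, hw0, hwn, hw1, hwi⟩ := exists_bump_integral_le (ε := ε / (8 * D)) (by positivity)
  have hirr1 : Irrational (θ / (1 : ℝ)) := by simpa using hθ
  obtain ⟨M₁, hM₁⟩ := uniformlyEquidistributed_real (T := 1) (zsmul_coe_ne_zero hirr1) w
    (ε / (8 * D)) (by positivity)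
  -- the modified function on the longer circle
  set b' : ℤ → ℝ := fun k => b (k % p).toNat with hb'
  have hb'B : ∀ k, |b' k| ≤ B := fun k => hB _
  have hb'p : ∀ k, b' (k + p) = b' k := fun k => by simp [hb']
  have hbper : Function.Periodic b p := hb
  have hb'n : ∀ j : ℕ, b' j = b j := fun j => by
    simp only [hb']
    rw [← Int.natCast_mod, Int.toNat_natCast, hbper.map_mod_nat]
  set v : UnitAddCircle → ℝ := fun x => u x * (1 - w x) with hv
  have hvc : Continuous v := by fun_prop
  set ψ₀ : ℝ → ℝ := fun x => v (x : UnitAddCircle) * b' ⌊x⌋ with hψ₀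
  have hψc : Continuous ψ₀ := continuous_mul_floor hvc (by simp [hv, hw0]) hb'B
  have hψp : Function.Periodic ψ₀ (p : ℝ) := fun x => by
    have e1 : ((x + p : ℝ) : UnitAddCircle) = (x : UnitAddCircle) := by
      rw [AddCircle.coe_add, coe_natCast_eq_zero, add_zero]
    have e2 : ⌊x + (p : ℝ)⌋ = ⌊x⌋ + p := Int.floor_add_natCast x p
    simp only [hψ₀, e1, e2, hb'p]
  have hFact : Fact ((0 : ℝ) < p) := ⟨hp0⟩
  -- The weight has period `p` in the integer part, so the product lives on the circle of length
  -- `p`. Along a residue class of `k` modulo `p` the motion there is rotation by `p * θ`, which is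
  -- again irrational.
  set ψ : C(AddCircle (p : ℝ), ℝ) := ⟨hψp.lift, hψc.quotient_lift _⟩ with hψ
  have hψapp : ∀ x : ℝ, ψ (x : AddCircle (p : ℝ)) = ψ₀ x := fun x => hψp.lift_coe x
  have hirrp : Irrational ((p * θ) / (p : ℝ)) := by
    rw [mul_div_cancel_left₀ _ hp0.ne']; exact hθ
  obtain ⟨J₁, hJ₁⟩ := uniformlyEquidistributed_real (T := (p : ℝ)) (zsmul_coe_ne_zero hirrp) ψ
    (ε / (4 * (A + 1))) (by positivity)
  set I := ∫ x, ψ x ∂(AddCircle.haarAddCircle (T := (p : ℝ))) with hI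
  -- The residue class of `c` contributes in the mean `a c * I`. Either the `a c` sum to zero, or
  -- the translates of `ψ` by the integers below `p` do, and then `I = 0` by invariance of Haar
  -- measure.
  have hII : (∑ c ∈ Finset.range p, a c) * I = 0 := by
    rcases hab with h | h
    · rw [h, zero_mul]
    · have h1 : ∀ c : ℕ, ∫ x, ψ (x + ((c : ℝ) : AddCircle (p : ℝ)))
          ∂(AddCircle.haarAddCircle (T := (p : ℝ))) = I := fun c =>
        integral_add_right_eq_self (fun x => ψ x) _
      have h2 : ∑ c ∈ Finset.range p, ∫ x, ψ (x + ((c : ℝ) : AddCircle (p : ℝ)))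
          ∂(AddCircle.haarAddCircle (T := (p : ℝ))) = 0 := by
        rw [← integral_finsetSum]
        · have : ∀ x : AddCircle (p : ℝ),
              ∑ c ∈ Finset.range p, ψ (x + ((c : ℝ) : AddCircle (p : ℝ))) = 0 := by
            intro x
            obtain ⟨y, hy, rfl⟩ := (AddCircle.coe_image_Ico_eq (p : ℝ) 0).symm.subset
              (Set.mem_univ x)
            have hy0 : 0 ≤ y := hy.1
            have e : ∀ c : ℕ, ψ ((y : AddCircle (p : ℝ)) + ((c : ℝ) : AddCircle (p : ℝ))) =
                v (y : UnitAddCircle) * b (⌊y⌋₊ + c) := fun c => by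
              rw [← AddCircle.coe_add, hψapp]
              simp only [hψ₀]
              have e1 : ((y + c : ℝ) : UnitAddCircle) = (y : UnitAddCircle) := by
                rw [AddCircle.coe_add, coe_natCast_eq_zero, add_zero]
              have e2 : ⌊y + (c : ℝ)⌋ = ((⌊y⌋₊ + c : ℕ) : ℤ) := by
                rw [Int.floor_add_natCast, Nat.cast_add, Int.natCast_floor_eq_floor hy0]
              rw [e1, e2, hb'n]
            simp only [e]
            rw [← Finset.mul_sum, sum_range_periodic_shift hb, h, mul_zero]
          simp [this]
        · intro c _
          exact integrable_continuousMap (ψ.comp ⟨fun x => x + ((c : ℝ) : AddCircle (p : ℝ)),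
            by fun_prop⟩)
      simp only [h1, Finset.sum_const, Finset.card_range, nsmul_eq_mul] at h2
      rw [(mul_eq_zero.1 h2).resolve_left hp0.ne', mul_zero]
  obtain ⟨M₂, hM₂⟩ := exists_nat_ge (4 * D * p / ε)
  rw [div_le_iff₀ hε] at hM₂
  refine ⟨max M₁ (max M₂ (p * J₁ + p)), fun M hM s hs => ?_⟩
  have hMM₁ : M₁ ≤ M := (le_max_left _ _).trans hM
  have hMM₂ : M₂ ≤ M := ((le_max_left _ _).trans (le_max_right _ _)).trans hM
  have hMM₃ : p * J₁ + p ≤ M := ((le_max_right _ _).trans (le_max_right _ _)).trans hM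
  set f : ℕ → ℝ := fun k => u ((s + k * θ : ℝ) : UnitAddCircle) * a k * b ⌊s + k * θ⌋₊ with hf
  set g : ℕ → ℝ := fun k => a k * ψ₀ (s + k * θ) with hg
  have hsk : ∀ k : ℕ, 0 ≤ s + k * θ := fun k => by positivity
  have hfg : ∀ k, f k = g k + f k * w ((s + k * θ : ℝ) : UnitAddCircle) := fun k => by
    have e2 : ⌊s + k * θ⌋ = ((⌊s + k * θ⌋₊ : ℕ) : ℤ) := (Int.natCast_floor_eq_floor (hsk k)).symm
    simp only [hf, hg, hψ₀, e2, hb'n, hv]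
    ring
  -- contribution of the bump
  have p1 : |∑ k ∈ Finset.range M, f k * w ((s + k * θ : ℝ) : UnitAddCircle)| ≤ ε / 4 * M := by
    have e1 : ∀ k : ℕ, ((s + k * θ : ℝ) : UnitAddCircle) =
        (s : UnitAddCircle) + k • (θ : UnitAddCircle) := fun k => by
      rw [AddCircle.coe_add, ← nsmul_eq_mul, AddCircle.coe_nsmul]
    have h1 := hM₁ M hMM₁ (s : UnitAddCircle)
    rw [Real.norm_eq_abs, smul_eq_mul] at h1
    have h2 := (abs_le.1 h1).2
    have h3 : ∑ k ∈ Finset.range M, w ((s + k * θ : ℝ) : UnitAddCircle) ≤ ε / (4 * D) * M := by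
      simp only [e1]
      have : (M : ℝ) * ∫ x, w x ∂(AddCircle.haarAddCircle (T := 1)) ≤ M * (ε / (8 * D)) := by
        gcongr
      have e3 : ε / (4 * D) * M = ε / (8 * D) * M + M * (ε / (8 * D)) := by field_simp; ring
      linarith
    refine (Finset.abs_sum_le_sum_abs _ _).trans ?_
    calc ∑ k ∈ Finset.range M, |f k * w ((s + k * θ : ℝ) : UnitAddCircle)|
        ≤ ∑ k ∈ Finset.range M, D * w ((s + k * θ : ℝ) : UnitAddCircle) := by
          refine Finset.sum_le_sum fun k _ => ?_
          rw [abs_mul, abs_of_nonneg (hwn _)]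
          exact mul_le_mul_of_nonneg_right (huD _ _ _) (hwn _)
      _ = D * ∑ k ∈ Finset.range M, w ((s + k * θ : ℝ) : UnitAddCircle) := by rw [Finset.mul_sum]
      _ ≤ D * (ε / (4 * D) * M) := by gcongr
      _ = ε / 4 * M := by field_simp
  have hgD : ∀ k, |g k| ≤ D := fun k => by
    have e2 : ⌊s + k * θ⌋ = ((⌊s + k * θ⌋₊ : ℕ) : ℤ) := (Int.natCast_floor_eq_floor (hsk k)).symm
    have : g k = f k * (1 - w ((s + k * θ : ℝ) : UnitAddCircle)) := by linarith [hfg k]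
    rw [this, abs_mul]
    have h1 : |1 - w ((s + k * θ : ℝ) : UnitAddCircle)| ≤ 1 := by
      rw [abs_of_nonneg (by linarith [hw1 ((s + k * θ : ℝ) : UnitAddCircle)])]
      linarith [hwn ((s + k * θ : ℝ) : UnitAddCircle)]
    calc _ ≤ D * 1 := mul_le_mul (huD _ _ _) h1 (abs_nonneg _) hD0.le
      _ = D := mul_one D
  -- the main part
  set J := M / p with hJ
  have hJJ : J₁ ≤ J := by
    rw [hJ, Nat.le_div_iff_mul_le hp, mul_comm]
    omega
  have hJM : J * p ≤ M := Nat.div_mul_le_self M p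
  have hJM' : M - J * p ≤ p := by
    have := Nat.mod_lt M hp
    have h2 := Nat.div_add_mod M p
    rw [mul_comm] at h2
    rw [← hJ] at h2
    omega
  have p2 : |∑ k ∈ Finset.range (J * p), g k| ≤ ε / 4 * M := by
    have e1 : ∀ c, ∑ j ∈ Finset.range J, g (j * p + c) =
        a c * ∑ j ∈ Finset.range J, ψ (((s + c * θ : ℝ) : AddCircle (p : ℝ)) +
          j • ((p * θ : ℝ) : AddCircle (p : ℝ))) := fun c => by
      rw [Finset.mul_sum]
      refine Finset.sum_congr rfl fun j _ => ?_
      have haper : Function.Periodic a p := ha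
      have h1 : a (j * p + c) = a c := by
        rw [add_comm, ← smul_eq_mul]
        exact haper.nsmul j c
      rw [← AddCircle.coe_nsmul, ← AddCircle.coe_add, hψapp]
      simp only [hg, h1]
      congr 2
      rw [nsmul_eq_mul]
      push_cast
      ring
    rw [sum_range_mul_eq]
    simp only [e1]
    have e2 : ∑ c ∈ Finset.range p, a c * ∑ j ∈ Finset.range J,
          ψ (((s + c * θ : ℝ) : AddCircle (p : ℝ)) + j • ((p * θ : ℝ) : AddCircle (p : ℝ))) =
        ∑ c ∈ Finset.range p, a c * (∑ j ∈ Finset.range J,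
          ψ (((s + c * θ : ℝ) : AddCircle (p : ℝ)) + j • ((p * θ : ℝ) : AddCircle (p : ℝ)))
            - J * I) := by
      simp only [mul_sub, Finset.sum_sub_distrib]
      have : ∑ c ∈ Finset.range p, a c * (J * I) = J * ((∑ c ∈ Finset.range p, a c) * I) := by
        rw [← Finset.sum_mul]; ring
      rw [this, hII, mul_zero, sub_zero]
    rw [e2]
    refine (Finset.abs_sum_le_sum_abs _ _).trans ?_
    calc _ ≤ ∑ c ∈ Finset.range p, (A + 1) * (ε / (4 * (A + 1)) * J) := by
          refine Finset.sum_le_sum fun c _ => ?_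
          rw [abs_mul]
          have h1 := hJ₁ J hJJ ((s + c * θ : ℝ) : AddCircle (p : ℝ))
          rw [Real.norm_eq_abs, smul_eq_mul] at h1
          exact mul_le_mul ((hA c).trans (by linarith)) h1 (abs_nonneg _) (by linarith)
      _ = ε / 4 * (J * p : ℕ) := by
          rw [Finset.sum_const, Finset.card_range, nsmul_eq_mul]
          push_cast
          field_simp
      _ ≤ ε / 4 * M := by gcongr
  have p3 : |∑ k ∈ Finset.range M, g k| ≤ ε / 2 * M := by
    have h1 := Finset.sum_range_add g (J * p) (M - J * p)
    rw [Nat.add_sub_cancel' hJM] at h1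
    rw [h1]
    have h2 : |∑ k ∈ Finset.range (M - J * p), g (J * p + k)| ≤ ε / 4 * M := by
      refine (Finset.abs_sum_le_sum_abs _ _).trans ?_
      calc _ ≤ ∑ k ∈ Finset.range (M - J * p), D := Finset.sum_le_sum fun k _ => hgD _
        _ = (M - J * p : ℕ) * D := by simp
        _ ≤ p * D := by gcongr
        _ ≤ ε / 4 * M₂ := by linarith
        _ ≤ ε / 4 * M := by gcongr
    refine (abs_add_le _ _).trans ?_
    linarith
  change |∑ k ∈ Finset.range M, f k| ≤ ε * M
  rw [Finset.sum_congr rfl fun k _ => hfg k, Finset.sum_add_distrib]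
  refine (abs_add_le _ _).trans ?_
  have : 0 ≤ ε / 4 * M := by positivity
  linarith

end PeriodicWeights

end SymbolicCP
end

noncomputable section
namespace SymbolicCP

/-! ### Mean convergence in the skew product -/

section Averages

variable {m n : ℕ} {μ : Measure (Seq m n)} {K : ENNReal} {p q : ℕ} {θ : ℝ}

/-- The value of `F` after `i` steps of the skew product over the rotation by `θ`. -/
def skewOrbit (q : ℕ) (θ : ℝ) (F : UnitAddCircle → Seq m n → Seq m n → ℝ) (s : ℝ) (i : ℕ)
    (z : Seq m n × Seq m n) : ℝ :=
  F ((s + i * θ : ℝ) : UnitAddCircle) (shift^[q * i] z.1) (shift^[⌊s + i * θ⌋₊] z.2)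

/-- The averages of `F` along the skew product converge in mean to `c`, uniformly in the
starting point of the rotation. -/
def UniformlyAverages (μ : Measure (Seq m n)) (q : ℕ) (θ : ℝ)
    (F : UnitAddCircle → Seq m n → Seq m n → ℝ) (c : ℝ) : Prop :=
  ∀ ε > 0, ∃ M₀ : ℕ, ∀ M ≥ M₀, ∀ s : ℝ, 0 ≤ s →
    ∫ z, |∑ i ∈ Finset.range M, skewOrbit q θ F s i z - M * c| ∂(μ.prod μ) ≤ ε * M

/-- Autocorrelation. -/
def corr (μ : Measure (Seq m n)) (f : Seq m n → ℝ) (j : ℕ) : ℝ := ∫ x, f x * f (shift^[j] x) ∂μ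

lemma abs_corr_le [IsProbabilityMeasure μ] {f : Seq m n → ℝ} (hf : ∀ x, |f x| ≤ 1) (j : ℕ) :
    |corr μ f j| ≤ 1 := by
  rw [← Real.norm_eq_abs, corr]
  refine (norm_integral_le_of_norm_le_const (C := 1) (ae_of_all _ fun x => ?_)).trans_eq (by simp)
  rw [norm_mul]
  exact mul_le_one₀ (hf _) (norm_nonneg _) (hf _)

/-- A sequence tending to zero along indices of linear growth has small sums. -/
lemma exists_sum_le_of_tendsto_zero {δ : ℕ → ℝ} (hδ : Tendsto δ atTop (𝓝 0)) {B : ℝ}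
    (hB : ∀ j, |δ j| ≤ B) (hθ : 0 < θ) {ε : ℝ} (hε : 0 < ε) :
    ∃ C : ℝ, 0 ≤ C ∧ ∀ (M : ℕ) (s : ℝ), 0 ≤ s →
      ∑ k ∈ Finset.range M, |δ ⌊s + k * θ⌋₊| ≤ ε * M + C := by
  have hB0 : 0 ≤ B := (abs_nonneg _).trans (hB 0)
  obtain ⟨j₀, hj₀⟩ := Metric.tendsto_atTop.1 hδ ε hε
  obtain ⟨k₀, hk₀⟩ := exists_nat_ge (j₀ / θ)
  rw [div_le_iff₀ hθ] at hk₀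
  refine ⟨k₀ * B, by positivity, fun M s hs => ?_⟩
  have h1 : ∀ k : ℕ, |δ ⌊s + k * θ⌋₊| ≤ ε + if k < k₀ then B else 0 := fun k => by
    split_ifs with hk
    · linarith [hB ⌊s + k * θ⌋₊]
    · have hkk : (k₀ : ℝ) ≤ k := by exact_mod_cast not_lt.1 hk
      have : j₀ ≤ ⌊s + k * θ⌋₊ := Nat.le_floor (by nlinarith)
      have := hj₀ _ this
      rw [Real.dist_eq, sub_zero] at this
      linarith
  refine (Finset.sum_le_sum fun k _ => h1 k).trans ?_
  rw [Finset.sum_add_distrib, Finset.sum_const, Finset.card_range, nsmul_eq_mul, mul_comm]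
  gcongr
  calc ∑ k ∈ Finset.range M, (if k < k₀ then B else 0)
      = ∑ k ∈ (Finset.range M).filter (· < k₀), B := by rw [Finset.sum_filter]
    _ = (((Finset.range M).filter (· < k₀)).card : ℝ) * B := by simp
    _ ≤ k₀ * B := by
        gcongr
        calc _ ≤ (Finset.range k₀).card := Finset.card_le_card fun k hk => by
              simp only [Finset.mem_filter, Finset.mem_range] at hk ⊢
              exact hk.2
          _ = k₀ := Finset.card_range _

lemma memLp_two_of_bound [IsProbabilityMeasure μ] {f : Seq m n → ℝ} (hfm : Measurable f)
    (hf : ∀ x, |f x| ≤ 1) : MemLp f 2 μ :=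
  MemLp.of_bound hfm.aestronglyMeasurable 1 (ae_of_all _ hf)

/-- Sums of products of autocorrelations along the two speeds. -/
lemma IsQuasiBernoulli.exists_sum_corr_le [IsProbabilityMeasure μ] (h : IsQuasiBernoulli K p μ)
    (hq1 : 1 ≤ q)
    (hq : Ergodic shift^[q] μ) (h1 : Ergodic shift μ) (hθ : Irrational θ) (hθ0 : 0 < θ)
    (u : C(UnitAddCircle, ℝ)) {f g : Seq m n → ℝ} (hfm : Measurable f) (hgm : Measurable g)
    (hf : ∀ x, |f x| ≤ 1) (hg : ∀ x, |g x| ≤ 1) (hfg : ∫ x, f x ∂μ = 0 ∨ ∫ x, g x ∂μ = 0) {ε : ℝ}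
    (hε : 0 < ε) :
    ∃ C : ℝ, 0 ≤ C ∧ ∀ (M : ℕ) (s : ℝ), 0 ≤ s →
      |∑ k ∈ Finset.range M, u ((s + k * θ : ℝ) : UnitAddCircle) * corr μ f (q * k) *
        corr μ g ⌊s + k * θ⌋₊| ≤ ε * M + C := by
  obtain ⟨a, ha, halim, haz⟩ := h.exists_periodic_correlation (memLp_two_of_bound hfm hf)
    (memLp_two_of_bound hfm hf)
  obtain ⟨b, hb, hblim, hbz⟩ := h.exists_periodic_correlation (memLp_two_of_bound hgm hg)
    (memLp_two_of_bound hgm hg)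
  obtain ⟨A, hA0, hA⟩ := exists_bound_of_periodic h.one_le ha
  obtain ⟨B, hB0, hB⟩ := exists_bound_of_periodic h.one_le hb
  have ha' : ∀ j, a (q * (j + p)) = a (q * j) := fun j => by
    have hper : Function.Periodic a p := ha
    have := hper.nsmul q (q * j)
    rw [smul_eq_mul] at this
    rw [← this, mul_add]
  -- The zero sum comes from ergodicity: of `shift^[q]` for `f`, which is read at multiples of `q`,
  -- and of `shift` itself for `g`.
  have hab : ∑ c ∈ Finset.range p, a (q * c) = 0 ∨ ∑ c ∈ Finset.range p, b c = 0 := by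
    rcases hfg with hf0 | hg0
    · exact Or.inl (haz q hq hf0)
    · have := hbz 1 (by simpa using h1) hg0
      simp only [one_mul] at this
      exact Or.inr this
  have hu : ∀ x, |u x| ≤ ‖u‖ := fun x => u.norm_coe_le_norm x
  set D := ‖u‖ + 1 with hD
  have hD0 : 0 < D := by positivity
  obtain ⟨M₀, hM₀⟩ := exists_sum_periodic_weights_le h.one_le (a := fun j => a (q * j)) ha' hb hab
    hθ hθ0.le u (ε := ε / 3) (by positivity)
  have hqlim : Tendsto (fun j => corr μ f (q * j) - a (q * j)) atTop (𝓝 0) :=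
    halim.comp (tendsto_id.const_mul_atTop' (by omega))
  obtain ⟨C₁, hC₁0, hC₁⟩ := exists_sum_le_of_tendsto_zero (θ := 1) hqlim (B := 1 + A)
    (fun j => (abs_sub _ _).trans (add_le_add (abs_corr_le hf _) (hA _))) one_pos
    (ε := ε / (3 * D)) (by positivity)
  obtain ⟨C₂, hC₂0, hC₂⟩ := exists_sum_le_of_tendsto_zero (θ := θ) hblim (B := 1 + B)
    (fun j => (abs_sub _ _).trans (add_le_add (abs_corr_le hg j) (hB _))) hθ0
    (ε := ε / (3 * (D * (A + 1)))) (by positivity)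
  set C₀ : ℝ := M₀ * (D * (A + 1) * (B + 1)) with hC₀
  have hC₀0 : 0 ≤ C₀ := by positivity
  refine ⟨C₀ + D * C₁ + D * (A + 1) * C₂, by positivity, fun M s hs => ?_⟩
  have t0 : |∑ k ∈ Finset.range M, u ((s + k * θ : ℝ) : UnitAddCircle) * a (q * k) *
      b ⌊s + k * θ⌋₊| ≤ ε / 3 * M + C₀ := by
    rcases le_or_gt M₀ M with hM | hM
    · have := hM₀ M hM s hs
      linarith
    · refine (Finset.abs_sum_le_sum_abs _ _).trans ?_
      calc _ ≤ ∑ k ∈ Finset.range M, D * (A + 1) * (B + 1) := by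
            refine Finset.sum_le_sum fun k _ => ?_
            rw [abs_mul, abs_mul]
            have e1 : |u ((s + k * θ : ℝ) : UnitAddCircle)| ≤ D := (hu _).trans (by linarith)
            have e2 : |a (q * k)| ≤ A + 1 := (hA _).trans (by linarith)
            have e3 : |b ⌊s + k * θ⌋₊| ≤ B + 1 := (hB _).trans (by linarith)
            gcongr
        _ = M * (D * (A + 1) * (B + 1)) := by simp
        _ ≤ C₀ := by rw [hC₀]; gcongr
        _ ≤ ε / 3 * M + C₀ := le_add_of_nonneg_left (by positivity)
  have t1 := hC₁ M 0 le_rfl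
  simp only [zero_add, mul_one, Nat.floor_natCast] at t1
  have t2 := hC₂ M s hs
  have hdec : ∀ k : ℕ, u ((s + k * θ : ℝ) : UnitAddCircle) * corr μ f (q * k) *
        corr μ g ⌊s + k * θ⌋₊ =
      u ((s + k * θ : ℝ) : UnitAddCircle) * a (q * k) * b ⌊s + k * θ⌋₊ +
      (u ((s + k * θ : ℝ) : UnitAddCircle) * ((corr μ f (q * k) - a (q * k)) *
        corr μ g ⌊s + k * θ⌋₊) + u ((s + k * θ : ℝ) : UnitAddCircle) * (a (q * k) *
        (corr μ g ⌊s + k * θ⌋₊ - b ⌊s + k * θ⌋₊))) := fun k => by ring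
  rw [Finset.sum_congr rfl fun k _ => hdec k, Finset.sum_add_distrib, Finset.sum_add_distrib]
  have s1 : |∑ k ∈ Finset.range M, u ((s + k * θ : ℝ) : UnitAddCircle) *
      ((corr μ f (q * k) - a (q * k)) * corr μ g ⌊s + k * θ⌋₊)| ≤ ε / 3 * M + D * C₁ := by
    refine (Finset.abs_sum_le_sum_abs _ _).trans ?_
    calc _ ≤ ∑ k ∈ Finset.range M, D * |corr μ f (q * k) - a (q * k)| := by
          refine Finset.sum_le_sum fun k _ => ?_
          rw [abs_mul, abs_mul]
          have e1 : |u ((s + k * θ : ℝ) : UnitAddCircle)| ≤ D := (hu _).trans (by linarith)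
          have e2 := abs_corr_le (μ := μ) hg ⌊s + k * θ⌋₊
          gcongr
          exact mul_le_of_le_one_right (abs_nonneg _) e2
      _ = D * ∑ k ∈ Finset.range M, |corr μ f (q * k) - a (q * k)| := by rw [Finset.mul_sum]
      _ ≤ D * (ε / (3 * D) * M + C₁) := by gcongr
      _ = ε / 3 * M + D * C₁ := by field_simp
  have s2 : |∑ k ∈ Finset.range M, u ((s + k * θ : ℝ) : UnitAddCircle) *
      (a (q * k) * (corr μ g ⌊s + k * θ⌋₊ - b ⌊s + k * θ⌋₊))| ≤
      ε / 3 * M + D * (A + 1) * C₂ := by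
    refine (Finset.abs_sum_le_sum_abs _ _).trans ?_
    calc _ ≤ ∑ k ∈ Finset.range M, D * (A + 1) * |corr μ g ⌊s + k * θ⌋₊ - b ⌊s + k * θ⌋₊| := by
          refine Finset.sum_le_sum fun k _ => ?_
          rw [abs_mul, abs_mul, mul_assoc]
          have e1 : |u ((s + k * θ : ℝ) : UnitAddCircle)| ≤ D := (hu _).trans (by linarith)
          have e2 : |a (q * k)| ≤ A + 1 := (hA _).trans (by linarith)
          gcongr
      _ = D * (A + 1) * ∑ k ∈ Finset.range M, |corr μ g ⌊s + k * θ⌋₊ - b ⌊s + k * θ⌋₊| := by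
          rw [Finset.mul_sum]
      _ ≤ D * (A + 1) * (ε / (3 * (D * (A + 1))) * M + C₂) := by gcongr; exact t2
      _ = ε / 3 * M + D * (A + 1) * C₂ := by field_simp
  have q1 := abs_add_le (∑ k ∈ Finset.range M, u ((s + k * θ : ℝ) : UnitAddCircle) *
      ((corr μ f (q * k) - a (q * k)) * corr μ g ⌊s + k * θ⌋₊))
      (∑ k ∈ Finset.range M, u ((s + k * θ : ℝ) : UnitAddCircle) *
      (a (q * k) * (corr μ g ⌊s + k * θ⌋₊ - b ⌊s + k * θ⌋₊)))
  refine (abs_add_le _ _).trans ?_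
  linarith

/-- The right side is twice the sum on and above the diagonal; the surplus is the sum of the
squares. -/
lemma sq_sum_le_two_mul (v : ℕ → ℝ) (M : ℕ) :
    (∑ i ∈ Finset.range M, v i) ^ 2 ≤
      2 * ∑ i ∈ Finset.range M, ∑ k ∈ Finset.range (M - i), v i * v (i + k) := by
  induction M with
  | zero => simp
  | succ M ih =>
    have h1 : ∀ i ∈ Finset.range M, ∑ k ∈ Finset.range (M + 1 - i), v i * v (i + k) =
        ∑ k ∈ Finset.range (M - i), v i * v (i + k) + v i * v M := fun i hi => by
      have hi := Finset.mem_range.1 hi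
      rw [show M + 1 - i = (M - i) + 1 by omega, Finset.sum_range_succ,
        Nat.add_sub_cancel' hi.le]
    rw [Finset.sum_range_succ, Finset.sum_range_succ, Finset.sum_congr rfl h1,
      Finset.sum_add_distrib, ← Finset.sum_mul]
    simp only [Nat.add_sub_cancel_left, Finset.sum_range_one, add_zero]
    nlinarith [sq_nonneg (v M)]

lemma corr_shift (hinv : MeasurePreserving shift μ μ) {f : Seq m n → ℝ} (hf : Measurable f)
    (i j : ℕ) : ∫ x, f (shift^[i] x) * f (shift^[i + j] x) ∂μ = corr μ f j := by
  have h1 : ∀ x : Seq m n, f (shift^[i + j] x) = f (shift^[j] (shift^[i] x)) := fun x => by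
    rw [add_comm, Function.iterate_add_apply]
  simp only [h1]
  exact integral_comp_measurePreserving (hinv.iterate i)
    (f := fun x => f x * f (shift^[j] x))
    (hf.mul (hf.comp (measurable_shift_iterate j))).aestronglyMeasurable

/-- After `i` steps the skew product restarts from a fractional part. This is why the estimates are
kept uniform in the starting point `s`. -/
lemma floor_add_mul {s : ℝ} (hs : 0 ≤ s) (hθ0 : 0 ≤ θ) (i k : ℕ) :
    ⌊s + (i + k : ℕ) * θ⌋₊ = ⌊s + i * θ⌋₊ + ⌊Int.fract (s + i * θ) + k * θ⌋₊ := by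
  have h0 : 0 ≤ s + i * θ := by positivity
  have h1 : (⌊s + i * θ⌋₊ : ℝ) = s + i * θ - Int.fract (s + i * θ) := by
    rw [← Int.floor_toNat]
    have := Int.toNat_of_nonneg (Int.floor_nonneg.2 h0)
    rw [show ((⌊s + i * θ⌋.toNat : ℕ) : ℝ) = ((⌊s + i * θ⌋.toNat : ℤ) : ℝ) by push_cast; rfl, this]
    exact (Int.self_sub_fract _).symm
  have h2 : 0 ≤ Int.fract (s + i * θ) + k * θ := by
    have := Int.fract_nonneg (s + i * θ)
    positivity
  rw [add_comm ⌊s + i * θ⌋₊, ← Nat.floor_add_natCast h2, h1]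
  congr 1
  push_cast
  ring

lemma coe_fract_add (s x : ℝ) : ((Int.fract s + x : ℝ) : UnitAddCircle) = ((s + x : ℝ) : UnitAddCircle) := by
  have h : s + x = Int.fract s + x + ⌊s⌋ := by have := Int.fract_add_floor s; linarith
  have h0 : ((⌊s⌋ : ℝ) : UnitAddCircle) = 0 := (AddCircle.coe_eq_zero_iff 1).2 ⟨⌊s⌋, by simp⟩
  rw [h, AddCircle.coe_add (1 : ℝ) (Int.fract s + x), h0, add_zero]

lemma integral_abs_le_sqrt {Ω : Type*} [MeasurableSpace Ω] {P : Measure Ω} [IsProbabilityMeasure P]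
    {X : Ω → ℝ} {B : ℝ} (hm : AEStronglyMeasurable X P) (hb : ∀ z, |X z| ≤ B) :
    ∫ z, |X z| ∂P ≤ √(∫ z, X z ^ 2 ∂P) := by
  have hX : MemLp X 2 P := MemLp.of_bound hm B (ae_of_all _ hb)
  refine Real.le_sqrt_of_sq_le ?_
  have hv := variance_nonneg (fun z => |X z|) P
  rw [variance_eq_sub (X := fun z => |X z|) hX.abs] at hv
  simp only [Pi.pow_apply, sq_abs] at hv
  linarith

lemma measurable_skewOrbit {F : UnitAddCircle → Seq m n → Seq m n → ℝ}
    (hF : ∀ t, Measurable (Function.uncurry (F t))) (s : ℝ) (i : ℕ) :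
    Measurable (skewOrbit q θ F s i) :=
  (hF _).comp (((measurable_shift_iterate _).comp measurable_fst).prodMk
    ((measurable_shift_iterate _).comp measurable_snd))

/-- A second moment computation. By independence of the two sequences and stationarity, the mean
product of the steps `i` and `i + k` involves the autocorrelation of `f` at `q * k` and that of `g`
at an integer part. Their weighted sum over `k` is small, uniformly in the fractional part at which
it starts. -/
lemma IsQuasiBernoulli.uniformlyAverages_zero [IsProbabilityMeasure μ] (h : IsQuasiBernoulli K p μ)
    (hq1 : 1 ≤ q)
    (hq : Ergodic shift^[q] μ) (h1 : Ergodic shift μ) (hθ : Irrational θ) (hθ0 : 0 < θ)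
    (u : C(UnitAddCircle, ℝ)) {f g : Seq m n → ℝ} (hfm : Measurable f) (hgm : Measurable g)
    (hf : ∀ x, |f x| ≤ 1) (hg : ∀ x, |g x| ≤ 1) (hfg : ∫ x, f x ∂μ = 0 ∨ ∫ x, g x ∂μ = 0) :
    UniformlyAverages μ q θ (fun t x y => u t * f x * g y) 0 := by
  intro ε hε
  set F : UnitAddCircle → Seq m n → Seq m n → ℝ := fun t x y => u t * f x * g y with hF
  have hFm : ∀ t, Measurable (Function.uncurry (F t)) := fun t => by
    have : Measurable fun z : Seq m n × Seq m n => u t * f z.1 * g z.2 := by fun_prop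
    exact this
  set D := ‖u‖ + 1 with hD
  have hD0 : 0 < D := by positivity
  have hu : ∀ x, |u x| ≤ D := fun x => (u.norm_coe_le_norm x).trans (by linarith)
  obtain ⟨C, hC0, hC⟩ := h.exists_sum_corr_le hq1 hq h1 hθ hθ0 u hfm hgm hf hg hfg
    (ε := ε ^ 2 / (4 * D)) (by positivity)
  obtain ⟨M₀, hM₀⟩ := exists_nat_ge (4 * D * C / ε ^ 2)
  rw [div_le_iff₀ (by positivity)] at hM₀
  refine ⟨M₀, fun M hM s hs => ?_⟩
  simp only [mul_zero, sub_zero]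
  have hFb : ∀ i z, |skewOrbit q θ F s i z| ≤ D := fun i z => by
    simp only [skewOrbit, hF, abs_mul]
    calc _ ≤ D * 1 * 1 := by gcongr; exacts [hu _, hf _, hg _]
      _ = D := by ring
  have hSm : Measurable fun z => ∑ i ∈ Finset.range M, skewOrbit q θ F s i z :=
    Finset.measurable_fun_sum _ fun i _ => measurable_skewOrbit hFm s i
  refine (integral_abs_le_sqrt (B := M * D) hSm.aestronglyMeasurable fun z => ?_).trans ?_
  · refine (Finset.abs_sum_le_sum_abs _ _).trans ?_
    refine (Finset.sum_le_sum fun i _ => hFb i z).trans_eq ?_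
    simp
  have hint : ∀ i j, Integrable (fun z => skewOrbit q θ F s i z * skewOrbit q θ F s j z)
      (μ.prod μ) := fun i j =>
    Integrable.of_bound ((measurable_skewOrbit hFm s i).mul
      (measurable_skewOrbit hFm s j)).aestronglyMeasurable (D * D) (ae_of_all _ fun z => by
        rw [Real.norm_eq_abs, abs_mul]
        exact mul_le_mul (hFb _ _) (hFb _ _) (abs_nonneg _) hD0.le)
  have hcor : ∀ i k : ℕ, ∫ z, skewOrbit q θ F s i z * skewOrbit q θ F s (i + k) z ∂(μ.prod μ) =
      u ((s + i * θ : ℝ) : UnitAddCircle) *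
        (u ((Int.fract (s + i * θ) + k * θ : ℝ) : UnitAddCircle) * corr μ f (q * k) *
          corr μ g ⌊Int.fract (s + i * θ) + k * θ⌋₊) := by
    intro i k
    have e : ∀ z : Seq m n × Seq m n, skewOrbit q θ F s i z * skewOrbit q θ F s (i + k) z =
        u ((s + i * θ : ℝ) : UnitAddCircle) *
          u ((Int.fract (s + i * θ) + k * θ : ℝ) : UnitAddCircle) *
        ((f (shift^[q * i] z.1) * f (shift^[q * i + q * k] z.1)) *
          (g (shift^[⌊s + i * θ⌋₊] z.2) *
            g (shift^[⌊s + i * θ⌋₊ + ⌊Int.fract (s + i * θ) + k * θ⌋₊] z.2))) := by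
      intro z
      simp only [skewOrbit, hF]
      rw [floor_add_mul hs hθ0.le, coe_fract_add, mul_add]
      have : s + ((i + k : ℕ) : ℝ) * θ = s + i * θ + k * θ := by push_cast; ring
      rw [this]
      ring
    simp only [e]
    rw [integral_const_mul, integral_prod_mul (μ := μ) (ν := μ)
      (fun x => f (shift^[q * i] x) * f (shift^[q * i + q * k] x)) (fun y =>
        g (shift^[⌊s + i * θ⌋₊] y) * g (shift^[⌊s + i * θ⌋₊ +
          ⌊Int.fract (s + i * θ) + k * θ⌋₊] y)), corr_shift h.invariant hfm,
      corr_shift h.invariant hgm]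
    ring
  refine Real.sqrt_le_iff.2 ⟨by positivity, ?_⟩
  calc ∫ z, (∑ i ∈ Finset.range M, skewOrbit q θ F s i z) ^ 2 ∂(μ.prod μ)
      ≤ ∫ z, 2 * ∑ i ∈ Finset.range M, ∑ k ∈ Finset.range (M - i),
          skewOrbit q θ F s i z * skewOrbit q θ F s (i + k) z ∂(μ.prod μ) := by
        refine integral_mono_of_nonneg (ae_of_all _ fun z => sq_nonneg _) ?_
          (ae_of_all _ fun z => sq_sum_le_two_mul _ M)
        exact (integrable_finsetSum _ fun i _ => integrable_finsetSum _ fun k _ =>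
          hint _ _).const_mul 2
    _ = 2 * ∑ i ∈ Finset.range M, u ((s + i * θ : ℝ) : UnitAddCircle) *
          ∑ k ∈ Finset.range (M - i), u ((Int.fract (s + i * θ) + k * θ : ℝ) : UnitAddCircle) *
            corr μ f (q * k) * corr μ g ⌊Int.fract (s + i * θ) + k * θ⌋₊ := by
        rw [integral_const_mul, integral_finsetSum _ fun i _ => integrable_finsetSum _ fun k _ =>
          hint _ _]
        congr 1
        refine Finset.sum_congr rfl fun i _ => ?_
        rw [integral_finsetSum _ fun k _ => hint _ _, Finset.mul_sum]
        exact Finset.sum_congr rfl fun k _ => hcor i k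
    _ ≤ 2 * ∑ i ∈ Finset.range M, D * (ε ^ 2 / (4 * D) * M + C) := by
        refine mul_le_mul_of_nonneg_left (Finset.sum_le_sum fun i _ => ?_) zero_le_two
        refine (le_abs_self _).trans ?_
        rw [abs_mul]
        refine mul_le_mul (hu _) ((hC (M - i) _ (Int.fract_nonneg _)).trans ?_) (abs_nonneg _) hD0.le
        gcongr
        omega
    _ = ε ^ 2 / 2 * M ^ 2 + 2 * D * C * M := by
        rw [Finset.sum_const, Finset.card_range, nsmul_eq_mul]
        field_simp
        ring
    _ ≤ (ε * M) ^ 2 := by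
        have hMM : (M₀ : ℝ) ≤ M := by exact_mod_cast hM
        have : 4 * D * C * M ≤ M₀ * ε ^ 2 * M := by gcongr
        have h3 : (M₀ : ℝ) * ε ^ 2 * M ≤ M * ε ^ 2 * M := by gcongr
        nlinarith

lemma UniformlyAverages.add [IsProbabilityMeasure μ]
    {F G : UnitAddCircle → Seq m n → Seq m n → ℝ} {c d B B' : ℝ}
    (hF : UniformlyAverages μ q θ F c) (hG : UniformlyAverages μ q θ G d)
    (hFm : ∀ t, Measurable (Function.uncurry (F t))) (hGm : ∀ t, Measurable (Function.uncurry (G t)))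
    (hFb : ∀ t x y, |F t x y| ≤ B) (hGb : ∀ t x y, |G t x y| ≤ B') :
    UniformlyAverages μ q θ (fun t x y => F t x y + G t x y) (c + d) := by
  intro ε hε
  obtain ⟨M₁, h₁⟩ := hF (ε / 2) (by positivity)
  obtain ⟨M₂, h₂⟩ := hG (ε / 2) (by positivity)
  refine ⟨max M₁ M₂, fun M hM s hs => ?_⟩
  have a₁ := h₁ M ((le_max_left _ _).trans hM) s hs
  have a₂ := h₂ M ((le_max_right _ _).trans hM) s hs
  have hi : ∀ (F : UnitAddCircle → Seq m n → Seq m n → ℝ) (c B : ℝ)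
      (_ : ∀ t, Measurable (Function.uncurry (F t))) (_ : ∀ t x y, |F t x y| ≤ B),
      Integrable (fun z => |∑ i ∈ Finset.range M, skewOrbit q θ F s i z - M * c|) (μ.prod μ) := by
    intro F c B hFm hFb
    refine Integrable.abs ((integrable_finsetSum _ fun i _ => ?_).sub (integrable_const _))
    exact Integrable.of_bound (measurable_skewOrbit hFm s i).aestronglyMeasurable B
      (ae_of_all _ fun z => hFb _ _ _)
  calc _ ≤ ∫ z, (|∑ i ∈ Finset.range M, skewOrbit q θ F s i z - M * c| +
        |∑ i ∈ Finset.range M, skewOrbit q θ G s i z - M * d|) ∂(μ.prod μ) := by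
        refine integral_mono_of_nonneg (ae_of_all _ fun z => abs_nonneg _)
          ((hi F c B hFm hFb).add (hi G d B' hGm hGb)) (ae_of_all _ fun z => ?_)
        have e : ∑ i ∈ Finset.range M, skewOrbit q θ (fun t x y => F t x y + G t x y) s i z =
            ∑ i ∈ Finset.range M, skewOrbit q θ F s i z +
              ∑ i ∈ Finset.range M, skewOrbit q θ G s i z := Finset.sum_add_distrib
        beta_reduce
        rw [e, mul_add, add_sub_add_comm]
        exact abs_add_le _ _
    _ ≤ ε * M := by
        rw [integral_add (hi F c B hFm hFb) (hi G d B' hGm hGb)]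
        linarith

lemma UniformlyAverages.const_mul {F : UnitAddCircle → Seq m n → Seq m n → ℝ} {c : ℝ} (a : ℝ)
    (hF : UniformlyAverages μ q θ F c) :
    UniformlyAverages μ q θ (fun t x y => a * F t x y) (a * c) := by
  intro ε hε
  obtain ⟨M₀, h₀⟩ := hF (ε / (|a| + 1)) (by positivity)
  refine ⟨M₀, fun M hM s hs => ?_⟩
  have e : ∀ z, |∑ i ∈ Finset.range M, skewOrbit q θ (fun t x y => a * F t x y) s i z - M * (a * c)|
      = |a| * |∑ i ∈ Finset.range M, skewOrbit q θ F s i z - M * c| := fun z => by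
    rw [← abs_mul]
    simp only [skewOrbit, mul_sub, Finset.mul_sum]
    congr 2
    ring
  simp only [e]
  rw [integral_const_mul]
  calc _ ≤ (|a| + 1) * (ε / (|a| + 1) * M) := by
        gcongr
        · linarith
        · exact h₀ M hM s hs
    _ = ε * M := by field_simp

lemma uniformlyAverages_rotation [IsProbabilityMeasure μ] (hθ : Irrational θ)
    (u : C(UnitAddCircle, ℝ)) :
    UniformlyAverages μ q θ (fun t _ _ => u t) (∫ t, u t) := by
  intro ε hε
  have hirr1 : Irrational (θ / (1 : ℝ)) := by simpa using hθ
  obtain ⟨M₀, h₀⟩ := uniformlyEquidistributed_real (T := 1) (zsmul_coe_ne_zero hirr1) u ε hε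
  refine ⟨M₀, fun M hM s hs => ?_⟩
  have := h₀ M hM (s : UnitAddCircle)
  simp only [skewOrbit, integral_const, probReal_univ, one_smul]
  have e1 : ∀ k : ℕ, ((s + k * θ : ℝ) : UnitAddCircle) =
      (s : UnitAddCircle) + k • (θ : UnitAddCircle) := fun k => by
    rw [AddCircle.coe_add, ← nsmul_eq_mul, AddCircle.coe_nsmul]
  simp only [e1]
  rwa [haarAddCircle_eq_volume, Real.norm_eq_abs, smul_eq_mul] at this

/-- With `a` and `b` the means, `f * g = (f - a) * g + a * (g - b) + a * b`. The first two summands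
have a factor of mean zero, and the last leaves only the rotation. -/
lemma IsQuasiBernoulli.uniformlyAverages_mul [IsProbabilityMeasure μ] (h : IsQuasiBernoulli K p μ)
    (hq1 : 1 ≤ q)
    (hq : Ergodic shift^[q] μ) (h1 : Ergodic shift μ) (hθ : Irrational θ) (hθ0 : 0 < θ)
    (u : C(UnitAddCircle, ℝ)) {f g : Seq m n → ℝ} (hfm : Measurable f) (hgm : Measurable g)
    (hf : ∀ x, f x ∈ Set.Icc (0 : ℝ) 1) (hg : ∀ x, g x ∈ Set.Icc (0 : ℝ) 1) :
    UniformlyAverages μ q θ (fun t x y => u t * f x * g y)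
      ((∫ t, u t) * (∫ x, f x ∂μ) * ∫ y, g y ∂μ) := by
  have hmean : ∀ (f : Seq m n → ℝ) (_ : ∀ x, f x ∈ Set.Icc (0 : ℝ) 1) (_ : Measurable f),
      ∫ x, f x ∂μ ∈ Set.Icc (0 : ℝ) 1 ∧ Integrable f μ := fun f hf hfm => by
    have hi : Integrable f μ := Integrable.of_bound hfm.aestronglyMeasurable 1
      (ae_of_all _ fun x => by rw [Real.norm_of_nonneg (hf x).1]; exact (hf x).2)
    refine ⟨⟨integral_nonneg fun x => (hf x).1, ?_⟩, hi⟩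
    exact (integral_mono hi (integrable_const 1) fun x => (hf x).2).trans_eq (by simp)
  obtain ⟨hfi, hfint⟩ := hmean f hf hfm
  obtain ⟨hgi, hgint⟩ := hmean g hg hgm
  set a := ∫ x, f x ∂μ with ha
  set b := ∫ x, g x ∂μ with hb
  set f₀ : Seq m n → ℝ := fun x => f x - a with hf₀
  set g₀ : Seq m n → ℝ := fun x => g x - b with hg₀
  have hf₀m : Measurable f₀ := hfm.sub_const a
  have hg₀m : Measurable g₀ := hgm.sub_const b
  have hf₀b : ∀ x, |f₀ x| ≤ 1 := fun x => abs_le.2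
    ⟨by simp only [hf₀]; linarith [(hf x).1, hfi.2], by simp only [hf₀]; linarith [(hf x).2, hfi.1]⟩
  have hg₀b : ∀ x, |g₀ x| ≤ 1 := fun x => abs_le.2
    ⟨by simp only [hg₀]; linarith [(hg x).1, hgi.2], by simp only [hg₀]; linarith [(hg x).2, hgi.1]⟩
  have hgb : ∀ x, |g x| ≤ 1 := fun x => by rw [abs_of_nonneg (hg x).1]; exact (hg x).2
  have hf₀i : ∫ x, f₀ x ∂μ = 0 := by
    simp only [hf₀]
    rw [integral_sub hfint (integrable_const _)]
    simp [ha]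
  have hg₀i : ∫ x, g₀ x ∂μ = 0 := by
    simp only [hg₀]
    rw [integral_sub hgint (integrable_const _)]
    simp [hb]
  have A1 := h.uniformlyAverages_zero hq1 hq h1 hθ hθ0 u hf₀m hgm hf₀b hgb (Or.inl hf₀i)
  have A2 := (h.uniformlyAverages_zero hq1 hq h1 hθ hθ0 u (f := fun _ => 1) measurable_const hg₀m
    (fun _ => by simp) hg₀b (Or.inr hg₀i)).const_mul a
  have A3 := (uniformlyAverages_rotation (μ := μ) (q := q) hθ u).const_mul (a * b)
  have hu : ∀ x, |u x| ≤ ‖u‖ := fun x => u.norm_coe_le_norm x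
  have A := (A1.add A2 (B := ‖u‖) (B' := |a| * ‖u‖) (fun t => ?_) (fun t => ?_) (fun t x y => ?_)
    (fun t x y => ?_)).add A3 (B := ‖u‖ + |a| * ‖u‖) (B' := |a * b| * ‖u‖) (fun t => ?_)
    (fun t => ?_) (fun t x y => ?_) (fun t x y => ?_)
  · convert! A using 1
    · funext t x y
      simp only [hf₀, hg₀]
      ring
    · ring
  · exact (show Measurable fun z : Seq m n × Seq m n => u t * f₀ z.1 * g z.2 by fun_prop)
  · exact (show Measurable fun z : Seq m n × Seq m n => a * (u t * 1 * g₀ z.2) by fun_prop)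
  · simp only [abs_mul]
    calc _ ≤ ‖u‖ * 1 * 1 := by gcongr; exacts [hu _, hf₀b _, hgb _]
      _ = _ := by ring
  · simp only [abs_mul, abs_one]
    calc _ ≤ |a| * (‖u‖ * 1 * 1) := by gcongr; exacts [hu _, hg₀b _]
      _ = _ := by ring
  · exact (show Measurable fun z : Seq m n × Seq m n => u t * f₀ z.1 * g z.2 +
      a * (u t * 1 * g₀ z.2) by fun_prop)
  · exact measurable_const
  · refine (abs_add_le _ _).trans ?_
    simp only [abs_mul, abs_one]
    calc _ ≤ ‖u‖ * 1 * 1 + |a| * (‖u‖ * 1 * 1) := by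
          gcongr; exacts [hu _, hf₀b _, hgb _, hu _, hg₀b _]
      _ = _ := by ring
  · rw [abs_mul]
    gcongr
    exact hu _

end Averages

end SymbolicCP
end

noncomputable section
namespace SymbolicCP

/-! ### Functions of the circle and of finitely many letters -/

section SimpleFunctions

variable {m n : ℕ} {μ : Measure (Seq m n)} {K : ENNReal} {p q : ℕ} {θ : ℝ} {a : ℕ}

/-- The function of the circle and of two prefixes given by a table of functions of the circle. -/
def tableFun (a : ℕ) (G : (Fin a → Fin m × Fin n) → (Fin a → Fin m × Fin n) → C(UnitAddCircle, ℝ))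
    (t : UnitAddCircle) (x y : Seq m n) : ℝ := G (prefixWord a x) (prefixWord a y) t

variable (G : (Fin a → Fin m × Fin n) → (Fin a → Fin m × Fin n) → C(UnitAddCircle, ℝ))

lemma measurable_tableFun (t : UnitAddCircle) : Measurable (Function.uncurry (tableFun a G t)) := by
  have h1 : Measurable fun z : Seq m n × Seq m n => (prefixWord a z.1, prefixWord a z.2) :=
    ((measurable_prefixWord a).comp measurable_fst).prodMk
      ((measurable_prefixWord a).comp measurable_snd)
  exact (measurable_of_countable fun w : (Fin a → Fin m × Fin n) × (Fin a → Fin m × Fin n) =>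
    G w.1 w.2 t).comp h1

lemma exists_tableFun_bound : ∃ B, 0 ≤ B ∧ ∀ t x y, |tableFun a G t x y| ≤ B := by
  refine ⟨∑ w, ∑ w', ‖G w w'‖, by positivity, fun t x y => ?_⟩
  refine ((G _ _).norm_coe_le_norm t).trans ?_
  refine (Finset.single_le_sum (f := fun w' => ‖G (prefixWord a x) w'‖)
    (fun _ _ => norm_nonneg _) (Finset.mem_univ _)).trans ?_
  exact Finset.single_le_sum (f := fun w => ∑ w', ‖G w w'‖)
    (fun _ _ => Finset.sum_nonneg fun _ _ => norm_nonneg _) (Finset.mem_univ _)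

/-- The indicator function of a word. -/
def wordInd (w : Fin a → Fin m × Fin n) : Seq m n → ℝ := (prefixWord a ⁻¹' {w}).indicator 1

lemma measurable_wordInd (w : Fin a → Fin m × Fin n) : Measurable (wordInd w) :=
  measurable_one.indicator (measurable_prefixWord a (measurableSet_singleton w))

lemma wordInd_mem_Icc (w : Fin a → Fin m × Fin n) (x : Seq m n) : wordInd w x ∈ Set.Icc (0 : ℝ) 1 := by
  unfold wordInd
  by_cases h : x ∈ prefixWord a ⁻¹' {w} <;> simp [h]

lemma wordInd_apply (w : Fin a → Fin m × Fin n) (x : Seq m n) :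
    wordInd w x = if w = prefixWord a x then 1 else 0 := by
  unfold wordInd
  by_cases h : prefixWord a x = w
  · simp [h]
  · simp [h, Ne.symm h]

lemma tableFun_eq_sum (t : UnitAddCircle) (x y : Seq m n) :
    tableFun a G t x y = ∑ w : (Fin a → Fin m × Fin n) × (Fin a → Fin m × Fin n),
      G w.1 w.2 t * wordInd w.1 x * wordInd w.2 y := by
  rw [Fintype.sum_prod_type]
  simp [wordInd_apply, tableFun]

lemma UniformlyAverages.sum [IsProbabilityMeasure μ] {ι : Type*} (S : Finset ι)
    {F : ι → UnitAddCircle → Seq m n → Seq m n → ℝ} {c B : ι → ℝ}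
    (hF : ∀ j, UniformlyAverages μ q θ (F j) (c j))
    (hFm : ∀ j t, Measurable (Function.uncurry (F j t)))
    (hFb : ∀ j t x y, |F j t x y| ≤ B j) :
    UniformlyAverages μ q θ (fun t x y => ∑ j ∈ S, F j t x y) (∑ j ∈ S, c j) := by
  classical
  induction S using Finset.induction_on with
  | empty =>
    intro ε hε
    exact ⟨0, fun M _ s _ => by simp [skewOrbit]; positivity⟩
  | insert j S hj ih =>
    simp only [Finset.sum_insert hj]
    refine (hF j).add ih (hFm j) (fun t => ?_) (hFb j) (B' := ∑ j ∈ S, B j) (fun t x y => ?_)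
    · exact Finset.measurable_fun_sum S fun i _ => hFm i t
    · exact (Finset.abs_sum_le_sum_abs _ _).trans (Finset.sum_le_sum fun i _ => hFb i t x y)

theorem IsQuasiBernoulli.uniformlyAverages_tableFun [IsProbabilityMeasure μ]
    (h : IsQuasiBernoulli K p μ) (hq1 : 1 ≤ q) (hq : Ergodic shift^[q] μ) (h1 : Ergodic shift μ)
    (hθ : Irrational θ) (hθ0 : 0 < θ) :
    UniformlyAverages μ q θ (tableFun a G)
      (∫ z, tableFun a G z.1 z.2.1 z.2.2 ∂((volume : Measure UnitAddCircle).prod (μ.prod μ))) := by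
  have hb : ∀ (w : (Fin a → Fin m × Fin n) × (Fin a → Fin m × Fin n)) t x y,
      |G w.1 w.2 t * wordInd w.1 x * wordInd w.2 y| ≤ ‖G w.1 w.2‖ := fun w t x y => by
    rw [abs_mul, abs_mul, abs_of_nonneg (wordInd_mem_Icc _ _).1,
      abs_of_nonneg (wordInd_mem_Icc _ _).1]
    calc _ ≤ ‖G w.1 w.2‖ * 1 * 1 :=
          mul_le_mul (mul_le_mul ((G w.1 w.2).norm_coe_le_norm t) (wordInd_mem_Icc _ _).2
            (wordInd_mem_Icc _ _).1 (norm_nonneg _)) (wordInd_mem_Icc _ _).2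
            (wordInd_mem_Icc _ _).1 (by positivity)
      _ = _ := by ring
  have hc : ∫ z, tableFun a G z.1 z.2.1 z.2.2 ∂((volume : Measure UnitAddCircle).prod (μ.prod μ)) =
      ∑ w : (Fin a → Fin m × Fin n) × (Fin a → Fin m × Fin n),
        (∫ t, G w.1 w.2 t) * (∫ x, wordInd w.1 x ∂μ) * ∫ y, wordInd w.2 y ∂μ := by
    simp only [tableFun_eq_sum]
    rw [integral_finsetSum]
    · refine Finset.sum_congr rfl fun w _ => ?_
      have e : ∀ z : UnitAddCircle × Seq m n × Seq m n,
          G w.1 w.2 z.1 * wordInd w.1 z.2.1 * wordInd w.2 z.2.2 =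
          G w.1 w.2 z.1 * (wordInd w.1 z.2.1 * wordInd w.2 z.2.2) := fun z => by ring
      simp only [e]
      rw [integral_prod_mul (μ := (volume : Measure UnitAddCircle)) (ν := μ.prod μ)
        (fun t => G w.1 w.2 t) (fun z : Seq m n × Seq m n => wordInd w.1 z.1 * wordInd w.2 z.2),
        integral_prod_mul (μ := μ) (ν := μ) (fun x => wordInd w.1 x) (fun y => wordInd w.2 y)]
      ring
    · intro w _
      refine Integrable.of_bound (Measurable.aestronglyMeasurable ?_) (‖G w.1 w.2‖)
        (ae_of_all _ fun z => hb w _ _ _)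
      exact ((((G w.1 w.2).continuous.measurable.comp measurable_fst).mul
        ((measurable_wordInd w.1).comp (measurable_fst.comp measurable_snd))).mul
        ((measurable_wordInd w.2).comp (measurable_snd.comp measurable_snd)))
  rw [hc]
  have hfun : tableFun a G = fun t x y => ∑ w : (Fin a → Fin m × Fin n) × (Fin a → Fin m × Fin n),
      G w.1 w.2 t * wordInd w.1 x * wordInd w.2 y := by
    funext t x y
    exact tableFun_eq_sum G t x y
  rw [hfun]
  refine UniformlyAverages.sum Finset.univ (B := fun w => ‖G w.1 w.2‖) (fun w => ?_)
    (fun w t => ?_) hb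
  · exact h.uniformlyAverages_mul hq1 hq h1 hθ hθ0 (G w.1 w.2) (measurable_wordInd _)
      (measurable_wordInd _) (wordInd_mem_Icc _) (wordInd_mem_Icc _)
  · exact ((((measurable_wordInd w.1).comp measurable_fst).const_mul _).mul
        ((measurable_wordInd w.2).comp measurable_snd))

end SimpleFunctions

/-! ### Transfer from independent pairs to the diagonal -/

section SlidingBlocks

variable {m n : ℕ} {μ : Measure (Seq m n)} {K : ENNReal} {p q : ℕ} {θ : ℝ} {a : ℕ}

/-- The value of `F` at the `k`-th step, when the origin of the sequences is moved back by `r`. -/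
def orbitVal (q : ℕ) (θ : ℝ) (r : ℕ) (F : UnitAddCircle → Seq m n → Seq m n → ℝ) (k : ℕ)
    (x y : Seq m n) : ℝ :=
  F ((k * θ : ℝ) : UnitAddCircle) (shift^[q * k - r] x) (shift^[⌊k * θ⌋₊ - r] y)

/-- From step `k` on, the values are those of the skew product started at the fractional part of `k
* θ` and at translated sequences. The offset `r` makes room for windows that reach into the past. -/
lemma orbitVal_add_eq_skewOrbit (hθ0 : 0 ≤ θ) {r k : ℕ} (h1 : r ≤ q * k) (h2 : r ≤ ⌊k * θ⌋₊)
    (F : UnitAddCircle → Seq m n → Seq m n → ℝ) (i : ℕ) (x y : Seq m n) :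
    orbitVal q θ r F (k + i) x y =
      skewOrbit q θ F (Int.fract (k * θ)) i (shift^[q * k - r] x, shift^[⌊k * θ⌋₊ - r] y) := by
  have e1 := floor_add_mul (s := 0) le_rfl hθ0 k i
  simp only [zero_add] at e1
  simp only [orbitVal, skewOrbit]
  rw [coe_fract_add, ← Function.iterate_add_apply, ← Function.iterate_add_apply, e1]
  have e2 : ((k + i : ℕ) : ℝ) * θ = k * θ + i * θ := by push_cast; ring
  have e3 : q * (k + i) - r = q * i + (q * k - r) := by rw [mul_add]; omega
  have e4 : ⌊k * θ⌋₊ + ⌊Int.fract (k * θ) + i * θ⌋₊ - r =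
      ⌊Int.fract (k * θ) + i * θ⌋₊ + (⌊k * θ⌋₊ - r) := by omega
  rw [e2, e3, e4]

lemma prefixWord_shift_congr {x x' : Seq m n} {i j a c : ℕ} (h : ∀ t, i ≤ t → t < j → x t = x' t)
    (h1 : i ≤ c) (h2 : c + a ≤ j) : prefixWord a (shift^[c] x) = prefixWord a (shift^[c] x') := by
  funext t
  have := t.2
  simp only [prefixWord, shift_iterate_apply]
  exact h _ (by omega) (by omega)

/-- For almost every point, most of the averages over blocks of a fixed large length along its
orbit are close to the mean. -/
theorem IsQuasiBernoulli.ae_eventually_sum_block_le [IsProbabilityMeasure μ]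
    (h : IsQuasiBernoulli K p μ) (hq1 : 1 ≤ q) (hθ : Irrational θ) (hθ0 : 0 < θ)
    (G : (Fin a → Fin m × Fin n) → (Fin a → Fin m × Fin n) → C(UnitAddCircle, ℝ)) {c : ℝ}
    (hG : UniformlyAverages μ q θ (tableFun a G) c) (r : ℕ) {ε : ℝ} (hε : 0 < ε) :
    ∃ M₀ : ℕ, ∀ M ≥ M₀, ∀ᵐ ω ∂μ, ∀ᶠ N : ℕ in atTop,
      ∑ k ∈ Finset.range N,
        |∑ i ∈ Finset.range M, orbitVal q θ r (tableFun a G) (k + i) ω ω - M * c| ≤ ε * M * N := by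
  have hK1 := h.upper.one_le
  set κ := K.toReal with hκ
  have hκ1 : 1 ≤ κ := by
    rw [hκ, ← ENNReal.toReal_one]
    exact ENNReal.toReal_mono h.ne_top hK1
  obtain ⟨M₀, hM₀⟩ := hG (ε / (5 * κ ^ 2)) (by positivity)
  refine ⟨max M₀ 1, fun M hM => ?_⟩
  have hM0 : M₀ ≤ M := (le_max_left _ _).trans hM
  have hM1 : 1 ≤ M := (le_max_right _ _).trans hM
  have hMpos : (0 : ℝ) < M := by exact_mod_cast hM1
  obtain ⟨B, hB0, hB⟩ := exists_tableFun_bound G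
  set D : ℝ := M * (B + |c|) + 1 with hD
  have hD0 : 0 < D := by positivity
  set S : ℕ → Seq m n → Seq m n → ℝ := fun k x y =>
    |∑ i ∈ Finset.range M, orbitVal q θ r (tableFun a G) (k + i) x y - M * c| with hS
  have hSm : ∀ k, Measurable (Function.uncurry (S k)) := fun k => by
    have : ∀ i, Measurable fun z : Seq m n × Seq m n =>
        orbitVal q θ r (tableFun a G) (k + i) z.1 z.2 := fun i =>
      (measurable_tableFun G _).comp (((measurable_shift_iterate _).comp measurable_fst).prodMk
        ((measurable_shift_iterate _).comp measurable_snd))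
    have h2 : Measurable fun z : Seq m n × Seq m n =>
        ∑ i ∈ Finset.range M, orbitVal q θ r (tableFun a G) (k + i) z.1 z.2 - M * c :=
      (Finset.measurable_fun_sum _ fun i _ => this i).sub_const _
    exact continuous_abs.measurable.comp h2
  have hSD : ∀ k x y, S k x y ≤ D := fun k x y => by
    simp only [hS]
    calc _ ≤ |∑ i ∈ Finset.range M, orbitVal q θ r (tableFun a G) (k + i) x y| + |M * c| :=
          abs_sub _ _
      _ ≤ M * B + M * |c| := by
          gcongr
          · refine (Finset.abs_sum_le_sum_abs _ _).trans ?_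
            refine (Finset.sum_le_sum fun i _ => hB _ _ _).trans_eq ?_
            simp
          · rw [abs_mul, Nat.abs_cast]
      _ ≤ D := by rw [hD]; linarith
  -- `C` bounds the distance from `q * k`, and from `⌊k * θ⌋₊`, of all letters read in a block of
  -- `M` steps.
  obtain ⟨C, hC⟩ : ∃ C : ℕ, C = r + q * M + a + ⌊M * θ⌋₊ + 1 := ⟨_, rfl⟩
  have hdep : ∀ k : ℕ, DependsOnWindows (⌊(q : ℝ) * k⌋₊ - (Nat.sqrt k + C))
      (⌊(q : ℝ) * k⌋₊ + (Nat.sqrt k + C)) (⌊θ * k⌋₊ - (Nat.sqrt k + C))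
      (⌊θ * k⌋₊ + (Nat.sqrt k + C)) fun x y => S k x y / D := fun k => by
    have e1 : ⌊(q : ℝ) * k⌋₊ = q * k := by rw [← Nat.cast_mul, Nat.floor_natCast]
    rw [e1, mul_comm θ]
    constructor
    · intro x x' y hx
      simp only [hS]
      congr 3
      refine Finset.sum_congr rfl fun i hi => ?_
      have hi := Finset.mem_range.1 hi
      simp only [orbitVal, tableFun]
      have : q * i ≤ q * M := Nat.mul_le_mul_left _ hi.le
      rw [prefixWord_shift_congr hx (by rw [mul_add]; omega) (by rw [mul_add]; omega)]
    · intro x y y' hy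
      simp only [hS]
      congr 3
      refine Finset.sum_congr rfl fun i hi => ?_
      have hi := Finset.mem_range.1 hi
      simp only [orbitVal, tableFun]
      have hl : ⌊(k : ℝ) * θ⌋₊ ≤ ⌊((k + i : ℕ) : ℝ) * θ⌋₊ := Nat.floor_le_floor (by
        gcongr
        omega)
      have hu : ⌊((k + i : ℕ) : ℝ) * θ⌋₊ ≤ ⌊(k : ℝ) * θ⌋₊ + ⌊M * θ⌋₊ + 1 := by
        have h1 := Nat.lt_floor_add_one ((k : ℝ) * θ)
        have h2 := Nat.lt_floor_add_one ((M : ℝ) * θ)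
        have h3 : (i : ℝ) * θ ≤ M * θ := by gcongr
        rw [← Nat.lt_succ_iff, Nat.floor_lt (by positivity)]
        push_cast
        linarith
      rw [prefixWord_shift_congr hy (by omega) (by omega)]
  have hev : ∀ᶠ k : ℕ in atTop, ∫ x, ∫ y, S k x y / D ∂μ ∂μ ≤ ε / (5 * κ ^ 2) * M / D := by
    obtain ⟨k₀, hk₀⟩ := exists_nat_ge (r / θ)
    rw [div_le_iff₀ hθ0] at hk₀
    filter_upwards [eventually_ge_atTop k₀, eventually_ge_atTop r] with k hk hkr
    have h1 : r ≤ q * k := hkr.trans (Nat.le_mul_of_pos_left k hq1)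
    have h2 : r ≤ ⌊k * θ⌋₊ := Nat.le_floor (hk₀.trans (by gcongr))
    have hi : Integrable (Function.uncurry fun x y => S k x y / D) (μ.prod μ) :=
      Integrable.of_bound ((hSm k).div_const D).aestronglyMeasurable 1 (ae_of_all _ fun z => by
        rw [Function.uncurry, Real.norm_of_nonneg (div_nonneg (abs_nonneg _) hD0.le)]
        exact div_le_one_of_le₀ (hSD _ _ _) hD0.le)
    rw [integral_integral hi, integral_div]
    refine div_le_div_of_nonneg_right ?_ hD0.le
    refine le_trans (le_of_eq ?_) (hM₀ M hM0 (Int.fract (k * θ)) (Int.fract_nonneg _))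
    -- Translating the two variables by different amounts preserves the product measure, so only the
    -- fractional part of `k * θ` still depends on `k`.
    have hmp := (h.invariant.iterate (q * k - r)).prod (h.invariant.iterate (⌊k * θ⌋₊ - r))
    have hm' : Measurable fun z =>
        |∑ i ∈ Finset.range M, skewOrbit q θ (tableFun a G) (Int.fract (k * θ)) i z - M * c| := by
      refine continuous_abs.measurable.comp (Measurable.sub_const ?_ _)
      exact Finset.measurable_fun_sum _ fun i _ => measurable_skewOrbit (measurable_tableFun G) _ i
    rw [← integral_comp_measurePreserving hmp hm'.aestronglyMeasurable]
    simp only [hS, orbitVal_add_eq_skewOrbit hθ0.le h1 h2]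
    rfl
  have hne : (q : ℝ) ≠ θ := fun hqθ => hθ ⟨q, by simpa using hqθ⟩
  have key := h.upper.ae_eventually_sum_le_of_ne h.ne_top h.invariant
    (by exact_mod_cast hq1 : (0 : ℝ) < q) hθ0 hne (ε := ε / (5 * κ ^ 2) * M / D) (by positivity)
    (e := fun k x y => S k x y / D) (fun k => (hSm k).div_const D)
    (fun k x y => div_nonneg (abs_nonneg _) hD0.le)
    (fun k x y => div_le_one_of_le₀ (hSD _ _ _) hD0.le) hdep hev
  filter_upwards [key] with ω hω
  filter_upwards [hω] with N hN
  rw [← Finset.sum_div, div_le_iff₀ hD0] at hN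
  refine hN.trans_eq ?_
  rw [← hκ]
  field_simp

/-- Summing over all blocks of length `M` counts every term `M` times, except near the two ends. -/
lemma abs_sum_sub_le_of_block {f : ℕ → ℝ} {B c : ℝ} (hB : ∀ k, |f k| ≤ B) (M N : ℕ) :
    |M * ∑ k ∈ Finset.range N, f k - M * (N * c)| ≤
      ∑ k ∈ Finset.range N, |∑ i ∈ Finset.range M, f (k + i) - M * c| + 2 * M ^ 2 * B := by
  have hB0 : 0 ≤ B := (abs_nonneg _).trans (hB 0)
  have h1 : ∀ i ∈ Finset.range M, |∑ k ∈ Finset.range N, f k - ∑ k ∈ Finset.range N, f (k + i)| ≤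
      2 * M * B := fun i hi => by
    have hi := Finset.mem_range.1 hi
    have e1 := Finset.sum_range_add f N i
    have e2 := Finset.sum_range_add f i N
    rw [add_comm i N] at e2
    simp only [add_comm i] at e2
    have e3 : ∑ k ∈ Finset.range N, f k - ∑ k ∈ Finset.range N, f (k + i) =
        ∑ k ∈ Finset.range i, f k - ∑ k ∈ Finset.range i, f (N + k) := by linarith
    rw [e3]
    have e4 : ∀ g : ℕ → ℝ, (∀ k, |g k| ≤ B) → |∑ k ∈ Finset.range i, g k| ≤ M * B := fun g hg => by
      refine (Finset.abs_sum_le_sum_abs _ _).trans ?_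
      refine (Finset.sum_le_sum fun k _ => hg k).trans ?_
      simp only [Finset.sum_const, Finset.card_range, nsmul_eq_mul]
      gcongr
    calc _ ≤ _ := abs_sub _ _
      _ ≤ M * B + M * B := add_le_add (e4 _ hB) (e4 _ fun k => hB _)
      _ = 2 * M * B := by ring
  have e : M * ∑ k ∈ Finset.range N, f k - M * (N * c) =
      ∑ i ∈ Finset.range M, (∑ k ∈ Finset.range N, f k - ∑ k ∈ Finset.range N, f (k + i)) +
      ∑ k ∈ Finset.range N, (∑ i ∈ Finset.range M, f (k + i) - M * c) := by
    have hcomm := Finset.sum_comm (s := Finset.range M) (t := Finset.range N)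
      (f := fun i k => f (k + i))
    rw [Finset.sum_sub_distrib, Finset.sum_sub_distrib, hcomm, Finset.sum_const, Finset.sum_const,
      Finset.card_range, Finset.card_range, nsmul_eq_mul, nsmul_eq_mul]
    ring
  rw [e]
  refine (abs_add_le _ _).trans ?_
  rw [add_comm]
  refine add_le_add (Finset.abs_sum_le_sum_abs _ _) ?_
  refine (Finset.abs_sum_le_sum_abs _ _).trans ((Finset.sum_le_sum h1).trans_eq ?_)
  simp only [Finset.sum_const, Finset.card_range, nsmul_eq_mul]
  ring

/-- Almost every orbit equidistributes. -/
theorem IsQuasiBernoulli.ae_tendsto_orbitVal [IsProbabilityMeasure μ]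
    (h : IsQuasiBernoulli K p μ) (hq1 : 1 ≤ q) (hθ : Irrational θ) (hθ0 : 0 < θ)
    (G : (Fin a → Fin m × Fin n) → (Fin a → Fin m × Fin n) → C(UnitAddCircle, ℝ)) {c : ℝ}
    (hG : UniformlyAverages μ q θ (tableFun a G) c) (r : ℕ) :
    ∀ᵐ ω ∂μ, ∀ ε > 0, ∀ᶠ N : ℕ in atTop,
      |∑ k ∈ Finset.range N, orbitVal q θ r (tableFun a G) k ω ω - N * c| ≤ ε * N := by
  obtain ⟨B, hB0, hB⟩ := exists_tableFun_bound G
  have key : ∀ j : ℕ, ∀ᵐ ω ∂μ, ∀ᶠ N : ℕ in atTop,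
      |∑ k ∈ Finset.range N, orbitVal q θ r (tableFun a G) k ω ω - N * c| ≤
        (1 / (j + 1) : ℝ) * N := fun j => by
    set ε : ℝ := 1 / (j + 1) with hε
    have hε0 : 0 < ε := by positivity
    obtain ⟨M₀, hM₀⟩ := h.ae_eventually_sum_block_le hq1 hθ hθ0 G hG r (ε := ε / 2) (by positivity)
    set M := max M₀ 1 with hM
    have hMpos : (0 : ℝ) < M := by exact_mod_cast le_max_right M₀ 1
    obtain ⟨N₀, hN₀⟩ := exists_nat_ge (2 * M * B / (ε / 2))
    rw [div_le_iff₀ (by positivity)] at hN₀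
    filter_upwards [hM₀ M (le_max_left _ _)] with ω hω
    filter_upwards [hω, eventually_ge_atTop N₀] with N hN hNN
    have h1 := abs_sum_sub_le_of_block (f := fun k => orbitVal q θ r (tableFun a G) k ω ω) (c := c)
      (fun k => hB _ _ _) M N
    rw [← mul_sub, abs_mul, Nat.abs_cast] at h1
    refine le_of_mul_le_mul_left (h1.trans ?_) hMpos
    have h2 : (N₀ : ℝ) ≤ N := by exact_mod_cast hNN
    have h3 : 2 * M * B ≤ N * (ε / 2) := hN₀.trans (by gcongr)
    have h4 : M * (2 * M * B) ≤ M * (N * (ε / 2)) := by gcongr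
    nlinarith
  filter_upwards [ae_all_iff.2 key] with ω hω ε hε
  obtain ⟨j, hj⟩ := exists_nat_one_div_lt hε
  filter_upwards [hω j] with N hN
  exact hN.trans (by gcongr)

end SlidingBlocks

end SymbolicCP
end

noncomputable section
namespace SymbolicCP

/-! ### Kronecker's lemma and summable errors -/

section Kronecker

/-- Kronecker's lemma: beyond `k₀` the tail of the series is at most `ε / 2`, and the factors `k +
1` are at most `N`. -/
lemma eventually_sum_mul_le {g : ℕ → ℝ} (hg0 : ∀ k, 0 ≤ g k) (hg : Summable g) {ε : ℝ}
    (hε : 0 < ε) : ∀ᶠ N : ℕ in atTop, ∑ k ∈ Finset.range N, (k + 1) * g k ≤ ε * N := by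
  obtain ⟨k₀, hk₀⟩ := ((tendsto_sum_nat_add g).eventually_le_const
    (show (0 : ℝ) < ε / 2 by positivity)).exists
  set C := ∑ k ∈ Finset.range k₀, (k + 1) * g k with hC
  obtain ⟨N₀, hN₀⟩ := exists_nat_ge (C / (ε / 2))
  rw [div_le_iff₀ (by positivity)] at hN₀
  filter_upwards [eventually_ge_atTop N₀, eventually_ge_atTop k₀] with N hN hNk
  obtain ⟨j, rfl⟩ := Nat.exists_eq_add_of_le hNk
  rw [Finset.sum_range_add]
  have h1 : ∑ i ∈ Finset.range j, g (k₀ + i) ≤ ε / 2 := by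
    refine le_trans ?_ hk₀
    simp only [add_comm k₀]
    exact ((summable_nat_add_iff k₀).2 hg).sum_le_tsum _ fun i _ => hg0 _
  have h2 : ∑ i ∈ Finset.range j, (((k₀ + i : ℕ) : ℝ) + 1) * g (k₀ + i) ≤
      (k₀ + j : ℕ) * ∑ i ∈ Finset.range j, g (k₀ + i) := by
    rw [Finset.mul_sum]
    refine Finset.sum_le_sum fun i hi => mul_le_mul_of_nonneg_right ?_ (hg0 _)
    have := Finset.mem_range.1 hi
    exact_mod_cast (by omega : k₀ + i + 1 ≤ k₀ + j)
  have h3 : ((k₀ + j : ℕ) : ℝ) * ∑ i ∈ Finset.range j, g (k₀ + i) ≤ (k₀ + j : ℕ) * (ε / 2) := by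
    gcongr
  have h4 : (N₀ : ℝ) * (ε / 2) ≤ (k₀ + j : ℕ) * (ε / 2) := by gcongr
  linarith

/-- No independence is needed: the series of the `D k / (k + 1)` has finite mean, so it converges
almost surely. -/
lemma ae_eventually_sum_le_of_summable {Ω : Type*} [MeasurableSpace Ω] {P : Measure Ω}
    [IsFiniteMeasure P] {D : ℕ → Ω → ℝ} (hm : ∀ k, Measurable (D k)) (h0 : ∀ k ω, 0 ≤ D k ω)
    (h1 : ∀ k ω, D k ω ≤ 1) (hs : Summable fun k : ℕ => (∫ ω, D k ω ∂P) / (k + 1)) :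
    ∀ᵐ ω ∂P, ∀ ε > 0, ∀ᶠ N : ℕ in atTop, ∑ k ∈ Finset.range N, D k ω ≤ ε * N := by
  have hi : ∀ k, Integrable (D k) P := fun k =>
    Integrable.of_bound (hm k).aestronglyMeasurable 1 (ae_of_all _ fun ω => by
      rw [Real.norm_of_nonneg (h0 k ω)]; exact h1 k ω)
  have hfin : ∫⁻ ω, ∑' k : ℕ, ENNReal.ofReal (D k ω / (k + 1)) ∂P ≠ ⊤ := by
    rw [lintegral_tsum fun k => ((hm k).div_const _).ennreal_ofReal.aemeasurable]
    have : ∀ k : ℕ, ∫⁻ ω, ENNReal.ofReal (D k ω / (k + 1)) ∂P =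
        ENNReal.ofReal ((∫ ω, D k ω ∂P) / (k + 1)) := fun k => by
      rw [← integral_div, ofReal_integral_eq_lintegral_ofReal ((hi k).div_const _)
        (ae_of_all _ fun ω => div_nonneg (h0 k ω) (by positivity))]
    simp only [this]
    exact hs.tsum_ofReal_ne_top
  have hmeas : Measurable fun ω => ∑' k : ℕ, ENNReal.ofReal (D k ω / (k + 1)) :=
    Measurable.tsum fun k => ((hm k).div_const _).ennreal_ofReal
  filter_upwards [ae_lt_top hmeas hfin] with ω hω ε hε
  have hsum : Summable fun k : ℕ => D k ω / (k + 1) := by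
    have := ENNReal.summable_toReal hω.ne
    refine this.congr fun k => ?_
    rw [ENNReal.toReal_ofReal (div_nonneg (h0 k ω) (by positivity))]
  filter_upwards [eventually_sum_mul_le (fun k => div_nonneg (h0 k ω) (by positivity)) hsum hε]
    with N hN
  refine le_trans (le_of_eq ?_) hN
  refine Finset.sum_congr rfl fun k _ => ?_
  field_simp

/-- The terms are of order `k ^ (-5 / 4)`. They arise from the memory loss bound `C / √r` with
windows of length `r = Nat.sqrt k`. -/
lemma summable_div_sqrt_sqrt (C : ℝ) :
    Summable fun k : ℕ => C / √(Nat.sqrt k : ℝ) / (k + 1) := by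
  have hs : Summable fun k : ℕ => 1 / ((k + 1 : ℕ) : ℝ) ^ (5 / 4 : ℝ) :=
    (summable_nat_add_iff 1).2 (Real.summable_one_div_nat_rpow.2 (by norm_num))
  have hs2 : Summable fun k : ℕ => 1 / √(Nat.sqrt k : ℝ) / (k + 1) := by
    refine (hs.mul_left 2).of_nonneg_of_le (fun k => by positivity) fun k => ?_
    rcases Nat.eq_zero_or_pos k with rfl | hk
    · simp
    have h1 : 1 ≤ Nat.sqrt k := Nat.sqrt_pos.2 hk
    have h2 : k + 1 ≤ 4 * (Nat.sqrt k * Nat.sqrt k) := by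
      have := Nat.lt_succ_sqrt k
      have h3 : k < (Nat.sqrt k + 1) * (Nat.sqrt k + 1) := this
      nlinarith
    have h3 : ((k + 1 : ℕ) : ℝ) ≤ 4 * (Nat.sqrt k : ℝ) ^ 2 := by
      rw [sq]; exact_mod_cast h2
    have h4 : ((k + 1 : ℕ) : ℝ) ^ (1 / 4 : ℝ) ≤ 2 * √(Nat.sqrt k : ℝ) := by
      have hs0 : (0 : ℝ) ≤ Nat.sqrt k := by positivity
      have e : (2 * √(Nat.sqrt k : ℝ)) ^ 4 = 16 * (Nat.sqrt k : ℝ) ^ 2 := by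
        rw [mul_pow, show (4 : ℕ) = 2 * 2 by norm_num, pow_mul (√(Nat.sqrt k : ℝ)),
          Real.sq_sqrt hs0]
        norm_num
      have h5 : (((k + 1 : ℕ) : ℝ) ^ (1 / 4 : ℝ)) ^ 4 = ((k + 1 : ℕ) : ℝ) := by
        rw [← Real.rpow_natCast, ← Real.rpow_mul (by positivity)]
        norm_num
      refine le_of_pow_le_pow_left₀ (n := 4) (by norm_num) (by positivity) ?_
      rw [h5, e]
      have : (0 : ℝ) ≤ (Nat.sqrt k : ℝ) ^ 2 := by positivity
      linarith
    have hsp : 0 < √(Nat.sqrt k : ℝ) := Real.sqrt_pos.2 (by exact_mod_cast h1)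
    have h6 : ((k + 1 : ℕ) : ℝ) ^ (5 / 4 : ℝ) = ((k + 1 : ℕ) : ℝ) * ((k + 1 : ℕ) : ℝ) ^ (1 / 4 : ℝ) := by
      rw [show (5 / 4 : ℝ) = 1 + 1 / 4 by norm_num, Real.rpow_add (by positivity), Real.rpow_one]
    rw [h6, div_div, mul_one_div, div_le_div_iff₀ (by positivity) (by positivity)]
    push_cast at h4 ⊢
    have : (0 : ℝ) ≤ k + 1 := by positivity
    nlinarith
  refine (hs2.mul_left C).congr fun k => ?_
  ring

end Kronecker

/-! ### Conditional laws along a typical sequence -/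

section LocalStructure

variable {m n : ℕ} {μ : Measure (Seq m n)} {K : ENNReal}

lemma integral_abs_condP_sub_le [IsProbabilityMeasure μ] {S S' : Finset (Bool × ℕ)}
    {V : Set (Seq m n)} (hV : MeasurableSet V) :
    ∫ ω, |condP μ S' V ω - condP μ S V ω| ∂μ ≤ √(sqDist μ S S' (V.indicator 1)) := by
  refine integral_abs_le_sqrt (B := 1) ?_ fun ω => ?_
  · exact ((constOnCells_avg S' _).continuous.sub
      (constOnCells_avg S _).continuous).aestronglyMeasurable
  · rw [abs_le]
    constructor <;> linarith [condP_nonneg (μ := μ) S hV ω, condP_nonneg (μ := μ) S' hV ω,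
      condP_le_one (μ := μ) S hV ω, condP_le_one (μ := μ) S' hV ω]

lemma measurable_condP (S : Finset (Bool × ℕ)) (V : Set (Seq m n)) : Measurable (condP μ S V) :=
  (constOnCells_avg S _).continuous.measurable

lemma condP_congr_of_timesIn {S : Finset (Bool × ℕ)} {i j : ℕ} (hS : TimesIn S i j)
    (V : Set (Seq m n)) {x x' : Seq m n} (h : ∀ t, i ≤ t → t < j → x t = x' t) :
    condP μ S V x = condP μ S V x' :=
  constOnCells_avg S _ x' x fun t ht => coord_congr (h _ (hS t ht).1 (hS t ht).2)

/-- Almost surely the conditional probability of an event given a long window is close on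
average to that given a short window. -/
lemma UpperQuasiBernoulli.ae_eventually_sum_condP_sub_le [IsProbabilityMeasure μ]
    (h : UpperQuasiBernoulli K μ) (hK : K ≠ ⊤) (hinv : MeasurePreserving shift μ μ)
    {β γ : ℝ} (hβ : 0 < β) (hγ : 0 < γ) (hne : β ≠ γ) {r : ℕ} {S S' : ℕ → Finset (Bool × ℕ)}
    {V : ℕ → Set (Seq m n)} (hV : ∀ k, MeasurableSet (V k))
    (hS : ∀ k : ℕ, TimesIn (S k) (⌊β * k⌋₊ - (Nat.sqrt k + r)) (⌊β * k⌋₊ + (Nat.sqrt k + r)))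
    (hS' : ∀ k : ℕ, TimesIn (S' k) (⌊β * k⌋₊ - (Nat.sqrt k + r)) (⌊β * k⌋₊ + (Nat.sqrt k + r)))
    {ε : ℝ} (hε : 0 < ε)
    (hD : ∀ᶠ k in atTop, sqDist μ (S k) (S' k) ((V k).indicator 1) ≤ (ε / (5 * K.toReal ^ 2)) ^ 2) :
    ∀ᵐ ω ∂μ, ∀ᶠ N : ℕ in atTop,
      ∑ k ∈ Finset.range N, |condP μ (S' k) (V k) ω - condP μ (S k) (V k) ω| ≤ ε * N := by
  set κ := K.toReal with hκ
  have hκ1 : 1 ≤ κ := by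
    rw [hκ, ← ENNReal.toReal_one]
    exact ENNReal.toReal_mono hK h.one_le
  have key := h.ae_eventually_sum_le_of_ne hK hinv hβ hγ hne (ε := ε / (5 * κ ^ 2)) (by positivity)
    (e := fun k x _ => |condP μ (S' k) (V k) x - condP μ (S k) (V k) x|) (fun k => ?_)
    (fun k x y => abs_nonneg _) (fun k x y => ?_) (C := r) (fun k => ⟨fun x x' y hx => ?_,
      fun x y y' hy => rfl⟩) (hD.mono fun k hk => ?_)
  · filter_upwards [key] with ω hω
    filter_upwards [hω] with N hN
    refine hN.trans_eq ?_
    rw [← hκ]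
    field_simp
  · exact continuous_abs.measurable.comp (((measurable_condP _ _).comp measurable_fst).sub
      ((measurable_condP _ _).comp measurable_fst))
  · rw [abs_le]
    constructor <;> linarith [condP_nonneg (μ := μ) (S k) (hV k) x,
      condP_nonneg (μ := μ) (S' k) (hV k) x, condP_le_one (μ := μ) (S k) (hV k) x,
      condP_le_one (μ := μ) (S' k) (hV k) x]
  · rw [condP_congr_of_timesIn (hS k) _ hx, condP_congr_of_timesIn (hS' k) _ hx]
  · simp only [integral_const, probReal_univ, one_smul]
    refine (integral_abs_condP_sub_le (hV k)).trans ?_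
    exact (Real.sqrt_le_sqrt hk).trans_eq (Real.sqrt_sq (by positivity))

lemma le_of_natSub_mul_sq_le {a r r₀ : ℕ} {D κ ε : ℝ} (hε : 0 < ε)
    (hr₀ : a * κ ^ 2 / ε ^ 2 + 1 ≤ r₀) (hr : r₀ + a ≤ r)
    (h : (r - a : ℕ) * D ^ 2 ≤ a * κ ^ 2) : D ≤ ε := by
  by_contra hcon
  push Not at hcon
  have h1 : (r₀ : ℝ) ≤ (r - a : ℕ) := by exact_mod_cast (by omega : r₀ ≤ r - a)
  have h2 : ε ^ 2 < D ^ 2 := by gcongr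
  have h3 : (a * κ ^ 2 / ε ^ 2 + 1) * ε ^ 2 = a * κ ^ 2 + ε ^ 2 := by field_simp
  have h4 : (a * κ ^ 2 / ε ^ 2 + 1) * ε ^ 2 ≤ r₀ * ε ^ 2 := by gcongr
  have h5 : (r₀ : ℝ) * ε ^ 2 ≤ (r - a : ℕ) * D ^ 2 := by gcongr
  have h6 : 0 < ε ^ 2 := by positivity
  linarith

/-- Eventually, windows of length `Nat.sqrt k` satisfy the side conditions of the memory loss
estimates. -/
lemma eventually_separated {β γ : ℝ} (hγ : 0 < γ) (hβ : γ < β) (r : ℕ) :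
    ∀ᶠ k : ℕ in atTop, r ≤ Nat.sqrt k ∧ Nat.sqrt k ≤ ⌊γ * k⌋₊ ∧ ⌊γ * k⌋₊ + Nat.sqrt k ≤ ⌊β * k⌋₊ ∧
      1 ≤ Nat.sqrt k := by
  obtain ⟨s₀, hs₀⟩ := exists_nat_ge (max (1 / γ) (1 / (β - γ)))
  have h1 := (le_max_left _ _).trans hs₀
  have h2 := (le_max_right _ _).trans hs₀
  rw [div_le_iff₀ hγ] at h1
  rw [div_le_iff₀ (by linarith)] at h2
  filter_upwards [eventually_ge_atTop (r ^ 2 + (s₀ + 1) ^ 2)] with k hk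
  have hs : s₀ + 1 ≤ Nat.sqrt k := Nat.le_sqrt'.2 (by omega)
  have hsr : (s₀ : ℝ) ≤ Nat.sqrt k := by exact_mod_cast (Nat.le_succ _).trans hs
  have hsq : (Nat.sqrt k : ℝ) * Nat.sqrt k ≤ k := by exact_mod_cast Nat.sqrt_le k
  have e1 : (Nat.sqrt k : ℝ) ≤ γ * k := by
    have : 1 ≤ Nat.sqrt k * γ := h1.trans (by gcongr)
    have h3 : (Nat.sqrt k : ℝ) * 1 ≤ Nat.sqrt k * (Nat.sqrt k * γ) := by gcongr
    nlinarith
  have e2 : (Nat.sqrt k : ℝ) ≤ (β - γ) * k := by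
    have hbg : 0 < β - γ := by linarith
    have : 1 ≤ Nat.sqrt k * (β - γ) := h2.trans (by gcongr)
    have h3 : (Nat.sqrt k : ℝ) * 1 ≤ Nat.sqrt k * (Nat.sqrt k * (β - γ)) := by gcongr
    nlinarith
  refine ⟨Nat.le_sqrt'.2 (by omega), Nat.le_floor e1, ?_, by omega⟩
  rw [← Nat.floor_add_natCast (by positivity)]
  exact Nat.floor_le_floor (by linarith)

/-- Almost surely, the conditional law of the future given the past of different lengths in the
two coordinates is close on average to a product of conditional laws given short windows. -/
theorem UpperQuasiBernoulli.exists_ae_eventually_sum_condP_biBox_sub_le [IsProbabilityMeasure μ]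
    (h : UpperQuasiBernoulli K μ) (hK : K ≠ ⊤) (hinv : MeasurePreserving shift μ μ)
    {β γ : ℝ} (hγ : 0 < γ) (hβ : γ < β) (b : Bool) (a : ℕ) {ε : ℝ} (hε : 0 < ε) :
    ∃ r₀ : ℕ, ∀ r ≥ r₀, ∀ η η' : Seq m n, ∀ᵐ ω ∂μ, ∀ᶠ N : ℕ in atTop,
      ∑ k ∈ Finset.range N,
        |condP μ (biBox b ⌊β * k⌋₊ ⌊γ * k⌋₊) (shift^[⌊β * k⌋₊] ⁻¹' cell (box b 0 a) η ∩
            shift^[⌊γ * k⌋₊] ⁻¹' cell (box (!b) 0 a) η') ω -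
          condP μ (farBox b ⌊β * k⌋₊ r) (shift^[⌊β * k⌋₊] ⁻¹' cell (box b 0 a) η) ω *
          condP μ (nearBox b ⌊γ * k⌋₊ r) (shift^[⌊γ * k⌋₊] ⁻¹' cell (box (!b) 0 a) η') ω| ≤
        ε * N := by
  set κ := K.toReal with hκ
  have hκ1 : 1 ≤ κ := by
    rw [hκ, ← ENNReal.toReal_one]
    exact ENNReal.toReal_mono hK h.one_le
  set δ : ℝ := (ε / 4 / (5 * κ ^ 2)) ^ 2 with hδ
  have hδ0 : 0 < δ := by positivity
  obtain ⟨r₀, hr₀⟩ := exists_nat_ge (a * κ ^ 2 / δ ^ 2 + 1)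
  obtain ⟨C, hC0, hC⟩ := exists_integral_condP_biBox_le h hK hinv a
  have hβ0 : 0 < β := hγ.trans hβ
  -- Two scales are used. For windows of the growing length `Nat.sqrt k` the mean square errors are
  -- summable against `1 / k`. The error of passing to the fixed length `r` need not tend to zero,
  -- but it has small mean and depends on windows of size about `Nat.sqrt k`, so the decoupling
  -- theorem applies to it.
  refine ⟨r₀ + a, fun r hr η η' => ?_⟩
  set V : ℕ → Set (Seq m n) := fun k => shift^[⌊β * k⌋₊] ⁻¹' cell (box b 0 a) η with hV
  set W : ℕ → Set (Seq m n) := fun k => shift^[⌊γ * k⌋₊] ⁻¹' cell (box (!b) 0 a) η' with hW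
  have hVm : ∀ k, MeasurableSet (V k) := fun k =>
    measurable_shift_iterate _ (measurableSet_cell _ _)
  have hWm : ∀ k, MeasurableSet (W k) := fun k =>
    measurable_shift_iterate _ (measurableSet_cell _ _)
  set X : ℕ → Seq m n → ℝ := fun k => condP μ (biBox b ⌊β * k⌋₊ ⌊γ * k⌋₊) (V k ∩ W k) with hX
  set Pf : ℕ → ℕ → Seq m n → ℝ := fun r k => condP μ (farBox b ⌊β * k⌋₊ r) (V k) with hPf
  set Pn : ℕ → ℕ → Seq m n → ℝ := fun r k => condP μ (nearBox b ⌊γ * k⌋₊ r) (W k) with hPn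
  have bf : ∀ r k ω, Pf r k ω ∈ Set.Icc (0 : ℝ) 1 := fun r k ω =>
    ⟨condP_nonneg _ (hVm k) ω, condP_le_one _ (hVm k) ω⟩
  have bn : ∀ r k ω, Pn r k ω ∈ Set.Icc (0 : ℝ) 1 := fun r k ω =>
    ⟨condP_nonneg _ (hWm k) ω, condP_le_one _ (hWm k) ω⟩
  have bX : ∀ k ω, X k ω ∈ Set.Icc (0 : ℝ) 1 := fun k ω =>
    ⟨condP_nonneg _ ((hVm k).inter (hWm k)) ω, condP_le_one _ ((hVm k).inter (hWm k)) ω⟩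
  -- windows of growing length
  have step1 : ∀ᵐ ω ∂μ, ∀ ε > 0, ∀ᶠ N : ℕ in atTop, ∑ k ∈ Finset.range N,
      (X k ω - Pf (Nat.sqrt k) k ω * Pn (Nat.sqrt k) k ω) ^ 2 ≤ ε * N := by
    refine ae_eventually_sum_le_of_summable (fun k => ?_) (fun k ω => sq_nonneg _) (fun k ω => ?_) ?_
    · exact ((measurable_condP _ _).sub ((measurable_condP _ _).mul (measurable_condP _ _))).pow_const 2
    · rw [sq_le_one_iff_abs_le_one, abs_le]
      have h1 := mul_nonneg (bf (Nat.sqrt k) k ω).1 (bn (Nat.sqrt k) k ω).1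
      have h2 := mul_le_one₀ (bf (Nat.sqrt k) k ω).2 (bn (Nat.sqrt k) k ω).1 (bn (Nat.sqrt k) k ω).2
      constructor <;> linarith [(bX k ω).1, (bX k ω).2]
    · refine Summable.of_norm_bounded_eventually_nat (summable_div_sqrt_sqrt C) ?_
      filter_upwards [eventually_separated hγ hβ 0] with k hk
      rw [Real.norm_of_nonneg (div_nonneg (integral_nonneg fun ω => sq_nonneg _) (by positivity))]
      exact div_le_div_of_nonneg_right (hC b _ _ _ hk.2.2.1 hk.2.1 hk.2.2.2 η η') (by positivity)
  -- windows of fixed length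
  have step2 : ∀ᵐ ω ∂μ, ∀ᶠ N : ℕ in atTop, ∑ k ∈ Finset.range N,
      |Pf (Nat.sqrt k) k ω - Pf r k ω| ≤ ε / 4 * N := by
    refine h.ae_eventually_sum_condP_sub_le hK hinv hβ0 hγ hβ.ne' (r := r) hVm (fun k => ?_)
      (fun k => ?_) (by positivity) ?_
    · intro t ht
      simp only [farBox, mem_box] at ht
      omega
    · intro t ht
      simp only [farBox, mem_box] at ht
      omega
    · filter_upwards [eventually_separated hγ hβ r] with k hk
      refine (sqDist_mono (S₁ := farBox b ⌊β * k⌋₊ r) (S₄ := biBox b ⌊β * k⌋₊ ⌊γ * k⌋₊)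
        subset_rfl ?_ ?_ (integrable_indicator (hVm k))).trans ?_
      · intro t ht
        simp only [farBox, mem_box] at ht ⊢
        grind
      · intro t ht
        simp only [farBox, biBox, Finset.mem_union, mem_box] at ht ⊢
        grind
      · exact le_of_natSub_mul_sq_le hδ0 hr₀ hr
          (memory_loss_single h hK hinv b (by omega) η)
  have step3 : ∀ᵐ ω ∂μ, ∀ᶠ N : ℕ in atTop, ∑ k ∈ Finset.range N,
      |Pn (Nat.sqrt k) k ω - Pn r k ω| ≤ ε / 4 * N := by
    refine h.ae_eventually_sum_condP_sub_le hK hinv hγ hβ0 hβ.ne (r := r) hWm (fun k => ?_)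
      (fun k => ?_) (by positivity) ?_
    · intro t ht
      simp only [nearBox, Finset.mem_union, mem_box] at ht
      omega
    · intro t ht
      simp only [nearBox, Finset.mem_union, mem_box] at ht
      omega
    · filter_upwards [eventually_separated hγ hβ r] with k hk
      refine (sqDist_mono (S₁ := nearBox b ⌊γ * k⌋₊ r) (S₄ := biBox b ⌊β * k⌋₊ ⌊γ * k⌋₊)
        subset_rfl ?_ ?_ (integrable_indicator (hWm k))).trans ?_
      · intro t ht
        simp only [nearBox, Finset.mem_union, mem_box] at ht ⊢
        grind
      · intro t ht
        simp only [nearBox, biBox, Finset.mem_union, mem_box] at ht ⊢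
        grind
      · exact le_of_natSub_mul_sq_le hδ0 hr₀ hr
          (memory_loss_double h hK hinv b (by omega) (by omega) η')
  filter_upwards [step1, step2, step3] with ω h1 h2 h3
  filter_upwards [h1 (ε ^ 2 / 16) (by positivity), h2, h3] with N n1 n2 n3
  have hpt : ∀ k, |X k ω - Pf r k ω * Pn r k ω| ≤
      (ε / 4 + 4 / ε * (X k ω - Pf (Nat.sqrt k) k ω * Pn (Nat.sqrt k) k ω) ^ 2) / 1 +
      |Pf (Nat.sqrt k) k ω - Pf r k ω| + |Pn (Nat.sqrt k) k ω - Pn r k ω| := fun k => by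
    set d := X k ω - Pf (Nat.sqrt k) k ω * Pn (Nat.sqrt k) k ω with hd
    have e : X k ω - Pf r k ω * Pn r k ω = d +
        ((Pf (Nat.sqrt k) k ω - Pf r k ω) * Pn (Nat.sqrt k) k ω +
        Pf r k ω * (Pn (Nat.sqrt k) k ω - Pn r k ω)) := by rw [hd]; ring
    -- Either `|d| ≤ ε / 4`, or `|d| ≤ 4 / ε * d ^ 2`. This turns averages of squares into averages
    -- of absolute values.
    have d1 : |d| ≤ ε / 4 + 4 / ε * d ^ 2 := by
      have : 4 / ε * d ^ 2 = (4 * d ^ 2) / ε := by ring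
      rw [this, ← sub_le_iff_le_add', le_div_iff₀ hε]
      nlinarith [sq_abs d, sq_nonneg (ε / 4 - |d|), sq_nonneg (|d| - ε / 8), abs_nonneg d]
    rw [e, div_one]
    refine (abs_add_le _ _).trans ?_
    rw [add_assoc]
    refine add_le_add d1 ((abs_add_le _ _).trans (add_le_add ?_ ?_))
    · rw [abs_mul, abs_of_nonneg (bn _ _ _).1]
      exact mul_le_of_le_one_right (abs_nonneg _) (bn _ _ _).2
    · rw [abs_mul, abs_of_nonneg (bf _ _ _).1]
      exact mul_le_of_le_one_left (abs_nonneg _) (bf _ _ _).2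
  refine (Finset.sum_le_sum fun k _ => hpt k).trans ?_
  simp only [div_one]
  rw [Finset.sum_add_distrib, Finset.sum_add_distrib, Finset.sum_add_distrib, ← Finset.mul_sum,
    Finset.sum_const, Finset.card_range, nsmul_eq_mul]
  have n1' : 4 / ε * ∑ k ∈ Finset.range N,
      (X k ω - Pf (Nat.sqrt k) k ω * Pn (Nat.sqrt k) k ω) ^ 2 ≤ ε / 4 * N := by
    calc _ ≤ 4 / ε * (ε ^ 2 / 16 * N) := by gcongr
      _ = ε / 4 * N := by field_simp; norm_num
  linarith

end LocalStructure

end SymbolicCP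
end

noncomputable section
namespace SymbolicCP

/-! ### The compact space of pairs of a sequence and a measure -/

section Compactness

variable {m n : ℕ}

scoped instance : BorelSpace (Seq m n) := Pi.borelSpace

scoped instance : TopologicalSpace (ProbabilityMeasure (Seq m n)) := inferInstance

scoped instance : TopologicalSpace.MetrizableSpace (ProbabilityMeasure (Seq m n)) := inferInstance

/-- Pairs of a sequence and a measure, with the Borel σ-algebra of the product topology. -/
def PointedMeasure (m n : ℕ) : Type := Seq m n × ProbabilityMeasure (Seq m n)

scoped instance : TopologicalSpace (PointedMeasure m n) :=
  inferInstanceAs (TopologicalSpace (Seq m n × ProbabilityMeasure (Seq m n)))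

scoped instance : CompactSpace (PointedMeasure m n) :=
  inferInstanceAs (CompactSpace (Seq m n × ProbabilityMeasure (Seq m n)))

scoped instance : TopologicalSpace.MetrizableSpace (PointedMeasure m n) :=
  inferInstanceAs (TopologicalSpace.MetrizableSpace (Seq m n × ProbabilityMeasure (Seq m n)))

scoped instance : SecondCountableTopology (PointedMeasure m n) := by
  let _ := TopologicalSpace.metrizableSpaceMetric (PointedMeasure m n)
  infer_instance

scoped instance : MeasurableSpace (PointedMeasure m n) := borel _

scoped instance : BorelSpace (PointedMeasure m n) := ⟨rfl⟩

lemma continuous_real_of_isClopen {E : Set (Seq m n)} (hE : IsClopen E) :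
    Continuous fun ν : ProbabilityMeasure (Seq m n) => (ν : Measure (Seq m n)).real E := by
  refine continuous_iff_continuousAt.2 fun ν => ?_
  have := ProbabilityMeasure.tendsto_measure_of_isClopen_of_tendsto (μs := id) (L := 𝓝 ν)
    tendsto_id hE
  simp only [ProbabilityMeasure.measureReal_eq_coe_coeFn]
  exact (NNReal.continuous_coe.tendsto _).comp this

lemma isClopen_preimage_prefixWord (a : ℕ) (E : Set (Fin a → Fin m × Fin n)) :
    IsClopen (prefixWord a ⁻¹' E) := (isClopen_discrete E).preimage (continuous_prefixWord a)

lemma probabilityMeasure_ext_of_prefixWord {ν ν' : ProbabilityMeasure (Seq m n)}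
    (h : ∀ a, ∀ w, (ν : Measure (Seq m n)).real (prefixWord a ⁻¹' {w}) =
      (ν' : Measure (Seq m n)).real (prefixWord a ⁻¹' {w})) : ν = ν' := by
  have key : ∀ k (ω : Seq m n), (ν : Measure (Seq m n)) (cylinder k ω) =
      (ν' : Measure (Seq m n)) (cylinder k ω) := fun k ω => by
    rw [← preimage_prefixWord, ← ENNReal.toReal_eq_toReal_iff' (measure_ne_top _ _)
      (measure_ne_top _ _)]
    exact h k _
  exact Subtype.ext (le_antisymm
    (measure_le_of_cylinder_le (ν₂ := (ν' : Measure (Seq m n))) 0 fun k _ ω => (key k ω).le)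
    (measure_le_of_cylinder_le (ν₂ := (ν : Measure (Seq m n))) 0 fun k _ ω => (key k ω).ge))

/-- The total variation distance between the laws of the words of length `a`. -/
def wordDist (a : ℕ) (ν ν' : ProbabilityMeasure (Seq m n)) : ℝ :=
  ∑ w : Fin a → Fin m × Fin n, |(ν : Measure (Seq m n)).real (prefixWord a ⁻¹' {w}) -
    (ν' : Measure (Seq m n)).real (prefixWord a ⁻¹' {w})|

lemma wordDist_nonneg (a : ℕ) (ν ν' : ProbabilityMeasure (Seq m n)) : 0 ≤ wordDist a ν ν' :=
  Finset.sum_nonneg fun _ _ => abs_nonneg _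

lemma wordDist_self (a : ℕ) (ν : ProbabilityMeasure (Seq m n)) : wordDist a ν ν = 0 := by
  simp [wordDist]

lemma wordDist_mono {a a' : ℕ} (h : a' ≤ a) (ν ν' : ProbabilityMeasure (Seq m n)) :
    wordDist a' ν ν' ≤ wordDist a ν ν' := by
  classical
  let π : (Fin a → Fin m × Fin n) → (Fin a' → Fin m × Fin n) := fun w i => w (Fin.castLE h i)
  have hπ : ∀ x : Seq m n, π (prefixWord a x) = prefixWord a' x := fun x => rfl
  have key : ∀ (ν : ProbabilityMeasure (Seq m n)) (w' : Fin a' → Fin m × Fin n),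
      (ν : Measure (Seq m n)).real (prefixWord a' ⁻¹' {w'}) =
        ∑ w ∈ Finset.univ.filter fun w => π w = w',
          (ν : Measure (Seq m n)).real (prefixWord a ⁻¹' {w}) := fun ν w' => by
    rw [← measureReal_biUnion_finset (Set.pairwiseDisjoint_fiber _ _) fun w _ =>
      (isClopen_preimage_prefixWord a _).isOpen.measurableSet]
    congr 1
    ext x
    simp [← hπ]
  calc wordDist a' ν ν'
      ≤ ∑ w', ∑ w ∈ Finset.univ.filter fun w => π w = w',
          |(ν : Measure (Seq m n)).real (prefixWord a ⁻¹' {w}) -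
            (ν' : Measure (Seq m n)).real (prefixWord a ⁻¹' {w})| := by
        refine Finset.sum_le_sum fun w' _ => ?_
        rw [key, key, ← Finset.sum_sub_distrib]
        exact Finset.abs_sum_le_sum_abs _ _
    _ = wordDist a ν ν' := Finset.sum_fiberwise _ _ _

lemma continuous_wordDist (a : ℕ) :
    Continuous fun p : ProbabilityMeasure (Seq m n) × ProbabilityMeasure (Seq m n) =>
      wordDist a p.1 p.2 := by
  refine continuous_finsetSum _ fun w _ => continuous_abs.comp (Continuous.sub ?_ ?_)
  · exact (continuous_real_of_isClopen (isClopen_preimage_prefixWord a _)).comp continuous_fst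
  · exact (continuous_real_of_isClopen (isClopen_preimage_prefixWord a _)).comp continuous_snd

/-- Continuous functions depend little on all but finitely many letters, and on all but the masses
of finitely many cylinders. -/
lemma exists_forall_abs_sub_le (f : C(UnitAddCircle × PointedMeasure m n, ℝ)) {η : ℝ}
    (hη : 0 < η) : ∃ a : ℕ, ∃ δ > 0, ∀ (t : UnitAddCircle) (z z' : PointedMeasure m n),
      z'.1 ∈ cylinder a z.1 → wordDist a z.2 z'.2 ≤ δ → |f (t, z) - f (t, z')| ≤ η := by
  by_contra hcon
  push Not at hcon
  -- The counterexamples, with `δ = 1 / (a + 1)`, form nonempty closed sets that decrease with `a`.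
  -- A point common to all of them would have equal arguments but values of `f` at distance at least
  -- `η`.
  let E : ℕ → Set ((UnitAddCircle × PointedMeasure m n) × PointedMeasure m n) := fun a =>
    {x | prefixWord a x.2.1 = prefixWord a x.1.2.1 ∧ wordDist a x.1.2.2 x.2.2 ≤ 1 / (a + 1) ∧
      η ≤ |f x.1 - f (x.1.1, x.2)|}
  have c1 : Continuous fun z : PointedMeasure m n => z.1 :=
    (continuous_fst : Continuous (Prod.fst : Seq m n × ProbabilityMeasure (Seq m n) → _))
  have c2 : Continuous fun z : PointedMeasure m n => z.2 :=
    (continuous_snd : Continuous (Prod.snd : Seq m n × ProbabilityMeasure (Seq m n) → _))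
  have hcl : ∀ a, IsClosed (E a) := fun a => by
    refine IsClosed.inter ?_ (IsClosed.inter ?_ ?_)
    · exact isClosed_eq ((continuous_prefixWord a).comp (c1.comp continuous_snd))
        ((continuous_prefixWord a).comp (c1.comp (continuous_snd.comp continuous_fst)))
    · exact isClosed_le ((continuous_wordDist a).comp
        ((c2.comp (continuous_snd.comp continuous_fst)).prodMk (c2.comp continuous_snd)))
        continuous_const
    · exact isClosed_le continuous_const (continuous_abs.comp ((f.continuous.comp
        continuous_fst).sub (f.continuous.comp
        ((continuous_fst.comp continuous_fst).prodMk continuous_snd))))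
  have hanti : ∀ a, E (a + 1) ⊆ E a := fun a x hx => by
    refine ⟨funext fun i => congrFun hx.1 (Fin.castSucc i), ?_, hx.2.2⟩
    refine (wordDist_mono (Nat.le_succ a) _ _).trans (hx.2.1.trans ?_)
    push_cast
    gcongr
    linarith
  have hne : ∀ a, (E a).Nonempty := fun a => by
    obtain ⟨t, z, z', h1, h2, h3⟩ := hcon a (1 / (a + 1)) (by positivity)
    exact ⟨((t, z), z'), prefixWord_eq_iff.2 h1, h2, h3.le⟩
  obtain ⟨x, hx⟩ := IsCompact.nonempty_iInter_of_sequence_nonempty_isCompact_isClosed E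
    hanti hne (hcl 0).isCompact hcl
  simp only [Set.mem_iInter] at hx
  have h1 : x.2.1 = x.1.2.1 := by
    funext i
    exact congrFun (hx (i + 1)).1 ⟨i, Nat.lt_succ_self i⟩
  have h2 : x.1.2.2 = x.2.2 := by
    refine probabilityMeasure_ext_of_prefixWord fun a w => ?_
    have h3 : ∀ j : ℕ, wordDist a x.1.2.2 x.2.2 ≤ 1 / (j + 1) := fun j => by
      refine (wordDist_mono (le_max_left a j) _ _).trans ((hx (max a j)).2.1.trans ?_)
      have : (j : ℝ) ≤ (max a j : ℕ) := by exact_mod_cast le_max_right a j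
      gcongr
    have h4 : wordDist a x.1.2.2 x.2.2 ≤ 0 :=
      ge_of_tendsto' tendsto_one_div_add_atTop_nhds_zero_nat h3
    have h5 := (Finset.sum_eq_zero_iff_of_nonneg fun _ _ => abs_nonneg _).1
      (le_antisymm h4 (wordDist_nonneg _ _ _)) w (Finset.mem_univ _)
    exact sub_eq_zero.1 (abs_eq_zero.1 h5)
  have h6 : x.1.2 = x.2 := Prod.ext h1.symm h2
  have h7 := (hx 0).2.2
  rw [← h6] at h7
  simp only [Prod.mk.eta, sub_self, abs_zero] at h7
  linarith

end Compactness

end SymbolicCP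
end

noncomputable section
namespace SymbolicCP

/-! ### Approximation of conditional laws by products -/

section LocalProduct

variable {m n : ℕ} {μ : Measure (Seq m n)} {K : ENNReal}

/-- The inequality `f ≤ g` may fail at finitely many indices, whose contribution the other half of
`ε` absorbs. -/
lemma eventually_sum_le_of_eventually_le {f g : ℕ → ℝ} {B ε : ℝ} (hf : ∀ k, f k ≤ B)
    (hg : ∀ k, 0 ≤ g k) (h : ∀ᶠ k in atTop, f k ≤ g k) (hε : 0 < ε)
    (hN : ∀ᶠ N : ℕ in atTop, ∑ k ∈ Finset.range N, g k ≤ ε / 2 * N) :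
    ∀ᶠ N : ℕ in atTop, ∑ k ∈ Finset.range N, f k ≤ ε * N := by
  obtain ⟨k₀, hk₀⟩ := eventually_atTop.1 h
  obtain ⟨N₀, hN₀⟩ := exists_nat_ge (k₀ * |B| / (ε / 2))
  rw [div_le_iff₀ (by positivity)] at hN₀
  filter_upwards [hN, eventually_ge_atTop (max N₀ k₀)] with N h1 h2
  obtain ⟨j, rfl⟩ := Nat.exists_eq_add_of_le ((le_max_right _ _).trans h2)
  have h3 : (N₀ : ℝ) * (ε / 2) ≤ (k₀ + j : ℕ) * (ε / 2) := by
    gcongr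
    exact (le_max_left _ _).trans h2
  rw [Finset.sum_range_add] at h1 ⊢
  have h4 : ∑ k ∈ Finset.range k₀, f k ≤ k₀ * |B| := by
    refine (Finset.sum_le_sum fun k _ => (hf k).trans (le_abs_self B)).trans_eq ?_
    simp
  have h5 : ∑ i ∈ Finset.range j, f (k₀ + i) ≤ ∑ i ∈ Finset.range j, g (k₀ + i) :=
    Finset.sum_le_sum fun i _ => hk₀ _ (Nat.le_add_right _ _)
  have h6 : 0 ≤ ∑ k ∈ Finset.range k₀, g k := Finset.sum_nonneg fun k _ => hg k
  linarith

lemma eventually_le_floor_mul {β : ℝ} (hβ : 0 < β) (r : ℕ) : ∀ᶠ k : ℕ in atTop, r ≤ ⌊k * β⌋₊ := by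
  obtain ⟨k₀, hk₀⟩ := exists_nat_ge (r / β)
  rw [div_le_iff₀ hβ] at hk₀
  filter_upwards [eventually_ge_atTop k₀] with k hk
  refine Nat.le_floor (hk₀.trans ?_)
  gcongr

/-- The conditional laws of the futures of the two coordinates, given the past of lengths `q * k`
and `⌊k * (q * α)⌋`, are close on average to products of conditional laws given finite windows
`S₁ r` and `S₂ r`. -/
structure IsLocallyProduct (μ : Measure (Seq m n)) (α : ℝ) (S₁ S₂ : ℕ → Finset (Bool × ℕ)) :
    Prop where
  timesIn_left : ∀ r, TimesIn (S₁ r) 0 (2 * r)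
  timesIn_right : ∀ r, TimesIn (S₂ r) 0 (2 * r)
  ae_eventually : ∀ q : ℕ, 1 ≤ q → ∀ a : ℕ, ∀ ε > 0, ∃ r₀ : ℕ, ∀ r ≥ r₀, ∀ η η' : Seq m n,
    ∀ᵐ ω ∂μ, ∀ᶠ N : ℕ in atTop, ∑ k ∈ Finset.range N,
      |condP μ (biBox true (q * k) ⌊k * (q * α)⌋₊) (shift^[q * k] ⁻¹' cell (box true 0 a) η ∩
          shift^[⌊k * (q * α)⌋₊] ⁻¹' cell (box false 0 a) η') ω -
        condP μ (S₁ r) (shift^[r] ⁻¹' cell (box true 0 a) η) (shift^[q * k - r] ω) *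
        condP μ (S₂ r) (shift^[r] ⁻¹' cell (box false 0 a) η')
          (shift^[⌊k * (q * α)⌋₊ - r] ω)| ≤ ε * N

lemma condP_farBox_eq (hinv : MeasurePreserving shift μ μ) (b : Bool) {k r : ℕ} (h : r ≤ k)
    {V : Set (Seq m n)} (hV : MeasurableSet V) (ω : Seq m n) :
    condP μ (farBox b k r) (shift^[k] ⁻¹' V) ω =
      condP μ (farBox b r r) (shift^[r] ⁻¹' V) (shift^[k - r] ω) := by
  rw [← condP_shift hinv _ _ (measurable_shift_iterate r hV), ← Set.preimage_comp,
    ← Function.iterate_add, Nat.add_sub_cancel' h, farBox, farBox, shiftSet_box, Nat.sub_self,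
    zero_add, Nat.add_sub_cancel' h]

lemma condP_nearBox_eq (hinv : MeasurePreserving shift μ μ) (b : Bool) {k r : ℕ} (h : r ≤ k)
    {V : Set (Seq m n)} (hV : MeasurableSet V) (ω : Seq m n) :
    condP μ (nearBox b k r) (shift^[k] ⁻¹' V) ω =
      condP μ (nearBox b r r) (shift^[r] ⁻¹' V) (shift^[k - r] ω) := by
  rw [← condP_shift hinv _ _ (measurable_shift_iterate r hV), ← Set.preimage_comp,
    ← Function.iterate_add, Nat.add_sub_cancel' h, nearBox, nearBox, shiftSet_union, shiftSet_box,
    shiftSet_box, Nat.sub_self, zero_add, Nat.add_sub_cancel' h,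
    show r + r + (k - r) = k + r by omega]

lemma timesIn_farBox (b : Bool) (r : ℕ) : TimesIn (farBox b r r) 0 (2 * r) := by
  intro t ht
  simp only [farBox, mem_box] at ht
  omega

lemma timesIn_nearBox (b : Bool) (r : ℕ) : TimesIn (nearBox b r r) 0 (2 * r) := by
  intro t ht
  simp only [nearBox, Finset.mem_union, mem_box] at ht
  omega

lemma abs_condP_sub_mul_le_one [IsProbabilityMeasure μ] {S S' S'' : Finset (Bool × ℕ)}
    {U V W : Set (Seq m n)} (hU : MeasurableSet U) (hV : MeasurableSet V) (hW : MeasurableSet W)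
    (x y z : Seq m n) : |condP μ S U x - condP μ S' V y * condP μ S'' W z| ≤ 1 := by
  have h1 := mul_nonneg (condP_nonneg (μ := μ) S' hV y) (condP_nonneg (μ := μ) S'' hW z)
  have h2 := mul_le_one₀ (condP_le_one (μ := μ) S' hV y) (condP_nonneg (μ := μ) S'' hW z)
    (condP_le_one (μ := μ) S'' hW z)
  rw [abs_le]
  constructor <;> linarith [condP_nonneg (μ := μ) S hU x, condP_le_one (μ := μ) S hU x]

/-- For `α < 1` the first coordinate is read further, for `α > 1` the second, and the far and near
windows exchange roles. Stationarity moves the windows to a position that does not depend on `k`. -/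
theorem UpperQuasiBernoulli.exists_isLocallyProduct [IsProbabilityMeasure μ]
    (h : UpperQuasiBernoulli K μ) (hK : K ≠ ⊤) (hinv : MeasurePreserving shift μ μ) {α : ℝ}
    (hα0 : 0 < α) (hα1 : α ≠ 1) : ∃ S₁ S₂, IsLocallyProduct μ α S₁ S₂ := by
  have hcell : ∀ (k : ℕ) (S : Finset (Bool × ℕ)) (η : Seq m n),
      MeasurableSet (shift^[k] ⁻¹' cell S η) := fun k S η =>
    measurable_shift_iterate _ (measurableSet_cell _ _)
  rcases lt_or_gt_of_ne hα1 with hα | hα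
  · refine ⟨fun r => farBox true r r, fun r => nearBox true r r, timesIn_farBox _,
      timesIn_nearBox _, fun q hq a ε hε => ?_⟩
    have hq0 : (0 : ℝ) < q := by exact_mod_cast hq
    obtain ⟨r₀, hr₀⟩ := h.exists_ae_eventually_sum_condP_biBox_sub_le hK hinv (β := q)
      (γ := q * α) (by positivity) (by nlinarith) true a (half_pos hε)
    refine ⟨r₀, fun r hr η η' => ?_⟩
    filter_upwards [hr₀ r hr η η'] with ω hω
    have e1 : ∀ k : ℕ, ⌊(q : ℝ) * k⌋₊ = q * k := fun k => by
      rw [← Nat.cast_mul, Nat.floor_natCast]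
    have e2 : ∀ k : ℕ, (q : ℝ) * α * k = k * (q * α) := fun k => mul_comm _ _
    simp only [e1, e2] at hω
    refine eventually_sum_le_of_eventually_le (B := 1) (fun k => abs_condP_sub_mul_le_one
      ((hcell _ _ _).inter (hcell _ _ _)) (hcell _ _ _) (hcell _ _ _) _ _ _)
      (fun k => abs_nonneg _) ?_ hε hω
    filter_upwards [eventually_le_floor_mul (β := q * α) (by positivity) r,
      eventually_ge_atTop r] with k h1 h2
    rw [condP_farBox_eq hinv _ (h2.trans (Nat.le_mul_of_pos_left k hq)) (measurableSet_cell _ _),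
      condP_nearBox_eq hinv _ h1 (measurableSet_cell _ _)]
    rfl
  · refine ⟨fun r => nearBox false r r, fun r => farBox false r r, timesIn_nearBox _,
      timesIn_farBox _, fun q hq a ε hε => ?_⟩
    have hq0 : (0 : ℝ) < q := by exact_mod_cast hq
    obtain ⟨r₀, hr₀⟩ := h.exists_ae_eventually_sum_condP_biBox_sub_le hK hinv (β := q * α)
      (γ := q) (by positivity) (by nlinarith) false a (half_pos hε)
    refine ⟨r₀, fun r hr η η' => ?_⟩
    filter_upwards [hr₀ r hr η' η] with ω hω
    have e1 : ∀ k : ℕ, ⌊(q : ℝ) * k⌋₊ = q * k := fun k => by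
      rw [← Nat.cast_mul, Nat.floor_natCast]
    have e2 : ∀ k : ℕ, (q : ℝ) * α * k = k * (q * α) := fun k => mul_comm _ _
    simp only [e1, e2] at hω
    refine eventually_sum_le_of_eventually_le (B := 1) (fun k => abs_condP_sub_mul_le_one
      ((hcell _ _ _).inter (hcell _ _ _)) (hcell _ _ _) (hcell _ _ _) _ _ _)
      (fun k => abs_nonneg _) ?_ hε hω
    filter_upwards [eventually_le_floor_mul (β := q * α) (by positivity) r,
      eventually_ge_atTop r] with k h1 h2
    rw [condP_nearBox_eq hinv _ (h2.trans (Nat.le_mul_of_pos_left k hq)) (measurableSet_cell _ _),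
      condP_farBox_eq hinv _ h1 (measurableSet_cell _ _), Set.inter_comm, mul_comm (condP _ _ _ _),
      biBox, biBox, Finset.union_comm]
    rfl

end LocalProduct

end SymbolicCP
end

noncomputable section
namespace SymbolicCP

/-! ### Local models built from two independent sequences -/

section LocalPoint

variable {m n : ℕ} {μ : ProbabilityMeasure (Seq m n)}

/-- The conditional probability given an event, and `μ` itself if the event is null. -/
def condProb (μ : ProbabilityMeasure (Seq m n)) (E : Set (Seq m n)) :
    ProbabilityMeasure (Seq m n) :=
  open Classical in
  if h : (μ : Measure (Seq m n)) E ≠ 0 then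
    (⟨(μ : Measure (Seq m n))[|E], cond_isProbabilityMeasure h⟩ :
      ProbabilityMeasure (Seq m n)) else μ

lemma toMeasure_condProb {E : Set (Seq m n)} (h : (μ : Measure (Seq m n)) E ≠ 0) :
    (condProb μ E : Measure (Seq m n)) = (μ : Measure (Seq m n))[|E] := by
  exact congrArg ProbabilityMeasure.toMeasure (dif_pos h)

lemma real_condProb {E : Set (Seq m n)} (hE : MeasurableSet E)
    (h : (μ : Measure (Seq m n)) E ≠ 0) (V : Set (Seq m n)) :
    (condProb μ E : Measure (Seq m n)).real V =
      (μ : Measure (Seq m n)).real (V ∩ E) / (μ : Measure (Seq m n)).real E := by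
  rw [toMeasure_condProb h, Measure.real, cond_apply hE, ENNReal.toReal_mul, ENNReal.toReal_inv,
    Set.inter_comm, div_eq_inv_mul, Measure.real, Measure.real]

/-- The first coordinate of one sequence, together with the second coordinate of another,
both from the time `r` on. -/
def joint (r : ℕ) (z : Seq m n × Seq m n) : Seq m n := fun i => ((z.1 (i + r)).1, (z.2 (i + r)).2)

lemma continuous_joint (r : ℕ) : Continuous (joint r : Seq m n × Seq m n → Seq m n) := by
  unfold joint
  fun_prop

/-- The product of the conditional laws of the two coordinates from the time `r` on, given finite
windows of two sequences. -/
def localMeasure (μ : ProbabilityMeasure (Seq m n)) (S₁ S₂ : Finset (Bool × ℕ)) (r : ℕ)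
    (z : Seq m n × Seq m n) : ProbabilityMeasure (Seq m n) :=
  ((condProb μ (cell S₁ z.1)).prod (condProb μ (cell S₂ z.2))).map
    (continuous_joint r).measurable.aemeasurable

/-- The pair of the joint sequence and of the product of its conditional laws. -/
def localPoint (μ : ProbabilityMeasure (Seq m n)) (S₁ S₂ : Finset (Bool × ℕ)) (r : ℕ)
    (z : Seq m n × Seq m n) : PointedMeasure m n := (joint r z, localMeasure μ S₁ S₂ r z)

lemma localMeasure_congr {S₁ S₂ : Finset (Bool × ℕ)} (r : ℕ) {z z' : Seq m n × Seq m n}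
    (h₁ : z'.1 ∈ cell S₁ z.1) (h₂ : z'.2 ∈ cell S₂ z.2) :
    localMeasure μ S₁ S₂ r z' = localMeasure μ S₁ S₂ r z := by
  simp only [localMeasure, cell_eq_of_mem h₁, cell_eq_of_mem h₂]

/-- The measure depends on finitely many letters only, so it is locally constant. -/
lemma continuous_localPoint (S₁ S₂ : Finset (Bool × ℕ)) (r : ℕ) :
    Continuous (localPoint μ S₁ S₂ r) := by
  refine (continuous_joint r).prodMk (continuous_iff_continuousAt.2 fun z => ?_)
  refine continuousAt_const.congr (f := fun _ => localMeasure μ S₁ S₂ r z) ?_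
  filter_upwards [((isClopen_cell S₁ z.1).isOpen.prod (isClopen_cell S₂ z.2).isOpen).mem_nhds
    ⟨mem_cell_self _ _, mem_cell_self _ _⟩] with z' hz'
  exact (localMeasure_congr r hz'.1 hz'.2).symm

lemma mem_cell_box_iff {b : Bool} {a : ℕ} {ζ x : Seq m n} :
    x ∈ cell (box b 0 a) ζ ↔ ∀ i < a, coord (b, i) x = coord (b, i) ζ := by
  constructor
  · exact fun h i hi => h _ (mem_box.2 ⟨rfl, Nat.zero_le _, hi⟩)
  · rintro h ⟨b', i⟩ hi
    obtain ⟨rfl, -, h3⟩ := mem_box.1 hi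
    exact h i h3

lemma mem_cell_box_true_iff {a : ℕ} {ζ x : Seq m n} :
    x ∈ cell (box true 0 a) ζ ↔ ∀ i < a, (x i).1 = (ζ i).1 := by
  simp [mem_cell_box_iff, coord]

lemma mem_cell_box_false_iff {a : ℕ} {ζ x : Seq m n} :
    x ∈ cell (box false 0 a) ζ ↔ ∀ i < a, (x i).2 = (ζ i).2 := by
  simp [mem_cell_box_iff, coord]

lemma biCylinder_eq_cell (k l : ℕ) (ω : Seq m n) : biCylinder k l ω = cell (biBox true k l) ω := by
  ext x
  rw [biBox, cell_union]
  exact and_congr mem_cell_box_true_iff.symm mem_cell_box_false_iff.symm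

lemma preimage_joint_cylinder (r a : ℕ) (ζ : Seq m n) :
    joint r ⁻¹' cylinder a ζ = (shift^[r] ⁻¹' cell (box true 0 a) ζ) ×ˢ
      (shift^[r] ⁻¹' cell (box false 0 a) ζ) := by
  ext z
  simp only [Set.mem_preimage, Set.mem_prod, mem_cell_box_true_iff, mem_cell_box_false_iff,
    shift_iterate_apply, cylinder, joint, Set.mem_ofPred_eq, Prod.ext_iff]
  grind

lemma preimage_biShift_cylinder (k l a : ℕ) (ζ : Seq m n) :
    biShift k l ⁻¹' cylinder a ζ = shift^[k] ⁻¹' cell (box true 0 a) ζ ∩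
      shift^[l] ⁻¹' cell (box false 0 a) ζ := by
  ext z
  simp only [Set.mem_preimage, Set.mem_inter_iff, mem_cell_box_true_iff, mem_cell_box_false_iff,
    shift_iterate_apply, cylinder, biShift, Set.mem_ofPred_eq, Prod.ext_iff]
  grind

lemma measurableSet_preimage_cell (r : ℕ) (S : Finset (Bool × ℕ)) (ζ : Seq m n) :
    MeasurableSet (shift^[r] ⁻¹' cell S ζ) := measurable_shift_iterate _ (measurableSet_cell _ _)

lemma real_localMeasure_cylinder {S₁ S₂ : Finset (Bool × ℕ)} {z : Seq m n × Seq m n}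
    (h₁ : (μ : Measure (Seq m n)) (cell S₁ z.1) ≠ 0) (h₂ : (μ : Measure (Seq m n)) (cell S₂ z.2) ≠ 0)
    (r a : ℕ) (ζ : Seq m n) :
    (localMeasure μ S₁ S₂ r z : Measure (Seq m n)).real (cylinder a ζ) =
      condP μ S₁ (shift^[r] ⁻¹' cell (box true 0 a) ζ) z.1 *
        condP μ S₂ (shift^[r] ⁻¹' cell (box false 0 a) ζ) z.2 := by
  rw [localMeasure, ProbabilityMeasure.toMeasure_map, ProbabilityMeasure.toMeasure_prod,
    map_measureReal_apply (continuous_joint r).measurable (measurableSet_cylinder a ζ),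
    preimage_joint_cylinder, measureReal_prod_prod,
    real_condProb (measurableSet_cell _ _) h₁, real_condProb (measurableSet_cell _ _) h₂,
    condP_apply _ (measurableSet_preimage_cell _ _ _),
    condP_apply _ (measurableSet_preimage_cell _ _ _)]

/-- The magnification of the pair of `ω` and `μ`, also for `ω` outside the support of `μ`. -/
def magnifiedPoint (μ : ProbabilityMeasure (Seq m n)) (k l : ℕ) (ω : Seq m n) :
    PointedMeasure m n :=
  (biShift k l ω, (condProb μ (biCylinder k l ω)).map
    (continuous_biShift k l).measurable.aemeasurable)

lemma magnify_coe (k l : ℕ) (ω : Seq m n) (h : ω ∈ (μ : Measure (Seq m n)).support) :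
    (magnify k l ⟨(ω, μ), h⟩).1 = magnifiedPoint μ k l ω := by
  refine Prod.ext rfl (Subtype.ext ?_)
  change ((μ : Measure (Seq m n))[|biCylinder k l ω]).map (biShift k l) =
    (condProb μ (biCylinder k l ω) : Measure (Seq m n)).map (biShift k l)
  rw [toMeasure_condProb (measure_biCylinder_ne_zero k l ⟨(ω, μ), h⟩)]

lemma real_magnifiedPoint_cylinder {k l : ℕ} {ω : Seq m n}
    (h : (μ : Measure (Seq m n)) (cell (biBox true k l) ω) ≠ 0) (a : ℕ) (ζ : Seq m n) :
    ((magnifiedPoint μ k l ω).2 : Measure (Seq m n)).real (cylinder a ζ) =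
      condP μ (biBox true k l) (shift^[k] ⁻¹' cell (box true 0 a) ζ ∩
        shift^[l] ⁻¹' cell (box false 0 a) ζ) ω := by
  rw [magnifiedPoint]
  dsimp only
  rw [ProbabilityMeasure.toMeasure_map,
    map_measureReal_apply (continuous_biShift k l).measurable (measurableSet_cylinder a ζ),
    preimage_biShift_cylinder, biCylinder_eq_cell, real_condProb (measurableSet_cell _ _) h,
    condP_apply _ ((measurableSet_preimage_cell _ _ _).inter (measurableSet_preimage_cell _ _ _))]

lemma ae_measure_cell_ne_zero (S : Finset (Bool × ℕ)) :
    ∀ᵐ ω ∂(μ : Measure (Seq m n)), (μ : Measure (Seq m n)) (cell S ω) ≠ 0 := by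
  have : {ω | ¬ (μ : Measure (Seq m n)) (cell S ω) ≠ 0} ⊆
      ⋃ w ∈ {w | (μ : Measure (Seq m n)) (restr S ⁻¹' {w}) = 0}, restr S ⁻¹' {w} := by
    intro ω hω
    simp only [Set.mem_iUnion]
    refine ⟨restr S ω, ?_, rfl⟩
    simpa [preimage_restr] using hω
  refine measure_mono_null this ((measure_biUnion_null_iff (Set.to_countable _)).2 fun w hw => hw)

/-- Extension of a word by a constant letter. -/
def extendWord {A : Type*} (d : A) {a : ℕ} (w : Fin a → A) (i : ℕ) : A :=
  if h : i < a then w ⟨i, h⟩ else d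

lemma extendWord_prefixWord {A : Type*} (d : A) {a : ℕ} (x : ℕ → A) {i : ℕ} (hi : i < a) :
    extendWord d (prefixWord a x) i = x i := by simp [extendWord, hi, prefixWord]

lemma prefixWord_extendWord {A : Type*} (d : A) {a : ℕ} (w : Fin a → A) :
    prefixWord a (extendWord d w) = w := by
  funext i
  simp [extendWord, prefixWord]

lemma continuous_of_prefixWord {β : Type*} [TopologicalSpace β] {a : ℕ}
    (g : (Fin a → Fin m × Fin n) → β) : Continuous fun x : Seq m n => g (prefixWord a x) :=
  continuous_of_discreteTopology.comp (continuous_prefixWord a)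

variable (μ) in
/-- Functions on words that approximate a continuous function of the local points. -/
def localTable (S₁ S₂ : Finset (Bool × ℕ)) (r A : ℕ) (d : Fin m × Fin n)
    (f : C(UnitAddCircle × PointedMeasure m n, ℝ)) (w w' : Fin A → Fin m × Fin n) :
    C(UnitAddCircle, ℝ) :=
  ⟨fun t => f (t, localPoint μ S₁ S₂ r (extendWord d w, extendWord d w')), by fun_prop⟩

/-- Letters from time `2 * r + a` on do not influence the local measure, whose windows end before `2
* r`, nor the first `a` letters of the joint sequence. -/
lemma abs_localTable_sub_le {S₁ S₂ : Finset (Bool × ℕ)} {r a : ℕ} (h₁ : TimesIn S₁ 0 (2 * r))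
    (h₂ : TimesIn S₂ 0 (2 * r)) {f : C(UnitAddCircle × PointedMeasure m n, ℝ)} {η δ : ℝ}
    (hδ : 0 ≤ δ) (h : ∀ (t : UnitAddCircle) (z z' : PointedMeasure m n),
      z'.1 ∈ cylinder a z.1 → wordDist a z.2 z'.2 ≤ δ → |f (t, z) - f (t, z')| ≤ η)
    (d : Fin m × Fin n) (t : UnitAddCircle) (x y : Seq m n) :
    |f (t, localPoint μ S₁ S₂ r (x, y)) -
      tableFun (2 * r + a) (localTable μ S₁ S₂ r (2 * r + a) d f) t x y| ≤ η := by
  refine h t _ (localPoint μ S₁ S₂ r (extendWord d (prefixWord (2 * r + a) x),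
    extendWord d (prefixWord (2 * r + a) y))) (fun i hi => ?_) ?_
  · simp only [localPoint, joint]
    rw [extendWord_prefixWord _ _ (by omega), extendWord_prefixWord _ _ (by omega)]
  · refine le_trans (le_of_eq ?_) hδ
    have e : localMeasure μ S₁ S₂ r (extendWord d (prefixWord (2 * r + a) x),
        extendWord d (prefixWord (2 * r + a) y)) = localMeasure μ S₁ S₂ r (x, y) :=
      localMeasure_congr r
        (fun t ht => coord_congr (extendWord_prefixWord _ _ (by have := h₁ t ht; omega)))
        (fun t ht => coord_congr (extendWord_prefixWord _ _ (by have := h₂ t ht; omega)))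
    simp only [localPoint, e]
    exact wordDist_self _ _

lemma continuous_tableFun_localTable (S₁ S₂ : Finset (Bool × ℕ)) (r A : ℕ) (d : Fin m × Fin n)
    (f : C(UnitAddCircle × PointedMeasure m n, ℝ)) :
    Continuous fun z : UnitAddCircle × Seq m n × Seq m n =>
      tableFun A (localTable μ S₁ S₂ r A d f) z.1 z.2.1 z.2.2 := by
  refine f.continuous.comp (continuous_fst.prodMk ((continuous_localPoint S₁ S₂ r).comp ?_))
  exact ((continuous_of_prefixWord (extendWord d)).comp
    (continuous_fst.comp continuous_snd)).prodMk
    ((continuous_of_prefixWord (extendWord d)).comp (continuous_snd.comp continuous_snd))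

end LocalPoint

end SymbolicCP
end

noncomputable section
namespace SymbolicCP

/-! ### Approximation of magnified points by local models -/

section Approximation

variable {m n : ℕ} {μ : ProbabilityMeasure (Seq m n)} {α : ℝ} {S₁ S₂ : ℕ → Finset (Bool × ℕ)}

/-- The mixing properties of Gibbs measures from which the generic behaviour of the magnification
is deduced. -/
structure IsDecoupled (μ : ProbabilityMeasure (Seq m n)) (α : ℝ)
    (S₁ S₂ : ℕ → Finset (Bool × ℕ)) : Prop where
  quasi : ∃ K p, IsQuasiBernoulli K p (μ : Measure (Seq m n))
  ergodic : Ergodic shift (μ : Measure (Seq m n))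
  irrational : Irrational α
  pos : 0 < α
  locallyProduct : IsLocallyProduct (μ : Measure (Seq m n)) α S₁ S₂

scoped instance : IsProbabilityMeasure (volume : Measure UnitAddCircle) := by
  rw [← haarAddCircle_eq_volume]
  infer_instance

/-- The mean of `f` over the local points of order `r`. -/
def localMean (μ : ProbabilityMeasure (Seq m n)) (S₁ S₂ : ℕ → Finset (Bool × ℕ)) (r : ℕ)
    (f : C(UnitAddCircle × PointedMeasure m n, ℝ)) : ℝ :=
  ∫ z, f (z.1, localPoint μ (S₁ r) (S₂ r) r z.2)
    ∂((volume : Measure UnitAddCircle).prod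
      ((μ : Measure (Seq m n)).prod (μ : Measure (Seq m n))))

lemma wordDist_eq_sum_cylinder (a : ℕ) (d : Fin m × Fin n) (ν ν' : ProbabilityMeasure (Seq m n)) :
    wordDist a ν ν' = ∑ w : Fin a → Fin m × Fin n,
      |(ν : Measure (Seq m n)).real (cylinder a (extendWord d w)) -
      (ν' : Measure (Seq m n)).real (cylinder a (extendWord d w))| := by
  refine Finset.sum_congr rfl fun w _ => ?_
  rw [← preimage_prefixWord, prefixWord_extendWord]

lemma joint_shift_iterate {r k l : ℕ} (h : r ≤ k) (h' : r ≤ l) (x : Seq m n) :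
    joint r (shift^[k - r] x, shift^[l - r] x) = biShift k l x := by
  funext i
  simp only [joint, biShift, shift_iterate_apply]
  rw [show i + r + (k - r) = i + k by omega, show i + r + (l - r) = i + l by omega]

/-- When `D` exceeds `δ`, the trivial bound `B` is at most `B / δ * D`. It is thus enough to control
`D` on average. -/
lemma abs_sub_le_add_mul {u v w η δ B D : ℝ} (hB : 0 ≤ B) (hδ : 0 < δ) (hD : 0 ≤ D)
    (hη : 0 ≤ η) (h1 : D ≤ δ → |u - v| ≤ η) (h2 : |u - v| ≤ B) (h3 : |v - w| ≤ η) :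
    |u - w| ≤ 2 * η + B / δ * D := by
  have h4 : |u - v| ≤ η + B / δ * D := by
    rcases le_total D δ with h | h
    · have : 0 ≤ B / δ * D := by positivity
      linarith [h1 h]
    · have : B ≤ B / δ * D := by
        rw [div_mul_eq_mul_div, le_div_iff₀ hδ]
        gcongr
      linarith
  linarith [abs_sub_le u v w]

lemma IsDecoupled.ae_forall_measure_cell_ne_zero (h : IsDecoupled μ α S₁ S₂)
    (S : Finset (Bool × ℕ)) :
    ∀ᵐ ω ∂(μ : Measure (Seq m n)), ∀ j, (μ : Measure (Seq m n)) (cell S (shift^[j] ω)) ≠ 0 :=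
  ae_all_iff.2 fun j => (h.ergodic.toMeasurePreserving.iterate j).quasiMeasurePreserving.ae
    (ae_measure_cell_ne_zero S)

/-- On words of length `a` both measures are given by conditional probabilities, and
`IsLocallyProduct` is applied word by word. Null cells, where `condProb` takes its default value,
are almost surely avoided along the whole orbit. -/
lemma IsDecoupled.exists_ae_eventually_sum_wordDist_le (h : IsDecoupled μ α S₁ S₂) {q : ℕ}
    (hq : 1 ≤ q) (a : ℕ) {ε : ℝ} (hε : 0 < ε) :
    ∃ r₀ : ℕ, ∀ r ≥ r₀, ∀ᵐ ω ∂(μ : Measure (Seq m n)), ∀ᶠ N : ℕ in atTop,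
      ∑ k ∈ Finset.range N, wordDist a (magnifiedPoint μ (q * k) ⌊k * (q * α)⌋₊ ω).2
        (localMeasure μ (S₁ r) (S₂ r) r
          (shift^[q * k - r] ω, shift^[⌊k * (q * α)⌋₊ - r] ω)) ≤ ε * N := by
  obtain ⟨ω₀⟩ := μ.nonempty
  set d := ω₀ 0
  set c : ℝ := (Fintype.card (Fin a → Fin m × Fin n) : ℝ) with hc
  obtain ⟨r₀, hr₀⟩ := h.locallyProduct.ae_eventually q hq a (ε / (c + 1)) (by positivity)
  refine ⟨r₀, fun r hr => ?_⟩
  filter_upwards [ae_all_iff.2 fun w : Fin a → Fin m × Fin n =>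
      hr₀ r hr (extendWord d w) (extendWord d w),
    h.ae_forall_measure_cell_ne_zero (S₁ r), h.ae_forall_measure_cell_ne_zero (S₂ r),
    ae_all_iff.2 fun k : ℕ => ae_measure_cell_ne_zero (μ := μ) (biBox true (q * k) ⌊k * (q * α)⌋₊)]
    with ω h1 h2 h3 h4
  filter_upwards [eventually_all.2 h1] with N hN
  have e : ∀ (i j : ℕ) (ζ : Seq m n), (localMeasure μ (S₁ r) (S₂ r) r
      (shift^[i] ω, shift^[j] ω) : Measure (Seq m n)).real (cylinder a ζ) =
      condP μ (S₁ r) (shift^[r] ⁻¹' cell (box true 0 a) ζ) (shift^[i] ω) *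
        condP μ (S₂ r) (shift^[r] ⁻¹' cell (box false 0 a) ζ) (shift^[j] ω) := fun i j ζ =>
    real_localMeasure_cylinder (z := (shift^[i] ω, shift^[j] ω)) (h2 i) (h3 j) r a ζ
  simp only [wordDist_eq_sum_cylinder a d, e, real_magnifiedPoint_cylinder (h4 _)]
  rw [Finset.sum_comm]
  refine (Finset.sum_le_sum fun w _ => hN w).trans ?_
  rw [Finset.sum_const, Finset.card_univ, nsmul_eq_mul, ← hc, ← mul_assoc]
  gcongr
  rw [← mul_div_assoc, div_le_iff₀ (by positivity)]
  nlinarith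

/-- Along the orbit of almost every `ω`, a continuous function of the magnified points is close on
average to a function of two finite windows, the averages of which converge. -/
theorem IsDecoupled.exists_uniformlyAverages (h : IsDecoupled μ α S₁ S₂) {q : ℕ} (hq : 1 ≤ q)
    (hqe : Ergodic shift^[q] (μ : Measure (Seq m n))) (f : C(UnitAddCircle × PointedMeasure m n, ℝ))
    {η : ℝ} (hη : 0 < η) :
    ∃ r₀ : ℕ, ∀ r ≥ r₀, ∃ (A : ℕ) (G : (Fin A → Fin m × Fin n) → (Fin A → Fin m × Fin n) →
        C(UnitAddCircle, ℝ)) (c : ℝ),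
      UniformlyAverages (μ : Measure (Seq m n)) q (q * α) (tableFun A G) c ∧
      |c - localMean μ S₁ S₂ r f| ≤ η ∧
      ∀ᵐ ω ∂(μ : Measure (Seq m n)), ∀ᶠ N : ℕ in atTop, ∑ k ∈ Finset.range N,
        |f (((k * (q * α) : ℝ) : UnitAddCircle), magnifiedPoint μ (q * k) ⌊k * (q * α)⌋₊ ω) -
          orbitVal q (q * α) r (tableFun A G) k ω ω| ≤ η * N := by
  obtain ⟨K, p, hKp⟩ := h.quasi
  obtain ⟨ω₀⟩ := μ.nonempty
  obtain ⟨a, δ, hδ, hf⟩ := exists_forall_abs_sub_le f (η := η / 8) (by positivity)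
  obtain ⟨r₀, hr₀⟩ := h.exists_ae_eventually_sum_wordDist_le hq a
    (ε := η / 4 / (2 * ‖f‖ / δ + 1)) (by positivity)
  have hq0 : (0 : ℝ) < q := by exact_mod_cast hq
  have hα := h.pos
  refine ⟨r₀, fun r hr => ⟨2 * r + a, localTable μ (S₁ r) (S₂ r) r (2 * r + a) (ω₀ 0) f, _,
    hKp.uniformlyAverages_tableFun _ hq hqe h.ergodic (h.irrational.natCast_mul (by omega))
    (by positivity), ?_, ?_⟩⟩
  · rw [localMean, ← integral_sub]
    · rw [← Real.norm_eq_abs]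
      refine (norm_integral_le_of_norm_le_const (C := η) (ae_of_all _ fun z => ?_)).trans_eq
        (by rw [probReal_univ, mul_one])
      rw [Real.norm_eq_abs, abs_sub_comm]
      exact (abs_localTable_sub_le (h.locallyProduct.timesIn_left r)
        (h.locallyProduct.timesIn_right r) hδ.le hf _ _ _ _).trans (by linarith)
    · obtain ⟨B, hB0, hB⟩ := exists_tableFun_bound
        (localTable μ (S₁ r) (S₂ r) r (2 * r + a) (ω₀ 0) f)
      exact Integrable.of_bound
        (continuous_tableFun_localTable _ _ _ _ _ _).aestronglyMeasurable B
        (ae_of_all _ fun z => hB _ _ _)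
    · exact Integrable.of_bound (f.continuous.comp (continuous_fst.prodMk
        ((continuous_localPoint _ _ _).comp continuous_snd))).aestronglyMeasurable ‖f‖
        (ae_of_all _ fun z => f.norm_coe_le_norm _)
  · filter_upwards [hr₀ r hr] with ω hω
    obtain ⟨B, hB0, hB⟩ := exists_tableFun_bound
      (localTable μ (S₁ r) (S₂ r) r (2 * r + a) (ω₀ 0) f)
    refine eventually_sum_le_of_eventually_le (B := ‖f‖ + B) (g := fun k : ℕ => 2 * (η / 8) +
      2 * ‖f‖ / δ * wordDist a (magnifiedPoint μ (q * k) ⌊k * (q * α)⌋₊ ω).2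
        (localMeasure μ (S₁ r) (S₂ r) r
          (shift^[q * k - r] ω, shift^[⌊k * (q * α)⌋₊ - r] ω))) (fun k => ?_) (fun k => ?_) ?_ hη ?_
    · exact (abs_sub _ _).trans (add_le_add (f.norm_coe_le_norm _) (hB _ _ _))
    · have := wordDist_nonneg a (magnifiedPoint μ (q * k) ⌊k * (q * α)⌋₊ ω).2
        (localMeasure μ (S₁ r) (S₂ r) r
          (shift^[q * k - r] ω, shift^[⌊k * (q * α)⌋₊ - r] ω))
      positivity
    · filter_upwards [eventually_le_floor_mul (β := q * α) (by positivity) r,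
        eventually_ge_atTop r] with k h1 h2
      refine abs_sub_le_add_mul (by positivity) hδ (wordDist_nonneg _ _ _) (by positivity)
        (fun hD => hf _ _ (localPoint μ (S₁ r) (S₂ r) r
          (shift^[q * k - r] ω, shift^[⌊k * (q * α)⌋₊ - r] ω)) ?_ hD) ?_
        (abs_localTable_sub_le (h.locallyProduct.timesIn_left r)
          (h.locallyProduct.timesIn_right r) hδ.le hf _ _ _ _)
      · have e : (localPoint μ (S₁ r) (S₂ r) r (shift^[q * k - r] ω,
            shift^[⌊k * (q * α)⌋₊ - r] ω)).1 = (magnifiedPoint μ (q * k) ⌊k * (q * α)⌋₊ ω).1 :=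
          joint_shift_iterate (h2.trans (Nat.le_mul_of_pos_left k hq)) h1 ω
        rw [e]
        exact mem_cylinder_self _ _
      · refine (abs_sub _ _).trans ((add_le_add (f.norm_coe_le_norm _)
          (f.norm_coe_le_norm _)).trans_eq (two_mul _).symm)
    · filter_upwards [hω] with N hN
      rw [Finset.sum_add_distrib, Finset.sum_const, Finset.card_range, nsmul_eq_mul,
        ← Finset.mul_sum]
      have h1 : 2 * ‖f‖ / δ * ∑ k ∈ Finset.range N,
          wordDist a (magnifiedPoint μ (q * k) ⌊k * (q * α)⌋₊ ω).2 (localMeasure μ (S₁ r) (S₂ r) r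
          (shift^[q * k - r] ω, shift^[⌊k * (q * α)⌋₊ - r] ω)) ≤ η / 4 * N := by
        refine (mul_le_mul_of_nonneg_left hN (by positivity)).trans ?_
        rw [← mul_assoc]
        gcongr
        rw [← mul_div_assoc, div_le_iff₀ (by positivity)]
        nlinarith [show 0 ≤ 2 * ‖f‖ / δ by positivity]
      linarith

end Approximation

end SymbolicCP
end

noncomputable section
namespace SymbolicCP

/-! ### The limit of the laws of the local points -/

section LimitLaw

variable {m n : ℕ} {μ : ProbabilityMeasure (Seq m n)} {α : ℝ} {S₁ S₂ : ℕ → Finset (Bool × ℕ)}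

/-- The approximating table function averages along the orbit to its own mean, which is close to the
local mean. -/
lemma IsDecoupled.exists_ae_eventually_abs_sum_sub_localMean_le (h : IsDecoupled μ α S₁ S₂)
    {q : ℕ} (hq : 1 ≤ q) (hqe : Ergodic shift^[q] (μ : Measure (Seq m n)))
    (f : C(UnitAddCircle × PointedMeasure m n, ℝ)) {η : ℝ} (hη : 0 < η) :
    ∃ r₀ : ℕ, ∀ r ≥ r₀, ∀ᵐ ω ∂(μ : Measure (Seq m n)), ∀ᶠ N : ℕ in atTop,
      |∑ k ∈ Finset.range N,
        f (((k * (q * α) : ℝ) : UnitAddCircle), magnifiedPoint μ (q * k) ⌊k * (q * α)⌋₊ ω) -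
          N * localMean μ S₁ S₂ r f| ≤ η * N := by
  obtain ⟨K, p, hKp⟩ := h.quasi
  have hα := h.pos
  have hq0 : (0 : ℝ) < q := by exact_mod_cast hq
  obtain ⟨r₀, hr₀⟩ := h.exists_uniformlyAverages hq hqe f (η := η / 3) (by positivity)
  refine ⟨r₀, fun r hr => ?_⟩
  obtain ⟨A, G, c, hG, hc, hae⟩ := hr₀ r hr
  filter_upwards [hae, hKp.ae_tendsto_orbitVal hq (h.irrational.natCast_mul (by omega))
    (by positivity) G hG r] with ω h1 h2
  filter_upwards [h1, h2 (η / 3) (by positivity)] with N h3 h4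
  have h5 : |(N : ℝ) * c - N * localMean μ S₁ S₂ r f| ≤ η / 3 * N := by
    rw [← mul_sub, abs_mul, Nat.abs_cast, mul_comm]
    gcongr
  have h6 := (Finset.abs_sum_le_sum_abs _ _).trans h3
  rw [Finset.sum_sub_distrib] at h6
  rw [abs_le] at *
  constructor <;> linarith [h4.1, h4.2, h5.1, h5.2, h6.1, h6.2]

/-- The averages along a single typical orbit are close to both means, so these are close to each
other; windows of different lengths are never compared directly. -/
lemma IsDecoupled.exists_forall_abs_localMean_sub_le (h : IsDecoupled μ α S₁ S₂)
    (f : C(UnitAddCircle × PointedMeasure m n, ℝ)) {η : ℝ} (hη : 0 < η) :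
    ∃ r₀ : ℕ, ∀ r ≥ r₀, ∀ r' ≥ r₀, |localMean μ S₁ S₂ r f - localMean μ S₁ S₂ r' f| ≤ η := by
  obtain ⟨r₀, hr₀⟩ := h.exists_ae_eventually_abs_sum_sub_localMean_le le_rfl
    (by simpa using h.ergodic) f (half_pos hη)
  refine ⟨r₀, fun r hr r' hr' => ?_⟩
  obtain ⟨ω, h1, h2⟩ := ((hr₀ r hr).and (hr₀ r' hr')).exists
  obtain ⟨N, ⟨h3, h4⟩, h5⟩ := ((h1.and h2).and (eventually_ge_atTop 1)).exists
  have hN : (0 : ℝ) < N := by exact_mod_cast h5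
  have h6 : N * |localMean μ S₁ S₂ r f - localMean μ S₁ S₂ r' f| ≤ N * η := by
    rw [← Nat.abs_cast, ← abs_mul, mul_sub, Nat.abs_cast]
    rw [abs_le] at *
    constructor <;> linarith [h3.1, h3.2, h4.1, h4.2]
  exact le_of_mul_le_mul_left h6 hN

/-- The law of the local points of order `r`. -/
def localLaw (μ : ProbabilityMeasure (Seq m n)) (S₁ S₂ : ℕ → Finset (Bool × ℕ)) (r : ℕ) :
    ProbabilityMeasure (PointedMeasure m n) :=
  (μ.prod μ).map (continuous_localPoint (μ := μ) (S₁ r) (S₂ r) r).measurable.aemeasurable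

lemma localMean_eq_integral (r : ℕ) (f : C(UnitAddCircle × PointedMeasure m n, ℝ)) :
    localMean μ S₁ S₂ r f = ∫ z, f z ∂((volume : Measure UnitAddCircle).prod
      (localLaw μ S₁ S₂ r : Measure (PointedMeasure m n))) := by
  have hm := (continuous_localPoint (μ := μ) (S₁ r) (S₂ r) r).measurable
  have e : (volume : Measure UnitAddCircle).prod
      (localLaw μ S₁ S₂ r : Measure (PointedMeasure m n)) =
      ((volume : Measure UnitAddCircle).prod
        ((μ : Measure (Seq m n)).prod (μ : Measure (Seq m n)))).map
        (Prod.map id (localPoint μ (S₁ r) (S₂ r) r)) := by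
    rw [← Measure.map_prod_map _ _ measurable_id hm, Measure.map_id]
    rfl
  rw [e, integral_map (measurable_id.prodMap hm).aemeasurable
    f.continuous.measurable.aestronglyMeasurable]
  rfl

/-- Under `μ × μ` the local measure is the conditional law of the joint sequence given the two
windows. This is the source of the support property of the limit law. -/
lemma prod_cell_inter_preimage_joint (T₁ T₂ : Finset (Bool × ℕ)) (r : ℕ) (z : Seq m n × Seq m n)
    {E : Set (Seq m n)} (hE : MeasurableSet E) :
    ((μ : Measure (Seq m n)).prod (μ : Measure (Seq m n)))
        (joint r ⁻¹' E ∩ cell T₁ z.1 ×ˢ cell T₂ z.2) =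
      (localMeasure μ T₁ T₂ r z : Measure (Seq m n)) E *
        ((μ : Measure (Seq m n)).prod (μ : Measure (Seq m n))) (cell T₁ z.1 ×ˢ cell T₂ z.2) := by
  set P := (μ : Measure (Seq m n)).prod (μ : Measure (Seq m n)) with hP
  by_cases h0 : P (cell T₁ z.1 ×ˢ cell T₂ z.2) = 0
  · rw [h0, mul_zero]
    exact measure_mono_null Set.inter_subset_right h0
  have h0' := h0
  rw [hP, Measure.prod_prod, mul_eq_zero, not_or] at h0'
  rw [localMeasure, ProbabilityMeasure.toMeasure_map, ProbabilityMeasure.toMeasure_prod,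
    Measure.map_apply (continuous_joint r).measurable hE, toMeasure_condProb h0'.1,
    toMeasure_condProb h0'.2, ProbabilityTheory.cond, ProbabilityTheory.cond,
    Measure.prod_smul_left, Measure.prod_smul_right, Measure.prod_restrict, ← hP,
    Measure.smul_apply, Measure.smul_apply,
    Measure.restrict_apply ((continuous_joint r).measurable hE)]
  rw [hP, Measure.prod_prod, ← hP, smul_eq_mul, smul_eq_mul]
  have e1 := ENNReal.inv_mul_cancel h0'.1 (measure_ne_top _ _)
  have e2 := ENNReal.inv_mul_cancel h0'.2 (measure_ne_top _ _)
  calc P (joint r ⁻¹' E ∩ cell T₁ z.1 ×ˢ cell T₂ z.2)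
      = (((μ : Measure (Seq m n)) (cell T₁ z.1))⁻¹ * (μ : Measure (Seq m n)) (cell T₁ z.1)) *
        (((μ : Measure (Seq m n)) (cell T₂ z.2))⁻¹ * (μ : Measure (Seq m n)) (cell T₂ z.2)) *
        P (joint r ⁻¹' E ∩ cell T₁ z.1 ×ˢ cell T₂ z.2) := by rw [e1, e2, one_mul, one_mul]
    _ = _ := by ring

lemma continuous_pointedMeasure_fst :
    Continuous (fun z : PointedMeasure m n => (z.1 : Seq m n)) :=
  (continuous_fst : Continuous (Prod.fst : Seq m n × ProbabilityMeasure (Seq m n) → _))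

lemma continuous_pointedMeasure_snd :
    Continuous (fun z : PointedMeasure m n => (z.2 : ProbabilityMeasure (Seq m n))) :=
  (continuous_snd : Continuous (Prod.snd : Seq m n × ProbabilityMeasure (Seq m n) → _))

lemma continuous_measure_of_isClopen {E : Set (Seq m n)} (hE : IsClopen E) :
    Continuous fun z : PointedMeasure m n => (z.2 : Measure (Seq m n)) E :=
  ((ENNReal.continuous_ofReal.comp (continuous_real_of_isClopen hE)).comp
    continuous_pointedMeasure_snd).congr fun _ => ofReal_measureReal

lemma isOpen_setOf_measure_lt {E : Set (Seq m n)} (hE : IsClopen E) (ε : ENNReal) :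
    IsOpen {z : PointedMeasure m n | z.1 ∈ E ∧ (z.2 : Measure (Seq m n)) E < ε} :=
  (hE.isOpen.preimage continuous_pointedMeasure_fst).inter
    (isOpen_lt (continuous_measure_of_isClopen hE) continuous_const)

/-- The local points rarely lie in sets that are nearly null for their conditional laws. -/
lemma localLaw_lt_le (r : ℕ) {E : Set (Seq m n)} (hE : IsClopen E) (ε : ENNReal) :
    (localLaw μ S₁ S₂ r : Measure (PointedMeasure m n))
      {z | z.1 ∈ E ∧ (z.2 : Measure (Seq m n)) E < ε} ≤ ε := by
  set P := (μ : Measure (Seq m n)).prod (μ : Measure (Seq m n)) with hP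
  set B := {z | joint r z ∈ E ∧ (localMeasure μ (S₁ r) (S₂ r) r z : Measure (Seq m n)) E < ε}
    with hB
  have e : (localLaw μ S₁ S₂ r : Measure (PointedMeasure m n))
      {z | z.1 ∈ E ∧ (z.2 : Measure (Seq m n)) E < ε} = P B := by
    rw [localLaw, ProbabilityMeasure.toMeasure_map, Measure.map_apply
      (continuous_localPoint _ _ _).measurable (isOpen_setOf_measure_lt hE ε).measurableSet]
    rfl
  rw [e]
  -- The local measure is constant on each fibre of `φ`. On a fibre that meets `B`, the conditional
  -- probability of `joint r ⁻¹' E` is its value at `E`, hence below `ε`.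
  set φ : Seq m n × Seq m n → (S₁ r → Fin m ⊕ Fin n) × (S₂ r → Fin m ⊕ Fin n) :=
    fun z => (restr (S₁ r) z.1, restr (S₂ r) z.2) with hφ
  have hφm : ∀ w, MeasurableSet (φ ⁻¹' {w}) := fun w =>
    ((isClosed_discrete {w}).preimage (((continuous_restr _).comp continuous_fst).prodMk
      ((continuous_restr _).comp continuous_snd))).measurableSet
  have hfib : ∀ z, φ ⁻¹' {φ z} = cell (S₁ r) z.1 ×ˢ cell (S₂ r) z.2 := fun z => by
    ext z'
    simp only [hφ, Set.mem_preimage, Set.mem_singleton_iff, Prod.mk.injEq, restr_eq_iff,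
      Set.mem_prod]
  have h1 : ∀ w, P (B ∩ φ ⁻¹' {w}) ≤ ε * P (φ ⁻¹' {w}) := fun w => by
    rcases (B ∩ φ ⁻¹' {w}).eq_empty_or_nonempty with h | ⟨z, hzB, rfl⟩
    · simp [h]
    · refine (measure_mono (t := joint r ⁻¹' E ∩ φ ⁻¹' {φ z})
        (Set.inter_subset_inter_left _ fun z' hz' => hz'.1)).trans ?_
      rw [hfib, prod_cell_inter_preimage_joint _ _ _ _ hE.isOpen.measurableSet]
      exact mul_le_mul_left hzB.2.le _
  calc P B ≤ P (⋃ w ∈ Finset.univ, B ∩ φ ⁻¹' {w}) := measure_mono fun z hz => by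
        simp only [Set.mem_iUnion]
        exact ⟨φ z, Finset.mem_univ _, hz, rfl⟩
    _ ≤ ∑ w, P (B ∩ φ ⁻¹' {w}) := measure_biUnion_finset_le _ _
    _ ≤ ∑ w, ε * P (φ ⁻¹' {w}) := Finset.sum_le_sum fun w _ => h1 w
    _ = ε := by
        rw [← Finset.mul_sum, sum_measure_preimage_singleton _ fun w _ => hφm w]
        simp

/-- Cylinders form a countable basis, so leaving the support is a countable union of conditions on
words. -/
lemma notMem_support_iff {z : PointedMeasure m n} :
    z.1 ∉ (z.2 : Measure (Seq m n)).support ↔ ∃ a, ∃ w : Fin a → Fin m × Fin n,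
      z.1 ∈ prefixWord a ⁻¹' {w} ∧ (z.2 : Measure (Seq m n)) (prefixWord a ⁻¹' {w}) = 0 := by
  rw [Measure.mem_support_iff_forall]
  push Not
  constructor
  · rintro ⟨U, hU, h0⟩
    obtain ⟨V, hVU, hV, hz⟩ := mem_nhds_iff.1 hU
    obtain ⟨a, ha⟩ := exists_cylinder_subset hV hz
    refine ⟨a, prefixWord a z.1, rfl, ?_⟩
    rw [preimage_prefixWord]
    exact measure_mono_null (ha.trans hVU) (le_zero_iff.1 h0)
  · rintro ⟨a, w, hz, h0⟩
    exact ⟨_, (isClopen_preimage_prefixWord a {w}).isOpen.mem_nhds hz, h0.le⟩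

lemma measurableSet_support :
    MeasurableSet {z : PointedMeasure m n | z.1 ∈ (z.2 : Measure (Seq m n)).support} := by
  have : {z : PointedMeasure m n | z.1 ∈ (z.2 : Measure (Seq m n)).support} =
      (⋃ a, ⋃ w : Fin a → Fin m × Fin n, {z : PointedMeasure m n | z.1 ∈ prefixWord a ⁻¹' {w}} ∩
        {z | (z.2 : Measure (Seq m n)) (prefixWord a ⁻¹' {w}) = 0})ᶜ := by
    ext z
    rw [← not_iff_not, Set.mem_compl_iff, not_not]
    simp only [Set.mem_iUnion]
    exact notMem_support_iff
  rw [this]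
  refine (MeasurableSet.iUnion fun a => MeasurableSet.iUnion fun w => ?_).compl
  have hc := isClopen_preimage_prefixWord (m := m) (n := n) a {w}
  exact (hc.isClosed.preimage continuous_pointedMeasure_fst).measurableSet.inter
    (isClosed_eq (continuous_measure_of_isClopen hc) continuous_const).measurableSet

/-- The laws of the local points converge to a law of points in the support of their measures. -/
theorem IsDecoupled.exists_limitLaw (h : IsDecoupled μ α S₁ S₂) :
    ∃ Q : ProbabilityMeasure (PointedMeasure m n),
      (∀ f : C(UnitAddCircle × PointedMeasure m n, ℝ), Tendsto (fun r => localMean μ S₁ S₂ r f) atTop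
        (𝓝 (∫ z, f z ∂((volume : Measure UnitAddCircle).prod
          (Q : Measure (PointedMeasure m n)))))) ∧
      ∀ᵐ z ∂(Q : Measure (PointedMeasure m n)), z.1 ∈ (z.2 : Measure (Seq m n)).support := by
  -- Compactness gives a limit along a subsequence; the Cauchy property of the means extends the
  -- convergence to all `r`.
  obtain ⟨Q, φ, hφ, hQ⟩ := CompactSpace.tendsto_subseq (localLaw μ S₁ S₂)
  refine ⟨Q, fun f => ?_, ?_⟩
  · have hc : CauchySeq fun r => localMean μ S₁ S₂ r f := Metric.cauchySeq_iff.2 fun ε hε => by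
      obtain ⟨r₀, hr₀⟩ := h.exists_forall_abs_localMean_sub_le f (half_pos hε)
      exact ⟨r₀, fun r hr r' hr' => (hr₀ r hr r' hr').trans_lt (half_lt_self hε)⟩
    refine tendsto_nhds_of_cauchySeq_of_subseq hc hφ.tendsto_atTop ?_
    let lam : ProbabilityMeasure UnitAddCircle := ⟨volume, inferInstance⟩
    have h1 : Tendsto (fun j => lam.prod (localLaw μ S₁ S₂ (φ j))) atTop (𝓝 (lam.prod Q)) :=
      (ProbabilityMeasure.continuous_prod.tendsto (lam, Q)).comp (tendsto_const_nhds.prodMk_nhds hQ)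
    have h2 := ProbabilityMeasure.tendsto_iff_forall_integral_tendsto.1 h1
      (BoundedContinuousFunction.mkOfCompact f)
    refine h2.congr fun j => ?_
    exact (localMean_eq_integral _ f).symm
  -- The condition of mass zero is relaxed to mass below `ε`, which is open, so that the portmanteau
  -- inequality transfers the bound `ε` from the local laws to `Q`.
  · have key : ∀ a, ∀ w : Fin a → Fin m × Fin n, (Q : Measure (PointedMeasure m n))
        {z | z.1 ∈ prefixWord a ⁻¹' {w} ∧
          (z.2 : Measure (Seq m n)) (prefixWord a ⁻¹' {w}) = 0} = 0 := fun a w => by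
      refine le_zero_iff.1 (ENNReal.le_of_forall_pos_le_add fun ε hε _ => ?_)
      rw [zero_add]
      have hc := isClopen_preimage_prefixWord (m := m) (n := n) a {w}
      have hε' : (0 : ENNReal) < ε := by exact_mod_cast hε
      refine (measure_mono (t := {z : PointedMeasure m n | z.1 ∈ prefixWord a ⁻¹' {w} ∧
        (z.2 : Measure (Seq m n)) (prefixWord a ⁻¹' {w}) < ε}) fun z hz => ⟨hz.1, ?_⟩).trans
        ((ProbabilityMeasure.le_liminf_measure_open_of_tendsto hQ
          (isOpen_setOf_measure_lt hc ε)).trans ?_)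
      · rw [hz.2]
        exact hε'
      · exact liminf_le_of_le (by isBoundedDefault) fun b hb =>
          (hb.exists.choose_spec).trans (localLaw_lt_le _ hc _)
    rw [ae_iff]
    refine measure_mono_null (t := ⋃ a, ⋃ w : Fin a → Fin m × Fin n, {z : PointedMeasure m n |
      z.1 ∈ prefixWord a ⁻¹' {w} ∧ (z.2 : Measure (Seq m n)) (prefixWord a ⁻¹' {w}) = 0})
      (fun z hz => ?_) (measure_iUnion_null fun a => measure_iUnion_null fun w => key a w)
    simp only [Set.mem_iUnion]
    exact notMem_support_iff.1 hz

end LimitLaw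

end SymbolicCP
end

noncomputable section
namespace SymbolicCP

/-! ### The magnification operator -/

section Operator

variable {m n : ℕ}

lemma biShift_biShift (k l k' l' : ℕ) (ω : Seq m n) :
    biShift k' l' (biShift k l ω) = biShift (k + k') (l + l') ω := by
  funext i
  simp only [biShift, Nat.add_assoc, Nat.add_comm k, Nat.add_comm l]

lemma biCylinder_add (k l k' l' : ℕ) (ω : Seq m n) :
    biCylinder (k + k') (l + l') ω =
      biCylinder k l ω ∩ biShift k l ⁻¹' biCylinder k' l' (biShift k l ω) := by
  have key : ∀ (k k' : ℕ) (P : ℕ → Prop), (∀ i < k + k', P i) ↔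
      (∀ i < k, P i) ∧ ∀ i < k', P (i + k) := fun k k' P => by
    refine ⟨fun h => ⟨fun i hi => h i (by omega), fun i hi => h _ (by omega)⟩, fun h i hi => ?_⟩
    by_cases hik : i < k
    · exact h.1 i hik
    · have := h.2 (i - k) (by omega)
      rwa [Nat.sub_add_cancel (not_lt.1 hik)] at this
  ext x
  simp only [biCylinder, biShift, Set.mem_inter_iff, Set.mem_preimage, Set.mem_ofPred_eq, key]
  tauto

/-- Conditioning in two stages: by `biCylinder_add` the two events combine into one, and the first
normalising factor cancels because the sequence lies in the support. -/
lemma magnify_magnify (k l k' l' : ℕ) (p : Xi m n) :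
    magnify k' l' (magnify k l p) = magnify (k + k') (l + l') p := by
  refine Subtype.ext (Prod.ext (biShift_biShift _ _ _ _ _) (Subtype.ext ?_))
  set ν := (p.1.2 : Measure (Seq m n)) with hν
  set C := biCylinder k l p.1.1 with hC
  set C' := biCylinder k' l' (biShift k l p.1.1) with hC'
  have hm := (continuous_biShift (m := m) (n := n) k l).measurable
  have hm' := (continuous_biShift (m := m) (n := n) k' l').measurable
  have hCm : MeasurableSet C := (isOpen_biCylinder _ _ _).measurableSet
  have hCm' : MeasurableSet C' := (isOpen_biCylinder _ _ _).measurableSet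
  change (((ν[|C]).map (biShift k l))[|C']).map (biShift k' l') =
    (ν[|biCylinder (k + k') (l + l') p.1.1]).map (biShift (k + k') (l + l'))
  have h0 : ν C ≠ 0 := measure_biCylinder_ne_zero k l p
  ext E hE
  have e : biShift (k + k') (l + l') ⁻¹' E = biShift k l ⁻¹' (biShift k' l' ⁻¹' E) := by
    ext x
    simp only [Set.mem_preimage, biShift_biShift]
  rw [Measure.map_apply hm' hE, cond_apply hCm', Measure.map_apply hm hCm',
    Measure.map_apply hm (hCm'.inter (hm' hE)), cond_apply hCm, cond_apply hCm,
    Measure.map_apply (continuous_biShift _ _).measurable hE, biCylinder_add,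
    cond_apply (hCm.inter (hm hCm')), e, Set.preimage_inter, ← Set.inter_assoc,
    ENNReal.mul_inv (Or.inr (measure_ne_top _ _)) (Or.inl (ENNReal.inv_ne_top.2 h0)), inv_inv]
  calc _ = ((ν C)⁻¹ * ν C) * ((ν (C ∩ biShift k l ⁻¹' C'))⁻¹ *
        ν (C ∩ biShift k l ⁻¹' C' ∩ biShift k l ⁻¹' (biShift k' l' ⁻¹' E))) := by ring
    _ = _ := by rw [ENNReal.inv_mul_cancel h0 (measure_ne_top _ _), one_mul]

lemma floor_add_floor_fract_add {x a : ℝ} (hx : 0 ≤ x) (ha : 0 ≤ a) :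
    ⌊x⌋₊ + ⌊Int.fract x + a⌋₊ = ⌊x + a⌋₊ := by
  rw [add_comm, ← Nat.floor_add_natCast (add_nonneg (Int.fract_nonneg x) ha), add_comm,
    ← add_assoc, natCast_floor_eq_intCast_floor hx, Int.floor_add_fract]

lemma ell_one_coe (x : ℝ) : ell m n 1 (x : UnitAddCircle) = ⌊Int.fract x + angle m n⌋₊ := by
  rw [ell, AddCircle.coe_equivIco_mk_apply]
  simp

lemma magnificationOperator_iterate_fst (k : ℕ) (x : UnitAddCircle × Xi m n) :
    (magnificationOperator^[k] x).1 = x.1 + ((k * angle m n : ℝ) : UnitAddCircle) := by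
  induction k with
  | zero => simp
  | succ k ih =>
    have e : ((k + 1 : ℕ) : ℝ) * angle m n = k * angle m n + angle m n := by push_cast; ring
    rw [Function.iterate_succ_apply', magnificationOperator, ih, add_assoc, ← AddCircle.coe_add, e]

/-- Starting from `t = 0` the jumps add up by `⌊x⌋₊ + ⌊Int.fract x + α⌋₊ = ⌊x + α⌋₊`, so the
iterates are single magnifications. -/
lemma magnificationOperator_iterate_zero (hα : 0 ≤ angle m n) (k : ℕ) (p : Xi m n) :
    magnificationOperator^[k] (0, p) =
      (((k * angle m n : ℝ) : UnitAddCircle), magnify k ⌊k * angle m n⌋₊ p) := by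
  refine Prod.ext (by rw [magnificationOperator_iterate_fst, zero_add]) ?_
  induction k with
  | zero =>
    refine Subtype.ext (Prod.ext ?_ (Subtype.ext ?_))
    · simp only [Function.iterate_zero, id_eq, CharP.cast_eq_zero, zero_mul, Nat.floor_zero]
      rfl
    · simp only [Function.iterate_zero, id_eq, CharP.cast_eq_zero, zero_mul, Nat.floor_zero]
      change (p.1.2 : Measure (Seq m n)) =
        ((p.1.2 : Measure (Seq m n))[|biCylinder 0 0 p.1.1]).map (biShift 0 0)
      have e1 : biCylinder 0 0 p.1.1 = Set.univ := by simp [biCylinder]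
      have e2 : (biShift 0 0 : Seq m n → Seq m n) = id := rfl
      rw [e1, e2, cond_univ, Measure.map_id]
  | succ k ih =>
    have e : ((k + 1 : ℕ) : ℝ) * angle m n = k * angle m n + angle m n := by push_cast; ring
    rw [Function.iterate_succ_apply', magnificationOperator, ih,
      magnificationOperator_iterate_fst, zero_add, ell_one_coe, magnify_magnify,
      floor_add_floor_fract_add (by positivity) hα, e]

lemma biCylinder_eq_of_mem {k l : ℕ} {ω ω' : Seq m n} (h : ω' ∈ biCylinder k l ω) :
    biCylinder k l ω' = biCylinder k l ω := by
  rw [biCylinder_eq_cell] at *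
  rw [biCylinder_eq_cell, cell_eq_of_mem h]

lemma continuous_xi_val : Continuous (Subtype.val : Xi m n → Seq m n × ProbabilityMeasure (Seq m n)) :=
  continuous_subtype_val

/-- Near `p` the conditioning cylinder is constant and clopen. Integrals against the magnified
measure are therefore quotients of continuous functions, with nonzero denominator at `p` by the
support condition. -/
lemma continuous_magnify (k l : ℕ) : Continuous (magnify k l : Xi m n → Xi m n) := by
  refine continuous_induced_rng.2 (Continuous.prodMk ?_ ?_)
  · exact (continuous_biShift k l).comp (continuous_fst.comp continuous_xi_val)
  refine continuous_iff_continuousAt.2 fun p => ?_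
  refine ProbabilityMeasure.tendsto_iff_forall_integral_tendsto.2 fun g => ?_
  set C := biCylinder k l p.1.1 with hC
  have hCc : IsClopen C := by rw [hC, biCylinder_eq_cell]; exact isClopen_cell _ _
  let g' : Seq m n →ᵇ ℝ := BoundedContinuousFunction.mkOfCompact
    ⟨C.indicator (g ∘ biShift k l), (g.continuous.comp (continuous_biShift k l)).indicator
      fun a ha => by simp [hCc.frontier_eq] at ha⟩
  have key : ∀ p' : Xi m n, p'.1.1 ∈ C →
      ∫ x, g x ∂(magnifiedMeasure k l p' : Measure (Seq m n)) =
        ((p'.1.2 : Measure (Seq m n)).real C)⁻¹ * ∫ x, g' x ∂(p'.1.2 : Measure (Seq m n)) := by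
    intro p' hp'
    change ∫ x, g x ∂(((p'.1.2 : Measure (Seq m n))[|biCylinder k l p'.1.1]).map (biShift k l)) = _
    rw [biCylinder_eq_of_mem hp', ← hC, integral_map (continuous_biShift k l).measurable.aemeasurable
      g.continuous.measurable.aestronglyMeasurable, ProbabilityTheory.cond, integral_smul_measure,
      ← integral_indicator hCc.isOpen.measurableSet, ENNReal.toReal_inv, smul_eq_mul]
    rfl
  have h1 : Continuous fun p : Xi m n => p.1.2 := continuous_snd.comp continuous_xi_val
  have h2 : Tendsto (fun p' : Xi m n => ((p'.1.2 : Measure (Seq m n)).real C)⁻¹ *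
      ∫ x, g' x ∂(p'.1.2 : Measure (Seq m n))) (𝓝 p)
      (𝓝 (((p.1.2 : Measure (Seq m n)).real C)⁻¹ * ∫ x, g' x ∂(p.1.2 : Measure (Seq m n)))) := by
    refine Tendsto.mul (Tendsto.inv₀ (((continuous_real_of_isClopen hCc).comp h1).tendsto p) ?_) ?_
    · exact (measureReal_ne_zero_iff (measure_ne_top _ _)).2 (measure_biCylinder_ne_zero k l p)
    · exact ((ProbabilityMeasure.continuous_integral_boundedContinuousFunction g').comp h1).tendsto p
  have h3 : ∀ᶠ p' in 𝓝 p, p'.1.1 ∈ C :=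
    (hCc.isOpen.preimage (continuous_fst.comp continuous_xi_val)).mem_nhds (mem_biCylinder_self _ _ _)
  rw [key p (mem_biCylinder_self _ _ _)]
  exact h2.congr' (h3.mono fun p' hp' => (key p' hp').symm)

/-- Jumps can occur only at `t = 0`, where the representative in `[0, 1)` jumps, and where `t + α`
is an integer. -/
lemma eventually_ell_one_eq (hα : 0 ≤ angle m n) {t : UnitAddCircle} (h0 : t ≠ 0)
    (h1 : t + (angle m n : UnitAddCircle) ≠ 0) : ∀ᶠ t' in 𝓝 t, ell m n 1 t' = ell m n 1 t := by
  set v : UnitAddCircle → ℝ := fun t => (AddCircle.equivIco (1 : ℝ) 0 t : ℝ) + angle m n with hv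
  have hell : ∀ t, ell m n 1 t = ⌊v t⌋₊ := fun t => by simp [ell, hv]
  have hvc : ContinuousAt v t := by
    refine ContinuousAt.add ?_ continuousAt_const
    exact continuousAt_subtype_val.comp (AddCircle.continuousAt_equivIco (1 : ℝ) 0 (by simpa using h0))
  have hv0 : 0 ≤ v t := add_nonneg (AddCircle.equivIco (1 : ℝ) 0 t).2.1 hα
  have hlt : (⌊v t⌋₊ : ℝ) < v t := by
    refine lt_of_le_of_ne (Nat.floor_le hv0) fun he => h1 ?_
    have h2 : t + (angle m n : UnitAddCircle) = (v t : UnitAddCircle) := by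
      rw [hv, AddCircle.coe_add, AddCircle.coe_equivIco]
    rw [h2, ← he]
    exact coe_natCast_eq_zero _
  filter_upwards [hvc.eventually (isOpen_Ioo.mem_nhds ⟨hlt, Nat.lt_floor_add_one (v t)⟩)] with t' ht'
  rw [hell, hell, Nat.floor_eq_iff ((Nat.cast_nonneg _).trans ht'.1.le)]
  exact ⟨ht'.1.le, ht'.2⟩

lemma continuousAt_magnificationOperator (hα : 0 ≤ angle m n) {x : UnitAddCircle × Xi m n}
    (h0 : x.1 ≠ 0) (h1 : x.1 + (angle m n : UnitAddCircle) ≠ 0) :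
    ContinuousAt magnificationOperator x := by
  have hc : Continuous fun y : UnitAddCircle × Xi m n =>
      (y.1 + (angle m n : UnitAddCircle), magnify 1 (ell m n 1 x.1) y.2) :=
    (continuous_fst.add continuous_const).prodMk ((continuous_magnify _ _).comp continuous_snd)
  refine hc.continuousAt.congr ?_
  filter_upwards [continuousAt_fst.eventually (eventually_ell_one_eq hα h0 h1)] with y hy
  rw [magnificationOperator, hy]

lemma measurable_magnificationOperator :
    Measurable (magnificationOperator : UnitAddCircle × Xi m n → _) := by
  have h1 : Measurable fun t : UnitAddCircle => ell m n 1 t := by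
    refine Nat.measurable_floor.comp (Measurable.add ?_ measurable_const)
    exact measurable_subtype_coe.comp (AddCircle.measurableEquivIco (1 : ℝ) 0).measurable
  have h2 : Measurable fun y : ℕ × Xi m n => magnify 1 y.1 y.2 :=
    measurable_from_prod_countable_right fun l => (continuous_magnify 1 l).measurable
  exact (measurable_fst.add_const _).prodMk
    (h2.comp ((h1.comp measurable_fst).prodMk measurable_snd))

end Operator

end SymbolicCP
end

noncomputable section
namespace SymbolicCP

/-! ### Empirical measures -/

section Empirical

variable {E F : Type*} [MeasurableSpace E] [MeasurableSpace F]

/-- The uniform distribution on the points `z 0, …, z N`. -/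
def empirical (z : ℕ → E) (N : ℕ) : ProbabilityMeasure E :=
  ⟨((N + 1 : ℕ) : ENNReal)⁻¹ • ∑ k ∈ Finset.range (N + 1), Measure.dirac (z k), ⟨by
    rw [Measure.smul_apply, Measure.finsetSum_apply]
    simp only [measure_univ, Finset.sum_const, Finset.card_range, nsmul_eq_mul, mul_one,
      smul_eq_mul]
    exact ENNReal.inv_mul_cancel (by simp) (ENNReal.natCast_ne_top _)⟩⟩

lemma toMeasure_empirical (z : ℕ → E) (N : ℕ) : (empirical z N : Measure E) =
    ((N + 1 : ℕ) : ENNReal)⁻¹ • ∑ k ∈ Finset.range (N + 1), Measure.dirac (z k) := rfl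

lemma map_empirical (z : ℕ → E) (N : ℕ) {g : E → F} (hg : Measurable g) :
    (empirical z N).map hg.aemeasurable = empirical (g ∘ z) N := by
  refine Subtype.ext ?_
  change (empirical z N : Measure E).map g = (empirical (g ∘ z) N : Measure F)
  rw [toMeasure_empirical, toMeasure_empirical, Measure.map_smul, Measure.map_finset_sum hg.aemeasurable]
  simp only [Measure.map_dirac' hg, Function.comp_apply]

lemma integral_empirical (z : ℕ → E) (N : ℕ) {f : E → ℝ} (hf : StronglyMeasurable f) :
    ∫ x, f x ∂(empirical z N : Measure E) =
      ((N + 1 : ℕ) : ℝ)⁻¹ * ∑ k ∈ Finset.range (N + 1), f (z k) := by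
  rw [toMeasure_empirical, integral_smul_measure, integral_finsetSum_measure]
  · simp only [integral_dirac' _ _ hf, ENNReal.toReal_inv, ENNReal.toReal_natCast, smul_eq_mul]
  · exact fun k _ => integrable_dirac' hf (by simp)

variable [TopologicalSpace E] [TopologicalSpace F]

/-- The continuous mapping theorem for maps that are continuous almost everywhere. -/
lemma tendsto_map_of_ae_continuousAt [BorelSpace E] [HasOuterApproxClosed E] [BorelSpace F]
    {μs : ℕ → ProbabilityMeasure E} {μ : ProbabilityMeasure E} (h : Tendsto μs atTop (𝓝 μ))
    {g : E → F} (hg : Measurable g) (hc : ∀ᵐ x ∂(μ : Measure E), ContinuousAt g x) :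
    Tendsto (fun i => (μs i).map hg.aemeasurable) atTop (𝓝 (μ.map hg.aemeasurable)) := by
  refine tendsto_of_forall_isOpen_le_liminf' fun G hG => ?_
  simp only [ProbabilityMeasure.toMeasure_map, Measure.map_apply hg hG.measurableSet]
  calc (μ : Measure E) (g ⁻¹' G) ≤ (μ : Measure E) (interior (g ⁻¹' G)) := by
        refine measure_mono_ae ?_
        filter_upwards [hc] with x hx hxG
        exact mem_interior_iff_mem_nhds.2 (hx.preimage_mem_nhds (hG.mem_nhds hxG))
    _ ≤ atTop.liminf fun i => (μs i : Measure E) (interior (g ⁻¹' G)) :=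
        ProbabilityMeasure.le_liminf_measure_open_of_tendsto h isOpen_interior
    _ ≤ _ := liminf_le_liminf (Eventually.of_forall fun i => measure_mono interior_subset)

/-- Open sets of `E` are preimages of open sets of `F`, so the portmanteau criterion transfers. This
brings convergence back from the compact space to `X`. -/
lemma tendsto_of_tendsto_map [BorelSpace E] [BorelSpace F] [HasOuterApproxClosed F]
    {μs : ℕ → ProbabilityMeasure E} {μ : ProbabilityMeasure E} {g : E → F} (hg : IsInducing g)
    (h : Tendsto (fun i => (μs i).map hg.continuous.measurable.aemeasurable) atTop
      (𝓝 (μ.map hg.continuous.measurable.aemeasurable))) : Tendsto μs atTop (𝓝 μ) := by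
  refine tendsto_of_forall_isOpen_le_liminf' fun G hG => ?_
  obtain ⟨G', hG', rfl⟩ := hg.isOpen_iff.1 hG
  have := ProbabilityMeasure.le_liminf_measure_open_of_tendsto h hG'
  simpa only [ProbabilityMeasure.toMeasure_map,
    Measure.map_apply hg.continuous.measurable hG'.measurableSet] using this

end Empirical

/-! ### Equidistribution of typical orbits in the compact space -/

section Generic

variable {m n : ℕ} {μ : ProbabilityMeasure (Seq m n)} {α : ℝ} {S₁ S₂ : ℕ → Finset (Bool × ℕ)}

/-- Lebesgue measure on the circle. -/
def circleMeasure : ProbabilityMeasure UnitAddCircle := ⟨volume, inferInstance⟩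

/-- `Q` is the limit of the laws of the local points. -/
def IsLimitLaw (μ : ProbabilityMeasure (Seq m n)) (S₁ S₂ : ℕ → Finset (Bool × ℕ))
    (Q : ProbabilityMeasure (PointedMeasure m n)) : Prop :=
  ∀ f : C(UnitAddCircle × PointedMeasure m n, ℝ), Tendsto (fun r => localMean μ S₁ S₂ r f) atTop
    (𝓝 (∫ z, f z ∂(circleMeasure.prod Q : Measure (UnitAddCircle × PointedMeasure m n))))

/-- The orbit of `(0, ω, μ)` under the `q`-th power of the magnification operator. -/
def magnifiedOrbit (μ : ProbabilityMeasure (Seq m n)) (α : ℝ) (q : ℕ) (ω : Seq m n) (k : ℕ) :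
    UnitAddCircle × PointedMeasure m n :=
  (((k * (q * α) : ℝ) : UnitAddCircle), magnifiedPoint μ (q * k) ⌊k * (q * α)⌋₊ ω)

lemma IsDecoupled.ae_eventually_abs_sum_sub_le (h : IsDecoupled μ α S₁ S₂)
    {Q : ProbabilityMeasure (PointedMeasure m n)} (hQ : IsLimitLaw μ S₁ S₂ Q)
    {q : ℕ} (hq : 1 ≤ q) (hqe : Ergodic shift^[q] (μ : Measure (Seq m n)))
    (f : C(UnitAddCircle × PointedMeasure m n, ℝ)) {η : ℝ} (hη : 0 < η) :
    ∀ᵐ ω ∂(μ : Measure (Seq m n)), ∀ᶠ N : ℕ in atTop,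
      |∑ k ∈ Finset.range N, f (magnifiedOrbit μ α q ω k) - N * ∫ z, f z
        ∂(circleMeasure.prod Q : Measure (UnitAddCircle × PointedMeasure m n))| ≤ η * N := by
  obtain ⟨r₀, hr₀⟩ := h.exists_ae_eventually_abs_sum_sub_localMean_le hq hqe f (half_pos hη)
  obtain ⟨r, hr, hr'⟩ := ((eventually_ge_atTop r₀).and
    ((hQ f).eventually (Metric.closedBall_mem_nhds _ (half_pos hη)))).exists
  filter_upwards [hr₀ r hr] with ω hω
  filter_upwards [hω] with N hN
  rw [Real.dist_eq, abs_le] at hr'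
  have h0 : (0 : ℝ) ≤ N := Nat.cast_nonneg N
  unfold magnifiedOrbit
  rw [abs_le] at hN ⊢
  constructor <;> nlinarith [hN.1, hN.2, hr'.1, hr'.2]

/-- The orbit of almost every point is equidistributed with respect to the limit law. -/
theorem IsDecoupled.ae_tendsto_empirical (h : IsDecoupled μ α S₁ S₂)
    {Q : ProbabilityMeasure (PointedMeasure m n)} (hQ : IsLimitLaw μ S₁ S₂ Q)
    {q : ℕ} (hq : 1 ≤ q) (hqe : Ergodic shift^[q] (μ : Measure (Seq m n))) :
    ∀ᵐ ω ∂(μ : Measure (Seq m n)),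
      Tendsto (empirical (magnifiedOrbit μ α q ω)) atTop (𝓝 (circleMeasure.prod Q)) := by
  -- A countable dense family of test functions yields one null set for all of them. Separability of
  -- the space of continuous functions is the reason for working in the compact space of all pairs.
  set d := TopologicalSpace.denseSeq C(UnitAddCircle × PointedMeasure m n, ℝ) with hd
  filter_upwards [ae_all_iff.2 fun j : ℕ => ae_all_iff.2 fun i : ℕ =>
    h.ae_eventually_abs_sum_sub_le hQ hq hqe (d j) (η := 1 / (i + 1)) (by positivity)] with ω hω
  refine ProbabilityMeasure.tendsto_iff_forall_integral_tendsto.2 fun g => ?_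
  refine Metric.tendsto_atTop'.2 fun ε hε => ?_
  set f : C(UnitAddCircle × PointedMeasure m n, ℝ) := g.toContinuousMap with hf
  obtain ⟨j, hj⟩ := (TopologicalSpace.denseRange_denseSeq
    C(UnitAddCircle × PointedMeasure m n, ℝ)).exists_dist_lt f (show 0 < ε / 4 by positivity)
  obtain ⟨i, hi⟩ := exists_nat_one_div_lt (show 0 < ε / 4 by positivity)
  obtain ⟨N₀, hN₀⟩ := eventually_atTop.1 (hω j i)
  refine ⟨N₀, fun N hN => ?_⟩
  have hNN := hN₀ (N + 1) (by omega)
  set M : ℝ := ((N + 1 : ℕ) : ℝ) with hM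
  have hM0 : 0 < M := by positivity
  have hpt : ∀ x, |f x - d j x| ≤ ε / 4 := fun x =>
    ((ContinuousMap.dist_apply_le_dist x).trans hj.le)
  have hint : ∀ f : C(UnitAddCircle × PointedMeasure m n, ℝ), Integrable f
      (circleMeasure.prod Q : Measure (UnitAddCircle × PointedMeasure m n)) := fun f =>
    Integrable.of_bound f.continuous.measurable.aestronglyMeasurable ‖f‖
      (ae_of_all _ fun z => f.norm_coe_le_norm _)
  have h1 : |∫ z, f z ∂(circleMeasure.prod Q : Measure (UnitAddCircle × PointedMeasure m n)) -
      ∫ z, d j z ∂(circleMeasure.prod Q : Measure (UnitAddCircle × PointedMeasure m n))| ≤ ε / 4 := by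
    rw [← integral_sub (hint _) (hint _), ← Real.norm_eq_abs]
    refine (norm_integral_le_of_norm_le_const (C := ε / 4) (ae_of_all _ hpt)).trans_eq ?_
    rw [probReal_univ, mul_one]
  have h2 : |∑ k ∈ Finset.range (N + 1), f (magnifiedOrbit μ α q ω k) -
      ∑ k ∈ Finset.range (N + 1), d j (magnifiedOrbit μ α q ω k)| ≤ ε / 4 * M := by
    rw [← Finset.sum_sub_distrib]
    refine (Finset.abs_sum_le_sum_abs _ _).trans ((Finset.sum_le_sum fun k _ => hpt _).trans_eq ?_)
    rw [Finset.sum_const, Finset.card_range, nsmul_eq_mul, mul_comm]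
  have h3 : 1 / ((i : ℝ) + 1) * M ≤ ε / 4 * M := by gcongr
  rw [integral_empirical _ _ g.continuous.stronglyMeasurable, Real.dist_eq]
  have h4 : |M * (M⁻¹ * ∑ k ∈ Finset.range (N + 1), f (magnifiedOrbit μ α q ω k) -
      ∫ z, f z ∂(circleMeasure.prod Q : Measure (UnitAddCircle × PointedMeasure m n)))| <
      M * ε := by
    rw [mul_sub, ← mul_assoc, mul_inv_cancel₀ hM0.ne', one_mul]
    rw [abs_lt]
    rw [abs_le] at h1 h2 hNN
    have := mul_pos hM0 hε
    constructor <;> nlinarith [h1.1, h1.2, h2.1, h2.2, hNN.1, hNN.2]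
  rw [abs_mul, abs_of_pos hM0] at h4
  exact lt_of_mul_lt_mul_left h4 hM0.le

end Generic

end SymbolicCP
end

noncomputable section
namespace SymbolicCP

/-! ### The embedding of `X` in the compact space -/

section Embedding

variable {m n : ℕ}

/-- The inclusion of `Ξ` in the space of all pairs of a sequence and a measure. -/
def Xi.toPointed (p : Xi m n) : PointedMeasure m n := p.1

lemma isEmbedding_toPointed : IsEmbedding (Xi.toPointed : Xi m n → PointedMeasure m n) :=
  IsEmbedding.subtypeVal (X := Seq m n × ProbabilityMeasure (Seq m n))

lemma range_toPointed : Set.range (Xi.toPointed : Xi m n → PointedMeasure m n) =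
    {z | z.1 ∈ (z.2 : Measure (Seq m n)).support} :=
  Subtype.range_val

scoped instance : TopologicalSpace.MetrizableSpace (Xi m n) := isEmbedding_toPointed.metrizableSpace

lemma measurableEmbedding_toPointed :
    MeasurableEmbedding (Xi.toPointed : Xi m n → PointedMeasure m n) :=
  isEmbedding_toPointed.measurableEmbedding (by rw [range_toPointed]; exact measurableSet_support)

/-- The inclusion of `X` in a compact space. -/
def toCompact (x : UnitAddCircle × Xi m n) : UnitAddCircle × PointedMeasure m n :=
  Prod.map id Xi.toPointed x

lemma isEmbedding_toCompact : IsEmbedding (toCompact : UnitAddCircle × Xi m n → _) :=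
  IsEmbedding.id.prodMap isEmbedding_toPointed

lemma measurableEmbedding_toCompact :
    MeasurableEmbedding (toCompact : UnitAddCircle × Xi m n → _) :=
  MeasurableEmbedding.id.prodMap measurableEmbedding_toPointed

/-- A law on pairs that is carried by `Ξ`, as a law on `Ξ`. -/
lemma exists_map_toPointed {Q : ProbabilityMeasure (PointedMeasure m n)}
    (hQ : ∀ᵐ z ∂(Q : Measure (PointedMeasure m n)), z.1 ∈ (z.2 : Measure (Seq m n)).support) :
    ∃ R : ProbabilityMeasure (Xi m n),
      R.map measurableEmbedding_toPointed.measurable.aemeasurable = Q := by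
  have h : ((Q : Measure (PointedMeasure m n)).comap Xi.toPointed).map Xi.toPointed = Q := by
    rw [measurableEmbedding_toPointed.map_comap, range_toPointed]
    exact Measure.restrict_eq_self_of_ae_mem hQ
  have hp : IsProbabilityMeasure ((Q : Measure (PointedMeasure m n)).comap
      (Xi.toPointed : Xi m n → _)) := by
    refine ⟨?_⟩
    have h1 := congrArg (fun ν => ν Set.univ) h
    simpa [Measure.map_apply measurableEmbedding_toPointed.measurable MeasurableSet.univ] using h1
  exact ⟨⟨_, hp⟩, Subtype.ext h⟩

lemma map_toCompact_prod {R : ProbabilityMeasure (Xi m n)}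
    {Q : ProbabilityMeasure (PointedMeasure m n)}
    (h : R.map measurableEmbedding_toPointed.measurable.aemeasurable = Q) :
    (circleMeasure.prod R).map measurableEmbedding_toCompact.measurable.aemeasurable =
      circleMeasure.prod Q := by
  rw [← h]
  refine Subtype.ext ?_
  change ((circleMeasure : Measure UnitAddCircle).prod (R : Measure (Xi m n))).map
      (Prod.map id Xi.toPointed) = (circleMeasure : Measure UnitAddCircle).prod
      ((R : Measure (Xi m n)).map Xi.toPointed)
  rw [← Measure.map_prod_map _ _ measurable_id measurableEmbedding_toPointed.measurable,
    Measure.map_id]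

end Embedding

/-! ### Equidistribution in `X` and invariance of the limit law -/

section Limit

/-- The two averages of a bounded function over `N + 1` points differ only in their end terms. -/
lemma tendsto_empirical_succ {E : Type*} [MeasurableSpace E] [TopologicalSpace E]
    [BorelSpace E] {z : ℕ → E} {P : ProbabilityMeasure E}
    (h : Tendsto (empirical z) atTop (𝓝 P)) :
    Tendsto (empirical fun k => z (k + 1)) atTop (𝓝 P) := by
  rw [ProbabilityMeasure.tendsto_iff_forall_integral_tendsto] at h ⊢
  intro f
  have h1 : Tendsto (fun N : ℕ => 2 * ‖f‖ * (((N + 1 : ℕ) : ℝ)⁻¹)) atTop (𝓝 0) := by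
    have := (tendsto_inv_atTop_nhds_zero_nat (𝕜 := ℝ)).comp (tendsto_add_atTop_nat 1)
    simpa using this.const_mul (2 * ‖f‖)
  have h2 : Tendsto (fun N => ∫ x, f x ∂(empirical (fun k => z (k + 1)) N : Measure E) -
      ∫ x, f x ∂(empirical z N : Measure E)) atTop (𝓝 0) := by
    refine squeeze_zero_norm (fun N => ?_) h1
    have hf : StronglyMeasurable f := f.continuous.stronglyMeasurable
    rw [integral_empirical _ _ hf, integral_empirical _ _ hf, ← mul_sub, ← Finset.sum_sub_distrib,
      Finset.sum_range_sub (fun k => f (z k)), norm_mul, mul_comm]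
    refine mul_le_mul ?_ ?_ (norm_nonneg _) (by positivity)
    · refine (norm_sub_le _ _).trans ?_
      linarith [f.norm_coe_le_norm (z (N + 1)), f.norm_coe_le_norm (z 0)]
    · rw [Real.norm_of_nonneg (by positivity)]
  have := (h f).add h2
  simpa using this

variable {m n : ℕ} {μ : ProbabilityMeasure (Seq m n)} {S₁ S₂ : ℕ → Finset (Bool × ℕ)}

lemma toCompact_iterate (hα : 0 ≤ angle m n) {ω : Seq m n}
    (hω : ω ∈ (μ : Measure (Seq m n)).support) (q k : ℕ) :
    toCompact (magnificationOperator^[q * k] (0, ⟨(ω, μ), hω⟩)) =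
      magnifiedOrbit μ (angle m n) q ω k := by
  have e : ((q * k : ℕ) : ℝ) * angle m n = k * (q * angle m n) := by push_cast; ring
  refine (congrArg toCompact (magnificationOperator_iterate_zero hα (q * k) _)).trans ?_
  rw [e]
  exact Prod.ext rfl (magnify_coe _ _ _ _)

/-- The orbit of almost every point in `X` is equidistributed. -/
theorem IsDecoupled.ae_tendsto_empirical_iterate (h : IsDecoupled μ (angle m n) S₁ S₂)
    {Q : ProbabilityMeasure (PointedMeasure m n)} (hQ : IsLimitLaw μ S₁ S₂ Q)
    {R : ProbabilityMeasure (Xi m n)}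
    (hR : R.map measurableEmbedding_toPointed.measurable.aemeasurable = Q)
    {q : ℕ} (hq : 1 ≤ q) (hqe : Ergodic shift^[q] (μ : Measure (Seq m n))) :
    ∀ᵐ ω ∂(μ : Measure (Seq m n)), ∃ hω : ω ∈ (μ : Measure (Seq m n)).support,
      Tendsto (empirical fun k => magnificationOperator^[q * k] (0, (⟨(ω, μ), hω⟩ : Xi m n)))
        atTop (𝓝 (circleMeasure.prod R)) := by
  filter_upwards [h.ae_tendsto_empirical hQ hq hqe, Measure.support_mem_ae] with ω h1 hω
  refine ⟨hω, tendsto_of_tendsto_map isEmbedding_toCompact.isInducing ?_⟩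
  rw [map_toCompact_prod hR]
  refine h1.congr fun N => ?_
  rw [map_empirical _ _ measurableEmbedding_toCompact.measurable]
  congr 1
  funext k
  exact (toCompact_iterate h.pos.le hω q k).symm

lemma ae_fst_ne (R : ProbabilityMeasure (Xi m n)) (t : UnitAddCircle) :
    ∀ᵐ x ∂(circleMeasure.prod R : Measure (UnitAddCircle × Xi m n)), x.1 ≠ t := by
  have h0 : (volume : Measure UnitAddCircle) {t} = 0 := by
    have := AddCircle.volume_closedBall (T := 1) (x := t) 0
    simpa using this
  have h1 : ∀ᵐ s ∂(volume : Measure UnitAddCircle), s ≠ t := by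
    rw [ae_iff]
    simpa using h0
  exact (Measure.quasiMeasurePreserving_fst (μ := (circleMeasure : Measure UnitAddCircle))
    (ν := (R : Measure (Xi m n)))).ae h1

lemma ae_continuousAt_magnificationOperator (hα : 0 ≤ angle m n) (R : ProbabilityMeasure (Xi m n)) :
    ∀ᵐ x ∂(circleMeasure.prod R : Measure (UnitAddCircle × Xi m n)),
      ContinuousAt magnificationOperator x := by
  filter_upwards [ae_fst_ne R 0, ae_fst_ne R (-(angle m n : UnitAddCircle))] with x h0 h1
  exact continuousAt_magnificationOperator hα h0 fun h => h1 (eq_neg_of_add_eq_zero_left h)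

/-- The limit law is invariant under the magnification operator. -/
theorem IsDecoupled.measurePreserving (h : IsDecoupled μ (angle m n) S₁ S₂)
    {Q : ProbabilityMeasure (PointedMeasure m n)} (hQ : IsLimitLaw μ S₁ S₂ Q)
    {R : ProbabilityMeasure (Xi m n)}
    (hR : R.map measurableEmbedding_toPointed.measurable.aemeasurable = Q) :
    MeasurePreserving magnificationOperator
      (circleMeasure.prod R : Measure (UnitAddCircle × Xi m n))
      (circleMeasure.prod R : Measure (UnitAddCircle × Xi m n)) := by
  refine ⟨measurable_magnificationOperator, ?_⟩
  -- Along one generic orbit the images of the empirical measures are the empirical measures of the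
  -- orbit started one step later. They have the same limit, and the operator is continuous almost
  -- everywhere for it.
  obtain ⟨ω, hω, h1⟩ := (h.ae_tendsto_empirical_iterate hQ hR le_rfl
    (by simpa using h.ergodic)).exists
  have h2 := tendsto_map_of_ae_continuousAt h1 measurable_magnificationOperator
    (ae_continuousAt_magnificationOperator h.pos.le R)
  have h3 := tendsto_empirical_succ h1
  refine congrArg ProbabilityMeasure.toMeasure (tendsto_nhds_unique h2 (h3.congr fun N => ?_))
  rw [map_empirical _ _ measurable_magnificationOperator]
  congr 1
  funext k
  simp only [one_mul, Function.comp_apply, Function.iterate_succ_apply']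

end Limit

end SymbolicCP
end

noncomputable section
namespace SymbolicCP

/-! ### Ergodicity of the limit law -/

section Ergodicity

variable {m n : ℕ} {μ : ProbabilityMeasure (Seq m n)} {α : ℝ} {S₁ S₂ : ℕ → Finset (Bool × ℕ)}

/-- Here `u` is the observable along the orbit and `v` its approximation with mean `c'`. The sum of
`|u - v|` runs to `N + M` because blocks that start before `N` stick out by up to `M`. -/
lemma sum_abs_block_sub_le {u v : ℕ → ℝ} {c c' ε : ℝ} {M N : ℕ} (hMN : M ≤ N) (hε : 0 ≤ ε)
    (h1 : ∑ k ∈ Finset.range (N + M), |u k - v k| ≤ ε * (N + M : ℕ))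
    (h2 : ∑ k ∈ Finset.range N, |∑ i ∈ Finset.range M, v (k + i) - M * c'| ≤ ε * M * N)
    (h3 : |c' - c| ≤ 2 * ε) :
    ∑ k ∈ Finset.range N, |∑ i ∈ Finset.range M, u (k + i) - M * c| ≤ 5 * ε * M * N := by
  have hpt : ∀ k, |∑ i ∈ Finset.range M, u (k + i) - M * c| ≤
      ∑ i ∈ Finset.range M, |u (k + i) - v (k + i)| +
        |∑ i ∈ Finset.range M, v (k + i) - M * c'| + M * (2 * ε) := fun k => by
    have e : ∑ i ∈ Finset.range M, u (k + i) - M * c =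
        ∑ i ∈ Finset.range M, (u (k + i) - v (k + i)) +
          (∑ i ∈ Finset.range M, v (k + i) - M * c') + M * (c' - c) := by
      rw [Finset.sum_sub_distrib]
      ring
    rw [e]
    refine (abs_add_le _ _).trans (add_le_add ((abs_add_le _ _).trans (add_le_add
      (Finset.abs_sum_le_sum_abs _ _) le_rfl)) ?_)
    rw [abs_mul, Nat.abs_cast]
    gcongr
  have h4 : ∑ k ∈ Finset.range N, ∑ i ∈ Finset.range M, |u (k + i) - v (k + i)| ≤
      M * (ε * (N + M : ℕ)) := by
    rw [Finset.sum_comm]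
    refine (Finset.sum_le_card_nsmul _ _ (ε * (N + M : ℕ)) fun i hi => ?_).trans_eq (by simp)
    have hi := Finset.mem_range.1 hi
    refine le_trans ?_ h1
    calc ∑ k ∈ Finset.range N, |u (k + i) - v (k + i)|
        = ∑ k ∈ (Finset.range N).image (· + i), |u k - v k| :=
          (Finset.sum_image (f := fun k => |u k - v k|) fun a _ b _ hab => by simpa using hab).symm
      _ ≤ _ := Finset.sum_le_sum_of_subset_of_nonneg (fun k hk => by
          simp only [Finset.mem_image, Finset.mem_range] at hk ⊢
          omega) fun _ _ _ => abs_nonneg _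
  refine (Finset.sum_le_sum fun k _ => hpt k).trans ?_
  rw [Finset.sum_add_distrib, Finset.sum_add_distrib, Finset.sum_const, Finset.card_range,
    nsmul_eq_mul]
  have h5 : (M : ℝ) * (ε * (N + M : ℕ)) ≤ M * (ε * (2 * N)) := by
    have : ((N + M : ℕ) : ℝ) ≤ 2 * N := by exact_mod_cast (by omega : N + M ≤ 2 * N)
    gcongr
  nlinarith

/-- Convergence of the averages along an orbit would not give ergodicity. What is needed is that
averages over blocks of one fixed length are close to the mean from most starting points of the
orbit. -/
lemma IsDecoupled.exists_ae_eventually_sum_block_le (h : IsDecoupled μ α S₁ S₂)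
    {Q : ProbabilityMeasure (PointedMeasure m n)} (hQ : IsLimitLaw μ S₁ S₂ Q)
    (f : C(UnitAddCircle × PointedMeasure m n, ℝ)) {η : ℝ} (hη : 0 < η) :
    ∃ M : ℕ, 1 ≤ M ∧ ∀ᵐ ω ∂(μ : Measure (Seq m n)), ∀ᶠ N : ℕ in atTop, ∑ k ∈ Finset.range N,
      |∑ i ∈ Finset.range M, f (magnifiedOrbit μ α 1 ω (k + i)) - M * ∫ z, f z
        ∂(circleMeasure.prod Q : Measure (UnitAddCircle × PointedMeasure m n))| ≤ η * M * N := by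
  obtain ⟨K, p, hKp⟩ := h.quasi
  have hα := h.pos
  have he1 : Ergodic shift^[1] (μ : Measure (Seq m n)) := by simpa using h.ergodic
  obtain ⟨r₀, hr₀⟩ := h.exists_uniformlyAverages le_rfl he1 f (η := η / 5) (by positivity)
  obtain ⟨r, hr, hr'⟩ := ((eventually_ge_atTop r₀).and
    ((hQ f).eventually (Metric.closedBall_mem_nhds _ (show 0 < η / 5 by positivity)))).exists
  rw [Real.dist_eq] at hr'
  obtain ⟨A, G, c, hG, hc, hae⟩ := hr₀ r hr
  have hirr : Irrational (((1 : ℕ) : ℝ) * α) := h.irrational.natCast_mul one_ne_zero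
  obtain ⟨M₀, hM₀⟩ := hKp.ae_eventually_sum_block_le le_rfl hirr (by simpa using hα) G hG r
    (ε := η / 5) (by positivity)
  refine ⟨max M₀ 1, le_max_right _ _, ?_⟩
  filter_upwards [hae, hM₀ _ (le_max_left M₀ 1)] with ω h1 h2
  filter_upwards [(tendsto_add_atTop_nat (max M₀ 1)).eventually h1, h2,
    eventually_ge_atTop (max M₀ 1)] with N h3 h4 h5
  refine (sum_abs_block_sub_le (ε := η / 5) (c' := c) h5 (by positivity) h3 h4 ?_).trans_eq
    (by ring)
  exact (abs_sub_le _ (localMean μ S₁ S₂ r f) _).trans (by linarith)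

/-- In the mean, long averages along the orbits of the magnification operator are close to the
integral. -/
lemma IsDecoupled.exists_integral_abs_average_sub_le (h : IsDecoupled μ (angle m n) S₁ S₂)
    {Q : ProbabilityMeasure (PointedMeasure m n)} (hQ : IsLimitLaw μ S₁ S₂ Q)
    {R : ProbabilityMeasure (Xi m n)}
    (hR : R.map measurableEmbedding_toPointed.measurable.aemeasurable = Q)
    (f : C(UnitAddCircle × PointedMeasure m n, ℝ)) {η : ℝ} (hη : 0 < η) :
    ∃ M : ℕ, 1 ≤ M ∧
      ∫ x, |(M : ℝ)⁻¹ * ∑ i ∈ Finset.range M, f (toCompact (magnificationOperator^[i] x)) - ∫ z, f z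
        ∂(circleMeasure.prod Q : Measure (UnitAddCircle × PointedMeasure m n))|
        ∂(circleMeasure.prod R : Measure (UnitAddCircle × Xi m n)) ≤ η := by
  set c := ∫ z, f z ∂(circleMeasure.prod Q : Measure (UnitAddCircle × PointedMeasure m n)) with hc
  obtain ⟨M, hM1, hM⟩ := h.exists_ae_eventually_sum_block_le hQ f hη
  refine ⟨M, hM1, ?_⟩
  have hM0 : (0 : ℝ) < M := by exact_mod_cast hM1
  obtain ⟨ω, ⟨hω, h1⟩, h2⟩ := ((h.ae_tendsto_empirical_iterate hQ hR le_rfl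
    (by simpa using h.ergodic)).and hM).exists
  set z : ℕ → UnitAddCircle × Xi m n := fun k =>
    magnificationOperator^[1 * k] (0, ⟨(ω, μ), hω⟩) with hz
  -- `g` is continuous almost everywhere, so its integral is the limit of its averages along a
  -- generic orbit, and these are the block deviations just estimated.
  set g : UnitAddCircle × Xi m n → ℝ := fun x =>
    |(M : ℝ)⁻¹ * ∑ i ∈ Finset.range M, f (toCompact (magnificationOperator^[i] x)) - c| with hg
  have hgm : Measurable g := by
    refine continuous_abs.measurable.comp (((Finset.measurable_fun_sum _ fun i _ => ?_).const_mul
      _).sub_const _)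
    exact f.continuous.measurable.comp (measurableEmbedding_toCompact.measurable.comp
      (measurable_magnificationOperator.iterate i))
  have hgc : ∀ᵐ x ∂(circleMeasure.prod R : Measure (UnitAddCircle × Xi m n)),
      ContinuousAt g x := by
    have hS := (h.measurePreserving hQ hR).quasiMeasurePreserving
    filter_upwards [ae_all_iff.2 fun j : ℕ =>
      (hS.iterate j).ae (ae_continuousAt_magnificationOperator h.pos.le R)] with x hx
    have hit : ∀ j, ContinuousAt magnificationOperator^[j] x := fun j => by
      induction j with
      | zero => exact continuousAt_id
      | succ j ih =>
        rw [Function.iterate_succ']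
        exact (hx j).comp ih
    refine ContinuousAt.abs (ContinuousAt.sub (ContinuousAt.mul continuousAt_const
      (tendsto_finsetSum _ fun i _ => ?_)) continuousAt_const)
    exact (f.continuous.comp isEmbedding_toCompact.continuous).continuousAt.comp (hit i)
  have h3 := ProbabilityMeasure.tendsto_iff_forall_integral_tendsto.1
    (tendsto_map_of_ae_continuousAt h1 hgm hgc)
  have hgB : ∀ x, g x ≤ ‖f‖ + |c| := fun x => by
    refine (abs_sub _ _).trans (add_le_add ?_ le_rfl)
    rw [abs_mul, abs_of_pos (inv_pos.2 hM0), inv_mul_le_iff₀ hM0]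
    refine (Finset.abs_sum_le_sum_abs _ _).trans ((Finset.sum_le_sum fun i _ =>
      f.norm_coe_le_norm _).trans_eq (by simp))
  have hB0 : 0 ≤ ‖f‖ + |c| := by positivity
  -- A bounded continuous test function that is the identity on the values of `g`.
  let φ : ℝ →ᵇ ℝ := BoundedContinuousFunction.ofNormedAddCommGroup
    (fun x => min |x| (‖f‖ + |c|)) (by fun_prop) (‖f‖ + |c|) fun x => by
      rw [Real.norm_of_nonneg (le_min (abs_nonneg _) hB0)]
      exact min_le_right _ _
  have hφ : ∀ x, φ (g x) = g x := fun x => by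
    change min |g x| (‖f‖ + |c|) = g x
    rw [abs_of_nonneg (abs_nonneg _), min_eq_left (hgB x)]
  have h4 := h3 φ
  have e1 : ∀ ν : ProbabilityMeasure (UnitAddCircle × Xi m n),
      ∫ x, φ x ∂(ν.map hgm.aemeasurable : Measure ℝ) =
        ∫ x, g x ∂(ν : Measure (UnitAddCircle × Xi m n)) := fun ν => by
    rw [ProbabilityMeasure.toMeasure_map, integral_map hgm.aemeasurable
      φ.continuous.measurable.aestronglyMeasurable]
    simp only [hφ]
  simp only [e1] at h4
  refine le_of_tendsto h4 ?_
  filter_upwards [(tendsto_add_atTop_nat 1).eventually h2] with N hN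
  rw [integral_empirical _ _ hgm.stronglyMeasurable, inv_mul_le_iff₀ (by positivity)]
  have e2 : ∀ k, g (z k) = (M : ℝ)⁻¹ *
      |∑ i ∈ Finset.range M, f (magnifiedOrbit μ (angle m n) 1 ω (k + i)) - M * c| := fun k => by
    have e3 : ∀ i, toCompact (magnificationOperator^[i] (z k)) =
        magnifiedOrbit μ (angle m n) 1 ω (k + i) := fun i => by
      rw [← toCompact_iterate h.pos.le hω, hz, ← Function.iterate_add_apply, one_mul, one_mul,
        add_comm]
    simp only [hg, e3]
    rw [← abs_of_pos (inv_pos.2 hM0), ← abs_mul, abs_of_pos (inv_pos.2 hM0), mul_sub,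
      inv_mul_cancel_left₀ hM0.ne']
  simp only [e2]
  rw [← Finset.mul_sum, inv_mul_le_iff₀ hM0]
  exact hN.trans_eq (by ring)

/-- The limit law is ergodic under the magnification operator. -/
theorem IsDecoupled.ergodic_magnificationOperator (h : IsDecoupled μ (angle m n) S₁ S₂)
    {Q : ProbabilityMeasure (PointedMeasure m n)} (hQ : IsLimitLaw μ S₁ S₂ Q)
    {R : ProbabilityMeasure (Xi m n)}
    (hR : R.map measurableEmbedding_toPointed.measurable.aemeasurable = Q) :
    Ergodic magnificationOperator (circleMeasure.prod R : Measure (UnitAddCircle × Xi m n)) := by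
  have hS := h.measurePreserving hQ hR
  set P := (circleMeasure.prod R : Measure (UnitAddCircle × Xi m n)) with hP
  set P' := (circleMeasure.prod Q : Measure (UnitAddCircle × PointedMeasure m n)) with hP'
  have hι := (measurableEmbedding_toCompact (m := m) (n := n)).measurable
  have hmap : P.map toCompact = P' := congrArg ProbabilityMeasure.toMeasure (map_toCompact_prod hR)
  refine ⟨hS, ⟨fun A hA hSA => ?_⟩⟩
  -- By invariance of `A` and of the measure, `f` may be replaced on `A` by its average over `M`
  -- steps, which is close in the mean to the constant `∫ f`.
  have key : ∀ f : C(UnitAddCircle × PointedMeasure m n, ℝ),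
      ∫ x in A, f (toCompact x) ∂P = P.real A * ∫ z, f z ∂P' := fun f => by
    have hfi : ∀ i, Integrable (fun x => f (toCompact (magnificationOperator^[i] x))) P := fun i =>
      Integrable.of_bound (f.continuous.measurable.comp (hι.comp
        (measurable_magnificationOperator.iterate i))).aestronglyMeasurable ‖f‖
        (ae_of_all _ fun x => f.norm_coe_le_norm _)
    have hinv : ∀ i, ∫ x in A, f (toCompact (magnificationOperator^[i] x)) ∂P =
        ∫ x in A, f (toCompact x) ∂P := fun i => by
      have hAi : magnificationOperator^[i] ⁻¹' A = A := by
        induction i with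
        | zero => rfl
        | succ i ih => rw [Function.iterate_succ', Set.preimage_comp, hSA, ih]
      have h1 := (hS.iterate i).restrict_preimage hA
      rw [hAi] at h1
      exact integral_comp_measurePreserving h1 (f := fun x => f (toCompact x))
        (f.continuous.measurable.comp hι).aestronglyMeasurable
    refine eq_of_abs_sub_le_all fun η hη => ?_
    obtain ⟨M, hM1, hM⟩ := h.exists_integral_abs_average_sub_le hQ hR f hη
    have hM0 : (0 : ℝ) < M := by exact_mod_cast hM1
    have hint : Integrable (fun x => (M : ℝ)⁻¹ *
        ∑ i ∈ Finset.range M, f (toCompact (magnificationOperator^[i] x))) P :=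
      (integrable_finsetSum _ fun i _ => hfi i).const_mul _
    have e : ∫ x in A, f (toCompact x) ∂P - P.real A * ∫ z, f z ∂P' = ∫ x in A, ((M : ℝ)⁻¹ *
        ∑ i ∈ Finset.range M, f (toCompact (magnificationOperator^[i] x)) - ∫ z, f z ∂P') ∂P := by
      rw [integral_sub hint.integrableOn (integrable_const _), integral_const_mul,
        integral_finsetSum _ fun i _ => (hfi i).integrableOn]
      simp only [hinv, Finset.sum_const, Finset.card_range, nsmul_eq_mul]
      rw [inv_mul_cancel_left₀ hM0.ne', setIntegral_const, smul_eq_mul]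
    rw [e]
    refine (abs_integral_le_integral_abs).trans (le_trans ?_ hM)
    exact setIntegral_le_integral (hint.sub (integrable_const _)).abs
      (ae_of_all _ fun x => abs_nonneg _)
  have hmeas : (P.restrict A).map toCompact = P A • P' := by
    have : IsFiniteMeasure (P A • P') := Measure.smul_finite _ (measure_ne_top _ _)
    refine ext_of_forall_integral_eq_of_IsFiniteMeasure fun f => ?_
    rw [integral_map hι.aemeasurable f.continuous.measurable.aestronglyMeasurable,
      integral_smul_measure]
    exact key f.toContinuousMap
  -- Evaluation on the image of `A` gives `P A = P A * P A`.
  have h2 := congrArg (fun ν => ν (toCompact '' A)) hmeas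
  have hAim := measurableEmbedding_toCompact.measurableSet_image.2 hA
  have hpre : (toCompact ⁻¹' (toCompact '' A) : Set (UnitAddCircle × Xi m n)) = A :=
    Set.preimage_image_eq _ isEmbedding_toCompact.injective
  simp only [← hmap, Measure.smul_apply, Measure.map_apply hι hAim, hpre, smul_eq_mul,
    Measure.restrict_apply hA, Set.inter_self] at h2
  rw [Filter.eventuallyConst_set']
  by_cases h0 : P A = 0
  · exact Or.inl (ae_eq_empty.2 h0)
  · have h1 : P A = 1 := by
      have := (ENNReal.mul_right_inj h0 (measure_ne_top P A)).1 ((mul_one _).trans h2)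
      exact this.symm
    exact Or.inr (eventuallyEq_univ.2 ((mem_ae_iff_prob_eq_one hA).2 h1))

end Ergodicity

end SymbolicCP
end

/-! ### Assembly of the main theorem -/

theorem mainTheorem3 (m n : ℕ) (hmn : Irrational (Real.log m / Real.log n))
    (Y : Set (SymbolicCP.Seq m n)) (hY : SymbolicCP.IsSFT Y)
    (hYtrans : SymbolicCP.IsTransitiveOn SymbolicCP.shift Y)
    (μ : ProbabilityMeasure (SymbolicCP.Seq m n))
    (hμ : SymbolicCP.IsInvariantGibbs Y (μ : Measure (SymbolicCP.Seq m n))) :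
    ∃ Qhat : Measure (SymbolicCP.Xi m n), IsProbabilityMeasure Qhat ∧
      Ergodic SymbolicCP.magnificationOperator
        ((volume : Measure UnitAddCircle).prod Qhat) ∧
      ∀ f : (UnitAddCircle × SymbolicCP.Xi m n) →ᵇ ℝ,
        ∀ q : ℕ, 1 ≤ q → SymbolicCP.IsTransitiveOn (SymbolicCP.shift^[q]) Y →
          ∀ᵐ ω ∂(μ : Measure (SymbolicCP.Seq m n)),
            ∃ hω : ω ∈ (μ : Measure (SymbolicCP.Seq m n)).support,
              Tendsto
                (fun N : ℕ => (1 / (N : ℝ)) * ∑ k ∈ Finset.Icc 1 N,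
                  f (SymbolicCP.magnificationOperator^[q * k] (0, ⟨(ω, μ), hω⟩)))
                atTop
                (𝓝 (∫ x, f x ∂((volume : Measure UnitAddCircle).prod Qhat))) := by
  open SymbolicCP in
  obtain ⟨⟨K, p, hKp⟩, hq⟩ := hμ.isQuasiBernoulli hY hYtrans
  have hα0 : 0 < angle m n :=
    lt_of_le_of_ne (div_nonneg (Real.log_natCast_nonneg m) (Real.log_natCast_nonneg n))
      hmn.ne_zero.symm
  have hα1 : angle m n ≠ 1 := hmn.ne_one
  obtain ⟨S₁, S₂, hS⟩ := hKp.upper.exists_isLocallyProduct hKp.ne_top hKp.invariant hα0 hα1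
  have hd : IsDecoupled μ (angle m n) S₁ S₂ :=
    ⟨⟨K, p, hKp⟩, by simpa using hq 1 le_rfl (by simpa using hYtrans), hmn, hα0, hS⟩
  obtain ⟨Q, hQ, hQs⟩ := hd.exists_limitLaw
  obtain ⟨R, hR⟩ := exists_map_toPointed hQs
  refine ⟨R, inferInstance, hd.ergodic_magnificationOperator hQ hR, fun f q hq1 hqY => ?_⟩
  filter_upwards [hd.ae_tendsto_empirical_iterate hQ hR hq1 (hq q hq1 hqY)] with ω ⟨hω, h⟩
  -- The empirical measure of index `N` has `N + 1` points. For the orbit started one step later it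
  -- averages over `1 ≤ k ≤ N + 1`, hence the shift of `N` by one.
  refine ⟨hω, (tendsto_add_atTop_iff_nat 1).1 ?_⟩
  refine (ProbabilityMeasure.tendsto_iff_forall_integral_tendsto.1
    (tendsto_empirical_succ h) f).congr fun N => ?_
  rw [integral_empirical _ _ f.continuous.stronglyMeasurable, one_div,
    Finset.range_eq_Ico,
    Finset.sum_Ico_add' (fun k => f (magnificationOperator^[q * k] (0, ⟨(ω, μ), hω⟩))) 0 (N + 1) 1]
  rfl
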